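/- **Model.** Let $d\ge 1$, $S>0$, and let $x_1,x_2,\dots\in[-S,S]^d$ be an arbitrary fixed design. For $\theta=(f,\sigma)$, the observations $Y_1,Y_2,\dots$ are independent with $Y_i\sim\mathcal N(f(x_i),\sigma^2)$; write $P_\theta^\infty$ for the law of the whole sequence, $\|f\|_{2,n}^2=n^{-1}\sum_{i=1}^n|f(x_i)|^2$ and $\rho_n(\theta,\theta')=\|f-f'\|_{2,n}+|\log\sigma-\log\sigma'|$. **Prior.** Under the prior $\Pi$, $\sigma\sim P^\sigma$ is independent of $$f(x)=\int g(x-\mu)\cos(\xi\cdot(x-\mu)+\phi)\,Q(d\xi\,d\mu\,d\phi),$$ where $Q$ is a symmetric Gamma random measure on $\mathbb R^d\times[-2S,2S]^d\times[0,\pi/2]$ with base distribution $\alpha F$ and scale $\eta$ ($\alpha,\eta>0$): a signed random measure whose values on disjoint measurable sets are independent and such that $Q(A)$ has characteristic function $t\mapsto(1+t^2/\eta^2)^{-\alpha F(A)}$ for every measurable $A$. Here $F=F_\xi\times F_\mu\times F_\phi$ is a product of probability measures on $\mathbb R^d$, $[-2S,2S]^d$ and $[0,\pi/2]$. Write $\Pi(\cdot\mid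 Y_1,\dots,Y_n)$ for the posterior given by Bayes' formula with the Gaussian likelihood; it is well defined. Assume the following. 1. $g:\mathbb R^d\to\mathbb R$ is a non-zero, non-negative Schwartz function, $|g(x)|\lesssim\exp(-C_0|x|^\tau)$ for some $C_0>0$, $\tau>1$; $g\ge C$ for some $C>0$ on a set $E\subseteq[-\pi,\pi]^d$ of positive Lebesgue measure; for some $0\le\gamma<1$, $\sup_{|a|=k}|D^a g(0)|\lesssim\exp(\gamma k\log k)$ for all large $k$; and for every $x\in[-S,S]^d$ there is $\mu\in[-2S,2S]^d$ with $g(x-\mu)>0$. 2. There are positive constants such that for all $t\in(0,1)$: $F_\mu(|z-z_0|\le t)\ge b_1t^{a_1}$ for all $z_0\in[-2S,2S]^d$; $F_\phi(|\phi-\phi_0|\le t)\ge b_{10}t^{a_{10}}$ for all $\phi_0\in[0,\pi/2]$; $F_\xi(|\xi-\xi_0|\le t)\ge b_{12}(1+|\xi_0|)^{-a_{12}}t^{a_{13}}$ for all $\xi_0\in\mathbb R^d$; and, for some $\kappa>(d-1)/2$, $F_\xi(|\xi|\ge x)\le b_{11}(1+x)^{-2(\kappa+1)}$ for all $x>0$.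 3. $P^\sigma$ is a probability measure on $(0,\infty)$ and there are positive constants such that, for all large $x$, $P^\sigma(\sigma>x)\le b_7x^{-a_7}$ and $P^\sigma(\sigma\le1/x)\le b_8\exp(-C_8x^{a_8})$. **Theorem.** Let $\beta>0$, let $f_0$ belong to the Hölder space $\mathcal C^\beta([-S,S]^d)$, let $\sigma_0>0$ be such that $P^\sigma(\sigma_0\le\sigma\le\sigma_0(1+t))\ge b_9t^{a_9}$ for all $t\in(0,1)$ and some $a_9,b_9>0$, and put $\theta_0=(f_0,\sigma_0)$ and $$\epsilon_n^2=n^{-2\beta/(2\beta+d)}(\log n)^{2\beta(2d+1)/(2\beta+d)}.$$ Then there is $M<\infty$ such that $$\lim_{n\to\infty}\Pi\big(\theta:\rho_n(\theta,\theta_0)>M\epsilon_n\,\big|\,Y_1,\dots,Y_n\big)=0\qquad P_{\theta_0}^\infty\text{-almost surely.}$$ The prior does not depend on $\beta$, so the procedure is adaptive: the rate holds simultaneously for all $\beta>0$. -/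

import Mathlib

open MeasureTheory ProbabilityTheory Filter Topology
open scoped NNReal ENNReal SchwartzMap

noncomputable section

namespace LocMod

/-- `ℝ^d` with its Euclidean norm. -/
abbrev E (d : ℕ) : Type := EuclideanSpace ℝ (Fin d)

/-- The closed cube `[-r, r]^d`. -/
def cube (d : ℕ) (r : ℝ) : Set (E d) := {x | ∀ i, x i ∈ Set.Icc (-r) r}

/-- The open cube `(-r, r)^d`. -/
def openCube (d : ℕ) (r : ℝ) : Set (E d) := {x | ∀ i, x i ∈ Set.Ioo (-r) r}

/-- The partial derivative `∂_{s 0} ⋯ ∂_{s (k-1)} f (x)` of order `k`. As `s` runs over all words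
of length `k`, this runs over all `D^a f (x)` with multi-index `|a| = k`, where `a i` is the number
of occurrences of `i` in `s`. -/
def partialDeriv {d k : ℕ} (s : Fin k → Fin d) (f : E d → ℝ) (x : E d) : ℝ :=
  iteratedFDeriv ℝ k f x (fun j => EuclideanSpace.single (s j) (1 : ℝ))

/-- The largest integer strictly smaller than `β` (for `β > 0`). -/
def holderOrder (β : ℝ) : ℕ := ⌈β⌉₊ - 1

/-- `f` restricted to `[-S, S]^d` belongs to the Hölder space `C^β([-S, S]^d)`: it is continuous on
the closed cube and, with `k` the largest integer strictly smaller than `β`, it is `k` times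
continuously differentiable in the open cube, with bounded partial derivatives up to order `k` and
`(β - k)`-Hölder partial derivatives of order `k`. -/
structure IsHolderOnCube {d : ℕ} (S β : ℝ) (f : E d → ℝ) : Prop where
  continuousOn : ContinuousOn f (cube d S)
  contDiffOn : ContDiffOn ℝ (holderOrder β : ℕ) f (openCube d S)
  bounded : ∃ C : ℝ, ∀ j ≤ holderOrder β, ∀ s : Fin j → Fin d, ∀ x ∈ openCube d S,
    |partialDeriv s f x| ≤ C
  holder : ∃ C : ℝ, ∀ s : Fin (holderOrder β) → Fin d, ∀ x ∈ openCube d S, ∀ y ∈ openCube d S,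
    |partialDeriv s f x - partialDeriv s f y| ≤ C * ‖x - y‖ ^ (β - (holderOrder β : ℝ))

/-! ### Symmetric Gamma random measures and location-modulation mixtures -/

/-- `ν` is the symmetric Gamma distribution `SGa(a, b)`, the law on `ℝ` with Fourier transform
`t ↦ (1 + t² / b²)^(-a)` (for `a = 0` this is the Dirac mass at `0`). -/
def IsSymmGamma (ν : Measure ℝ) (a b : ℝ) : Prop :=
  IsProbabilityMeasure ν ∧ ∀ t : ℝ, charFun ν t = (((1 + t ^ 2 / b ^ 2) ^ (-a) : ℝ) : ℂ)

/-- `Q` is a symmetric Gamma random measure on `X` with base distribution `α F` and scale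
parameter `η`, defined on the probability space `(Ω, P)`: a signed random measure that is
independently scattered, with `Q(A) ∼ SGa(α F(A), η)` for every measurable `A`. -/
structure IsSymmGammaRandomMeasure {Ω X : Type*} [MeasurableSpace Ω] [MeasurableSpace X]
    (P : Measure Ω) (Q : Ω → SignedMeasure X) (α η : ℝ) (F : Measure X) : Prop where
  measurable : ∀ A : Set X, MeasurableSet A → Measurable fun ω => Q ω A
  indep : ∀ (k : ℕ) (A : Fin k → Set X), (∀ i, MeasurableSet (A i)) →
    Pairwise (fun i j => Disjoint (A i) (A j)) → iIndepFun (fun i ω => Q ω (A i)) P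
  law : ∀ A : Set X, MeasurableSet A → IsSymmGamma (P.map fun ω => Q ω A) (α * F.real A) η

/-- The index space of the atoms `(ξ, μ, φ)`: frequency, location, phase. -/
abbrev Atom (d : ℕ) : Type := E d × E d × ℝ

/-- The location-modulation kernel `K_{ξ,φ}(x) = g(x) cos(ξ · x + φ)`. -/
def kernel {d : ℕ} (g : E d → ℝ) (ξ : E d) (φ : ℝ) (x : E d) : ℝ :=
  g x * Real.cos (inner ℝ ξ x + φ)

/-- The mixture `x ↦ ∫ K_{ξ,φ}(x - μ) q(dξ dμ dφ)` with respect to a signed measure `q`. -/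
def mixture {d : ℕ} (g : E d → ℝ) (q : SignedMeasure (Atom d)) (x : E d) : ℝ :=
  ∫ᵛ z, kernel g z.1 z.2.2 (x - z.2.1) ∂•q

/-! ### Assumptions on the prior -/

/-- Assumptions on the mother function `g`. -/
structure MotherAssumption {d : ℕ} (g : 𝓢(E d, ℝ)) : Prop where
  ne_zero : g ≠ 0
  nonneg : ∀ x, 0 ≤ g x
  tail : ∃ c C₀ τ : ℝ, 0 < C₀ ∧ 1 < τ ∧ ∀ x, |g x| ≤ c * Real.exp (-C₀ * ‖x‖ ^ τ)
  lower : ∃ A ⊆ cube d Real.pi, MeasurableSet A ∧ 0 < volume A ∧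
    ∃ C : ℝ, 0 < C ∧ ∀ x ∈ A, C ≤ g x
  deriv_zero : ∃ γ : ℝ, 0 ≤ γ ∧ γ < 1 ∧ ∃ c : ℝ, ∀ᶠ k : ℕ in atTop, ∀ s : Fin k → Fin d,
    |partialDeriv s g 0| ≤ c * Real.exp (γ * k * Real.log k)

/-- Assumptions on the law of the locations. -/
structure LocationAssumption {d : ℕ} (S : ℝ) (Fμ : Measure (E d)) : Prop where
  support : Fμ (cube d (2 * S))ᶜ = 0
  small_ball : ∃ a b : ℝ, 0 < a ∧ 0 < b ∧ ∀ t ∈ Set.Ioo (0 : ℝ) 1, ∀ z₀ ∈ cube d (2 * S),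
    b * t ^ a ≤ Fμ.real {z | ‖z - z₀‖ ≤ t}

/-- Assumptions on the law of the phases. -/
structure PhaseAssumption (Fφ : Measure ℝ) : Prop where
  support : Fφ (Set.Icc 0 (Real.pi / 2))ᶜ = 0
  small_ball : ∃ a b : ℝ, 0 < a ∧ 0 < b ∧ ∀ t ∈ Set.Ioo (0 : ℝ) 1,
    ∀ φ₀ ∈ Set.Icc 0 (Real.pi / 2), b * t ^ a ≤ Fφ.real {φ | |φ - φ₀| ≤ t}

/-- Assumptions on the law of the frequencies. -/
structure FrequencyAssumption {d : ℕ} (Fξ : Measure (E d)) : Prop where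
  tail : ∃ κ b : ℝ, ((d : ℝ) - 1) / 2 < κ ∧ 0 < b ∧ ∀ x : ℝ, 0 < x →
    Fξ.real {ξ | x ≤ ‖ξ‖} ≤ b * (1 + x) ^ (-2 * (κ + 1))
  small_ball : ∃ a a' b : ℝ, 0 < a ∧ 0 < a' ∧ 0 < b ∧ ∀ t ∈ Set.Ioo (0 : ℝ) 1, ∀ ξ₀ : E d,
    b * (1 + ‖ξ₀‖) ^ (-a) * t ^ a' ≤ Fξ.real {ξ | ‖ξ - ξ₀‖ ≤ t}

/-- Assumptions on the prior law of the noise level that do not involve its true value. -/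
structure NoiseAssumption (Pσ : Measure ℝ) : Prop where
  support : Pσ (Set.Ioi 0)ᶜ = 0
  upper_tail : ∃ a b : ℝ, 0 < a ∧ 0 < b ∧ ∀ᶠ x : ℝ in atTop,
    Pσ.real {σ | x < σ} ≤ b * x ^ (-a)
  lower_tail : ∃ a b C : ℝ, 0 < a ∧ 0 < b ∧ 0 < C ∧ ∀ᶠ x : ℝ in atTop,
    Pσ.real {σ | σ ≤ 1 / x} ≤ b * Real.exp (-C * x ^ a)

/-- The prior law of the noise level puts enough mass to the right of the true value `σ₀`. -/
def NoiseMassAt (Pσ : Measure ℝ) (σ₀ : ℝ) : Prop :=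
  ∃ a b : ℝ, 0 < a ∧ 0 < b ∧ ∀ t ∈ Set.Ioo (0 : ℝ) 1,
    b * t ^ a ≤ Pσ.real (Set.Icc σ₀ (σ₀ * (1 + t)))

/-! ### The regression model, the prior and the posterior -/

/-- Parameters `θ = (f, σ)`, with the product σ-algebra. -/
abbrev Param (d : ℕ) : Type := (E d → ℝ) × ℝ

/-- The law of the infinite sequence of independent observations `Y_i ∼ N(f(x_i), σ²)`. -/
def dataLaw {d : ℕ} (x : ℕ → E d) (θ : Param d) : Measure (ℕ → ℝ) :=
  Measure.infinitePi fun i => gaussianReal (θ.1 (x i)) (Real.toNNReal (θ.2 ^ 2))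

/-- The prior: `f` is the mixture directed by `Q`, and `σ ∼ Pσ` is independent of `f`. -/
def prior {d : ℕ} {Ω : Type*} [MeasurableSpace Ω] (P : Measure Ω) (g : E d → ℝ)
    (Q : Ω → SignedMeasure (Atom d)) (Pσ : Measure ℝ) : Measure (Param d) :=
  (P.map fun ω => mixture g (Q ω)).prod Pσ

/-- The likelihood of `θ` based on the first `n` observations. -/
def likelihood {d : ℕ} (x : ℕ → E d) (n : ℕ) (y : ℕ → ℝ) (θ : Param d) : ℝ≥0∞ :=
  ∏ i ∈ Finset.range n, gaussianPDF (θ.1 (x i)) (Real.toNNReal (θ.2 ^ 2)) (y i)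

/-- The posterior distribution given the first `n` observations (Bayes' formula). -/
def posterior {d : ℕ} (Pi₀ : Measure (Param d)) (x : ℕ → E d) (n : ℕ) (y : ℕ → ℝ) :
    Measure (Param d) :=
  (∫⁻ θ, likelihood x n y θ ∂Pi₀)⁻¹ • Pi₀.withDensity (likelihood x n y)

/-- The distance `ρ_n((f, σ), (f', σ')) = ‖f - f'‖_{2,n} + |log σ - log σ'|`. -/
def rho {d : ℕ} (x : ℕ → E d) (n : ℕ) (θ θ' : Param d) : ℝ :=
  Real.sqrt ((n : ℝ)⁻¹ * ∑ i ∈ Finset.range n, |θ.1 (x i) - θ'.1 (x i)| ^ 2)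
    + |Real.log θ.2 - Real.log θ'.2|

/-- The rate, given by `ε_n² = n^{-2β/(2β+d)} (log n)^{2β(2d+1)/(2β+d)}`. -/
def rate (d : ℕ) (β : ℝ) (n : ℕ) : ℝ :=
  Real.sqrt ((n : ℝ) ^ (-(2 * β) / (2 * β + d)) *
    Real.log n ^ (2 * β * (2 * d + 1) / (2 * β + d)))

end LocMod

end

/-!
# Posterior contraction for symmetric Gamma location-modulation mixtures

The proof has three parts: a general contraction theorem, a sieve, and a lower bound for the prior
mass of neighborhoods of the truth.

**Contraction** (`posterior_contraction`). No tests are constructed. If a piece of the parameter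
space has diameter at most `ε` and lies at distance at least `M ε` from the truth, then its
contribution to the numerator of Bayes' formula is a likelihood ratio of one of its points `θ₁`
against the truth, times an average of likelihood ratios against `θ₁`. The first factor has a small
Hellinger affinity, the second one a bounded chi-square integral, and Hölder's inequality combines
the two (`lintegral_min_piece_le`). The evidence is bounded below by its inverse moment over a
neighborhood of the truth (`lintegral_evidence_inv_le`). For Gaussian observations all these
integrals are explicit. The expected posterior mass of the complement of the ball is summable in
`n`, hence the posterior mass tends to zero almost surely.

**Sieve** (`exists_sieve`). The prior serves as its own sieve: with high probability, a realization
of the mixture is the centre of a ball, for the maximum over the design points, whose prior mass is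
at least `exp (-C n ε²)` (`exists_typical_mixture`), and disjoint balls of this mass cannot be more
than `exp (C n ε²)` in number (`exists_cover_of_ball_mass`). To find these balls, the atom space is
cut into cells, finer for higher frequencies, on which the random measure has independent masses
(`exists_typical_small_ball`). Keeping the mass of a cell below a radius `r` has probability at
least `exp (-C a log (1 / r))`, where `a` is the base mass of the cell
(`IsSymmGamma.exists_central_ge`). This cost is proportional to `a`, and so its sum over all cells
stays small however fine the partition, because the frequency law has a finite first moment. The
few cells whose mass exceeds the radius are charged by `IsSymmGamma.exists_interval_ge`, and the
total charge has exponential moments. The noise levels are cut logarithmically.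

**Prior mass** (`exists_prior_mass_ge`). A Hölder function is approximated by a finite mixture with
`(r / η)^d` atoms up to `η^β` and a term exponentially small in `r` (`exists_mixture_approx`):
finitely many translates of `g` have a sum `G` that is positive on the cube; the quotient `f₀ / G`
is smoothed with the `2r`-th power of the modulus of a Dirichlet kernel, which is a convex
combination of characters; each character times each translate of `g` is a combination of two
kernels with phases `0` and `π / 2`. The smoothing has no boundary effect, since it is carried out
along segments inside the cube, and it has the right order for every `β`, since the value at the end
of a segment is extrapolated from the values at equidistant points
(`exists_extrapolation_error_le`). With `η = ε^(1/β)` and `r` of order `log n`, the number of atoms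
times `log n` is at most a multiple of `n ε²` (`inv_rate_rpow_mul_log_pow`), which is the price of
being close to the finite mixture (`exists_small_ball_mixture`).
-/

noncomputable section

namespace LocMod

/-! ### Gaussian affinities and chi-square integrals -/

/-- The density of `N(m, s²)` as a real function of the standard deviation `s > 0`. -/
def normalDensity (m s x : ℝ) : ℝ :=
  (s * √(2 * Real.pi))⁻¹ * Real.exp (-(x - m) ^ 2 / (2 * s ^ 2))

lemma normalDensity_pos {m s : ℝ} (hs : 0 < s) (x : ℝ) : 0 < normalDensity m s x := by
  unfold normalDensity; positivity

lemma gaussianPDFReal_eq_normalDensity {m s : ℝ} (hs : 0 < s) (x : ℝ) :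
    gaussianPDFReal m (Real.toNNReal (s ^ 2)) x = normalDensity m s x := by
  unfold gaussianPDFReal normalDensity
  rw [Real.coe_toNNReal _ (sq_nonneg s)]
  congr 2
  rw [mul_comm, Real.sqrt_mul (sq_nonneg s), Real.sqrt_sq hs.le]

lemma gaussianPDF_eq_normalDensity {m s : ℝ} (hs : 0 < s) (x : ℝ) :
    gaussianPDF m (Real.toNNReal (s ^ 2)) x = ENNReal.ofReal (normalDensity m s x) := by
  rw [gaussianPDF, gaussianPDFReal_eq_normalDensity hs]

lemma measurable_normalDensity (m s : ℝ) : Measurable (normalDensity m s) := by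
  unfold normalDensity; fun_prop

lemma toNNReal_sq_ne_zero {s : ℝ} (hs : 0 < s) : Real.toNNReal (s ^ 2) ≠ 0 :=
  (Real.toNNReal_pos.2 (by positivity)).ne'

lemma lintegral_normalDensity {m s : ℝ} (hs : 0 < s) :
    ∫⁻ x, ENNReal.ofReal (normalDensity m s x) = 1 := by
  have := lintegral_gaussianPDF_eq_one m (toNNReal_sq_ne_zero hs)
  simpa only [gaussianPDF_eq_normalDensity hs] using this

lemma lintegral_gaussianReal {m s : ℝ} (hs : 0 < s) {f : ℝ → ℝ≥0∞} (hf : Measurable f) :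
    ∫⁻ x, f x ∂(gaussianReal m (Real.toNNReal (s ^ 2)))
      = ∫⁻ x, ENNReal.ofReal (normalDensity m s x) * f x := by
  rw [gaussianReal_of_var_ne_zero _ (toNNReal_sq_ne_zero hs),
    lintegral_withDensity_eq_lintegral_mul _ (measurable_gaussianPDF _ _) hf]
  simp [gaussianPDF_eq_normalDensity hs]

/-- The geometric mean of two Gaussian densities is a multiple of a Gaussian density; the factor
is their Hellinger affinity. -/
lemma normalDensity_mul_eq_sq {m₁ m₂ s₁ s₂ : ℝ} (h₁ : 0 < s₁) (h₂ : 0 < s₂) (x : ℝ) :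
    normalDensity m₁ s₁ x * normalDensity m₂ s₂ x
      = (√(2 * s₁ * s₂ / (s₁ ^ 2 + s₂ ^ 2)) * Real.exp (-(m₁ - m₂) ^ 2 / (4 * (s₁ ^ 2 + s₂ ^ 2)))
        * normalDensity ((m₁ * s₂ ^ 2 + m₂ * s₁ ^ 2) / (s₁ ^ 2 + s₂ ^ 2))
          (√2 * s₁ * s₂ / √(s₁ ^ 2 + s₂ ^ 2)) x) ^ 2 := by
  have hv : 0 < s₁ ^ 2 + s₂ ^ 2 := by positivity
  have hq : √(s₁ ^ 2 + s₂ ^ 2) ^ 2 = s₁ ^ 2 + s₂ ^ 2 := Real.sq_sqrt hv.le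
  have hq0 : 0 < √(s₁ ^ 2 + s₂ ^ 2) := Real.sqrt_pos.2 hv
  have h2 : √2 ^ 2 = (2 : ℝ) := Real.sq_sqrt (by norm_num)
  have hpi : √(2 * Real.pi) ^ 2 = 2 * Real.pi := Real.sq_sqrt (by positivity)
  unfold normalDensity
  have e1 : ∀ a b c d : ℝ, (a * Real.exp b) * (c * Real.exp d) = a * c * Real.exp (b + d) := by
    intros; rw [Real.exp_add]; ring
  have e2 : ∀ a b c d : ℝ, (a * Real.exp b * (c * Real.exp d)) ^ 2
      = (a ^ 2 * c ^ 2) * Real.exp (2 * (b + d)) := by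
    intro a b c d
    rw [two_mul, Real.exp_add (b + d), Real.exp_add]; ring
  rw [e1, e2]
  congr 1
  · rw [Real.sq_sqrt (by positivity), inv_pow, mul_pow, div_pow, mul_pow, mul_pow, h2, hq, hpi,
      ← mul_inv, show s₁ * √(2 * Real.pi) * (s₂ * √(2 * Real.pi))
        = s₁ * s₂ * √(2 * Real.pi) ^ 2 by ring, hpi]
    field_simp
  · congr 1
    rw [div_pow, mul_pow, mul_pow, h2, hq]
    field_simp
    ring

lemma lintegral_sqrt_normalDensity_mul {m₁ m₂ s₁ s₂ : ℝ} (h₁ : 0 < s₁) (h₂ : 0 < s₂) :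
    ∫⁻ x, ENNReal.ofReal (√(normalDensity m₁ s₁ x * normalDensity m₂ s₂ x))
      = ENNReal.ofReal (√(2 * s₁ * s₂ / (s₁ ^ 2 + s₂ ^ 2)) *
        Real.exp (-(m₁ - m₂) ^ 2 / (4 * (s₁ ^ 2 + s₂ ^ 2)))) := by
  have hs : 0 < √2 * s₁ * s₂ / √(s₁ ^ 2 + s₂ ^ 2) := by positivity
  simp_rw [normalDensity_mul_eq_sq h₁ h₂]
  have : ∀ x, ENNReal.ofReal (√((√(2 * s₁ * s₂ / (s₁ ^ 2 + s₂ ^ 2)) *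
        Real.exp (-(m₁ - m₂) ^ 2 / (4 * (s₁ ^ 2 + s₂ ^ 2)))
        * normalDensity ((m₁ * s₂ ^ 2 + m₂ * s₁ ^ 2) / (s₁ ^ 2 + s₂ ^ 2))
          (√2 * s₁ * s₂ / √(s₁ ^ 2 + s₂ ^ 2)) x) ^ 2))
      = ENNReal.ofReal (√(2 * s₁ * s₂ / (s₁ ^ 2 + s₂ ^ 2)) *
        Real.exp (-(m₁ - m₂) ^ 2 / (4 * (s₁ ^ 2 + s₂ ^ 2)))) *
        ENNReal.ofReal (normalDensity ((m₁ * s₂ ^ 2 + m₂ * s₁ ^ 2) / (s₁ ^ 2 + s₂ ^ 2))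
          (√2 * s₁ * s₂ / √(s₁ ^ 2 + s₂ ^ 2)) x) := by
    intro x
    have := (normalDensity_pos (m := (m₁ * s₂ ^ 2 + m₂ * s₁ ^ 2) / (s₁ ^ 2 + s₂ ^ 2)) hs x).le
    rw [Real.sqrt_sq (by positivity), ENNReal.ofReal_mul (by positivity)]
  simp_rw [this]
  rw [lintegral_const_mul _ (measurable_normalDensity _ _).ennreal_ofReal,
    lintegral_normalDensity hs, mul_one]

lemma normalDensity_sq_div {m₁ m₂ s₁ s₂ : ℝ} (h₁ : 0 < s₁) (h₂ : 0 < s₂)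
    (hD : 0 < 2 * s₂ ^ 2 - s₁ ^ 2) (x : ℝ) :
    normalDensity m₁ s₁ x ^ 2 / normalDensity m₂ s₂ x
      = s₂ ^ 2 / (s₁ * √(2 * s₂ ^ 2 - s₁ ^ 2))
          * Real.exp ((m₁ - m₂) ^ 2 / (2 * s₂ ^ 2 - s₁ ^ 2))
        * normalDensity ((2 * m₁ * s₂ ^ 2 - m₂ * s₁ ^ 2) / (2 * s₂ ^ 2 - s₁ ^ 2))
          (s₁ * s₂ / √(2 * s₂ ^ 2 - s₁ ^ 2)) x := by
  have hq : √(2 * s₂ ^ 2 - s₁ ^ 2) ^ 2 = 2 * s₂ ^ 2 - s₁ ^ 2 := Real.sq_sqrt hD.le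
  have hq0 : 0 < √(2 * s₂ ^ 2 - s₁ ^ 2) := Real.sqrt_pos.2 hD
  have hpi : 0 < √(2 * Real.pi) := by positivity
  unfold normalDensity
  have e1 : ∀ a b c d : ℝ, (a * Real.exp b) ^ 2 / (c * Real.exp d)
      = a ^ 2 / c * Real.exp (2 * b - d) := by
    intros; rw [Real.exp_sub, two_mul, Real.exp_add]; ring
  have e2 : ∀ a b c d : ℝ, (a * Real.exp b * (c * Real.exp d))
      = (a * c) * Real.exp (b + d) := by
    intro a b c d
    rw [Real.exp_add]; ring
  rw [e1, e2]
  congr 1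
  · field_simp
  · congr 1
    rw [div_pow, mul_pow, hq]
    field_simp
    ring

lemma lintegral_normalDensity_sq_div {m₁ m₂ s₁ s₂ : ℝ} (h₁ : 0 < s₁) (h₂ : 0 < s₂)
    (hD : 0 < 2 * s₂ ^ 2 - s₁ ^ 2) :
    ∫⁻ x, ENNReal.ofReal (normalDensity m₁ s₁ x ^ 2 / normalDensity m₂ s₂ x)
      = ENNReal.ofReal (s₂ ^ 2 / (s₁ * √(2 * s₂ ^ 2 - s₁ ^ 2))
          * Real.exp ((m₁ - m₂) ^ 2 / (2 * s₂ ^ 2 - s₁ ^ 2))) := by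
  have hs : 0 < s₁ * s₂ / √(2 * s₂ ^ 2 - s₁ ^ 2) := by positivity
  simp_rw [normalDensity_sq_div h₁ h₂ hD]
  have hc : 0 ≤ s₂ ^ 2 / (s₁ * √(2 * s₂ ^ 2 - s₁ ^ 2))
          * Real.exp ((m₁ - m₂) ^ 2 / (2 * s₂ ^ 2 - s₁ ^ 2)) := by positivity
  simp_rw [ENNReal.ofReal_mul hc]
  rw [lintegral_const_mul _ (measurable_normalDensity _ _).ennreal_ofReal,
    lintegral_normalDensity hs, mul_one]

/-- The chi-square integral of two Gaussian laws whose parameters are within `ε`. -/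
lemma chiSquare_factor_le {m₁ m₂ s₁ s₂ ε K : ℝ} (h₁ : 0 < s₁) (h₂ : 0 < s₂)
    (hε : ε ≤ 1 / 16) (hlog : |Real.log s₁ - Real.log s₂| ≤ ε) (hm : |m₁ - m₂| ≤ K * ε * s₂) :
    0 < 2 * s₂ ^ 2 - s₁ ^ 2 ∧
    s₂ ^ 2 / (s₁ * √(2 * s₂ ^ 2 - s₁ ^ 2)) * Real.exp ((m₁ - m₂) ^ 2 / (2 * s₂ ^ 2 - s₁ ^ 2))
      ≤ Real.exp ((32 + 2 * K ^ 2) * ε ^ 2) := by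
  have hε0 : 0 ≤ ε := (abs_nonneg _).trans hlog
  set t := 2 * (Real.log s₁ - Real.log s₂) with ht
  have hr : s₁ ^ 2 = s₂ ^ 2 * Real.exp t := by
    rw [ht, mul_comm 2, mul_two, Real.exp_add, Real.exp_sub, Real.exp_log h₁, Real.exp_log h₂]
    field_simp
  have htε : |t| ≤ 2 * ε := by rw [ht, abs_mul, abs_two]; linarith
  have ht1 : |t| ≤ 1 := by linarith
  have hw : |Real.exp t - 1| ≤ 4 * ε := by
    have := Real.abs_exp_sub_one_le ht1
    linarith
  set w := Real.exp t - 1 with hwdef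
  have he : Real.exp t = 1 + w := by rw [hwdef]; ring
  have hw' := abs_le.1 hw
  have hs22 : 0 < s₂ ^ 2 := by positivity
  have hDe : 2 * s₂ ^ 2 - s₁ ^ 2 = s₂ ^ 2 * (1 - w) := by rw [hr, he]; ring
  have hD2 : s₂ ^ 2 / 2 ≤ 2 * s₂ ^ 2 - s₁ ^ 2 := by
    rw [hDe]; nlinarith
  have hD : 0 < 2 * s₂ ^ 2 - s₁ ^ 2 := by linarith
  refine ⟨hD, ?_⟩
  have h3 : Real.exp ((m₁ - m₂) ^ 2 / (2 * s₂ ^ 2 - s₁ ^ 2)) ≤ Real.exp (2 * K ^ 2 * ε ^ 2) := by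
    apply Real.exp_le_exp.2
    rw [div_le_iff₀ hD]
    have : (m₁ - m₂) ^ 2 ≤ (K * ε * s₂) ^ 2 := by
      rw [← sq_abs]; gcongr
    nlinarith [sq_nonneg (K * ε)]
  have hww : w ^ 2 ≤ 16 * ε ^ 2 := by
    rw [← sq_abs]
    calc |w| ^ 2 ≤ (4 * ε) ^ 2 := by gcongr
      _ = _ := by ring
  have h4 : s₂ ^ 2 / (s₁ * √(2 * s₂ ^ 2 - s₁ ^ 2)) ≤ Real.exp (32 * ε ^ 2) := by
    have hwlt : w ^ 2 ≤ 1 / 2 := by nlinarith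
    have hprod : (s₁ * √(2 * s₂ ^ 2 - s₁ ^ 2)) ^ 2 = (s₂ ^ 2) ^ 2 * (1 - w ^ 2) := by
      rw [mul_pow, Real.sq_sqrt hD.le, hDe, hr, he]; ring
    rw [div_le_iff₀ (by positivity)]
    apply le_of_sq_le_sq _ (by positivity)
    rw [mul_pow, hprod, ← Real.exp_nat_mul]
    have : (1 : ℝ) ≤ Real.exp (2 * w ^ 2) * (1 - w ^ 2) := by
      have := Real.add_one_le_exp (2 * w ^ 2)
      nlinarith
    have h5 : Real.exp (2 * w ^ 2) ≤ Real.exp ((2 : ℕ) * (32 * ε ^ 2)) := by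
      apply Real.exp_le_exp.2; push_cast; nlinarith
    have h6 : (1 : ℝ) ≤ Real.exp ((2 : ℕ) * (32 * ε ^ 2)) * (1 - w ^ 2) :=
      this.trans (by gcongr; linarith)
    nlinarith [sq_nonneg (s₂ ^ 2)]
  calc _ ≤ Real.exp (32 * ε ^ 2) * Real.exp (2 * K ^ 2 * ε ^ 2) := by gcongr
    _ = _ := by rw [← Real.exp_add]; congr 1; ring

/-- The square of the factor by which different standard deviations reduce the Hellinger affinity of
two Gaussian laws: it decays with the distance of the logarithms of the standard deviations. -/
lemma affinity_factor_le {s₁ s₂ : ℝ} (h₁ : 0 < s₁) (h₂ : 0 < s₂) :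
    2 * s₁ * s₂ / (s₁ ^ 2 + s₂ ^ 2) ≤ (1 + (Real.log s₁ - Real.log s₂) ^ 2 / 4)⁻¹ := by
  set t := Real.log s₁ - Real.log s₂
  have hr : s₁ = s₂ * Real.exp t := by
    rw [Real.exp_sub, Real.exp_log h₁, Real.exp_log h₂]; field_simp
  have hc : 1 + t ^ 2 / 4 ≤ Real.cosh t := by
    rw [← Real.cosh_abs, Real.cosh_eq, ← sq_abs]
    have h1 := Real.quadratic_le_exp_of_nonneg (abs_nonneg t)
    have h2 := Real.add_one_le_exp (-|t|)
    linarith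
  have : 2 * s₁ * s₂ / (s₁ ^ 2 + s₂ ^ 2) = (Real.cosh t)⁻¹ := by
    have h := Real.exp_pos t
    rw [Real.cosh_eq, hr, Real.exp_neg]
    field_simp
  rw [this]
  gcongr

/-! ### Likelihood ratios -/

section Likelihood

variable {d : ℕ} {x : ℕ → E d} {n : ℕ}

lemma likelihood_eq_ofReal (y : ℕ → ℝ) {θ : Param d} (hθ : 0 < θ.2) :
    likelihood x n y θ
      = ENNReal.ofReal (∏ i ∈ Finset.range n, normalDensity (θ.1 (x i)) θ.2 (y i)) := by
  unfold likelihood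
  rw [ENNReal.ofReal_prod_of_nonneg fun i _ => (normalDensity_pos hθ _).le]
  exact Finset.prod_congr rfl fun i _ => gaussianPDF_eq_normalDensity hθ _

lemma likelihood_ne_zero (y : ℕ → ℝ) {θ : Param d} (hθ : 0 < θ.2) : likelihood x n y θ ≠ 0 := by
  rw [likelihood_eq_ofReal y hθ]
  exact (ENNReal.ofReal_pos.2 (Finset.prod_pos fun i _ => normalDensity_pos hθ _)).ne'

lemma likelihood_ne_top (y : ℕ → ℝ) (θ : Param d) : likelihood x n y θ ≠ ∞ :=
  ENNReal.prod_ne_top fun _ _ => gaussianPDF_ne_top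

lemma measurable_likelihood (x : ℕ → E d) (n : ℕ) :
    Measurable fun p : Param d × (ℕ → ℝ) => likelihood x n p.2 p.1 := by
  unfold likelihood
  refine Finset.measurable_prod _ fun i _ => ?_
  have h : Measurable fun p : Param d × (ℕ → ℝ) =>
      (p.1.1 (x i), Real.toNNReal (p.1.2 ^ 2), p.2 i) :=
    ((measurable_pi_apply _).comp (measurable_fst.comp measurable_fst)).prodMk
      ((by fun_prop : Measurable fun p : Param d × (ℕ → ℝ) => Real.toNNReal (p.1.2 ^ 2)).prodMk
        ((measurable_pi_apply i).comp measurable_snd))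
  exact measurable_uncurry_gaussianPDF.comp h

/-- Integrals of product functions of the first `n` observations factorize. -/
lemma lintegral_dataLaw_prod {θ₀ : Param d} (h₀ : 0 < θ₀.2) {φ : ℕ → ℝ → ℝ}
    (hφ : ∀ i, Measurable (φ i)) :
    ∫⁻ y, ∏ i ∈ Finset.range n, ENNReal.ofReal (φ i (y i)) ∂dataLaw x θ₀
      = ∏ i ∈ Finset.range n, ∫⁻ t, ENNReal.ofReal (normalDensity (θ₀.1 (x i)) θ₀.2 t * φ i t) := by
  unfold dataLaw
  rw [lintegral_prod_eq_prod_lintegral_of_indepFun (Finset.range n)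
    (fun i (y : ℕ → ℝ) => ENNReal.ofReal (φ i (y i)))
    (iIndepFun_infinitePi (P := fun i => gaussianReal (θ₀.1 (x i)) (Real.toNNReal (θ₀.2 ^ 2)))
      (X := fun i t => ENNReal.ofReal (φ i t)) fun i => (hφ i).ennreal_ofReal)
    (fun i => ((hφ i).comp (measurable_pi_apply i)).ennreal_ofReal)]
  refine Finset.prod_congr rfl fun i _ => ?_
  rw [(measurePreserving_eval_infinitePi
    (fun i => gaussianReal (θ₀.1 (x i)) (Real.toNNReal (θ₀.2 ^ 2))) i).lintegral_comp
    (hφ i).ennreal_ofReal, lintegral_gaussianReal h₀ (hφ i).ennreal_ofReal]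
  refine lintegral_congr fun t => ?_
  rw [ENNReal.ofReal_mul (normalDensity_pos h₀ t).le]

/-- The likelihood ratio has mean one under the true law. -/
lemma lintegral_likelihoodRatio {θ θ₀ : Param d} (h : 0 < θ.2) (h₀ : 0 < θ₀.2) :
    ∫⁻ y, likelihood x n y θ / likelihood x n y θ₀ ∂dataLaw x θ₀ = 1 := by
  have : ∀ y, likelihood x n y θ / likelihood x n y θ₀
      = ∏ i ∈ Finset.range n, ENNReal.ofReal
        ((fun i t => normalDensity (θ.1 (x i)) θ.2 t / normalDensity (θ₀.1 (x i)) θ₀.2 t) i (y i)) := by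
    intro y
    rw [likelihood_eq_ofReal y h, likelihood_eq_ofReal y h₀,
      ← ENNReal.ofReal_div_of_pos (Finset.prod_pos fun i _ => normalDensity_pos h₀ _),
      ← Finset.prod_div_distrib, ENNReal.ofReal_prod_of_nonneg]
    exact fun i _ => (div_pos (normalDensity_pos h _) (normalDensity_pos h₀ _)).le
  simp_rw [this]
  rw [lintegral_dataLaw_prod h₀ (φ := fun i t => normalDensity (θ.1 (x i)) θ.2 t
      / normalDensity (θ₀.1 (x i)) θ₀.2 t) fun i => (measurable_normalDensity _ _).div
    (measurable_normalDensity _ _)]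
  refine Finset.prod_eq_one fun i _ => ?_
  rw [← lintegral_normalDensity (m := θ.1 (x i)) h]
  refine lintegral_congr fun t => ?_
  rw [mul_div_cancel₀ _ (normalDensity_pos h₀ _).ne']

/-- The chi-square integral `∫ p_θ² / p_{θ'}` in the `n`-fold experiment. -/
lemma lintegral_chiSquare_le {θ θ' θ₀ : Param d} {ε K : ℝ} (h : 0 < θ.2) (h' : 0 < θ'.2)
    (h₀ : 0 < θ₀.2) (hε : ε ≤ 1 / 16) (hlog : |Real.log θ.2 - Real.log θ'.2| ≤ ε)
    (hm : ∀ i < n, |θ.1 (x i) - θ'.1 (x i)| ≤ K * ε * θ'.2) :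
    ∫⁻ y, (likelihood x n y θ / likelihood x n y θ') ^ 2
        * (likelihood x n y θ' / likelihood x n y θ₀) ∂dataLaw x θ₀
      ≤ ENNReal.ofReal (Real.exp ((32 + 2 * K ^ 2) * (n * ε ^ 2))) := by
  have : ∀ y, (likelihood x n y θ / likelihood x n y θ') ^ 2
        * (likelihood x n y θ' / likelihood x n y θ₀)
      = ∏ i ∈ Finset.range n, ENNReal.ofReal
        ((fun i t => normalDensity (θ.1 (x i)) θ.2 t ^ 2 / normalDensity (θ'.1 (x i)) θ'.2 t
          / normalDensity (θ₀.1 (x i)) θ₀.2 t) i (y i)) := by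
    intro y
    have a := Finset.prod_pos fun i (_ : i ∈ Finset.range n) =>
      normalDensity_pos (m := θ.1 (x i)) h (y i)
    have b := Finset.prod_pos fun i (_ : i ∈ Finset.range n) =>
      normalDensity_pos (m := θ'.1 (x i)) h' (y i)
    have c := Finset.prod_pos fun i (_ : i ∈ Finset.range n) =>
      normalDensity_pos (m := θ₀.1 (x i)) h₀ (y i)
    rw [likelihood_eq_ofReal y h, likelihood_eq_ofReal y h', likelihood_eq_ofReal y h₀,
      ← ENNReal.ofReal_div_of_pos b, ← ENNReal.ofReal_div_of_pos c, ← ENNReal.ofReal_pow (by positivity),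
      ← ENNReal.ofReal_mul (by positivity), ← ENNReal.ofReal_prod_of_nonneg]
    · congr 1
      simp only [Finset.prod_div_distrib, Finset.prod_pow]
      field_simp
    · intro i _
      have := normalDensity_pos (m := θ.1 (x i)) h (y i)
      have := normalDensity_pos (m := θ'.1 (x i)) h' (y i)
      have := normalDensity_pos (m := θ₀.1 (x i)) h₀ (y i)
      positivity
  simp_rw [this]
  rw [lintegral_dataLaw_prod h₀ (φ := fun i t => normalDensity (θ.1 (x i)) θ.2 t ^ 2
      / normalDensity (θ'.1 (x i)) θ'.2 t / normalDensity (θ₀.1 (x i)) θ₀.2 t)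
    fun i => (((measurable_normalDensity _ _).pow_const 2).div
    (measurable_normalDensity _ _)).div (measurable_normalDensity _ _)]
  calc _ ≤ ∏ i ∈ Finset.range n, ENNReal.ofReal (Real.exp ((32 + 2 * K ^ 2) * ε ^ 2)) := by
        refine Finset.prod_le_prod' fun i hi => ?_
        obtain ⟨hD, hle⟩ := chiSquare_factor_le h h' hε hlog (hm i (Finset.mem_range.1 hi))
        refine le_trans (le_of_eq ?_) (ENNReal.ofReal_le_ofReal hle)
        rw [← lintegral_normalDensity_sq_div h h' hD]
        refine lintegral_congr fun t => ?_
        rw [mul_div_cancel₀ _ (normalDensity_pos h₀ _).ne']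
    _ = _ := by
        rw [Finset.prod_const, Finset.card_range, ← ENNReal.ofReal_pow (Real.exp_pos _).le,
          ← Real.exp_nat_mul]
        congr 2; ring

/-- The inverse likelihood ratio of a parameter close to the truth has a controlled mean under the
true law: it is a chi-square integral with the roles of the two parameters exchanged. -/
lemma lintegral_likelihoodRatio_inv_le {θ θ₀ : Param d} {ε K : ℝ} (h : 0 < θ.2)
    (h₀ : 0 < θ₀.2) (hε : ε ≤ 1 / 16) (hlog : |Real.log θ₀.2 - Real.log θ.2| ≤ ε)
    (hm : ∀ i < n, |θ₀.1 (x i) - θ.1 (x i)| ≤ K * ε * θ.2) :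
    ∫⁻ y, (likelihood x n y θ / likelihood x n y θ₀)⁻¹ ∂dataLaw x θ₀
      ≤ ENNReal.ofReal (Real.exp ((32 + 2 * K ^ 2) * (n * ε ^ 2))) := by
  refine le_trans (le_of_eq (lintegral_congr fun y => ?_))
    (lintegral_chiSquare_le h₀ h h₀ hε hlog hm)
  have a := likelihood_ne_zero (x := x) (n := n) y h
  have a' := likelihood_ne_top (x := x) (n := n) y θ
  have b := likelihood_ne_zero (x := x) (n := n) y h₀
  have b' := likelihood_ne_top (x := x) (n := n) y θ₀
  rw [sq, mul_assoc, ENNReal.inv_div (.inl b') (.inl b)]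
  have : likelihood x n y θ₀ / likelihood x n y θ * (likelihood x n y θ / likelihood x n y θ₀)
      = 1 := by
    rw [div_eq_mul_inv, div_eq_mul_inv, mul_assoc, ← mul_assoc _ (likelihood x n y θ) _,
      ENNReal.inv_mul_cancel a a', one_mul, ENNReal.mul_inv_cancel b b']
  rw [this, mul_one]

/-- Parameters at `rho`-distance at least `M ε` have exponentially small Hellinger affinity. -/
lemma lintegral_affinity_le {θ θ₀ : Param d} {ε M : ℝ} (h : 0 < θ.2) (h₀ : 0 < θ₀.2)
    (hM : 0 ≤ M) (hε : 0 ≤ ε) (hMε : M * ε ≤ 1) (hrho : M * ε < rho x n θ θ₀) :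
    ∫⁻ y, (likelihood x n y θ / likelihood x n y θ₀) ^ (1 / 2 : ℝ) ∂dataLaw x θ₀
      ≤ ENNReal.ofReal (Real.exp (-(min (1 / 64) (1 / (160 * θ₀.2 ^ 2)) * M ^ 2) * (n * ε ^ 2))) := by
  have : ∀ y, (likelihood x n y θ / likelihood x n y θ₀) ^ (1 / 2 : ℝ)
      = ∏ i ∈ Finset.range n, ENNReal.ofReal
        ((fun i t => √(normalDensity (θ.1 (x i)) θ.2 t / normalDensity (θ₀.1 (x i)) θ₀.2 t)) i
          (y i)) := by
    intro y
    have a := Finset.prod_pos fun i (_ : i ∈ Finset.range n) =>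
      normalDensity_pos (m := θ.1 (x i)) h (y i)
    have c := Finset.prod_pos fun i (_ : i ∈ Finset.range n) =>
      normalDensity_pos (m := θ₀.1 (x i)) h₀ (y i)
    rw [likelihood_eq_ofReal y h, likelihood_eq_ofReal y h₀,
      ← ENNReal.ofReal_div_of_pos c, ENNReal.ofReal_rpow_of_nonneg (by positivity) (by norm_num),
      ← Finset.prod_div_distrib, ← ENNReal.ofReal_prod_of_nonneg (fun _ _ => Real.sqrt_nonneg _)]
    congr 1
    rw [← Real.sqrt_eq_rpow, Real.sqrt_prod]
    exact fun i _ => (div_pos (normalDensity_pos h _) (normalDensity_pos h₀ _)).le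
  simp_rw [this]
  rw [lintegral_dataLaw_prod h₀ (φ := fun i t => √(normalDensity (θ.1 (x i)) θ.2 t
      / normalDensity (θ₀.1 (x i)) θ₀.2 t)) fun i => ((measurable_normalDensity _ _).div
    (measurable_normalDensity _ _)).sqrt]
  have hterm : ∀ i, ∫⁻ t, ENNReal.ofReal (normalDensity (θ₀.1 (x i)) θ₀.2 t *
      √(normalDensity (θ.1 (x i)) θ.2 t / normalDensity (θ₀.1 (x i)) θ₀.2 t))
      = ENNReal.ofReal (√(2 * θ.2 * θ₀.2 / (θ.2 ^ 2 + θ₀.2 ^ 2)) *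
        Real.exp (-(θ.1 (x i) - θ₀.1 (x i)) ^ 2 / (4 * (θ.2 ^ 2 + θ₀.2 ^ 2)))) := by
    intro i
    rw [← lintegral_sqrt_normalDensity_mul h h₀]
    refine lintegral_congr fun t => ?_
    congr 1
    have a := normalDensity_pos (m := θ.1 (x i)) h t
    have b := normalDensity_pos (m := θ₀.1 (x i)) h₀ t
    rw [Real.sqrt_div a.le, Real.sqrt_mul a.le]
    have : normalDensity (θ₀.1 (x i)) θ₀.2 t = √(normalDensity (θ₀.1 (x i)) θ₀.2 t) ^ 2 :=
      (Real.sq_sqrt b.le).symm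
    have hb := Real.sqrt_pos.2 b
    nth_rewrite 1 [this]
    field_simp
  simp_rw [hterm]
  rw [← ENNReal.ofReal_prod_of_nonneg fun _ _ => by positivity]
  apply ENNReal.ofReal_le_ofReal
  rw [Finset.prod_mul_distrib, Finset.prod_const, Finset.card_range, ← Real.exp_sum]
  set c := min (1 / 64) (1 / (160 * θ₀.2 ^ 2))
  set τ := Real.log θ.2 - Real.log θ₀.2 with hτ
  have hsum : ∑ i ∈ Finset.range n, -(θ.1 (x i) - θ₀.1 (x i)) ^ 2 / (4 * (θ.2 ^ 2 + θ₀.2 ^ 2))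
      = -((∑ i ∈ Finset.range n, |θ.1 (x i) - θ₀.1 (x i)| ^ 2) / (4 * (θ.2 ^ 2 + θ₀.2 ^ 2))) := by
    rw [Finset.sum_div, ← Finset.sum_neg_distrib]
    refine Finset.sum_congr rfl fun i _ => ?_
    rw [sq_abs, neg_div]
  rw [hsum]
  set V := ∑ i ∈ Finset.range n, |θ.1 (x i) - θ₀.1 (x i)| ^ 2 with hV
  have hV0 : 0 ≤ V := Finset.sum_nonneg fun i _ => by positivity
  have haff := affinity_factor_le h h₀
  have haff1 : 2 * θ.2 * θ₀.2 / (θ.2 ^ 2 + θ₀.2 ^ 2) ≤ 1 := by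
    rw [div_le_one (by positivity)]; nlinarith [sq_nonneg (θ.2 - θ₀.2)]
  unfold rho at hrho
  by_cases hcase : M * ε / 2 < |τ|
  · have h1 : Real.exp (-(V / (4 * (θ.2 ^ 2 + θ₀.2 ^ 2)))) ≤ 1 := by
      rw [Real.exp_le_one_iff]; have : 0 ≤ V / (4 * (θ.2 ^ 2 + θ₀.2 ^ 2)) := by positivity
      linarith
    have hτ2 : (M * ε / 2) ^ 2 ≤ τ ^ 2 := by
      rw [← sq_abs τ]; gcongr
    have h2 : 2 * θ.2 * θ₀.2 / (θ.2 ^ 2 + θ₀.2 ^ 2) ≤ Real.exp (-(M ^ 2 * ε ^ 2 / 32)) := by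
      refine haff.trans ?_
      rw [Real.exp_neg]
      apply inv_anti₀ (Real.exp_pos _)
      have h3 : M ^ 2 * ε ^ 2 ≤ 1 := by rw [← mul_pow]; exact pow_le_one₀ (by positivity) hMε
      have := Real.abs_exp_sub_one_le (x := M ^ 2 * ε ^ 2 / 32) (by
        rw [abs_of_nonneg (by positivity)]; linarith)
      rw [abs_of_nonneg (a := M ^ 2 * ε ^ 2 / 32) (by positivity)] at this
      have h4 := (abs_le.1 this).2
      nlinarith
    have h5 : √(2 * θ.2 * θ₀.2 / (θ.2 ^ 2 + θ₀.2 ^ 2)) ≤ Real.exp (-(M ^ 2 * ε ^ 2 / 64)) := by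
      rw [Real.sqrt_le_left (Real.exp_pos _).le, ← Real.exp_nat_mul]
      refine h2.trans (le_of_eq ?_)
      congr 1; push_cast; ring
    calc _ ≤ Real.exp (-(M ^ 2 * ε ^ 2 / 64)) ^ n * 1 := by gcongr
      _ = Real.exp (-(1 / 64 * M ^ 2) * (n * ε ^ 2)) := by
        rw [mul_one, ← Real.exp_nat_mul]; congr 1; ring
      _ ≤ _ := by
        apply Real.exp_le_exp.2
        have : c ≤ 1 / 64 := min_le_left _ _
        have h0 : 0 ≤ M ^ 2 * (n * ε ^ 2) := by positivity
        nlinarith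
  · rw [not_lt] at hcase
    have hΔ : M * ε / 2 < √((n : ℝ)⁻¹ * V) := by linarith
    have hn : (n : ℝ) ≠ 0 := by
      intro h0
      rw [h0] at hΔ
      simp only [inv_zero, zero_mul, Real.sqrt_zero] at hΔ
      have : 0 ≤ M * ε / 2 := by positivity
      linarith
    have hnpos : (0 : ℝ) < n := lt_of_le_of_ne (Nat.cast_nonneg n) hn.symm
    have hV1 : n * (M * ε / 2) ^ 2 ≤ V := by
      have := (Real.lt_sqrt (by positivity)).1 hΔ
      rw [inv_mul_eq_div, lt_div_iff₀ hnpos] at this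
      linarith
    have hσ : θ.2 ^ 2 ≤ 3 * θ₀.2 ^ 2 := by
      have hτ' : |τ| ≤ 1 / 2 := by linarith
      have : θ.2 ^ 2 = θ₀.2 ^ 2 * Real.exp (2 * τ) := by
        rw [two_mul, Real.exp_add, hτ, Real.exp_sub, Real.exp_log h, Real.exp_log h₀]
        field_simp
      rw [this, mul_comm]
      gcongr
      calc Real.exp (2 * τ) ≤ Real.exp 1 := by
            apply Real.exp_le_exp.2; linarith [(abs_le.1 hτ').2]
        _ ≤ 3 := Real.exp_one_lt_three.le
    have hs1 : √(2 * θ.2 * θ₀.2 / (θ.2 ^ 2 + θ₀.2 ^ 2)) ≤ 1 := by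
      rw [Real.sqrt_le_one]; exact haff1
    calc _ ≤ 1 ^ n * Real.exp (-(1 / (160 * θ₀.2 ^ 2) * M ^ 2) * (n * ε ^ 2)) := by
          gcongr
          rw [neg_mul, neg_le_neg_iff, le_div_iff₀ (by positivity)]
          refine le_trans ?_ hV1
          have hp : 0 < θ₀.2 ^ 2 := by positivity
          rw [show 1 / (160 * θ₀.2 ^ 2) * M ^ 2 * (n * ε ^ 2) * (4 * (θ.2 ^ 2 + θ₀.2 ^ 2))
            = (n * (M * ε / 2) ^ 2) * ((θ.2 ^ 2 + θ₀.2 ^ 2) / (10 * θ₀.2 ^ 2)) by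
              field_simp; ring]
          apply mul_le_of_le_one_right (by positivity)
          rw [div_le_one (by positivity)]
          linarith
      _ ≤ _ := by
        rw [one_pow, one_mul]
        apply Real.exp_le_exp.2
        have : c ≤ 1 / (160 * θ₀.2 ^ 2) := min_le_right _ _
        have h0 : 0 ≤ M ^ 2 * (n * ε ^ 2) := by positivity
        nlinarith

end Likelihood

/-! ### Posterior contraction without tests -/

section Contraction

variable {d : ℕ} {x : ℕ → E d} {n : ℕ}

instance (x : ℕ → E d) (θ : Param d) : IsProbabilityMeasure (dataLaw x θ) := by
  unfold dataLaw; infer_instance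

/-- The likelihood ratio of `θ` against `θ₀`. -/
def likelihoodRatio (x : ℕ → E d) (n : ℕ) (θ₀ θ : Param d) (y : ℕ → ℝ) : ℝ≥0∞ :=
  likelihood x n y θ / likelihood x n y θ₀

lemma measurable_likelihoodRatio (x : ℕ → E d) (n : ℕ) (θ₀ : Param d) :
    Measurable fun p : Param d × (ℕ → ℝ) => likelihoodRatio x n θ₀ p.1 p.2 := by
  have h : Measurable fun p : Param d × (ℕ → ℝ) => likelihood x n p.2 θ₀ := by
    unfold likelihood
    exact Finset.measurable_prod _ fun i _ =>
      (measurable_gaussianPDF _ _).comp ((measurable_pi_apply i).comp measurable_snd)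
  exact Measurable.div (measurable_likelihood x n) h

lemma measurable_likelihoodRatio_left (x : ℕ → E d) (n : ℕ) (θ₀ : Param d) (y : ℕ → ℝ) :
    Measurable fun θ : Param d => likelihoodRatio x n θ₀ θ y :=
  Measurable.of_uncurry_right (f := fun θ y => likelihoodRatio x n θ₀ θ y)
    (measurable_likelihoodRatio x n θ₀)

lemma measurable_likelihoodRatio_right (x : ℕ → E d) (n : ℕ) (θ₀ θ : Param d) :
    Measurable fun y : ℕ → ℝ => likelihoodRatio x n θ₀ θ y :=
  Measurable.of_uncurry_left (f := fun θ y => likelihoodRatio x n θ₀ θ y)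
    (measurable_likelihoodRatio x n θ₀)

lemma likelihoodRatio_ne_zero (y : ℕ → ℝ) {θ₀ θ : Param d} (h : 0 < θ.2) :
    likelihoodRatio x n θ₀ θ y ≠ 0 :=
  ENNReal.div_ne_zero.2 ⟨likelihood_ne_zero y h, likelihood_ne_top y θ₀⟩

lemma likelihoodRatio_ne_top (y : ℕ → ℝ) {θ₀ θ : Param d} (h₀ : 0 < θ₀.2) :
    likelihoodRatio x n θ₀ θ y ≠ ∞ :=
  ENNReal.div_ne_top (likelihood_ne_top y θ) (likelihood_ne_zero y h₀)

lemma measurable_lintegral_likelihoodRatio (Pi₀ : Measure (Param d)) [SFinite Pi₀]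
    (x : ℕ → E d) (n : ℕ) (θ₀ : Param d) :
    Measurable fun y => ∫⁻ θ, likelihoodRatio x n θ₀ θ y ∂Pi₀ :=
  (measurable_likelihoodRatio x n θ₀).lintegral_prod_left'

/-- Bayes' formula in terms of likelihood ratios. -/
lemma posterior_apply (Pi₀ : Measure (Param d)) (y : ℕ → ℝ) {θ₀ : Param d} (h₀ : 0 < θ₀.2)
    {U : Set (Param d)} (hU : MeasurableSet U) :
    posterior Pi₀ x n y U = (∫⁻ θ, likelihoodRatio x n θ₀ θ y ∂Pi₀)⁻¹
      * ∫⁻ θ in U, likelihoodRatio x n θ₀ θ y ∂Pi₀ := by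
  have a := likelihood_ne_zero (x := x) (n := n) y h₀
  have b := likelihood_ne_top (x := x) (n := n) y θ₀
  have hL : ∀ θ, likelihood x n y θ = likelihood x n y θ₀ * likelihoodRatio x n θ₀ θ y := by
    intro θ
    unfold likelihoodRatio
    rw [ENNReal.mul_div_cancel a b]
  unfold posterior
  rw [Measure.smul_apply, withDensity_apply _ hU, smul_eq_mul]
  rw [lintegral_congr hL, lintegral_congr hL, lintegral_const_mul _ (measurable_likelihoodRatio_left x n θ₀ y),
    lintegral_const_mul _ (measurable_likelihoodRatio_left x n θ₀ y),
    ENNReal.mul_inv (.inl a) (.inl b), mul_mul_mul_comm, ENNReal.inv_mul_cancel a b, one_mul]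

/-- The prior mean of the likelihood ratio has mean one under the true law. -/
lemma lintegral_lintegral_likelihoodRatio (Pi₀ : Measure (Param d)) [SFinite Pi₀]
    (hpos : ∀ᵐ θ ∂Pi₀, 0 < θ.2) {θ₀ : Param d} (h₀ : 0 < θ₀.2) :
    ∫⁻ y, ∫⁻ θ, likelihoodRatio x n θ₀ θ y ∂Pi₀ ∂dataLaw x θ₀ = Pi₀ Set.univ := by
  rw [lintegral_lintegral_swap]
  · rw [← lintegral_one]
    refine lintegral_congr_ae ?_
    filter_upwards [hpos] with θ hθ
    exact lintegral_likelihoodRatio hθ h₀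
  · exact ((measurable_likelihoodRatio x n θ₀).comp measurable_swap).aemeasurable

/-- The marginal density is almost surely positive and finite, so that the posterior is a
probability measure. -/
lemma ae_isProbabilityMeasure_posterior (Pi₀ : Measure (Param d)) [IsProbabilityMeasure Pi₀]
    (hpos : ∀ᵐ θ ∂Pi₀, 0 < θ.2) {θ₀ : Param d} (h₀ : 0 < θ₀.2) :
    ∀ᵐ y ∂dataLaw x θ₀, IsProbabilityMeasure (posterior Pi₀ x n y) := by
  have hfin : ∀ᵐ y ∂dataLaw x θ₀, ∫⁻ θ, likelihoodRatio x n θ₀ θ y ∂Pi₀ < ∞ := by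
    refine ae_lt_top (measurable_lintegral_likelihoodRatio Pi₀ x n θ₀) ?_
    rw [lintegral_lintegral_likelihoodRatio Pi₀ hpos h₀]
    exact measure_ne_top _ _
  filter_upwards [hfin] with y hy
  refine ⟨?_⟩
  rw [posterior_apply Pi₀ y h₀ MeasurableSet.univ, Measure.restrict_univ]
  refine ENNReal.inv_mul_cancel ?_ hy.ne
  rw [Ne, lintegral_eq_zero_iff (measurable_likelihoodRatio_left x n θ₀ y)]
  intro h
  have : ∀ᵐ θ ∂Pi₀, False := by
    filter_upwards [h, hpos] with θ hθ hθ'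
    exact likelihoodRatio_ne_zero y hθ' hθ
  exact (this.exists).elim fun _ h => h

/-- The evidence on a set `B` is not small in mean: an upper bound for its inverse moment. -/
lemma lintegral_evidence_inv_le (Pi₀ : Measure (Param d)) [IsProbabilityMeasure Pi₀]
    {θ₀ : Param d} (h₀ : 0 < θ₀.2) {B : Set (Param d)} (hB : MeasurableSet B)
    (hB0 : Pi₀ B ≠ 0) (hBpos : ∀ θ ∈ B, 0 < θ.2) {c : ℝ≥0∞}
    (hc : ∀ θ ∈ B, ∫⁻ y, (likelihoodRatio x n θ₀ θ y)⁻¹ ∂dataLaw x θ₀ ≤ c) :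
    ∫⁻ y, (∫⁻ θ in B, likelihoodRatio x n θ₀ θ y ∂Pi₀)⁻¹ ∂dataLaw x θ₀ ≤ (Pi₀ B)⁻¹ * c := by
  have hBt : Pi₀ B ≠ ∞ := measure_ne_top _ _
  -- Cauchy-Schwarz inequality for the square roots of the likelihood ratio and of its inverse
  have hCS : ∀ y, Pi₀ B ^ 2 ≤ (∫⁻ θ in B, likelihoodRatio x n θ₀ θ y ∂Pi₀)
      * ∫⁻ θ in B, (likelihoodRatio x n θ₀ θ y)⁻¹ ∂Pi₀ := by
    intro y
    have hm := measurable_likelihoodRatio_left x n θ₀ y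
    have h := ENNReal.lintegral_mul_le_Lp_mul_Lq (Pi₀.restrict B)
      (p := 2) (q := 2) (by constructor <;> norm_num)
      (f := fun θ => likelihoodRatio x n θ₀ θ y ^ (1 / 2 : ℝ))
      (g := fun θ => ((likelihoodRatio x n θ₀ θ y)⁻¹) ^ (1 / 2 : ℝ))
      (hm.pow_const _).aemeasurable (hm.inv.pow_const _).aemeasurable
    have h1 : ∫⁻ θ in B, ((fun θ => likelihoodRatio x n θ₀ θ y ^ (1 / 2 : ℝ)) *
        fun θ => ((likelihoodRatio x n θ₀ θ y)⁻¹) ^ (1 / 2 : ℝ)) θ ∂Pi₀ = Pi₀ B := by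
      rw [← setLIntegral_one B]
      refine setLIntegral_congr_fun hB fun θ hθ => ?_
      simp only [Pi.mul_apply]
      rw [← ENNReal.mul_rpow_of_nonneg _ _ (by norm_num), ENNReal.mul_inv_cancel
        (likelihoodRatio_ne_zero y (hBpos θ hθ)) (likelihoodRatio_ne_top y h₀), ENNReal.one_rpow]
    rw [h1] at h
    simp only [← ENNReal.rpow_mul] at h
    norm_num at h
    rw [← ENNReal.mul_rpow_of_nonneg _ _ (by norm_num)] at h
    calc Pi₀ B ^ 2 ≤ (_ ^ (1 / 2 : ℝ)) ^ 2 := by gcongr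
      _ = _ := by rw [← ENNReal.rpow_natCast, ← ENNReal.rpow_mul]; norm_num
  have hpt : ∀ y, (∫⁻ θ in B, likelihoodRatio x n θ₀ θ y ∂Pi₀)⁻¹
      ≤ (Pi₀ B)⁻¹ ^ 2 * ∫⁻ θ in B, (likelihoodRatio x n θ₀ θ y)⁻¹ ∂Pi₀ := by
    intro y
    have h := hCS y
    set X := ∫⁻ θ in B, likelihoodRatio x n θ₀ θ y ∂Pi₀
    set Y := ∫⁻ θ in B, (likelihoodRatio x n θ₀ θ y)⁻¹ ∂Pi₀
    rw [ENNReal.inv_le_iff_inv_le, ENNReal.mul_inv (.inl (by simp [hBt])) (.inl (by simp [hB0])),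
      ← ENNReal.inv_pow, inv_inv]
    rw [mul_comm X] at h
    rw [← div_eq_mul_inv]
    exact ENNReal.div_le_of_le_mul' h
  calc _ ≤ ∫⁻ y, (Pi₀ B)⁻¹ ^ 2 * ∫⁻ θ in B, (likelihoodRatio x n θ₀ θ y)⁻¹ ∂Pi₀ ∂dataLaw x θ₀ :=
        lintegral_mono hpt
    _ = (Pi₀ B)⁻¹ ^ 2 * ∫⁻ θ in B, ∫⁻ y, (likelihoodRatio x n θ₀ θ y)⁻¹ ∂dataLaw x θ₀ ∂Pi₀ := by
        have hm : Measurable fun p : Param d × (ℕ → ℝ) => (likelihoodRatio x n θ₀ p.1 p.2)⁻¹ :=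
          (measurable_likelihoodRatio x n θ₀).inv
        rw [lintegral_const_mul _ hm.lintegral_prod_left', lintegral_lintegral_swap]
        exact (hm.comp measurable_swap).aemeasurable
    _ ≤ (Pi₀ B)⁻¹ ^ 2 * ∫⁻ θ in B, c ∂Pi₀ := by
        refine mul_le_mul' le_rfl ?_
        exact setLIntegral_mono measurable_const hc
    _ = (Pi₀ B)⁻¹ * c := by
        rw [setLIntegral_const, sq, mul_assoc, mul_comm c, ← mul_assoc _ _ c,
          ENNReal.inv_mul_cancel hB0 hBt, one_mul]

/-- A piece of the parameter space that is far from the truth and has small diameter receives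
little posterior mass. The affinity and the chi-square integral are combined by Hölder's
inequality with exponents `3/2` and `3`. -/
lemma lintegral_min_piece_le (Pi₀ : Measure (Param d)) [IsProbabilityMeasure Pi₀]
    {θ₀ θ₁ : Param d} (h₁ : 0 < θ₁.2) {A : Set (Param d)} {c H X : ℝ≥0∞}
    (hH : ∫⁻ y, (likelihoodRatio x n θ₀ θ₁ y) ^ (1 / 2 : ℝ) ∂dataLaw x θ₀ ≤ H)
    (hX : ∀ θ ∈ A, ∫⁻ y, (likelihoodRatio x n θ₁ θ y) ^ 2 * likelihoodRatio x n θ₀ θ₁ y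
      ∂dataLaw x θ₀ ≤ X) :
    ∫⁻ y, min 1 (c * ∫⁻ θ in A, likelihoodRatio x n θ₀ θ y ∂Pi₀) ∂dataLaw x θ₀
      ≤ c ^ (2 / 3 : ℝ) * H ^ (2 / 3 : ℝ) * X ^ (1 / 3 : ℝ) := by
  set ρ : (ℕ → ℝ) → ℝ≥0∞ := fun y => likelihoodRatio x n θ₀ θ₁ y with hρ
  set W : (ℕ → ℝ) → ℝ≥0∞ := fun y => ∫⁻ θ in A, likelihoodRatio x n θ₁ θ y ∂Pi₀ with hW
  have hρm : Measurable ρ := measurable_likelihoodRatio_right x n θ₀ θ₁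
  have hWm : Measurable W := measurable_lintegral_likelihoodRatio _ x n θ₁
  -- With this factorization, `min 1 (c ρ W) ≤ (c ρ W)^(2/3) = c^(2/3) ρ^(1/3) (ρ W²)^(1/3)`.
  have hfact : ∀ y, ∫⁻ θ in A, likelihoodRatio x n θ₀ θ y ∂Pi₀ = ρ y * W y := by
    intro y
    simp only [hρ, hW]
    rw [← lintegral_const_mul _ (measurable_likelihoodRatio_left x n θ₁ y)]
    refine lintegral_congr fun θ => ?_
    unfold likelihoodRatio
    rw [mul_comm, div_eq_mul_inv, div_eq_mul_inv, div_eq_mul_inv, mul_assoc,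
      ← mul_assoc (likelihood x n y θ₁)⁻¹,
      ENNReal.inv_mul_cancel (likelihood_ne_zero y h₁) (likelihood_ne_top y _), one_mul]
  have hmin : ∀ z : ℝ≥0∞, min 1 z ≤ z ^ (2 / 3 : ℝ) := by
    intro z
    rcases le_total 1 z with h | h
    · rw [min_eq_left h]; exact ENNReal.one_le_rpow h (by norm_num)
    · rw [min_eq_right h]; 
      simpa using ENNReal.rpow_le_rpow_of_exponent_ge h (by norm_num : (2 / 3 : ℝ) ≤ 1)
  have hW2 : ∀ y, W y ^ 2 ≤ ∫⁻ θ in A, likelihoodRatio x n θ₁ θ y ^ 2 ∂Pi₀ := by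
    intro y
    have hm := measurable_likelihoodRatio_left x n θ₁ y
    have h := ENNReal.lintegral_mul_le_Lp_mul_Lq (Pi₀.restrict A)
      (p := 2) (q := 2) (by constructor <;> norm_num)
      (f := fun θ => likelihoodRatio x n θ₁ θ y) (g := fun _ => 1)
      hm.aemeasurable measurable_const.aemeasurable
    simp only [Pi.mul_apply, mul_one, ENNReal.one_rpow, lintegral_one, Measure.restrict_apply_univ]
      at h
    calc W y ^ 2 ≤ ((∫⁻ θ in A, likelihoodRatio x n θ₁ θ y ^ (2 : ℝ) ∂Pi₀) ^ (1 / 2 : ℝ)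
          * (Pi₀ A) ^ (1 / 2 : ℝ)) ^ 2 := by gcongr
      _ ≤ ((∫⁻ θ in A, likelihoodRatio x n θ₁ θ y ^ (2 : ℝ) ∂Pi₀) ^ (1 / 2 : ℝ) * 1) ^ 2 := by
          gcongr
          exact ENNReal.rpow_le_one prob_le_one (by norm_num)
      _ = _ := by
          rw [mul_one, ← ENNReal.rpow_natCast, ← ENNReal.rpow_mul]
          norm_num
  have hρW : ∫⁻ y, ρ y * W y ^ 2 ∂dataLaw x θ₀ ≤ X := by
    have hm : Measurable fun p : Param d × (ℕ → ℝ) =>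
        likelihoodRatio x n θ₁ p.1 p.2 ^ 2 * likelihoodRatio x n θ₀ θ₁ p.2 :=
      ((measurable_likelihoodRatio x n θ₁).pow_const 2).mul (hρm.comp measurable_snd)
    calc _ ≤ ∫⁻ y, ∫⁻ θ in A, likelihoodRatio x n θ₁ θ y ^ 2 * likelihoodRatio x n θ₀ θ₁ y ∂Pi₀
            ∂dataLaw x θ₀ := by
          refine lintegral_mono fun y => ?_
          rw [lintegral_mul_const _ ((measurable_likelihoodRatio_left x n θ₁ y).pow_const 2),
            mul_comm]
          gcongr
          exact hW2 y
      _ = ∫⁻ θ in A, ∫⁻ y, likelihoodRatio x n θ₁ θ y ^ 2 * likelihoodRatio x n θ₀ θ₁ y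
            ∂dataLaw x θ₀ ∂Pi₀ :=
          lintegral_lintegral_swap (hm.comp measurable_swap).aemeasurable
      _ ≤ ∫⁻ θ in A, X ∂Pi₀ := setLIntegral_mono measurable_const hX
      _ ≤ X := by
          rw [setLIntegral_const]
          exact mul_le_of_le_one_right' prob_le_one
  calc _ ≤ ∫⁻ y, c ^ (2 / 3 : ℝ) * (ρ y ^ (1 / 3 : ℝ) * (ρ y ^ (1 / 3 : ℝ) * W y ^ (2 / 3 : ℝ)))
        ∂dataLaw x θ₀ := by
        refine lintegral_mono fun y => (hmin _).trans (le_of_eq ?_)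
        rw [hfact, ENNReal.mul_rpow_of_nonneg _ _ (by norm_num),
          ENNReal.mul_rpow_of_nonneg _ _ (by norm_num), ← mul_assoc (ρ y ^ (1 / 3 : ℝ)),
          ← ENNReal.rpow_add_of_nonneg _ _ (by norm_num) (by norm_num)]
        norm_num
    _ = c ^ (2 / 3 : ℝ) * ∫⁻ y, ((fun y => ρ y ^ (1 / 3 : ℝ)) *
          fun y => (ρ y ^ (1 / 3 : ℝ) * W y ^ (2 / 3 : ℝ))) y ∂dataLaw x θ₀ := by
        rw [← lintegral_const_mul]
        · rfl
        · exact (hρm.pow_const _).mul ((hρm.pow_const _).mul (hWm.pow_const _))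
    _ ≤ c ^ (2 / 3 : ℝ) * (H ^ (2 / 3 : ℝ) * X ^ (1 / 3 : ℝ)) := by
        refine mul_le_mul' le_rfl ?_
        refine (ENNReal.lintegral_mul_le_Lp_mul_Lq (dataLaw x θ₀) (p := 3 / 2) (q := 3)
          (by constructor <;> norm_num) (hρm.pow_const _).aemeasurable
          ((hρm.pow_const _).mul (hWm.pow_const _)).aemeasurable).trans ?_
        gcongr ?_ * ?_
        · simp only [← ENNReal.rpow_mul]
          norm_num
          gcongr
        · gcongr
          refine le_trans (le_of_eq (lintegral_congr fun y => ?_)) hρW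
          rw [Pi.mul_apply, ENNReal.mul_rpow_of_nonneg _ _ (by norm_num), ← ENNReal.rpow_mul,
            ← ENNReal.rpow_mul, ← ENNReal.rpow_natCast]
          norm_num
    _ = _ := by rw [mul_assoc]

end Contraction

section ContractionRate

variable {d : ℕ}

lemma measurable_rho (x : ℕ → E d) (n : ℕ) (θ₀ : Param d) :
    Measurable fun θ : Param d => rho x n θ θ₀ := by
  unfold rho
  have h : ∀ i, Measurable fun θ : Param d => θ.1 (x i) := fun i =>
    (measurable_pi_apply (x i)).comp measurable_fst
  have h' : Measurable fun θ : Param d => Real.log θ.2 := Real.measurable_log.comp measurable_snd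
  refine Measurable.add (Measurable.sqrt (Measurable.const_mul ?_ _)) ?_
  · exact Finset.measurable_fun_sum _ fun i _ =>
      (continuous_abs.measurable.comp ((h i).sub_const _)).pow_const 2
  · exact continuous_abs.measurable.comp (h'.sub_const _)

/-- The nonasymptotic bound behind posterior contraction: the expected posterior mass of the
complement of a ball, in terms of the prior mass `p` of a neighbourhood of the truth, the number of
pieces of a sieve and the prior mass of the complement of the sieve. The free level `c` is the
lower bound imposed on the evidence. -/
lemma lintegral_posterior_le (Pi₀ : Measure (Param d)) [IsProbabilityMeasure Pi₀]
    (hpos : ∀ᵐ θ ∂Pi₀, 0 < θ.2) {x : ℕ → E d} {n : ℕ} {θ₀ : Param d} (h₀ : 0 < θ₀.2)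
    {ε K M : ℝ} (hM : 0 ≤ M) (hε0 : 0 ≤ ε) (hε : ε ≤ 1 / 16) (hMε : M * ε ≤ 1)
    {B : Set (Param d)} (hB : MeasurableSet B) (hB0 : Pi₀ B ≠ 0)
    (hBb : ∀ θ ∈ B, 0 < θ.2 ∧ |Real.log θ₀.2 - Real.log θ.2| ≤ ε ∧
      ∀ i < n, |θ₀.1 (x i) - θ.1 (x i)| ≤ K * ε * θ.2)
    {ι : Type} [Fintype ι] {A : ι → Set (Param d)} (hA : ∀ j, MeasurableSet (A j))
    (hAb : ∀ j, ∀ θ ∈ A j, ∀ θ' ∈ A j, 0 < θ.2 ∧ |Real.log θ.2 - Real.log θ'.2| ≤ ε ∧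
      ∀ i < n, |θ.1 (x i) - θ'.1 (x i)| ≤ ε * θ'.2) {c : ℝ≥0∞} (hc : c ≠ 0) :
    ∫⁻ y, posterior Pi₀ x n y {θ | M * ε < rho x n θ θ₀} ∂dataLaw x θ₀
      ≤ c * ((Pi₀ B)⁻¹ * ENNReal.ofReal (Real.exp ((32 + 2 * K ^ 2) * (n * ε ^ 2))))
        + (Fintype.card ι * (c⁻¹ ^ (2 / 3 : ℝ)
          * ENNReal.ofReal (Real.exp (-(min (1 / 64) (1 / (160 * θ₀.2 ^ 2)) * M ^ 2)
            * (n * ε ^ 2))) ^ (2 / 3 : ℝ)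
          * ENNReal.ofReal (Real.exp (34 * (n * ε ^ 2))) ^ (1 / 3 : ℝ))
        + c⁻¹ * Pi₀ (⋃ j, A j)ᶜ) := by
  classical
  set U : Set (Param d) := {θ | M * ε < rho x n θ θ₀} with hUdef
  have hU : MeasurableSet U := measurableSet_lt measurable_const (measurable_rho x n θ₀)
  set D : (ℕ → ℝ) → ℝ≥0∞ := fun y => ∫⁻ θ, likelihoodRatio x n θ₀ θ y ∂Pi₀ with hD
  have hDm : Measurable D := measurable_lintegral_likelihoodRatio Pi₀ x n θ₀
  have hAUm : ∀ S : Set (Param d), Measurable fun y => ∫⁻ θ in S, likelihoodRatio x n θ₀ θ y ∂Pi₀ :=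
    fun S => measurable_lintegral_likelihoodRatio _ x n θ₀
  -- only the pieces that meet `U` matter
  let J : Finset ι := Finset.univ.filter fun j => (A j ∩ U).Nonempty
  have hpt : ∀ y, posterior Pi₀ x n y U ≤ c * (∫⁻ θ in B, likelihoodRatio x n θ₀ θ y ∂Pi₀)⁻¹
      + (∑ j ∈ J, min 1 (c⁻¹ * ∫⁻ θ in A j, likelihoodRatio x n θ₀ θ y ∂Pi₀)
        + c⁻¹ * ∫⁻ θ in (⋃ j, A j)ᶜ, likelihoodRatio x n θ₀ θ y ∂Pi₀) := by
    intro y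
    -- If the evidence on `B` is below `c`, the first term is at least one; otherwise `c` bounds the
    -- denominator in Bayes' formula from below.
    rcases lt_or_ge (∫⁻ θ in B, likelihoodRatio x n θ₀ θ y ∂Pi₀) c with hlt | hge
    · have h1 : posterior Pi₀ x n y U ≤ 1 := by
        rw [posterior_apply Pi₀ y h₀ hU]
        calc _ ≤ (D y)⁻¹ * D y := by
              gcongr; exact setLIntegral_le_lintegral _ _
          _ ≤ 1 := ENNReal.inv_mul_le_one _
      refine h1.trans (le_add_right ?_)
      rw [← div_eq_mul_inv]
      rcases eq_or_ne (∫⁻ θ in B, likelihoodRatio x n θ₀ θ y ∂Pi₀) 0 with h0 | h0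
      · rw [h0, ENNReal.div_zero hc]; exact le_top
      · rw [ENNReal.le_div_iff_mul_le (.inl h0) (.inl hlt.ne_top), one_mul]
        exact hlt.le
    · refine le_add_left ?_
      have hDc : (D y)⁻¹ ≤ c⁻¹ := by
        apply ENNReal.inv_le_inv.2
        exact hge.trans (lintegral_mono' Measure.restrict_le_self le_rfl)
      have hsub : U ⊆ (⋃ j ∈ J, A j) ∪ (⋃ j, A j)ᶜ := by
        intro θ hθ
        by_cases h : θ ∈ ⋃ j, A j
        · left
          obtain ⟨j, hj⟩ := Set.mem_iUnion.1 h
          exact Set.mem_biUnion (Finset.mem_coe.2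
            (Finset.mem_filter.2 ⟨Finset.mem_univ j, ⟨θ, hj, hθ⟩⟩)) hj
        · exact Or.inr h
      rw [posterior_apply Pi₀ y h₀ hU]
      have hle : ∀ S : Set (Param d), MeasurableSet S →
          (D y)⁻¹ * ∫⁻ θ in S, likelihoodRatio x n θ₀ θ y ∂Pi₀
            ≤ min 1 (c⁻¹ * ∫⁻ θ in S, likelihoodRatio x n θ₀ θ y ∂Pi₀) := by
        intro S hS
        refine le_min ?_ (by gcongr)
        calc _ ≤ (D y)⁻¹ * D y := by
              gcongr; exact setLIntegral_le_lintegral _ _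
          _ ≤ 1 := ENNReal.inv_mul_le_one _
      calc (D y)⁻¹ * ∫⁻ θ in U, likelihoodRatio x n θ₀ θ y ∂Pi₀
          ≤ (D y)⁻¹ * (∑ j ∈ J, ∫⁻ θ in A j, likelihoodRatio x n θ₀ θ y ∂Pi₀
            + ∫⁻ θ in (⋃ j, A j)ᶜ, likelihoodRatio x n θ₀ θ y ∂Pi₀) := by
            gcongr
            refine (lintegral_mono_set hsub).trans ((lintegral_union_le _ _ _).trans ?_)
            gcongr
            rw [← Finset.tsum_subtype J fun j => ∫⁻ θ in A j, likelihoodRatio x n θ₀ θ y ∂Pi₀]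
            refine le_trans (le_of_eq ?_) (lintegral_iUnion_le (fun j : J => A j) _)
            congr 2
            ext θ
            simp
        _ = ∑ j ∈ J, (D y)⁻¹ * ∫⁻ θ in A j, likelihoodRatio x n θ₀ θ y ∂Pi₀
            + (D y)⁻¹ * ∫⁻ θ in (⋃ j, A j)ᶜ, likelihoodRatio x n θ₀ θ y ∂Pi₀ := by
            rw [mul_add, Finset.mul_sum]
        _ ≤ _ := by
            gcongr with j hj
            exact hle _ (hA j)
  have hpiece : ∀ j ∈ J, ∫⁻ y, min 1 (c⁻¹ * ∫⁻ θ in A j, likelihoodRatio x n θ₀ θ y ∂Pi₀)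
      ∂dataLaw x θ₀ ≤ c⁻¹ ^ (2 / 3 : ℝ)
          * ENNReal.ofReal (Real.exp (-(min (1 / 64) (1 / (160 * θ₀.2 ^ 2)) * M ^ 2)
            * (n * ε ^ 2))) ^ (2 / 3 : ℝ)
          * ENNReal.ofReal (Real.exp (34 * (n * ε ^ 2))) ^ (1 / 3 : ℝ) := by
    intro j hj
    obtain ⟨θ₁, h₁A, h₁U⟩ := (Finset.mem_filter.1 hj).2
    have h₁ : 0 < θ₁.2 := (hAb j θ₁ h₁A θ₁ h₁A).1
    refine lintegral_min_piece_le Pi₀ h₁ (lintegral_affinity_le h₁ h₀ hM hε0 hMε h₁U) ?_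
    intro θ hθ
    obtain ⟨a, b, e⟩ := hAb j θ hθ θ₁ h₁A
    refine (lintegral_chiSquare_le (K := 1) a h₁ h₀ hε b fun i hi => ?_).trans (le_of_eq ?_)
    · rw [one_mul]; exact e i hi
    · norm_num
  calc _ ≤ ∫⁻ y, (c * (∫⁻ θ in B, likelihoodRatio x n θ₀ θ y ∂Pi₀)⁻¹
      + (∑ j ∈ J, min 1 (c⁻¹ * ∫⁻ θ in A j, likelihoodRatio x n θ₀ θ y ∂Pi₀)
        + c⁻¹ * ∫⁻ θ in (⋃ j, A j)ᶜ, likelihoodRatio x n θ₀ θ y ∂Pi₀)) ∂dataLaw x θ₀ :=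
        lintegral_mono hpt
    _ = c * ∫⁻ y, (∫⁻ θ in B, likelihoodRatio x n θ₀ θ y ∂Pi₀)⁻¹ ∂dataLaw x θ₀
        + (∑ j ∈ J, ∫⁻ y, min 1 (c⁻¹ * ∫⁻ θ in A j, likelihoodRatio x n θ₀ θ y ∂Pi₀) ∂dataLaw x θ₀
        + c⁻¹ * ∫⁻ y, ∫⁻ θ in (⋃ j, A j)ᶜ, likelihoodRatio x n θ₀ θ y ∂Pi₀ ∂dataLaw x θ₀) := by
        have hBi : Measurable fun y => (∫⁻ θ in B, likelihoodRatio x n θ₀ θ y ∂Pi₀)⁻¹ :=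
          (hAUm B).inv
        rw [lintegral_add_left (hBi.const_mul c), lintegral_const_mul _ hBi,
          lintegral_add_right _ ((hAUm _).const_mul _), lintegral_const_mul _ (hAUm _),
          lintegral_finsetSum]
        exact fun j _ => measurable_const.min ((hAUm _).const_mul _)
    _ ≤ _ := by
        gcongr ?_ + (?_ + ?_)
        · refine mul_le_mul' le_rfl (lintegral_evidence_inv_le Pi₀ h₀ hB hB0
            (fun θ hθ => (hBb θ hθ).1) fun θ hθ => ?_)
          obtain ⟨a, b, e⟩ := hBb θ hθ
          exact lintegral_likelihoodRatio_inv_le a h₀ hε b e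
        · refine (Finset.sum_le_sum hpiece).trans ?_
          rw [Finset.sum_const, nsmul_eq_mul]
          gcongr
          exact Finset.card_filter_le _ _
        · refine mul_le_mul' le_rfl ?_
          rw [lintegral_lintegral_likelihoodRatio _ (ae_restrict_of_ae hpos) h₀]
          simp

/-- **Posterior contraction.** If the prior puts mass at least `exp (-C₁ n ε_n²)` on a neighbourhood
of the truth and if, for every `C`, it puts mass at least `1 - exp (-C n ε_n²)` on a sieve made of
`exp (C₂ n ε_n²)` pieces of diameter at most `ε_n` (relatively to the noise level), then the
posterior contracts almost surely at the rate `ε_n`. -/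
theorem posterior_contraction (Pi₀ : Measure (Param d)) [IsProbabilityMeasure Pi₀]
    (hpos : ∀ᵐ θ ∂Pi₀, 0 < θ.2) (x : ℕ → E d) (θ₀ : Param d) (h₀ : 0 < θ₀.2)
    (ε : ℕ → ℝ) (hε0 : ∀ᶠ n in atTop, 0 < ε n) (hε : Tendsto ε atTop (𝓝 0))
    (hlog : ∀ᶠ n : ℕ in atTop, 2 * Real.log n ≤ n * ε n ^ 2)
    {C₁ K : ℝ}
    (hmass : ∀ᶠ n in atTop, ∃ B : Set (Param d), MeasurableSet B ∧
      Real.exp (-C₁ * (n * ε n ^ 2)) ≤ Pi₀.real B ∧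
      ∀ θ ∈ B, 0 < θ.2 ∧ |Real.log θ₀.2 - Real.log θ.2| ≤ ε n ∧
        ∀ i < n, |θ₀.1 (x i) - θ.1 (x i)| ≤ K * ε n * θ.2)
    (hsieve : ∀ C : ℝ, ∃ C₂ : ℝ, ∀ᶠ n in atTop, ∃ (ι : Type) (_ : Fintype ι)
      (A : ι → Set (Param d)), (∀ j, MeasurableSet (A j)) ∧
      (Fintype.card ι : ℝ) ≤ Real.exp (C₂ * (n * ε n ^ 2)) ∧
      Pi₀.real (⋃ j, A j)ᶜ ≤ Real.exp (-C * (n * ε n ^ 2)) ∧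
      ∀ j, ∀ θ ∈ A j, ∀ θ' ∈ A j, 0 < θ.2 ∧ |Real.log θ.2 - Real.log θ'.2| ≤ ε n ∧
        ∀ i < n, |θ.1 (x i) - θ'.1 (x i)| ≤ ε n * θ'.2) :
    ∃ M : ℝ, ∀ᵐ y ∂dataLaw x θ₀, Tendsto
      (fun n => posterior Pi₀ x n y {θ | M * ε n < rho x n θ θ₀}) atTop (𝓝 0) := by
  -- `exp (-C' n ε_n²)` is the level that the evidence reaches with high probability.
  set C' := C₁ + (32 + 2 * K ^ 2) + 1 with hC'
  obtain ⟨C₂, hC₂⟩ := hsieve (C' + 1)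
  set m := min (1 / 64) (1 / (160 * θ₀.2 ^ 2)) with hm
  have hm0 : 0 < m := by positivity
  -- the constant is chosen so that the affinity beats the entropy and the evidence
  set M := √((3 / 2) * (|C₂| + |C'| + 34 + 1) / m) with hMdef
  have hM2 : m * M ^ 2 = (3 / 2) * (|C₂| + |C'| + 34 + 1) := by
    rw [hMdef, Real.sq_sqrt (by positivity)]; field_simp
  have hM : 0 ≤ M := Real.sqrt_nonneg _
  refine ⟨M, ?_⟩
  have hMε : ∀ᶠ n in atTop, M * ε n ≤ 1 := by
    have : Tendsto (fun n => M * ε n) atTop (𝓝 (M * 0)) := hε.const_mul M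
    rw [mul_zero] at this
    exact (this.eventually_lt_const one_pos).mono fun _ h => h.le
  have hbound : ∀ᶠ n : ℕ in atTop,
      ∫⁻ y, posterior Pi₀ x n y {θ | M * ε n < rho x n θ θ₀} ∂dataLaw x θ₀
        ≤ ENNReal.ofReal (3 * ((n : ℝ) ^ 2)⁻¹) := by
    filter_upwards [hε0, hε.eventually_le_const (by norm_num : (0 : ℝ) < 1 / 16), hMε, hlog, hmass,
      hC₂, eventually_gt_atTop 0] with n hn0 hn1 hn2 hnlog hnB hnA hnpos
    obtain ⟨B, hBm, hBmass, hBb⟩ := hnB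
    obtain ⟨ι, _, A, hAm, hcard, hcompl, hAb⟩ := hnA
    set t := (n : ℝ) * ε n ^ 2 with ht
    have ht0 : 0 ≤ t := by positivity
    have hPB : 0 < Pi₀.real B := (Real.exp_pos _).trans_le hBmass
    have hB0 : Pi₀ B ≠ 0 := fun h => by simp [Measure.real, h] at hPB
    have h := lintegral_posterior_le Pi₀ hpos h₀ hM hn0.le hn1 hn2 hBm hB0 hBb hAm hAb
      (c := ENNReal.ofReal (Real.exp (-C' * t))) (by simp [Real.exp_pos])
    refine h.trans ?_
    rw [← ENNReal.ofReal_inv_of_pos (Real.exp_pos _), ← Real.exp_neg,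
      ENNReal.ofReal_rpow_of_nonneg (Real.exp_pos _).le (by norm_num),
      ENNReal.ofReal_rpow_of_nonneg (Real.exp_pos _).le (by norm_num),
      ENNReal.ofReal_rpow_of_nonneg (Real.exp_pos _).le (by norm_num),
      ← Real.exp_mul, ← Real.exp_mul, ← Real.exp_mul]
    have e1 : (Pi₀ B)⁻¹ ≤ ENNReal.ofReal (Real.exp (C₁ * t)) := by
      rw [ENNReal.inv_le_iff_inv_le, ← ENNReal.ofReal_inv_of_pos (Real.exp_pos _), ← Real.exp_neg,
        ← ofReal_measureReal]
      apply ENNReal.ofReal_le_ofReal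
      rwa [← neg_mul]
    have e2 : Pi₀ (⋃ j, A j)ᶜ ≤ ENNReal.ofReal (Real.exp (-(C' + 1) * t)) := by
      rw [← ofReal_measureReal]
      exact ENNReal.ofReal_le_ofReal hcompl
    have e3 : (Fintype.card ι : ℝ≥0∞) ≤ ENNReal.ofReal (Real.exp (C₂ * t)) := by
      rw [← ENNReal.ofReal_natCast]
      exact ENNReal.ofReal_le_ofReal hcard
    have e4 : Real.exp (-t) ≤ ((n : ℝ) ^ 2)⁻¹ := by
      rw [Real.exp_neg]
      apply inv_anti₀ (by positivity)
      have : (n : ℝ) ^ 2 = Real.exp (2 * Real.log n) := by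
        rw [mul_comm, Real.exp_mul, Real.exp_log (by positivity)]; norm_cast
      rw [this]
      exact Real.exp_le_exp.2 hnlog
    refine (add_le_add (mul_le_mul' le_rfl (mul_le_mul' e1 le_rfl)) (add_le_add
      (mul_le_mul' e3 le_rfl) (mul_le_mul' le_rfl e2))).trans ?_
    simp only [← ENNReal.ofReal_mul (Real.exp_pos _).le, ← Real.exp_add,
      ← ENNReal.ofReal_add (Real.exp_pos _).le (Real.exp_pos _).le]
    rw [← ENNReal.ofReal_add (Real.exp_pos _).le (by positivity)]
    apply ENNReal.ofReal_le_ofReal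
    have k1 : Real.exp (-C' * t + (C₁ * t + (32 + 2 * K ^ 2) * t)) ≤ Real.exp (-t) := by
      apply Real.exp_le_exp.2; rw [hC']; linarith
    have k2 : Real.exp (C₂ * t + (-(-C' * t) * (2 / 3) + -(m * M ^ 2) * t * (2 / 3)
        + 34 * t * (1 / 3))) ≤ Real.exp (-t) := by
      apply Real.exp_le_exp.2
      rw [hM2]
      have a1 := mul_le_mul_of_nonneg_right (le_abs_self C₂) ht0
      have a2 := mul_le_mul_of_nonneg_right (le_abs_self C') ht0
      have a3 : 0 ≤ |C'| * t := by positivity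
      nlinarith
    have k3 : Real.exp (-(-C' * t) + -(C' + 1) * t) ≤ Real.exp (-t) := by
      apply Real.exp_le_exp.2; linarith
    linarith
  -- the expected posterior masses are summable
  obtain ⟨N, hN⟩ := eventually_atTop.1 hbound
  set F : ℕ → (ℕ → ℝ) → ℝ≥0∞ := fun k y =>
    posterior Pi₀ x (k + N) y {θ | M * ε (k + N) < rho x (k + N) θ θ₀} with hF
  have hU : ∀ n, MeasurableSet {θ : Param d | M * ε n < rho x n θ θ₀} := fun n =>
    measurableSet_lt measurable_const (measurable_rho x n θ₀)
  have hFm : ∀ k, Measurable (F k) := by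
    intro k
    simp only [hF, posterior_apply Pi₀ _ h₀ (hU (k + N))]
    exact (measurable_lintegral_likelihoodRatio _ x _ θ₀).inv.mul
      (measurable_lintegral_likelihoodRatio _ x _ θ₀)
  have hsum : ∫⁻ y, ∑' k, F k y ∂dataLaw x θ₀ ≠ ∞ := by
    rw [lintegral_tsum fun k => (hFm k).aemeasurable]
    have hle : ∑' k, ∫⁻ y, F k y ∂dataLaw x θ₀
        ≤ ∑' k : ℕ, ENNReal.ofReal (3 * (((k + N : ℕ) : ℝ) ^ 2)⁻¹) :=
      ENNReal.tsum_le_tsum fun k => hN (k + N) (by omega)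
    refine ne_top_of_le_ne_top ?_ hle
    have hs : Summable fun k : ℕ => 3 * (((k + N : ℕ) : ℝ) ^ 2)⁻¹ :=
      ((summable_nat_add_iff N).2 (Real.summable_nat_pow_inv.2 one_lt_two)).mul_left 3
    exact hs.tsum_ofReal_ne_top
  filter_upwards [ae_lt_top (Measurable.tsum hFm) hsum] with y hy
  have := ENNReal.tendsto_atTop_zero_of_tsum_ne_top hy.ne
  exact (tendsto_add_atTop_iff_nat N).1 this

end ContractionRate

/-! ### The symmetric Gamma distribution -/

section SymmGamma

lemma one_sub_rpow_neg_le {y a : ℝ} (hy : 1 ≤ y) : 1 - y ^ (-a) ≤ a * Real.log y := by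
  rw [Real.rpow_def_of_pos (by linarith)]
  have := Real.add_one_le_exp (Real.log y * -a)
  linarith

/-- Tail bound for a law whose characteristic function is close to one. -/
lemma measureReal_abs_gt_le_of_charFun {ν : Measure ℝ} [IsProbabilityMeasure ν] {a s r : ℝ}
    (ha : 0 ≤ a) (hr : 0 < r)
    (h : ∀ t : ℝ, ‖1 - charFun ν t‖ ≤ a * Real.log (1 + t ^ 2 * s ^ 2)) :
    ν.real {x | r < |x|} ≤ 2 * a * Real.log (1 + 4 * s ^ 2 / r ^ 2) := by
  refine (measureReal_abs_gt_le_integral_charFun hr).trans ?_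
  have hb : ‖∫ t in (-2 * r⁻¹)..(2 * r⁻¹), 1 - charFun ν t‖
      ≤ (a * Real.log (1 + 4 * s ^ 2 / r ^ 2)) * |2 * r⁻¹ - -2 * r⁻¹| := by
    refine intervalIntegral.norm_integral_le_of_norm_le_const fun t ht => (h t).trans ?_
    have hr' : 0 < r⁻¹ := by positivity
    rw [Set.uIoc_of_le (by linarith)] at ht
    have ht2 : t ^ 2 ≤ (2 * r⁻¹) ^ 2 := by
      apply sq_le_sq'
      · linarith [ht.1]
      · exact ht.2
    gcongr a * Real.log (1 + ?_)
    calc t ^ 2 * s ^ 2 ≤ (2 * r⁻¹) ^ 2 * s ^ 2 := by gcongr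
      _ = _ := by field_simp; ring
  calc _ ≤ 2⁻¹ * r * ((a * Real.log (1 + 4 * s ^ 2 / r ^ 2)) * |2 * r⁻¹ - -2 * r⁻¹|) := by gcongr
    _ = _ := by
      rw [show (2 : ℝ) * r⁻¹ - -2 * r⁻¹ = 4 * r⁻¹ by ring, abs_of_pos (by positivity)]
      have : r * r⁻¹ = 1 := mul_inv_cancel₀ hr.ne'
      linear_combination (2 * a * Real.log (1 + 4 * s ^ 2 / r ^ 2)) * this

lemma IsSymmGamma.norm_one_sub_charFun_le {ν : Measure ℝ} {a b : ℝ} (h : IsSymmGamma ν a b)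
    (ha : 0 ≤ a) (t : ℝ) : ‖1 - charFun ν t‖ ≤ a * Real.log (1 + t ^ 2 * b⁻¹ ^ 2) := by
  have hy : 1 ≤ 1 + t ^ 2 / b ^ 2 := by
    have : 0 ≤ t ^ 2 / b ^ 2 := by positivity
    linarith
  rw [h.2, ← Complex.ofReal_one, ← Complex.ofReal_sub, Complex.norm_real, Real.norm_eq_abs,
    abs_of_nonneg, inv_pow, ← div_eq_mul_inv]
  · exact one_sub_rpow_neg_le hy
  · rw [sub_nonneg]
    exact Real.rpow_le_one_of_one_le_of_nonpos hy (by linarith)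

/-- The tails of a symmetric Gamma law are proportional to its shape parameter, because so is the
distance of its characteristic function to one. -/
lemma IsSymmGamma.measureReal_abs_gt_le {ν : Measure ℝ} {a b r : ℝ} (h : IsSymmGamma ν a b)
    (ha : 0 ≤ a) (hr : 0 < r) :
    ν.real {x | r < |x|} ≤ 2 * a * Real.log (1 + 4 * b⁻¹ ^ 2 / r ^ 2) := by
  have := h.1
  exact measureReal_abs_gt_le_of_charFun ha hr (h.norm_one_sub_charFun_le ha)

lemma measurable_gammaPDF (a r : ℝ) : Measurable (gammaPDF a r) :=
  (measurable_gammaPDFReal a r).ennreal_ofReal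

/-- The Laplace transform of the Gamma distribution. -/
lemma lintegral_exp_gammaMeasure {a s : ℝ} (ha : 0 < a) (hs : s < 1) :
    ∫⁻ g, ENNReal.ofReal (Real.exp (s * g)) ∂gammaMeasure a 1
      = ENNReal.ofReal ((1 - s) ^ (-a)) := by
  have h1 : 0 < 1 - s := by linarith
  rw [gammaMeasure, lintegral_withDensity_eq_lintegral_mul _
    (measurable_gammaPDF a 1) (by fun_prop)]
  rw [← mul_one (ENNReal.ofReal ((1 - s) ^ (-a))), ← lintegral_gammaPDF_eq_one ha h1,
    ← lintegral_const_mul _ (measurable_gammaPDF a (1 - s))]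
  refine lintegral_congr fun g => ?_
  rcases lt_or_ge g 0 with hg | hg
  · simp [gammaPDF_of_neg hg]
  · rw [Pi.mul_apply, gammaPDF_of_nonneg hg, gammaPDF_of_nonneg hg,
      ← ENNReal.ofReal_mul (by positivity), ← ENNReal.ofReal_mul (by positivity)]
    congr 1
    rw [Real.one_rpow, Real.rpow_neg h1.le]
    have : Real.exp (-((1 - s) * g)) = Real.exp (-(1 * g)) * Real.exp (s * g) := by
      rw [← Real.exp_add]; congr 1; ring
    rw [this]
    have := Real.rpow_pos_of_pos h1 a
    field_simp

/-- The law of `√(2 G) Z / b`, where `G` and `Z` are independent, `G` has the Gamma distribution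
with shape `a` and `Z` is a standard Gaussian variable. -/
def gammaMixture (a b : ℝ) : Measure ℝ :=
  ((gammaMeasure a 1).prod (gaussianReal 0 1)).map fun p => √(2 * p.1) / b * p.2

lemma measurable_gammaMixture_map (b : ℝ) :
    Measurable fun p : ℝ × ℝ => √(2 * p.1) / b * p.2 := by fun_prop

lemma isProbabilityMeasure_gammaMixture {a : ℝ} (ha : 0 < a) (b : ℝ) :
    IsProbabilityMeasure (gammaMixture a b) := by
  have := isProbabilityMeasure_gammaMeasure ha one_pos
  exact Measure.isProbabilityMeasure_map (measurable_gammaMixture_map b).aemeasurable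

lemma ae_nonneg_gammaMeasure (a : ℝ) : ∀ᵐ g ∂gammaMeasure a 1, 0 ≤ g := by
  rw [gammaMeasure, ae_withDensity_iff (measurable_gammaPDF a 1)]
  refine ae_of_all _ fun g hg => ?_
  by_contra h
  exact hg (gammaPDF_of_neg (not_le.1 h))

lemma charFun_gammaMixture {a b : ℝ} (ha : 0 < a) (t : ℝ) :
    charFun (gammaMixture a b) t = (((1 + t ^ 2 / b ^ 2) ^ (-a) : ℝ) : ℂ) := by
  have := isProbabilityMeasure_gammaMeasure ha one_pos
  rw [charFun_apply_real, gammaMixture, integral_map (measurable_gammaMixture_map b).aemeasurable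
    (by fun_prop), integral_prod]
  · have hin : ∀ᵐ g ∂gammaMeasure a 1,
        ∫ z, Complex.exp (t * ((√(2 * g) / b * z : ℝ) : ℂ) * Complex.I) ∂gaussianReal 0 1
          = ((Real.exp (-(t ^ 2 / b ^ 2) * g) : ℝ) : ℂ) := by
      filter_upwards [ae_nonneg_gammaMeasure a] with g hg
      have h := charFun_gaussianReal (μ := 0) (v := 1) (t * (√(2 * g) / b))
      rw [charFun_apply_real] at h
      convert h using 1
      · refine integral_congr_ae (ae_of_all _ fun z => ?_)
        push_cast
        ring_nf
      · push_cast
        congr 1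
        rw [mul_pow, div_pow, ← Complex.ofReal_pow (√(2 * g)), Real.sq_sqrt (by positivity)]
        push_cast
        ring
    rw [integral_congr_ae hin, integral_complex_ofReal]
    congr 1
    have hl := lintegral_exp_gammaMeasure ha (s := -(t ^ 2 / b ^ 2))
      (by have : 0 ≤ t ^ 2 / b ^ 2 := by positivity
          linarith)
    rw [integral_eq_lintegral_of_nonneg_ae (ae_of_all _ fun g => (Real.exp_pos _).le)
      (by fun_prop), hl, sub_neg_eq_add, ENNReal.toReal_ofReal (by positivity)]
  · refine Integrable.mono' (integrable_const (1 : ℝ)) (by fun_prop) (ae_of_all _ fun p => ?_)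
    rw [← Complex.ofReal_mul, Complex.norm_exp_ofReal_mul_I]

/-- A symmetric Gamma law is a Gaussian scale mixture, by comparison of characteristic functions. -/
lemma IsSymmGamma.eq_gammaMixture {ν : Measure ℝ} {a b : ℝ} (h : IsSymmGamma ν a b)
    (ha : 0 < a) : ν = gammaMixture a b := by
  have := h.1
  have := isProbabilityMeasure_gammaMixture ha b
  refine Measure.ext_of_charFun ?_
  funext t
  rw [h.2, charFun_gammaMixture ha]

lemma IsSymmGamma.eq_dirac {ν : Measure ℝ} {b : ℝ} (h : IsSymmGamma ν 0 b) :
    ν = Measure.dirac 0 := by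
  have := h.1
  refine Measure.ext_of_charFun ?_
  funext t
  rw [h.2, charFun_dirac]
  simp

lemma lintegral_gammaMixture {a b : ℝ} (ha : 0 < a) {f : ℝ → ℝ≥0∞} (hf : Measurable f) :
    ∫⁻ x, f x ∂gammaMixture a b
      = ∫⁻ g, ∫⁻ z, f (√(2 * g) / b * z) ∂gaussianReal 0 1 ∂gammaMeasure a 1 := by
  have := isProbabilityMeasure_gammaMeasure ha one_pos
  rw [gammaMixture, lintegral_map hf (measurable_gammaMixture_map b), lintegral_prod]
  exact (hf.comp (measurable_gammaMixture_map b)).aemeasurable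

lemma one_sub_rpow_neg_le_exp {s a : ℝ} (ha : 0 ≤ a) (hs0 : 0 ≤ s) (hs : s ≤ 1 / 2) :
    (1 - s) ^ (-a) ≤ Real.exp (2 * a * s) := by
  rw [Real.rpow_def_of_pos (by linarith)]
  apply Real.exp_le_exp.2
  have h := Real.one_sub_inv_le_log_of_pos (by linarith : 0 < 1 - s)
  have h2 : -(2 * s) ≤ 1 - (1 - s)⁻¹ := by
    have h3 : (1 - s)⁻¹ ≤ 1 + 2 * s := by
      rw [inv_le_comm₀ (by linarith) (by linarith), inv_eq_one_div, div_le_iff₀ (by linarith)]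
      nlinarith
    linarith
  nlinarith

/-- The symmetric Gamma distribution has exponential moments. -/
lemma IsSymmGamma.lintegral_exp_le {ν : Measure ℝ} {a b l : ℝ} (h : IsSymmGamma ν a b)
    (ha : 0 ≤ a) (hl : l ^ 2 / b ^ 2 ≤ 1 / 2) :
    ∫⁻ x, ENNReal.ofReal (Real.exp (l * x)) ∂ν
      ≤ ENNReal.ofReal (Real.exp (2 * a * (l ^ 2 / b ^ 2))) := by
  rcases ha.eq_or_lt with rfl | ha
  · rw [h.eq_dirac, lintegral_dirac]
    simp
  · rw [h.eq_gammaMixture ha, lintegral_gammaMixture ha (by fun_prop)]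
    refine le_trans (le_of_eq ?_) ((lintegral_exp_gammaMeasure ha (s := l ^ 2 / b ^ 2)
      (by linarith)).le.trans (ENNReal.ofReal_le_ofReal
        (one_sub_rpow_neg_le_exp ha.le (by positivity) hl)))
    refine lintegral_congr_ae ?_
    filter_upwards [ae_nonneg_gammaMeasure a] with g hg
    have hm := congrFun (mgf_id_gaussianReal (μ := 0) (v := 1)) (l * (√(2 * g) / b))
    rw [mgf] at hm
    have hi : Integrable (fun z => Real.exp (l * (√(2 * g) / b) * z)) (gaussianReal 0 1) :=
      integrable_exp_mul_gaussianReal _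
    have he : ∀ z, Real.exp (l * (√(2 * g) / b * z)) = Real.exp (l * (√(2 * g) / b) * z) :=
      fun z => by rw [mul_assoc]
    simp_rw [he]
    rw [← ofReal_integral_eq_lintegral_ofReal hi (ae_of_all _ fun z => (Real.exp_pos _).le)]
    simp only [id] at hm
    rw [hm]
    congr 2
    rw [mul_pow, div_pow, Real.sq_sqrt (by positivity)]
    simp
    ring

lemma gaussianReal_Icc_ge {l u R : ℝ} (hR : ∀ z ∈ Set.Icc l u, |z| ≤ R) :
    ENNReal.ofReal ((√(2 * Real.pi))⁻¹ * Real.exp (-R ^ 2 / 2) * (u - l))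
      ≤ gaussianReal 0 1 (Set.Icc l u) := by
  rw [gaussianReal_apply _ one_ne_zero, ENNReal.ofReal_mul (by positivity), ← Real.volume_Icc,
    ← setLIntegral_const]
  refine setLIntegral_mono (measurable_gaussianPDF _ _) fun z hz => ?_
  apply ENNReal.ofReal_le_ofReal
  unfold gaussianPDFReal
  have := hR z hz
  simp only [NNReal.coe_one, mul_one, sub_zero]
  gcongr ?_ * Real.exp ?_
  rw [neg_div, neg_div, neg_le_neg_iff, ← sq_abs z]
  gcongr

lemma exists_Gamma_add_one_le (α : ℝ) :
    ∃ C : ℝ, 1 ≤ C ∧ ∀ a, 0 ≤ a → a ≤ α → Real.Gamma (a + 1) ≤ C := by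
  have hc : ContinuousOn (fun a => Real.Gamma (a + 1)) (Set.Icc 0 α) := by
    intro a ha
    refine ContinuousAt.continuousWithinAt ?_
    refine ContinuousAt.comp (g := Real.Gamma) (f := fun a : ℝ => a + 1) ?_
      (continuousAt_id.add continuousAt_const)
    refine (Real.differentiableAt_Gamma fun m => ?_).continuousAt
    have : (0 : ℝ) ≤ m := Nat.cast_nonneg m
    have := ha.1
    linarith
  obtain ⟨C, hC⟩ := (isCompact_Icc.image_of_continuousOn hc).bddAbove
  exact ⟨max 1 C, le_max_left _ _, fun a h0 h1 =>
    (hC ⟨a, ⟨h0, h1⟩, rfl⟩).trans (le_max_right _ _)⟩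

lemma gammaMeasure_Ioc_ge {a l u c : ℝ} (ha : 0 < a) (hl : 0 ≤ l) (hc0 : 0 ≤ c)
    (hc : ∀ g ∈ Set.Ioc l u, c ≤ g ^ (a - 1) * Real.exp (-g)) :
    ENNReal.ofReal (a / Real.Gamma (a + 1) * c * (u - l)) ≤ gammaMeasure a 1 (Set.Ioc l u) := by
  have hG := Real.Gamma_pos_of_pos (by linarith : 0 < a + 1)
  have hG' := Real.Gamma_pos_of_pos ha
  rw [gammaMeasure, withDensity_apply _ measurableSet_Ioc, ENNReal.ofReal_mul (by positivity),
    ← Real.volume_Ioc, ← setLIntegral_const]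
  refine setLIntegral_mono (measurable_gammaPDF _ _) fun g hg => ?_
  have hg0 : 0 < g := hl.trans_lt hg.1
  rw [gammaPDF_of_nonneg hg0.le]
  apply ENNReal.ofReal_le_ofReal
  have h1 : a / Real.Gamma (a + 1) = 1 / Real.Gamma a := by
    rw [Real.Gamma_add_one ha.ne']; field_simp
  rw [h1, Real.one_rpow, one_mul, mul_assoc]
  gcongr
  exact hc g hg

/-- Mass of a small interval around an arbitrary point. -/
lemma IsSymmGamma.exists_interval_ge {b : ℝ} (hb : 0 < b) (α : ℝ) :
    ∃ c C : ℝ, 0 < c ∧ 0 < C ∧ ∀ (ν : Measure ℝ) (a u r : ℝ), IsSymmGamma ν a b → 0 ≤ a → a ≤ α →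
      0 < r → r ≤ 1 → c * a * r * Real.exp (-C * |u|) ≤ ν.real {x | |x - u| ≤ r} := by
  obtain ⟨G, hG1, hG⟩ := exists_Gamma_add_one_le α
  have hpi : 0 < √(2 * Real.pi) := by positivity
  refine ⟨(√(2 * Real.pi))⁻¹ * (b / G) * Real.exp (-(4 + b ^ 2)), 4 + b ^ 2, by positivity,
    by positivity, ?_⟩
  intro ν a u r h ha0 haα hr hr1
  have := h.1
  rcases ha0.eq_or_lt with rfl | ha
  · simp
  set T := 1 + |u| with hT
  have hT1 : 1 ≤ T := by have := abs_nonneg u; linarith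
  have hS : MeasurableSet {x : ℝ | |x - u| ≤ r} :=
    measurableSet_le (by fun_prop) measurable_const
  -- Given that the Gamma variable is near `T`, of the order of `|u|`, the interval is at a bounded
  -- multiple of `√T` standard deviations from the mean.
  have hin : ∀ g ∈ Set.Ioc T (T + 1), ENNReal.ofReal ((√(2 * Real.pi))⁻¹
      * Real.exp (-(b * √T) ^ 2 / 2) * (r * b / (T + 1)))
      ≤ ∫⁻ z, Set.indicator {x : ℝ | |x - u| ≤ r} 1 (√(2 * g) / b * z) ∂gaussianReal 0 1 := by
    intro g hg
    have hg0 : 0 < g := by linarith [hg.1]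
    have hq : 0 < √(2 * g) := by positivity
    have hsub : Set.Icc ((u - r) * b / √(2 * g)) ((u + r) * b / √(2 * g))
        ⊆ {z | √(2 * g) / b * z ∈ {x : ℝ | |x - u| ≤ r}} := by
      intro z hz
      have h1 := hz.1
      have h2 := hz.2
      rw [div_le_iff₀ hq] at h1
      rw [le_div_iff₀ hq] at h2
      simp only [Set.mem_ofPred_eq, abs_le]
      have e : √(2 * g) / b * z = z * √(2 * g) / b := by ring
      rw [e]
      constructor
      · rw [neg_le_sub_iff_le_add, ← sub_le_iff_le_add, le_div_iff₀ hb]; linarith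
      · rw [sub_le_iff_le_add, div_le_iff₀ hb]; linarith
    have hmeas : MeasurableSet {z | √(2 * g) / b * z ∈ {x : ℝ | |x - u| ≤ r}} :=
      (measurable_const_mul _) hS
    have heq : ∫⁻ z, Set.indicator {x : ℝ | |x - u| ≤ r} 1 (√(2 * g) / b * z) ∂gaussianReal 0 1
        = gaussianReal 0 1 {z | √(2 * g) / b * z ∈ {x : ℝ | |x - u| ≤ r}} := by
      rw [← lintegral_indicator_one hmeas]
      rfl
    rw [heq]
    refine le_trans ?_ (measure_mono hsub)
    refine le_trans ?_ (gaussianReal_Icc_ge (R := b * √T) ?_)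
    · apply ENNReal.ofReal_le_ofReal
      gcongr
      rw [← sub_div, div_le_div_iff₀ (by positivity) hq]
      have hq2 : √(2 * g) ≤ T + 1 + 1 := by
        rw [Real.sqrt_le_left (by linarith)]
        nlinarith [hg.2, sq_nonneg T]
      have : √(2 * g) ≤ 2 * (T + 1) := by linarith
      nlinarith [mul_pos hr hb]
    · intro z hz
      have hz1 := hz.1
      have hz2 := hz.2
      rw [div_le_iff₀ hq] at hz1
      rw [le_div_iff₀ hq] at hz2
      have hu := neg_abs_le u
      have hu' := le_abs_self u
      have hzq : |z| * √(2 * g) ≤ b * T := by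
        rw [← abs_of_pos hq, ← abs_mul, abs_le]
        constructor <;> nlinarith
      have hTq : √T * √T = T := Real.mul_self_sqrt (by linarith)
      have hq3 : √T ≤ √(2 * g) := Real.sqrt_le_sqrt (by linarith [hg.1])
      have hsT : 0 < √T := Real.sqrt_pos.2 (by linarith)
      have : |z| * √T ≤ b * √T * √T := by
        calc |z| * √T ≤ |z| * √(2 * g) := by gcongr
          _ ≤ b * T := hzq
          _ = _ := by rw [mul_assoc, hTq]
      exact le_of_mul_le_mul_right this hsT
  have hgam := gammaMeasure_Ioc_ge (a := a) (l := T) (u := T + 1)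
    (c := (T + 1)⁻¹ * Real.exp (-(T + 1))) ha (by linarith) (by positivity) (by
      intro g hg
      have hg1 : 1 ≤ g := by linarith [hg.1]
      gcongr ?_ * Real.exp (-?_)
      · calc (T + 1)⁻¹ ≤ g⁻¹ := by gcongr; exact hg.2
          _ = g ^ (-1 : ℝ) := by rw [Real.rpow_neg_one]
          _ ≤ _ := Real.rpow_le_rpow_of_exponent_le hg1 (by linarith)
      · exact hg.2)
  have hmain : ENNReal.ofReal ((√(2 * Real.pi))⁻¹ * Real.exp (-(b * √T) ^ 2 / 2)
      * (r * b / (T + 1))) * ENNReal.ofReal (a / Real.Gamma (a + 1)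
        * ((T + 1)⁻¹ * Real.exp (-(T + 1))) * (T + 1 - T)) ≤ ν {x | |x - u| ≤ r} := by
    rw [← lintegral_indicator_one hS, h.eq_gammaMixture ha,
      lintegral_gammaMixture ha (measurable_one.indicator hS)]
    calc _ ≤ ENNReal.ofReal ((√(2 * Real.pi))⁻¹ * Real.exp (-(b * √T) ^ 2 / 2)
          * (r * b / (T + 1))) * gammaMeasure a 1 (Set.Ioc T (T + 1)) := by gcongr
      _ = ∫⁻ g in Set.Ioc T (T + 1), ENNReal.ofReal ((√(2 * Real.pi))⁻¹
          * Real.exp (-(b * √T) ^ 2 / 2) * (r * b / (T + 1))) ∂gammaMeasure a 1 := by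
          rw [setLIntegral_const]
      _ ≤ ∫⁻ g in Set.Ioc T (T + 1), ∫⁻ z, Set.indicator {x : ℝ | |x - u| ≤ r} 1
          (√(2 * g) / b * z) ∂gaussianReal 0 1 ∂gammaMeasure a 1 :=
          setLIntegral_mono' measurableSet_Ioc hin
      _ ≤ _ := setLIntegral_le_lintegral _ _
  have hGa := Real.Gamma_pos_of_pos (by linarith : 0 < a + 1)
  rw [← ENNReal.ofReal_mul (by positivity), ← ofReal_measureReal,
    ENNReal.ofReal_le_ofReal_iff measureReal_nonneg] at hmain
  refine le_trans ?_ hmain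
  have hexp : Real.exp (-(4 + b ^ 2)) * Real.exp (-(4 + b ^ 2) * |u|)
      ≤ Real.exp (-(b * √T) ^ 2 / 2) * Real.exp (-(T + 1)) * ((T + 1)⁻¹ * (T + 1)⁻¹) := by
    have h1 : Real.exp (-(2 * T)) ≤ (T + 1)⁻¹ * (T + 1)⁻¹ := by
      rw [two_mul, neg_add, Real.exp_add, Real.exp_neg]
      have := Real.add_one_le_exp T
      gcongr
    have h2 : (b * √T) ^ 2 = b ^ 2 * T := by rw [mul_pow, Real.sq_sqrt (by linarith)]
    refine le_trans ?_ (mul_le_mul_of_nonneg_left h1 (by positivity))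
    rw [← Real.exp_add, ← Real.exp_add, ← Real.exp_add, h2]
    apply Real.exp_le_exp.2
    rw [hT]
    have := abs_nonneg u
    nlinarith [mul_nonneg (sq_nonneg b) this, sq_nonneg b]
  have hGG : G⁻¹ ≤ (Real.Gamma (a + 1))⁻¹ := by
    gcongr; exact hG a ha.le haα
  calc _ = (√(2 * Real.pi))⁻¹ * b * a * r * (G⁻¹ * (Real.exp (-(4 + b ^ 2))
        * Real.exp (-(4 + b ^ 2) * |u|))) := by ring
    _ ≤ (√(2 * Real.pi))⁻¹ * b * a * r * ((Real.Gamma (a + 1))⁻¹ * (Real.exp (-(b * √T) ^ 2 / 2)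
        * Real.exp (-(T + 1)) * ((T + 1)⁻¹ * (T + 1)⁻¹))) := by gcongr
    _ = _ := by ring

lemma gammaMeasure_Ioc_zero_ge {a t : ℝ} (ha : 0 < a) (ht : 0 < t) (ht1 : t ≤ 1) :
    ENNReal.ofReal (Real.exp (-1) / Real.Gamma (a + 1) * t ^ a) ≤ gammaMeasure a 1 (Set.Ioc 0 t) := by
  have hG := Real.Gamma_pos_of_pos (by linarith : 0 < a + 1)
  have hG' := Real.Gamma_pos_of_pos ha
  have hint : IntegrableOn (fun g : ℝ => g ^ (a - 1)) (Set.Ioc 0 t) :=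
    (intervalIntegrable_iff_integrableOn_Ioc_of_le ht.le).1
      (intervalIntegral.intervalIntegrable_rpow' (by linarith))
  have hval : ∫⁻ g in Set.Ioc 0 t, ENNReal.ofReal (g ^ (a - 1)) = ENNReal.ofReal (t ^ a / a) := by
    rw [← ofReal_integral_eq_lintegral_ofReal hint
      ((ae_restrict_iff' measurableSet_Ioc).2 (ae_of_all _ fun g hg => Real.rpow_nonneg hg.1.le _)),
      ← intervalIntegral.integral_of_le ht.le, integral_rpow (.inl (by linarith))]
    simp [ha.ne']
  rw [gammaMeasure, withDensity_apply _ measurableSet_Ioc]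
  calc _ = ENNReal.ofReal (Real.exp (-1) / Real.Gamma a) * ENNReal.ofReal (t ^ a / a) := by
        rw [← ENNReal.ofReal_mul (by positivity), Real.Gamma_add_one ha.ne']
        congr 1
        field_simp
    _ = ∫⁻ g in Set.Ioc 0 t, ENNReal.ofReal (Real.exp (-1) / Real.Gamma a)
          * ENNReal.ofReal (g ^ (a - 1)) := by
        rw [← hval, lintegral_const_mul _ (by fun_prop)]
    _ ≤ _ := by
        refine setLIntegral_mono (measurable_gammaPDF _ _) fun g hg => ?_
        rw [gammaPDF_of_nonneg hg.1.le, ← ENNReal.ofReal_mul (by positivity)]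
        apply ENNReal.ofReal_le_ofReal
        rw [Real.one_rpow, one_mul]
        have h1 : Real.exp (-1) ≤ Real.exp (-g) := Real.exp_le_exp.2 (by linarith [hg.2])
        have h2 := Real.rpow_nonneg hg.1.le (a - 1)
        calc _ = 1 / Real.Gamma a * g ^ (a - 1) * Real.exp (-1) := by ring
          _ ≤ _ := by gcongr

lemma log_mul_one_div_sq_le {k r : ℝ} (hk : 0 ≤ k) (hr : 0 < r) (hr2 : r ≤ 1 / 2) :
    Real.log ((1 + k) * (1 / r) ^ 2) ≤ (Real.log (1 + k) / Real.log 2 + 2) * Real.log (1 / r) := by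
  have hl2 : 0 < Real.log 2 := Real.log_pos one_lt_two
  have hΛ : Real.log 2 ≤ Real.log (1 / r) := by
    apply Real.log_le_log two_pos
    rw [le_div_iff₀ hr]; linarith
  calc Real.log ((1 + k) * (1 / r) ^ 2) = Real.log (1 + k) + 2 * Real.log (1 / r) := by
        rw [Real.log_mul (by positivity) (by positivity), Real.log_pow]; norm_num
    _ = Real.log (1 + k) / Real.log 2 * Real.log 2 + 2 * Real.log (1 / r) := by
      rw [div_mul_cancel₀ _ hl2.ne']
    _ ≤ Real.log (1 + k) / Real.log 2 * Real.log (1 / r) + 2 * Real.log (1 / r) := by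
      have : 0 ≤ Real.log (1 + k) := Real.log_nonneg (by linarith)
      gcongr
    _ = _ := by ring

lemma log_one_add_div_sq_le {k r : ℝ} (hk : 0 ≤ k) (hr : 0 < r) (hr2 : r ≤ 1 / 2) :
    Real.log (1 + k / r ^ 2) ≤ (Real.log (1 + k) / Real.log 2 + 2) * Real.log (1 / r) := by
  refine le_trans (Real.log_le_log (by positivity) ?_) (log_mul_one_div_sq_le hk hr hr2)
  have : 1 ≤ 1 / r ^ 2 := by rw [le_div_iff₀ (by positivity)]; nlinarith
  calc _ ≤ 1 / r ^ 2 + k / r ^ 2 := by gcongr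
    _ = _ := by field_simp

/-- Mass of a small interval around zero. The exponent is proportional to `a`, so that the bound
can be multiplied over the cells of an arbitrarily fine partition. -/
lemma IsSymmGamma.exists_central_ge {b : ℝ} (hb : 0 < b) (α : ℝ) :
    ∃ C : ℝ, 0 < C ∧ ∀ (ν : Measure ℝ) (a r : ℝ), IsSymmGamma ν a b → 0 ≤ a → a ≤ α →
      0 < r → r ≤ 1 / 2 → Real.exp (-C * (a * Real.log (1 / r))) ≤ ν.real {x | |x| ≤ r} := by
  obtain ⟨G, hG1, hG⟩ := exists_Gamma_add_one_le α
  have hpi : 0 < √(2 * Real.pi) := by positivity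
  have hl2 : 0 < Real.log 2 := Real.log_pos one_lt_two
  set C₁ := Real.log (1 + 4 * b⁻¹ ^ 2) / Real.log 2 + 2 with hC₁
  set C₂ := Real.log (1 + 2 / b ^ 2) / Real.log 2 + 2 with hC₂
  have hC₁0 : 0 < C₁ := by
    have : 0 ≤ Real.log (1 + 4 * b⁻¹ ^ 2) := Real.log_nonneg (by
      have : 0 ≤ 4 * b⁻¹ ^ 2 := by positivity
      linarith)
    positivity
  have hC₂0 : 0 < C₂ := by
    have : 0 ≤ Real.log (1 + 2 / b ^ 2) := Real.log_nonneg (by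
      have : 0 ≤ 2 / b ^ 2 := by positivity
      linarith)
    positivity
  set c := (√(2 * Real.pi))⁻¹ * Real.exp (-1 ^ 2 / 2) * (1 - -1) * (Real.exp (-1) / G) with hc
  have hc0 : 0 < c := by positivity
  refine ⟨4 * C₁ + C₂ + 4 * C₁ * |Real.log c|, by positivity, ?_⟩
  intro ν a r h ha0 haα hr hr2
  have := h.1
  have hS : MeasurableSet {x : ℝ | |x| ≤ r} := measurableSet_le (by fun_prop) measurable_const
  set Λ := Real.log (1 / r) with hΛ
  have hΛ0 : 0 ≤ Λ := Real.log_nonneg (by rw [le_div_iff₀ hr]; linarith)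
  have haΛ : 0 ≤ a * Λ := by positivity
  set y := 2 * a * (C₁ * Λ) with hy
  have hy0 : 0 ≤ y := by positivity
  -- For small shape parameters the tail bound suffices. Otherwise `a log (1 / r)` is bounded below, so
  -- that constants can be absorbed, and the representation as a Gaussian mixture applies.
  by_cases hcase : y ≤ 1 / 2
  · have htail : ν.real {x | r < |x|} ≤ y := by
      refine (h.measureReal_abs_gt_le ha0 hr).trans ?_
      rw [hy]
      gcongr
      exact log_one_add_div_sq_le (by positivity) hr hr2
    have hcompl : {x : ℝ | |x| ≤ r} = {x | r < |x|}ᶜ := by ext; simp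
    have hm : MeasurableSet {x : ℝ | r < |x|} := measurableSet_lt measurable_const (by fun_prop)
    rw [hcompl, probReal_compl_eq_one_sub hm]
    have h1 : Real.exp (-(2 * y)) ≤ 1 - y := by
      rw [Real.exp_neg]
      apply inv_le_of_inv_le₀ (by linarith)
      have := Real.add_one_le_exp (2 * y)
      refine le_trans ?_ this
      rw [inv_eq_one_div, div_le_iff₀ (by linarith)]
      nlinarith
    have h2 : Real.exp (-(4 * C₁ + C₂ + 4 * C₁ * |Real.log c|) * (a * Λ)) ≤ Real.exp (-(2 * y)) := by
      apply Real.exp_le_exp.2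
      rw [hy]
      have : 0 ≤ (C₂ + 4 * C₁ * |Real.log c|) * (a * Λ) := by positivity
      nlinarith
    linarith
  · rw [not_le] at hcase
    have ha : 0 < a := by
      rcases ha0.eq_or_lt with rfl | ha
      · rw [hy] at hcase; norm_num at hcase
      · exact ha
    set t := r ^ 2 * b ^ 2 / (b ^ 2 + 2) with ht
    have ht0 : 0 < t := by positivity
    have ht1 : t ≤ 1 := by
      rw [ht, div_le_one (by positivity)]
      have : r ^ 2 ≤ 1 := by nlinarith
      nlinarith [sq_nonneg b]
    have ht2 : 2 * t ≤ r ^ 2 * b ^ 2 := by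
      rw [ht, ← mul_div_assoc, div_le_iff₀ (by positivity)]
      nlinarith [sq_nonneg (r * b), sq_nonneg (r * b * b)]
    have hin : ∀ g ∈ Set.Ioc 0 t, ENNReal.ofReal ((√(2 * Real.pi))⁻¹ * Real.exp (-1 ^ 2 / 2)
        * (1 - -1)) ≤ ∫⁻ z, Set.indicator {x : ℝ | |x| ≤ r} 1 (√(2 * g) / b * z)
          ∂gaussianReal 0 1 := by
      intro g hg
      have hg0 : 0 < g := hg.1
      have hmeas : MeasurableSet {z | √(2 * g) / b * z ∈ {x : ℝ | |x| ≤ r}} :=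
        (measurable_const_mul _) hS
      have heq : ∫⁻ z, Set.indicator {x : ℝ | |x| ≤ r} 1 (√(2 * g) / b * z) ∂gaussianReal 0 1
          = gaussianReal 0 1 {z | √(2 * g) / b * z ∈ {x : ℝ | |x| ≤ r}} := by
        rw [← lintegral_indicator_one hmeas]
        rfl
      rw [heq]
      refine le_trans (gaussianReal_Icc_ge (fun z hz => abs_le.2 hz)) (measure_mono fun z hz => ?_)
      have hq : √(2 * g) ≤ r * b := by
        rw [Real.sqrt_le_left (by positivity), mul_pow]
        linarith [hg.2]
      simp only [Set.mem_ofPred_eq]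
      rw [abs_mul, abs_of_nonneg (by positivity), div_mul_eq_mul_div, div_le_iff₀ hb]
      calc √(2 * g) * |z| ≤ r * b * 1 := by
            gcongr
            exact abs_le.2 hz
        _ = r * b := mul_one _
    have hmain : ENNReal.ofReal ((√(2 * Real.pi))⁻¹ * Real.exp (-1 ^ 2 / 2) * (1 - -1))
        * ENNReal.ofReal (Real.exp (-1) / Real.Gamma (a + 1) * t ^ a) ≤ ν {x | |x| ≤ r} := by
      rw [← lintegral_indicator_one hS, h.eq_gammaMixture ha,
        lintegral_gammaMixture ha (measurable_one.indicator hS)]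
      calc _ ≤ ENNReal.ofReal ((√(2 * Real.pi))⁻¹ * Real.exp (-1 ^ 2 / 2) * (1 - -1))
            * gammaMeasure a 1 (Set.Ioc 0 t) := by
            gcongr
            exact gammaMeasure_Ioc_zero_ge ha ht0 ht1
        _ = ∫⁻ g in Set.Ioc 0 t, ENNReal.ofReal ((√(2 * Real.pi))⁻¹ * Real.exp (-1 ^ 2 / 2)
            * (1 - -1)) ∂gammaMeasure a 1 := by rw [setLIntegral_const]
        _ ≤ ∫⁻ g in Set.Ioc 0 t, ∫⁻ z, Set.indicator {x : ℝ | |x| ≤ r} 1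
            (√(2 * g) / b * z) ∂gaussianReal 0 1 ∂gammaMeasure a 1 :=
            setLIntegral_mono' measurableSet_Ioc hin
        _ ≤ _ := setLIntegral_le_lintegral _ _
    have hGa := Real.Gamma_pos_of_pos (by linarith : 0 < a + 1)
    rw [← ENNReal.ofReal_mul (by positivity), ← ofReal_measureReal,
      ENNReal.ofReal_le_ofReal_iff measureReal_nonneg] at hmain
    refine le_trans ?_ hmain
    have hta : Real.exp (-(C₂ * (a * Λ))) ≤ t ^ a := by
      rw [Real.rpow_def_of_pos ht0]
      apply Real.exp_le_exp.2
      have hlt : -Real.log t ≤ C₂ * Λ := by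
        rw [← Real.log_inv]
        refine le_trans (le_of_eq ?_)
          (log_mul_one_div_sq_le (k := 2 / b ^ 2) (by positivity) hr hr2)
        congr 1
        rw [ht]
        field_simp
      nlinarith
    have hcK : Real.exp (-|Real.log c|) ≤ c := by
      calc _ ≤ Real.exp (Real.log c) := Real.exp_le_exp.2 (neg_abs_le _)
        _ = c := Real.exp_log hc0
    have hGG : Real.exp (-1) / G ≤ Real.exp (-1) / Real.Gamma (a + 1) := by
      gcongr; exact hG a ha.le haα
    calc _ ≤ Real.exp (-(C₂ * (a * Λ))) * Real.exp (-|Real.log c|) := by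
          rw [← Real.exp_add]
          apply Real.exp_le_exp.2
          have h3 : 1 ≤ 4 * C₁ * (a * Λ) := by rw [hy] at hcase; linarith
          have h4 : |Real.log c| ≤ |Real.log c| * (4 * C₁ * (a * Λ)) :=
            le_mul_of_one_le_right (abs_nonneg _) h3
          have h5 : 0 ≤ 4 * C₁ * (a * Λ) := by positivity
          nlinarith
      _ ≤ t ^ a * c := by gcongr
      _ = (√(2 * Real.pi))⁻¹ * Real.exp (-1 ^ 2 / 2) * (1 - -1) * (Real.exp (-1) / G * t ^ a) := by
          rw [hc]; ring
      _ ≤ _ := by gcongr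

end SymmGamma

/-! ### Integrals against symmetric Gamma random measures -/

section RandomMeasure

variable {X Ω : Type*}

/-- The step function obtained by rounding the values of `h` down to multiples of `1 / (N + 1)`. -/
def roundDown (h : X → ℝ) (N : ℕ) (z : X) : ℝ := ⌊((N : ℝ) + 1) * h z⌋ / ((N : ℝ) + 1)

lemma roundDown_mem (h : X → ℝ) (N : ℕ) (z : X) :
    roundDown h N z ≤ h z ∧ h z - 1 / ((N : ℝ) + 1) ≤ roundDown h N z := by
  have hN : 0 < (N : ℝ) + 1 := by positivity
  unfold roundDown
  constructor
  · rw [div_le_iff₀ hN, mul_comm]; exact Int.floor_le _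
  · rw [le_div_iff₀ hN, sub_mul, div_mul_cancel₀ _ hN.ne']
    have := Int.sub_one_lt_floor (((N : ℝ) + 1) * h z)
    linarith

lemma abs_roundDown_le {h : X → ℝ} {b : ℝ} (hb : ∀ z, |h z| ≤ b) (N : ℕ) (z : X) :
    |roundDown h N z| ≤ b + 1 / ((N : ℝ) + 1) := by
  have h1 := roundDown_mem h N z
  have h2 := abs_le.1 (hb z)
  have h3 : 0 < 1 / ((N : ℝ) + 1) := by positivity
  rw [abs_le]; constructor <;> linarith

lemma tendsto_roundDown (h : X → ℝ) (z : X) :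
    Tendsto (fun N => roundDown h N z) atTop (𝓝 (h z)) := by
  refine tendsto_of_tendsto_of_tendsto_of_le_of_le (g := fun N : ℕ => h z - 1 / ((N : ℝ) + 1))
    (h := fun _ => h z) ?_ tendsto_const_nhds (fun N => (roundDown_mem h N z).2)
    (fun N => (roundDown_mem h N z).1)
  simpa using tendsto_const_nhds.sub (tendsto_one_div_add_atTop_nhds_zero_nat (𝕜 := ℝ))

variable [MeasurableSpace X] [MeasurableSpace Ω]

lemma isFiniteMeasure_variation (q : SignedMeasure X) : IsFiniteMeasure q.variation := by
  rw [← SignedMeasure.totalVariation_eq_variation, SignedMeasure.totalVariation]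
  infer_instance

lemma integrable_of_abs_le (q : SignedMeasure X) {h : X → ℝ} (hm : Measurable h) {b : ℝ}
    (hb : ∀ z, |h z| ≤ b) : q.Integrable h := by
  have := isFiniteMeasure_variation q
  exact Integrable.of_bound hm.aestronglyMeasurable b (ae_of_all _ hb)

lemma integral_indicator_const_signed (q : SignedMeasure X) {A : Set X} (hA : MeasurableSet A)
    (c : ℝ) : ∫ᵛ z, A.indicator (fun _ => c) z ∂•q = c * q A := by
  have := isFiniteMeasure_variation q
  rw [VectorMeasure.integral_indicator_const _ hA]
  simp

lemma measurable_roundDown {h : X → ℝ} (hm : Measurable h) (N : ℕ) :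
    Measurable (roundDown h N) := by
  unfold roundDown
  have : Measurable fun z => (⌊((N : ℝ) + 1) * h z⌋ : ℤ) :=
    Int.measurable_floor.comp (hm.const_mul _)
  exact ((measurable_of_countable (fun k : ℤ => (k : ℝ))).comp this).div_const _

lemma tendsto_integral_roundDown (q : SignedMeasure X) {h : X → ℝ} (hm : Measurable h) {b : ℝ}
    (hb : ∀ z, |h z| ≤ b) :
    Tendsto (fun N => ∫ᵛ z, roundDown h N z ∂•q) atTop (𝓝 (∫ᵛ z, h z ∂•q)) := by
  have := isFiniteMeasure_variation q
  refine VectorMeasure.tendsto_integral_filter_of_norm_le_const ?_ ⟨b + 1, ?_⟩ ?_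
  · exact Eventually.of_forall fun N => (measurable_roundDown hm N).aestronglyMeasurable
  · refine Eventually.of_forall fun N => ae_of_all _ fun z => (abs_roundDown_le hb N z).trans ?_
    have : 1 / ((N : ℝ) + 1) ≤ 1 := by
      rw [div_le_one (by positivity)]
      linarith [(Nat.cast_nonneg N : (0 : ℝ) ≤ N)]
    linarith
  · exact ae_of_all _ fun z => tendsto_roundDown h z

/-- The level sets of `roundDown h N`. -/
def roundCell (h : X → ℝ) (N : ℕ) (k : ℤ) : Set X := {z | ⌊((N : ℝ) + 1) * h z⌋ = k}

lemma measurableSet_roundCell {h : X → ℝ} (hm : Measurable h) (N : ℕ) (k : ℤ) :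
    MeasurableSet (roundCell h N k) :=
  (Int.measurable_floor.comp (hm.const_mul _)) (measurableSet_singleton k)

/-- The integral of the rounded function is a finite linear combination of masses of level sets, with
coefficients that do not depend on the signed measure. -/
lemma exists_integral_roundDown {h : X → ℝ} (hm : Measurable h) {b : ℝ} (hb : ∀ z, |h z| ≤ b)
    (N : ℕ) : ∃ s : Finset ℤ, (∀ k ∈ s, |(k : ℝ) / ((N : ℝ) + 1)| ≤ b + 1 / ((N : ℝ) + 1)) ∧
      ∀ q : SignedMeasure X,
      ∫ᵛ z, roundDown h N z ∂•q = ∑ k ∈ s, (k : ℝ) / ((N : ℝ) + 1) * q (roundCell h N k) := by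
  have hN : 0 < (N : ℝ) + 1 := by positivity
  have hin : ∀ k : ℤ, |(k : ℝ) / ((N : ℝ) + 1)| ≤ b + 1 / ((N : ℝ) + 1) →
      k ∈ Finset.Icc ⌈-(((N : ℝ) + 1) * (b + 1 / ((N : ℝ) + 1)))⌉
        ⌊((N : ℝ) + 1) * (b + 1 / ((N : ℝ) + 1))⌋ := by
    intro k hk
    rw [abs_div, abs_of_pos hN, div_le_iff₀ hN, mul_comm] at hk
    rw [Finset.mem_Icc]
    exact ⟨Int.ceil_le.2 (abs_le.1 hk).1, Int.le_floor.2 (abs_le.1 hk).2⟩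
  classical
  refine ⟨{k ∈ Finset.Icc ⌈-(((N : ℝ) + 1) * (b + 1 / ((N : ℝ) + 1)))⌉
        ⌊((N : ℝ) + 1) * (b + 1 / ((N : ℝ) + 1))⌋ | |(k : ℝ) / ((N : ℝ) + 1)| ≤
          b + 1 / ((N : ℝ) + 1)}, fun k hk => (Finset.mem_filter.1 hk).2, fun q => ?_⟩
  set s : Finset ℤ := {k ∈ Finset.Icc ⌈-(((N : ℝ) + 1) * (b + 1 / ((N : ℝ) + 1)))⌉
        ⌊((N : ℝ) + 1) * (b + 1 / ((N : ℝ) + 1))⌋ | |(k : ℝ) / ((N : ℝ) + 1)| ≤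
          b + 1 / ((N : ℝ) + 1)} with hs
  have heq : ∀ z, roundDown h N z = ∑ k ∈ s,
      (roundCell h N k).indicator (fun _ => (k : ℝ) / ((N : ℝ) + 1)) z := by
    intro z
    rw [Finset.sum_eq_single (⌊((N : ℝ) + 1) * h z⌋)]
    · rw [Set.indicator_of_mem (by rfl)]; rfl
    · intro k _ hk
      exact Set.indicator_of_notMem (fun h => hk h.symm) _
    · intro hk
      exact (hk (by
        have := abs_roundDown_le hb N z
        rw [roundDown] at this
        exact Finset.mem_filter.2 ⟨hin _ this, this⟩)).elim
  simp_rw [heq]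
  rw [VectorMeasure.integral_finsetSum]
  · exact Finset.sum_congr rfl fun k _ =>
      integral_indicator_const_signed q (measurableSet_roundCell hm N k) _
  · intro k _
    refine integrable_of_abs_le q (b := |(k : ℝ) / ((N : ℝ) + 1)|)
      (measurable_const.indicator (measurableSet_roundCell hm N k)) fun z => ?_
    by_cases hz : z ∈ roundCell h N k
    · rw [Set.indicator_of_mem hz]
    · rw [Set.indicator_of_notMem hz]; simp

variable {P : Measure Ω} {Q : Ω → SignedMeasure X} {α η : ℝ} {F : Measure X}

/-- Integrals of bounded functions are random variables, although only the measurability of the masses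
of sets is assumed: they are limits of integrals of step functions. -/
lemma IsSymmGammaRandomMeasure.measurable_integral (hQ : IsSymmGammaRandomMeasure P Q α η F)
    {h : X → ℝ} (hm : Measurable h) {b : ℝ} (hb : ∀ z, |h z| ≤ b) :
    Measurable fun ω => ∫ᵛ z, h z ∂•(Q ω) := by
  refine measurable_of_tendsto_metrizable (f := fun N ω => ∫ᵛ z, roundDown h N z ∂•(Q ω))
    (fun N => ?_) (tendsto_pi_nhds.2 fun ω => tendsto_integral_roundDown (Q ω) hm hb)
  obtain ⟨s, -, hs⟩ := exists_integral_roundDown hm hb N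
  simp_rw [hs]
  exact Finset.measurable_sum _ fun k _ =>
    (hQ.measurable _ (measurableSet_roundCell hm N k)).const_mul _

/-- Independence over a family of disjoint sets with an arbitrary finite index type. -/
lemma IsSymmGammaRandomMeasure.iIndepFun (hQ : IsSymmGammaRandomMeasure P Q α η F)
    {ι : Type*} [Finite ι] {A : ι → Set X} (hA : ∀ i, MeasurableSet (A i))
    (hd : Pairwise fun i j => Disjoint (A i) (A j)) :
    ProbabilityTheory.iIndepFun (fun i ω => Q ω (A i)) P := by
  obtain ⟨k, ⟨e⟩⟩ := Finite.exists_equiv_fin ι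
  have := hQ.indep k (fun i => A (e.symm i)) (fun i => hA _)
    (fun i j hij => hd (e.symm.injective.ne hij))
  have h2 := this.precomp e.injective
  simpa using h2

/-- Exponential moments of integrals with respect to the random measure. -/
lemma IsSymmGammaRandomMeasure.lintegral_exp_integral_le [IsProbabilityMeasure P]
    [IsProbabilityMeasure F] (hQ : IsSymmGammaRandomMeasure P Q α η F)
    (hα : 0 ≤ α) {h : X → ℝ} (hm : Measurable h) {b : ℝ} (hb0 : 0 < b)
    (hb : ∀ z, |h z| ≤ b) {A : Set X} (hA : MeasurableSet A) (hz : ∀ z ∉ A, h z = 0) {l : ℝ}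
    (hl : l ^ 2 * (2 * b) ^ 2 / η ^ 2 ≤ 1 / 2) :
    ∫⁻ ω, ENNReal.ofReal (Real.exp (l * ∫ᵛ z, h z ∂•(Q ω))) ∂P
      ≤ ENNReal.ofReal (Real.exp (2 * (α * F.real A) * (l ^ 2 * (2 * b) ^ 2 / η ^ 2))) := by
  obtain ⟨N₀, hN₀⟩ := exists_nat_gt (1 / b)
  have hstep : ∀ N ≥ N₀, ∫⁻ ω, ENNReal.ofReal (Real.exp (l * ∫ᵛ z, roundDown h N z ∂•(Q ω))) ∂P
      ≤ ENNReal.ofReal (Real.exp (2 * (α * F.real A) * (l ^ 2 * (2 * b) ^ 2 / η ^ 2))) := by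
    intro N hN
    have hN1 : 1 / ((N : ℝ) + 1) ≤ b := by
      rw [div_le_iff₀ (by positivity)]
      rw [div_lt_iff₀ hb0] at hN₀
      have : (N₀ : ℝ) ≤ N := by exact_mod_cast hN
      nlinarith
    obtain ⟨s, hsb, hs⟩ := exists_integral_roundDown hm hb N
    set c : ℤ → ℝ := fun k => (k : ℝ) / ((N : ℝ) + 1) with hc
    have hcell : ∀ k, MeasurableSet (roundCell h N k) := measurableSet_roundCell hm N
    have hdisj : ∀ i j : ℤ, i ≠ j → Disjoint (roundCell h N i) (roundCell h N j) := by
      intro i j hij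
      rw [Set.disjoint_left]
      intro z hi hj
      exact hij (hi.symm.trans hj)
    have hind : ProbabilityTheory.iIndepFun (fun (i : s) ω => Q ω (roundCell h N i)) P :=
      hQ.iIndepFun (fun i => hcell i) (fun i j hij => hdisj _ _ (Subtype.coe_injective.ne hij))
    have hmeas : ∀ k : ℤ, Measurable fun x : ℝ => ENNReal.ofReal (Real.exp (l * (c k * x))) :=
      fun k => by fun_prop
    have hone : ∀ k ∈ s, ∫⁻ ω, ENNReal.ofReal (Real.exp (l * (c k * Q ω (roundCell h N k)))) ∂P
        ≤ ENNReal.ofReal (Real.exp (2 * (α * F.real (roundCell h N k ∩ A))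
          * (l ^ 2 * (2 * b) ^ 2 / η ^ 2))) := by
      intro k hk
      by_cases hk0 : k = 0
      · simp only [hk0, hc, Int.cast_zero, zero_div, zero_mul, mul_zero, Real.exp_zero,
          lintegral_const, measure_univ, mul_one]
        apply ENNReal.ofReal_le_ofReal
        apply Real.one_le_exp
        positivity
      · have hsub : roundCell h N k ∩ A = roundCell h N k := by
          rw [Set.inter_eq_left]
          intro z hz'
          by_contra hzA
          apply hk0
          have : ⌊((N : ℝ) + 1) * h z⌋ = k := hz'
          rw [hz z hzA] at this
          simpa using this.symm
        rw [hsub]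
        have hlaw := hQ.law _ (hcell k)
        have hck : (c k) ^ 2 ≤ (2 * b) ^ 2 := by
          apply sq_le_sq'
          · linarith [(abs_le.1 (hsb k hk)).1]
          · linarith [(abs_le.1 (hsb k hk)).2]
        have hle : (l * c k) ^ 2 / η ^ 2 ≤ l ^ 2 * (2 * b) ^ 2 / η ^ 2 := by
          rw [mul_pow]; gcongr
        have h1 := hlaw.lintegral_exp_le (l := l * c k) (by positivity) (hle.trans hl)
        rw [lintegral_map (by fun_prop) (hQ.measurable _ (hcell k))] at h1
        simp_rw [mul_assoc l] at h1
        refine h1.trans (ENNReal.ofReal_le_ofReal (Real.exp_le_exp.2 ?_))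
        rw [← mul_assoc] at *
        gcongr
    calc ∫⁻ ω, ENNReal.ofReal (Real.exp (l * ∫ᵛ z, roundDown h N z ∂•(Q ω))) ∂P
        = ∫⁻ ω, ∏ k : s, ENNReal.ofReal (Real.exp (l * (c k * Q ω (roundCell h N k)))) ∂P := by
          refine lintegral_congr fun ω => ?_
          rw [hs, Finset.mul_sum, Real.exp_sum, ENNReal.ofReal_prod_of_nonneg
            (fun _ _ => (Real.exp_pos _).le), Finset.prod_coe_sort s
              (fun k : ℤ => ENNReal.ofReal (Real.exp (l * (c k * Q ω (roundCell h N k)))))]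
      _ = ∏ k : s, ∫⁻ ω, ENNReal.ofReal (Real.exp (l * (c k * Q ω (roundCell h N k)))) ∂P := by
          refine lintegral_prod_eq_prod_lintegral_of_indepFun Finset.univ _
            (hind.comp (fun k x => ENNReal.ofReal (Real.exp (l * (c k * x)))) fun k => hmeas k)
            fun k => (hmeas k).comp (hQ.measurable _ (hcell k))
      _ ≤ ∏ k : s, ENNReal.ofReal (Real.exp (2 * (α * F.real (roundCell h N k ∩ A))
          * (l ^ 2 * (2 * b) ^ 2 / η ^ 2))) :=
          Finset.prod_le_prod' fun k _ => hone k k.2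
      _ = ENNReal.ofReal (Real.exp (2 * (α * ∑ k ∈ s, F.real (roundCell h N k ∩ A))
          * (l ^ 2 * (2 * b) ^ 2 / η ^ 2))) := by
          rw [← ENNReal.ofReal_prod_of_nonneg (fun _ _ => (Real.exp_pos _).le), ← Real.exp_sum,
            Finset.sum_coe_sort s (fun k : ℤ => 2 * (α * F.real (roundCell h N k ∩ A))
              * (l ^ 2 * (2 * b) ^ 2 / η ^ 2)), ← Finset.sum_mul, ← Finset.mul_sum,
            ← Finset.mul_sum]
      _ ≤ _ := by
          apply ENNReal.ofReal_le_ofReal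
          apply Real.exp_le_exp.2
          gcongr
          rw [← measureReal_biUnion_finset (fun i _ j _ hij =>
            (hdisj i j hij).mono Set.inter_subset_left Set.inter_subset_left)
            (fun k _ => (hcell k).inter hA)]
          exact measureReal_mono (Set.iUnion₂_subset fun k _ => Set.inter_subset_right)
  have hlim : ∀ ω, Tendsto
      (fun N => ENNReal.ofReal (Real.exp (l * ∫ᵛ z, roundDown h N z ∂•(Q ω)))) atTop
      (𝓝 (ENNReal.ofReal (Real.exp (l * ∫ᵛ z, h z ∂•(Q ω))))) := fun ω =>
    (ENNReal.continuous_ofReal.comp (Real.continuous_exp.comp (continuous_const_mul l))).continuousAt.tendsto.comp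
      (tendsto_integral_roundDown (Q ω) hm hb)
  have hmeasN : ∀ N, Measurable fun ω =>
      ENNReal.ofReal (Real.exp (l * ∫ᵛ z, roundDown h N z ∂•(Q ω))) := fun N =>
    ((hQ.measurable_integral (measurable_roundDown hm N)
      (abs_roundDown_le hb N)).const_mul l).exp.ennreal_ofReal
  calc _ = ∫⁻ ω, liminf (fun N => ENNReal.ofReal
        (Real.exp (l * ∫ᵛ z, roundDown h N z ∂•(Q ω)))) atTop ∂P :=
        lintegral_congr fun ω => (hlim ω).liminf_eq.symm
    _ ≤ liminf (fun N => ∫⁻ ω, ENNReal.ofReal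
        (Real.exp (l * ∫ᵛ z, roundDown h N z ∂•(Q ω))) ∂P) atTop :=
        lintegral_liminf_le hmeasN
    _ ≤ _ := by
      refine (liminf_le_liminf (v := fun _ => _) (eventually_atTop.2 ⟨N₀, hstep⟩)).trans ?_
      simp

/-- Large deviations of an integral with a small integrand. -/
lemma IsSymmGammaRandomMeasure.measureReal_abs_integral_gt_le [IsProbabilityMeasure P]
    [IsProbabilityMeasure F] (hQ : IsSymmGammaRandomMeasure P Q α η F)
    (hα : 0 ≤ α) (hη : 0 < η) {h : X → ℝ} (hm : Measurable h) {b : ℝ} (hb0 : 0 < b)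
    (hb : ∀ z, |h z| ≤ b) (t : ℝ) :
    P.real {ω | t < |∫ᵛ z, h z ∂•(Q ω)|} ≤ 2 * Real.exp (α / 2) * Real.exp (-(η * t / (4 * b))) := by
  have hY := hQ.measurable_integral hm hb
  have key : ∀ s : ℝ, |s| = 1 → P.real {ω | t ≤ s * ∫ᵛ z, h z ∂•(Q ω)}
      ≤ Real.exp (α / 2) * Real.exp (-(η * t / (4 * b))) := by
    intro s hs
    have hs2 : s ^ 2 = 1 := by rw [← sq_abs, hs]; norm_num
    have hl : (s * (η / (4 * b))) ^ 2 * (2 * b) ^ 2 / η ^ 2 = 1 / 4 := by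
      rw [mul_pow, hs2]; field_simp; norm_num
    have h1 := hQ.lintegral_exp_integral_le hα hm hb0 hb MeasurableSet.univ
      (fun z hz => (hz trivial).elim) (l := s * (η / (4 * b))) (by rw [hl]; norm_num)
    rw [hl, probReal_univ] at h1
    have h2 := mul_meas_ge_le_lintegral₀ (μ := P)
      (f := fun ω => ENNReal.ofReal (Real.exp (s * (η / (4 * b)) * ∫ᵛ z, h z ∂•(Q ω))))
      ((hY.const_mul _).exp.ennreal_ofReal.aemeasurable)
      (ENNReal.ofReal (Real.exp (η * t / (4 * b))))
    have h3 : {ω | t ≤ s * ∫ᵛ z, h z ∂•(Q ω)} ⊆ {ω | ENNReal.ofReal (Real.exp (η * t / (4 * b)))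
        ≤ ENNReal.ofReal (Real.exp (s * (η / (4 * b)) * ∫ᵛ z, h z ∂•(Q ω)))} := by
      intro ω hω
      apply ENNReal.ofReal_le_ofReal
      apply Real.exp_le_exp.2
      have h4 : t ≤ s * ∫ᵛ z, h z ∂•(Q ω) := hω
      calc η * t / (4 * b) = η / (4 * b) * t := by ring
        _ ≤ η / (4 * b) * (s * ∫ᵛ z, h z ∂•(Q ω)) := by gcongr
        _ = _ := by ring
    have h5 := (mul_le_mul_right (measure_mono (μ := P) h3)
      (ENNReal.ofReal (Real.exp (η * t / (4 * b))))).trans (h2.trans h1)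
    rw [← ofReal_measureReal, ← ENNReal.ofReal_mul (Real.exp_pos _).le,
      ENNReal.ofReal_le_ofReal_iff (Real.exp_pos _).le] at h5
    rw [Real.exp_neg, ← div_eq_mul_inv, le_div_iff₀ (Real.exp_pos _), mul_comm]
    refine h5.trans (le_of_eq ?_)
    congr 1; ring
  have hsub : {ω | t < |∫ᵛ z, h z ∂•(Q ω)|} ⊆ {ω | t ≤ 1 * ∫ᵛ z, h z ∂•(Q ω)} ∪
      {ω | t ≤ (-1) * ∫ᵛ z, h z ∂•(Q ω)} := by
    intro ω hω
    rcases lt_abs.1 (show t < |∫ᵛ z, h z ∂•(Q ω)| from hω) with h | h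
    · left; simpa using h.le
    · right; simpa using h.le
  calc _ ≤ _ := measureReal_mono hsub
    _ ≤ _ := measureReal_union_le _ _
    _ ≤ Real.exp (α / 2) * Real.exp (-(η * t / (4 * b)))
        + Real.exp (α / 2) * Real.exp (-(η * t / (4 * b))) :=
        add_le_add (key 1 (by simp)) (key (-1) (by simp))
    _ = _ := by ring

/-- An integral over a set of small base measure is small with high probability. -/
lemma IsSymmGammaRandomMeasure.measureReal_abs_integral_gt_le_of_support [IsProbabilityMeasure P]
    [IsProbabilityMeasure F] (hQ : IsSymmGammaRandomMeasure P Q α η F)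
    (hα : 0 ≤ α) (hη : 0 < η) {h : X → ℝ} (hm : Measurable h) {b : ℝ} (hb0 : 0 < b)
    (hb : ∀ z, |h z| ≤ b) {A : Set X} (hA : MeasurableSet A) (hz : ∀ z ∉ A, h z = 0)
    {t : ℝ} (ht : 0 < t) :
    P.real {ω | t < |∫ᵛ z, h z ∂•(Q ω)|}
      ≤ 4 * (Real.exp (α * F.real A / 2) - 1) / (η * t / (4 * b)) ^ 2 := by
  have hY := hQ.measurable_integral hm hb
  set l := η / (4 * b) with hl
  have hl0 : 0 < l := by positivity
  have hone : ∀ s : ℝ, s ^ 2 = 1 →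
      ∫⁻ ω, ENNReal.ofReal (Real.exp (s * l * ∫ᵛ z, h z ∂•(Q ω))) ∂P
        ≤ ENNReal.ofReal (Real.exp (α * F.real A / 2)) := by
    intro s hs
    have hle : (s * l) ^ 2 * (2 * b) ^ 2 / η ^ 2 = 1 / 4 := by
      rw [mul_pow, hs, hl]; field_simp; norm_num
    have h1 := hQ.lintegral_exp_integral_le hα hm hb0 hb hA hz (l := s * l)
      (by rw [hle]; norm_num)
    rw [hle] at h1
    refine h1.trans (ENNReal.ofReal_le_ofReal (Real.exp_le_exp.2 (le_of_eq ?_)))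
    ring
  -- The constant `2` is kept on the left, so that the bound vanishes with the base mass of `A`.
  have hcosh : ∀ x : ℝ, 2 + x ^ 2 / 2 ≤ Real.exp (1 * x) + Real.exp (-1 * x) := by
    have hnn : ∀ x : ℝ, 0 ≤ x → 2 + x ^ 2 / 2 ≤ Real.exp x + Real.exp (-x) := by
      intro x hx
      have h1 := Real.quadratic_le_exp_of_nonneg hx
      have h2 := Real.add_one_le_exp (-x)
      linarith
    intro x
    rw [one_mul, neg_one_mul]
    rcases le_total 0 x with hx | hx
    · exact hnn x hx
    · have := hnn (-x) (by linarith)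
      rw [neg_neg, neg_sq] at this
      linarith
  have hev : MeasurableSet {ω | t < |∫ᵛ z, h z ∂•(Q ω)|} :=
    measurableSet_lt measurable_const (by simpa [Real.norm_eq_abs] using hY.norm)
  have hsum : ENNReal.ofReal 2 + ENNReal.ofReal ((l * t) ^ 2 / 2)
      * P {ω | t < |∫ᵛ z, h z ∂•(Q ω)|} ≤ ENNReal.ofReal (2 * Real.exp (α * F.real A / 2)) := by
    calc _ = ∫⁻ ω, (ENNReal.ofReal 2 + {ω | t < |∫ᵛ z, h z ∂•(Q ω)|}.indicator
          (fun _ => ENNReal.ofReal ((l * t) ^ 2 / 2)) ω) ∂P := by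
          rw [lintegral_add_left measurable_const, lintegral_indicator_const hev]
          simp
      _ ≤ ∫⁻ ω, (ENNReal.ofReal (Real.exp (1 * l * ∫ᵛ z, h z ∂•(Q ω)))
          + ENNReal.ofReal (Real.exp (-1 * l * ∫ᵛ z, h z ∂•(Q ω)))) ∂P := by
          refine lintegral_mono fun ω => ?_
          have h1 := hcosh (l * ∫ᵛ z, h z ∂•(Q ω))
          dsimp only
          rw [← ENNReal.ofReal_add (Real.exp_pos _).le (Real.exp_pos _).le, mul_assoc, mul_assoc]
          by_cases hω : ω ∈ {ω | t < |∫ᵛ z, h z ∂•(Q ω)|}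
          · rw [Set.indicator_of_mem hω, ← ENNReal.ofReal_add zero_le_two (by positivity)]
            refine ENNReal.ofReal_le_ofReal (le_trans ?_ h1)
            have h2 : t < |∫ᵛ z, h z ∂•(Q ω)| := hω
            have h3 : (l * t) ^ 2 ≤ (l * ∫ᵛ z, h z ∂•(Q ω)) ^ 2 := by
              rw [mul_pow, mul_pow, ← sq_abs (∫ᵛ z, h z ∂•(Q ω))]
              gcongr
            linarith
          · rw [Set.indicator_of_notMem hω, add_zero]
            refine ENNReal.ofReal_le_ofReal (le_trans ?_ h1)
            have : 0 ≤ (l * ∫ᵛ z, h z ∂•(Q ω)) ^ 2 := sq_nonneg _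
            linarith
      _ = _ := lintegral_add_left (hY.const_mul _).exp.ennreal_ofReal _
      _ ≤ _ := add_le_add (hone 1 (by norm_num)) (hone (-1) (by norm_num))
      _ = _ := by rw [← ENNReal.ofReal_add (Real.exp_pos _).le (Real.exp_pos _).le]; ring_nf
  rw [← ofReal_measureReal, ← ENNReal.ofReal_mul (by positivity),
    ← ENNReal.ofReal_add zero_le_two (by positivity),
    ENNReal.ofReal_le_ofReal_iff (by positivity)] at hsum
  have hlt : η * t / (4 * b) = l * t := by rw [hl]; ring
  rw [hlt, le_div_iff₀ (by positivity)]
  linarith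

end RandomMeasure

/-! ### Independent cells -/

section Cells

/-- The expected exponential of the part of a symmetric Gamma variable exceeding a threshold is
proportional to the shape parameter. -/
lemma IsSymmGamma.exists_lintegral_large_le {b k : ℝ} (hb : 0 < b) (hk : 0 < k)
    (hkb : (2 * k) ^ 2 / b ^ 2 ≤ 1 / 2) {α : ℝ} (hα : 0 ≤ α) :
    ∃ C : ℝ, 0 < C ∧ ∀ (ν : Measure ℝ) (a r s : ℝ), IsSymmGamma ν a b → 0 ≤ a → a ≤ α →
      0 < r → r ≤ 1 / 2 →
      ∫⁻ x, ENNReal.ofReal (Real.exp (if r < |x| then s + k * |x| else 0)) ∂ν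
        ≤ ENNReal.ofReal (Real.exp (C * (a * Real.exp s * Real.log (1 / r)))) := by
  have hl2 : 0 < Real.log 2 := Real.log_pos one_lt_two
  set C₁ := Real.log (1 + 4 * b⁻¹ ^ 2) / Real.log 2 + 2 with hC₁
  have hC₁0 : 0 < C₁ := by
    have : 0 ≤ Real.log (1 + 4 * b⁻¹ ^ 2) := Real.log_nonneg (by
      have : 0 ≤ 4 * b⁻¹ ^ 2 := by positivity
      linarith)
    positivity
  set D := (1 - Real.exp (-(2 * k))) ^ 2 with hD
  have hD0 : 0 < D := by
    have : Real.exp (-(2 * k)) < 1 := Real.exp_lt_one_iff.2 (by linarith)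
    have : 0 < 1 - Real.exp (-(2 * k)) := by linarith
    positivity
  set E := 2 * (2 * Real.exp (2 * α)) / D with hE
  refine ⟨2 * C₁ * Real.exp k + E / Real.log 2, by positivity, ?_⟩
  intro ν a r s h ha haα hr hr2
  have := h.1
  have hΛ : Real.log 2 ≤ Real.log (1 / r) := by
    apply Real.log_le_log two_pos
    rw [le_div_iff₀ hr]; linarith
  set Λ := Real.log (1 / r) with hΛd
  have hmabs : ∀ c : ℝ, MeasurableSet {x : ℝ | c < |x|} := fun c =>
    measurableSet_lt measurable_const (by fun_prop)
  -- Values larger than one are controlled by the Laplace transform.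
  have hbig : ∫⁻ x, {x : ℝ | 1 < |x|}.indicator (fun x => ENNReal.ofReal (Real.exp (k * |x|))) x ∂ν
      ≤ ENNReal.ofReal (E * a) := by
    have hpt : ∀ x : ℝ, ENNReal.ofReal 2 + ENNReal.ofReal D *
        {x : ℝ | 1 < |x|}.indicator (fun x => ENNReal.ofReal (Real.exp (k * |x|))) x
        ≤ ENNReal.ofReal (Real.exp (2 * k * x)) + ENNReal.ofReal (Real.exp (-(2 * k) * x)) := by
      intro x
      rw [← ENNReal.ofReal_add (Real.exp_pos _).le (Real.exp_pos _).le]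
      have hsym : Real.exp (2 * k * x) + Real.exp (-(2 * k) * x)
          = Real.exp (k * |x|) ^ 2 + (Real.exp (k * |x|))⁻¹ ^ 2 := by
        rw [← Real.exp_neg, ← Real.exp_nat_mul, ← Real.exp_nat_mul]
        rcases abs_cases x with ⟨hx, _⟩ | ⟨hx, _⟩ <;> rw [hx] <;> push_cast
        · congr 2 <;> ring
        · rw [add_comm]; congr 2 <;> ring
      set y := Real.exp (k * |x|) with hy
      have hy0 : 0 < y := Real.exp_pos _
      have hy1 : 1 ≤ y := Real.one_le_exp (by positivity)
      have hyi : y * y⁻¹ = 1 := mul_inv_cancel₀ hy0.ne'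
      rw [hsym]
      by_cases hx : 1 < |x|
      · rw [Set.indicator_of_mem (by exact hx), ← ENNReal.ofReal_mul hD0.le,
          ← ENNReal.ofReal_add zero_le_two (by positivity)]
        apply ENNReal.ofReal_le_ofReal
        have h1 : y⁻¹ ^ 2 ≤ Real.exp (-(2 * k)) := by
          rw [hy, ← Real.exp_neg, ← Real.exp_nat_mul]
          apply Real.exp_le_exp.2
          push_cast
          nlinarith
        have h2 : 1 - Real.exp (-(2 * k)) ≤ 1 - y⁻¹ ^ 2 := by linarith
        have h3 : D ≤ (1 - y⁻¹ ^ 2) ^ 2 := by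
          have : Real.exp (-(2 * k)) ≤ 1 := Real.exp_le_one_iff.2 (by linarith)
          rw [hD]
          exact pow_le_pow_left₀ (by linarith) h2 2
        have h4 : y ^ 2 + y⁻¹ ^ 2 = 2 + (1 - y⁻¹ ^ 2) ^ 2 * y ^ 2 := by
          have : y⁻¹ ^ 2 * y ^ 2 = 1 := by rw [← mul_pow, mul_comm, hyi, one_pow]
          linear_combination (2 - y⁻¹ ^ 2) * this
        rw [h4]
        have h5 : y ≤ y ^ 2 := by nlinarith
        have h6 : D * y ≤ (1 - y⁻¹ ^ 2) ^ 2 * y ^ 2 := by gcongr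
        linarith
      · rw [Set.indicator_of_notMem (by exact hx), mul_zero, add_zero]
        apply ENNReal.ofReal_le_ofReal
        nlinarith [sq_nonneg (y - y⁻¹)]
    have hm : Measurable ({x : ℝ | 1 < |x|}.indicator
        (fun x => ENNReal.ofReal (Real.exp (k * |x|)))) :=
      Measurable.indicator (by fun_prop) (hmabs 1)
    have h1 := h.lintegral_exp_le ha (l := 2 * k) hkb
    have h2 := h.lintegral_exp_le ha (l := -(2 * k)) (by rw [neg_sq]; exact hkb)
    rw [neg_sq] at h2
    set x₀ := 2 * a * ((2 * k) ^ 2 / b ^ 2) with hx₀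
    have hx₀0 : 0 ≤ x₀ := by positivity
    have hx₀a : x₀ ≤ a := by
      calc x₀ ≤ 2 * a * (1 / 2) := by rw [hx₀]; gcongr
        _ = a := by ring
    have h3 := lintegral_mono (μ := ν) hpt
    rw [lintegral_add_left measurable_const, lintegral_const_mul _ hm,
      lintegral_add_left (by fun_prop)] at h3
    simp only [lintegral_const, measure_univ, mul_one] at h3
    have h4 := h3.trans (add_le_add h1 h2)
    rw [← ENNReal.ofReal_add (Real.exp_pos _).le (Real.exp_pos _).le] at h4
    have h5 : Real.exp x₀ + Real.exp x₀ ≤ 2 + D * (E * a) := by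
      have h6 : Real.exp x₀ - 1 ≤ x₀ * Real.exp x₀ := by
        have := Real.add_one_le_exp (-x₀)
        rw [Real.exp_neg] at this
        have h7 : (1 - x₀) * Real.exp x₀ ≤ 1 := by
          calc _ ≤ (Real.exp x₀)⁻¹ * Real.exp x₀ := by gcongr; linarith
            _ = 1 := inv_mul_cancel₀ (Real.exp_pos _).ne'
        linarith
      have h8 : x₀ * Real.exp x₀ ≤ a * Real.exp (2 * α) := by
        gcongr
        linarith
      have h9 : D * (E * a) = 4 * (a * Real.exp (2 * α)) := by
        rw [hE]; field_simp; ring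
      rw [h9]
      have : 0 ≤ a * Real.exp (2 * α) := by positivity
      linarith
    have h6 := h4.trans (ENNReal.ofReal_le_ofReal h5)
    rw [ENNReal.ofReal_add zero_le_two (by positivity), ENNReal.add_le_add_iff_left
      ENNReal.ofReal_ne_top, ENNReal.ofReal_mul hD0.le,
      ENNReal.mul_le_mul_iff_right (by simpa using hD0) ENNReal.ofReal_ne_top] at h6
    exact h6
  have hmid : ν {x | r < |x|} ≤ ENNReal.ofReal (2 * a * (C₁ * Λ)) := by
    rw [← ofReal_measureReal]
    apply ENNReal.ofReal_le_ofReal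
    refine (h.measureReal_abs_gt_le ha hr).trans ?_
    gcongr
    exact log_one_add_div_sq_le (by positivity) hr hr2
  have hpt : ∀ x : ℝ, ENNReal.ofReal (Real.exp (if r < |x| then s + k * |x| else 0))
      ≤ 1 + ENNReal.ofReal (Real.exp s) * ({x : ℝ | r < |x|}.indicator
        (fun _ => ENNReal.ofReal (Real.exp k)) x + {x : ℝ | 1 < |x|}.indicator
        (fun x => ENNReal.ofReal (Real.exp (k * |x|))) x) := by
    intro x
    by_cases hx : r < |x|
    · rw [if_pos hx, Set.indicator_of_mem (by exact hx), Real.exp_add,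
        ENNReal.ofReal_mul (Real.exp_pos _).le]
      refine le_trans ?_ le_add_self
      refine mul_le_mul' le_rfl ?_
      by_cases hx1 : 1 < |x|
      · rw [Set.indicator_of_mem (by exact hx1)]; exact le_add_self
      · refine le_trans (ENNReal.ofReal_le_ofReal (Real.exp_le_exp.2 ?_)) le_self_add
        nlinarith
    · rw [if_neg hx]; simp
  calc _ ≤ _ := lintegral_mono hpt
    _ = 1 + ENNReal.ofReal (Real.exp s) * (ENNReal.ofReal (Real.exp k) * ν {x | r < |x|}
        + ∫⁻ x, {x : ℝ | 1 < |x|}.indicator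
        (fun x => ENNReal.ofReal (Real.exp (k * |x|))) x ∂ν) := by
        rw [lintegral_add_left measurable_const, lintegral_const_mul, lintegral_add_left,
          lintegral_indicator_const (hmabs r)]
        · simp
        · exact measurable_const.indicator (hmabs r)
        · exact (measurable_const.indicator (hmabs r)).add
            (Measurable.indicator (by fun_prop) (hmabs 1))
    _ ≤ 1 + ENNReal.ofReal (Real.exp s) * (ENNReal.ofReal (Real.exp k) *
        ENNReal.ofReal (2 * a * (C₁ * Λ)) + ENNReal.ofReal (E * a)) := by gcongr
    _ = ENNReal.ofReal (1 + Real.exp s * (Real.exp k * (2 * a * (C₁ * Λ)) + E * a)) := by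
        have hΛ0 : 0 < Λ := hl2.trans_le hΛ
        rw [← ENNReal.ofReal_mul (Real.exp_pos _).le, ← ENNReal.ofReal_add (by positivity)
          (by positivity), ← ENNReal.ofReal_mul (Real.exp_pos _).le,
          ENNReal.ofReal_add zero_le_one (by positivity), ENNReal.ofReal_one]
    _ ≤ _ := by
        apply ENNReal.ofReal_le_ofReal
        refine le_trans ?_ (Real.add_one_le_exp _)
        rw [add_comm]
        refine add_le_add ?_ le_rfl
        have : E * a ≤ E / Real.log 2 * a * Λ := by
          calc E * a = E / Real.log 2 * a * Real.log 2 := by field_simp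
            _ ≤ _ := by gcongr
        calc _ ≤ Real.exp s * (Real.exp k * (2 * a * (C₁ * Λ)) + E / Real.log 2 * a * Λ) := by gcongr
          _ = _ := by ring

variable {X Ω : Type*} [MeasurableSpace X] [MeasurableSpace Ω]
  {P : Measure Ω} {Q : Ω → SignedMeasure X} {α η : ℝ} {F : Measure X}

/-- The cost of forcing a cell of base mass `a` to receive mass `v` up to an error `r`. -/
def cellCost (c C a r v : ℝ) : ℝ := if v = 0 then 0 else Real.log (1 / (c * a * r)) + C * |v|

/-- Lower bound for the probability that the random measure assigns prescribed masses to finitely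
many cells. -/
lemma IsSymmGammaRandomMeasure.exists_cells_ge [IsProbabilityMeasure P] [IsProbabilityMeasure F]
    (hQ : IsSymmGammaRandomMeasure P Q α η F) (hα : 0 < α) (hη : 0 < η) :
    ∃ c C : ℝ, 0 < c ∧ c ≤ 1 ∧ 0 < C ∧ ∀ {ι : Type} [Fintype ι] (A : ι → Set X) (r v : ι → ℝ),
      (∀ i, MeasurableSet (A i)) → (Pairwise fun i j => Disjoint (A i) (A j)) →
      (∀ i, 0 < r i ∧ r i ≤ 1 / 2) → (∀ i, v i ≠ 0 → 0 < F.real (A i)) →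
      Real.exp (-(C * ∑ i, F.real (A i) * Real.log (1 / r i)
        + ∑ i, cellCost c C (F.real (A i)) (r i) (v i)))
        ≤ P.real {ω | ∀ i, |Q ω (A i) - v i| ≤ r i} := by
  obtain ⟨c, C₁, hc, hC₁, h1⟩ := IsSymmGamma.exists_interval_ge hη α
  obtain ⟨C₂, hC₂, h2⟩ := IsSymmGamma.exists_central_ge hη α
  refine ⟨min 1 (c * α), max C₁ (C₂ * α), by positivity, min_le_left _ _,
    lt_max_of_lt_left hC₁, ?_⟩
  intro ι _ A r v hA hd hr hv
  have hind := hQ.iIndepFun hA hd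
  have hm : ∀ i, MeasurableSet {x : ℝ | |x - v i| ≤ r i} := fun i =>
    measurableSet_le (by fun_prop) measurable_const
  have heq : P.real {ω | ∀ i, |Q ω (A i) - v i| ≤ r i}
      = ∏ i, (P.map fun ω => Q ω (A i)).real {x : ℝ | |x - v i| ≤ r i} := by
    have h3 := hind.meas_iInter (s := fun i => {ω | |Q ω (A i) - v i| ≤ r i})
      (fun i => ⟨_, hm i, rfl⟩)
    have h4 : {ω | ∀ i, |Q ω (A i) - v i| ≤ r i} = ⋂ i, {ω | |Q ω (A i) - v i| ≤ r i} := by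
      ext; simp
    rw [measureReal_def, h4, h3, ENNReal.toReal_prod]
    refine Finset.prod_congr rfl fun i _ => ?_
    rw [measureReal_def, Measure.map_apply (hQ.measurable _ (hA i)) (hm i)]
    rfl
  rw [heq, Finset.mul_sum, ← Finset.sum_add_distrib, ← Finset.sum_neg_distrib, Real.exp_sum]
  refine Finset.prod_le_prod (fun i _ => (Real.exp_pos _).le) fun i _ => ?_
  have hlaw := hQ.law _ (hA i)
  have hF0 : 0 ≤ F.real (A i) := measureReal_nonneg
  have hF1 : F.real (A i) ≤ 1 := measureReal_le_one
  have ha : α * F.real (A i) ≤ α := by nlinarith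
  have hL : 0 ≤ Real.log (1 / r i) := Real.log_nonneg (by
    rw [le_div_iff₀ (hr i).1]; linarith [(hr i).2])
  by_cases hvi : v i = 0
  · rw [cellCost, if_pos hvi, add_zero, hvi]
    simp only [sub_zero]
    refine le_trans (Real.exp_le_exp.2 ?_) (h2 _ _ _ hlaw (by positivity) ha (hr i).1 (hr i).2)
    rw [neg_mul, neg_le_neg_iff]
    calc C₂ * (α * F.real (A i) * Real.log (1 / r i))
        = C₂ * α * (F.real (A i) * Real.log (1 / r i)) := by ring
      _ ≤ _ := by gcongr; exact le_max_right _ _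
  · rw [cellCost, if_neg hvi]
    have hFpos := hv i hvi
    refine le_trans ?_ (h1 _ _ (v i) _ hlaw (by positivity) ha (hr i).1 (by linarith [(hr i).2]))
    have hpos : 0 < min 1 (c * α) * F.real (A i) * r i := by
      have := (hr i).1
      positivity
    calc _ ≤ Real.exp (-(Real.log (1 / (min 1 (c * α) * F.real (A i) * r i))
          + C₁ * |v i|)) := by
          apply Real.exp_le_exp.2
          rw [neg_le_neg_iff]
          have : C₁ * |v i| ≤ max C₁ (C₂ * α) * |v i| := by gcongr; exact le_max_left _ _
          have : 0 ≤ max C₁ (C₂ * α) * (F.real (A i) * Real.log (1 / r i)) := by positivity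
          linarith
      _ = min 1 (c * α) * F.real (A i) * r i * Real.exp (-C₁ * |v i|) := by
          rw [neg_add, Real.exp_add, one_div, Real.log_inv, neg_neg, Real.exp_log hpos, neg_mul]
      _ ≤ c * (α * F.real (A i)) * r i * Real.exp (-C₁ * |v i|) := by
          have h5 := (hr i).1.le
          have h6 : min 1 (c * α) * F.real (A i) ≤ c * (α * F.real (A i)) := by
            rw [← mul_assoc]
            gcongr
            exact min_le_right _ _
          gcongr

/-- Exponential moment of the weighted number and size of the cells whose mass exceeds a
threshold. -/
lemma IsSymmGammaRandomMeasure.exists_large_cells_le [IsProbabilityMeasure P]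
    [IsProbabilityMeasure F] (hQ : IsSymmGammaRandomMeasure P Q α η F) (hα : 0 < α) (hη : 0 < η) :
    ∃ k C : ℝ, 0 < k ∧ 0 < C ∧ ∀ {ι : Type} [Fintype ι] (A : ι → Set X) (r w : ι → ℝ) (L : ℝ),
      (∀ i, MeasurableSet (A i)) → (Pairwise fun i j => Disjoint (A i) (A j)) →
      (∀ i, 0 < r i ∧ r i ≤ 1 / 2) →
      P.real {ω | L < ∑ i, if r i < |Q ω (A i)| then w i + k * |Q ω (A i)| else 0}
        ≤ Real.exp (-L + C * ∑ i, F.real (A i) * Real.exp (w i) * Real.log (1 / r i)) := by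
  obtain ⟨C, hC, h⟩ := IsSymmGamma.exists_lintegral_large_le hη (k := η / 4) (by positivity)
    (by rw [div_le_iff₀ (by positivity)]; nlinarith [sq_nonneg η]) hα.le
  refine ⟨η / 4, C * α, by positivity, by positivity, ?_⟩
  intro ι _ A r w L hA hd hr
  have hind := hQ.iIndepFun hA hd
  have hm : ∀ i, Measurable fun x : ℝ =>
      ENNReal.ofReal (Real.exp (if r i < |x| then w i + η / 4 * |x| else 0)) := fun i =>
    (Measurable.exp (Measurable.ite (measurableSet_lt measurable_const (by fun_prop))
      (by fun_prop) measurable_const)).ennreal_ofReal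
  set Z : Ω → ℝ := fun ω => ∑ i, if r i < |Q ω (A i)| then w i + η / 4 * |Q ω (A i)| else 0 with hZ
  have h1 : ∫⁻ ω, ENNReal.ofReal (Real.exp (Z ω)) ∂P
      ≤ ENNReal.ofReal (Real.exp (C * α *
        ∑ i, F.real (A i) * Real.exp (w i) * Real.log (1 / r i))) := by
    calc ∫⁻ ω, ENNReal.ofReal (Real.exp (Z ω)) ∂P
        = ∫⁻ ω, ∏ i, ENNReal.ofReal (Real.exp
          (if r i < |Q ω (A i)| then w i + η / 4 * |Q ω (A i)| else 0)) ∂P := by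
          refine lintegral_congr fun ω => ?_
          rw [hZ, Real.exp_sum, ENNReal.ofReal_prod_of_nonneg (fun _ _ => (Real.exp_pos _).le)]
      _ = ∏ i, ∫⁻ ω, ENNReal.ofReal (Real.exp
          (if r i < |Q ω (A i)| then w i + η / 4 * |Q ω (A i)| else 0)) ∂P :=
          lintegral_prod_eq_prod_lintegral_of_indepFun Finset.univ _
            (hind.comp (fun i x => ENNReal.ofReal (Real.exp
              (if r i < |x| then w i + η / 4 * |x| else 0))) hm)
            fun i => (hm i).comp (hQ.measurable _ (hA i))
      _ ≤ ∏ i, ENNReal.ofReal (Real.exp (C * α *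
          (F.real (A i) * Real.exp (w i) * Real.log (1 / r i)))) := by
          refine Finset.prod_le_prod' fun i _ => ?_
          have ha : α * F.real (A i) ≤ α := by
            have : F.real (A i) ≤ 1 := measureReal_le_one
            nlinarith
          have h2 := h _ _ (r i) (w i) (hQ.law _ (hA i)) (by positivity) ha (hr i).1 (hr i).2
          rw [lintegral_map (hm i) (hQ.measurable _ (hA i))] at h2
          refine h2.trans (le_of_eq ?_)
          congr 2; ring
      _ = _ := by
          rw [← ENNReal.ofReal_prod_of_nonneg (fun _ _ => (Real.exp_pos _).le), ← Real.exp_sum,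
            ← Finset.mul_sum]
  have hZm : Measurable Z := by
    refine Finset.measurable_sum _ fun i _ => ?_
    have := hQ.measurable _ (hA i)
    exact Measurable.ite (measurableSet_lt measurable_const (by fun_prop)) (by fun_prop)
      measurable_const
  have h2 := mul_meas_ge_le_lintegral₀ (μ := P) (f := fun ω => ENNReal.ofReal (Real.exp (Z ω)))
    hZm.exp.ennreal_ofReal.aemeasurable (ENNReal.ofReal (Real.exp L))
  have h3 : {ω | L < Z ω} ⊆ {ω | ENNReal.ofReal (Real.exp L) ≤ ENNReal.ofReal (Real.exp (Z ω))} :=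
    fun ω hω => ENNReal.ofReal_le_ofReal (Real.exp_le_exp.2 (le_of_lt hω))
  have h4 := (mul_le_mul_right (measure_mono (μ := P) h3)
    (ENNReal.ofReal (Real.exp L))).trans (h2.trans h1)
  rw [← ofReal_measureReal, ← ENNReal.ofReal_mul (Real.exp_pos _).le,
    ENNReal.ofReal_le_ofReal_iff (Real.exp_pos _).le] at h4
  rw [Real.exp_add, Real.exp_neg, inv_mul_eq_div, le_div_iff₀ (Real.exp_pos _), mul_comm]
  exact h4

end Cells

/-! ### Packing of typical realizations -/

section Packing

/-- If every point of `G` has a neighbourhood of probability at least `p`, then `G` is covered by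
at most `1 / p` neighbourhoods of twice the size: a maximal separated subset has disjoint
neighbourhoods. -/
lemma exists_cover_of_ball_mass {Ω : Type*} [MeasurableSpace Ω] (P : Measure Ω)
    [IsProbabilityMeasure P] {f : Ω → ℕ → ℝ} (hf : ∀ j, Measurable fun ω => f ω j) (n : ℕ)
    {G : Set Ω} {e p : ℝ} (hp : 0 < p) (he : 0 ≤ e)
    (hG : ∀ ω₀ ∈ G, p ≤ P.real {ω | ∀ j < n, |f ω j - f ω₀ j| ≤ e}) :
    ∃ t : Finset Ω, (t.card : ℝ) ≤ 1 / p ∧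
      ∀ ω ∈ G, ∃ ω₀ ∈ t, ∀ j < n, |f ω j - f ω₀ j| ≤ 2 * e := by
  classical
  set B : Ω → Set Ω := fun ω₀ => {ω | ∀ j < n, |f ω j - f ω₀ j| ≤ e} with hB
  have hBm : ∀ ω₀, MeasurableSet (B ω₀) := by
    intro ω₀
    have : B ω₀ = ⋂ j ∈ Finset.range n, {ω | |f ω j - f ω₀ j| ≤ e} := by ext; simp [hB]
    rw [this]
    exact Finset.measurableSet_biInter _ fun j _ =>
      measurableSet_le ((hf j).sub_const _).norm measurable_const
  set Sep : Finset Ω → Prop := fun t => (∀ ω ∈ t, ω ∈ G) ∧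
    ∀ a ∈ t, ∀ b ∈ t, a ≠ b → ∃ j < n, 2 * e < |f a j - f b j| with hSep
  have hcard : ∀ t, Sep t → (t.card : ℝ) ≤ 1 / p := by
    intro t ht
    have hdisj : (t : Set Ω).PairwiseDisjoint B := by
      intro a ha b hb hab
      obtain ⟨j, hj, hlt⟩ := ht.2 a ha b hb hab
      refine Set.disjoint_left.2 fun ω h1 h2 => ?_
      have h3 := h1 j hj
      have h4 := h2 j hj
      have : |f a j - f b j| ≤ 2 * e := by
        calc |f a j - f b j| = |(f ω j - f b j) - (f ω j - f a j)| := by congr 1; ring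
          _ ≤ _ := abs_sub _ _
          _ ≤ _ := by linarith
      linarith
    have h1 : ∑ ω ∈ t, P.real (B ω) ≤ 1 := by
      rw [← measureReal_biUnion_finset hdisj fun ω _ => hBm ω]
      exact measureReal_le_one
    have h2 : ∑ _ω ∈ t, p ≤ ∑ ω ∈ t, P.real (B ω) := Finset.sum_le_sum fun ω hω => hG ω (ht.1 ω hω)
    rw [Finset.sum_const, nsmul_eq_mul] at h2
    rw [le_div_iff₀ hp]
    linarith
  set N : Set ℕ := {k | ∃ t, Sep t ∧ t.card = k} with hN
  -- a separated set of maximal cardinality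
  have hNne : N.Nonempty := ⟨0, ∅, by simp [hSep], rfl⟩
  have hNb : BddAbove N := ⟨⌊1 / p⌋₊, by
    rintro k ⟨t, ht, rfl⟩
    exact Nat.le_floor (hcard t ht)⟩
  obtain ⟨t, ht, hcardt⟩ := Nat.sSup_mem hNne hNb
  refine ⟨t, hcard t ht, fun ω hω => ?_⟩
  by_contra! hcon
  have hnot : ω ∉ t := by
    intro hmem
    obtain ⟨j, -, hj⟩ := hcon ω hmem
    rw [sub_self, abs_zero] at hj
    linarith
  have hins : Sep (insert ω t) := by
    refine ⟨fun a ha => ?_, fun a ha b hb hab => ?_⟩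
    · rcases Finset.mem_insert.1 ha with rfl | ha
      · exact hω
      · exact ht.1 a ha
    · rcases Finset.mem_insert.1 ha with ha' | ha' <;> rcases Finset.mem_insert.1 hb with hb' | hb'
      · exact (hab (ha'.trans hb'.symm)).elim
      · rw [ha']; exact hcon b hb'
      · obtain ⟨j, hj, h⟩ := hcon a ha'
        exact ⟨j, hj, by rwa [abs_sub_comm, hb']⟩
      · exact ht.2 a ha' b hb' hab
  have := le_csSup hNb (show t.card + 1 ∈ N from ⟨_, hins, Finset.card_insert_of_notMem hnot⟩)
  omega

end Packing

/-! ### Discretized mixtures -/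

section Discretization

variable {X Ω : Type*} [MeasurableSpace X] [MeasurableSpace Ω]
  {P : Measure Ω} {Q : Ω → SignedMeasure X} {α η : ℝ} {F : Measure X}

/-- Bound for the probability that replacing the random measure by its masses on cells changes
one of `n` integrals by more than `2 t`; here `b` bounds the oscillation of the integrands on the
cells, `L` the integrands and `τ` the base mass outside the cells. -/
def discretizationError (α η b L τ t : ℝ) (n : ℕ) : ℝ :=
  n * (2 * Real.exp (α / 2) * Real.exp (-(η * t / (4 * b)))
    + 4 * (Real.exp (α * τ / 2) - 1) / (η * t / (4 * L)) ^ 2)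

/-- The random measure may be replaced by its masses on cells, placed at the points `z i`: on the cells
the integrands oscillate by at most `b`, and the complement of the cells has small base mass. -/
lemma IsSymmGammaRandomMeasure.measureReal_discretization_le [IsProbabilityMeasure P]
    [IsProbabilityMeasure F] (hQ : IsSymmGammaRandomMeasure P Q α η F) (hα : 0 ≤ α) (hη : 0 < η)
    {H : ℕ → X → ℝ} (hH : ∀ j, Measurable (H j)) {L : ℝ} (hL : 0 < L) (hHL : ∀ j z, |H j z| ≤ L)
    (n : ℕ) {ι : Type} [Fintype ι] {A : ι → Set X} (hA : ∀ i, MeasurableSet (A i))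
    (hd : Pairwise fun i j => Disjoint (A i) (A j)) (z : ι → X) {b t : ℝ} (hb : 0 < b) (ht : 0 < t)
    (hosc : ∀ i, ∀ y ∈ A i, ∀ j, |H j y - H j (z i)| ≤ b) :
    P.real {ω | ∃ j < n, 2 * t < |∫ᵛ y, H j y ∂•(Q ω) - ∑ i, Q ω (A i) * H j (z i)|}
      ≤ discretizationError α η b L (F.real (⋃ i, A i)ᶜ) t n := by
  classical
  set U := ⋃ i, A i with hU
  have hUm : MeasurableSet U := MeasurableSet.iUnion hA
  set h₁ : ℕ → X → ℝ := fun j y => ∑ i, (A i).indicator (fun y => H j y - H j (z i)) y with hh₁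
  set h₂ : ℕ → X → ℝ := fun j => Uᶜ.indicator (H j) with hh₂
  have hm₁ : ∀ j, Measurable (h₁ j) := fun j => Finset.measurable_sum _ fun i _ =>
    ((hH j).sub_const _).indicator (hA i)
  have hm₂ : ∀ j, Measurable (h₂ j) := fun j => (hH j).indicator hUm.compl
  have hsum : ∀ (φ : ι → X → ℝ) (y : X) (i₀ : ι), y ∈ A i₀ →
      ∑ i, (A i).indicator (φ i) y = φ i₀ y := by
    intro φ y i₀ hy
    rw [Finset.sum_eq_single i₀]
    · exact Set.indicator_of_mem hy _
    · intro i _ hi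
      exact Set.indicator_of_notMem (fun hyi => Set.disjoint_left.1 (hd hi) hyi hy) _
    · intro h; exact (h (Finset.mem_univ _)).elim
  have hsum0 : ∀ (φ : ι → X → ℝ) (y : X), y ∉ U → ∑ i, (A i).indicator (φ i) y = 0 := by
    intro φ y hy
    exact Finset.sum_eq_zero fun i _ => Set.indicator_of_notMem
      (fun h => hy (Set.mem_iUnion.2 ⟨i, h⟩)) _
  have hb₁ : ∀ j y, |h₁ j y| ≤ b := by
    intro j y
    by_cases hy : y ∈ U
    · obtain ⟨i, hi⟩ := Set.mem_iUnion.1 hy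
      rw [hh₁]; dsimp only
      rw [hsum (fun i y => H j y - H j (z i)) y i hi]
      exact hosc i y hi j
    · rw [hh₁]; dsimp only
      rw [hsum0 _ y hy, abs_zero]; exact hb.le
  have hb₂ : ∀ j y, |h₂ j y| ≤ L := by
    intro j y
    by_cases hy : y ∈ Uᶜ
    · rw [hh₂]; dsimp only; rw [Set.indicator_of_mem hy]; exact hHL j y
    · rw [hh₂]; dsimp only; rw [Set.indicator_of_notMem hy, abs_zero]; exact hL.le
  have hdec : ∀ j y, H j y = (∑ i, (A i).indicator (fun _ => H j (z i)) y) + (h₁ j y + h₂ j y) := by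
    intro j y
    rw [hh₁, hh₂]; dsimp only
    by_cases hy : y ∈ U
    · obtain ⟨i, hi⟩ := Set.mem_iUnion.1 hy
      rw [hsum _ y i hi, hsum (fun i y => H j y - H j (z i)) y i hi,
        Set.indicator_of_notMem (by simpa using hy)]
      ring
    · rw [hsum0 _ y hy, hsum0 _ y hy, Set.indicator_of_mem (by simpa using hy)]
      ring
  have hint : ∀ ω j, ∫ᵛ y, H j y ∂•(Q ω) - ∑ i, Q ω (A i) * H j (z i)
      = ∫ᵛ y, h₁ j y ∂•(Q ω) + ∫ᵛ y, h₂ j y ∂•(Q ω) := by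
    intro ω j
    have hi₁ := integrable_of_abs_le (Q ω) (hm₁ j) (hb₁ j)
    have hi₂ := integrable_of_abs_le (Q ω) (hm₂ j) (hb₂ j)
    have hi₃ : ∀ i ∈ Finset.univ, (Q ω).Integrable ((A i).indicator fun _ => H j (z i)) := by
      intro i _
      refine integrable_of_abs_le (Q ω) (measurable_const.indicator (hA i)) (b := L) fun y => ?_
      by_cases hy : y ∈ A i
      · rw [Set.indicator_of_mem hy]; exact hHL j _
      · rw [Set.indicator_of_notMem hy, abs_zero]; exact hL.le
    have h1 : ∫ᵛ y, H j y ∂•(Q ω) = ∫ᵛ y, ((∑ i, (A i).indicator (fun _ => H j (z i)) y)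
        + (h₁ j y + h₂ j y)) ∂•(Q ω) := by simp_rw [← hdec]
    rw [h1, VectorMeasure.integral_fun_add (g := fun y => h₁ j y + h₂ j y)
      (VectorMeasure.Integrable.fun_finsetSum _ hi₃) (hi₁.add hi₂), VectorMeasure.integral_finsetSum _ hi₃, VectorMeasure.integral_fun_add hi₁ hi₂]
    have h2 : ∑ i, ∫ᵛ y, (A i).indicator (fun _ => H j (z i)) y ∂•(Q ω)
        = ∑ i, Q ω (A i) * H j (z i) := Finset.sum_congr rfl fun i _ => by
      rw [integral_indicator_const_signed _ (hA i), mul_comm]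
    rw [h2]; ring
  have hsub : {ω | ∃ j < n, 2 * t < |∫ᵛ y, H j y ∂•(Q ω) - ∑ i, Q ω (A i) * H j (z i)|}
      ⊆ ⋃ j ∈ Finset.range n, ({ω | t < |∫ᵛ y, h₁ j y ∂•(Q ω)|} ∪
        {ω | t < |∫ᵛ y, h₂ j y ∂•(Q ω)|}) := by
    rintro ω ⟨j, hj, hω⟩
    rw [hint] at hω
    refine Set.mem_biUnion (Finset.mem_coe.2 (Finset.mem_range.2 hj)) ?_
    by_contra hcon
    rw [Set.mem_union, not_or] at hcon
    have h1 : |∫ᵛ y, h₁ j y ∂•(Q ω)| ≤ t := not_lt.1 hcon.1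
    have h2 : |∫ᵛ y, h₂ j y ∂•(Q ω)| ≤ t := not_lt.1 hcon.2
    have := abs_add_le (∫ᵛ y, h₁ j y ∂•(Q ω)) (∫ᵛ y, h₂ j y ∂•(Q ω))
    linarith
  calc _ ≤ _ := measureReal_mono hsub (measure_ne_top _ _)
    _ ≤ ∑ j ∈ Finset.range n, P.real ({ω | t < |∫ᵛ y, h₁ j y ∂•(Q ω)|} ∪
        {ω | t < |∫ᵛ y, h₂ j y ∂•(Q ω)|}) := measureReal_biUnion_finset_le _ _
    _ ≤ ∑ _j ∈ Finset.range n, (2 * Real.exp (α / 2) * Real.exp (-(η * t / (4 * b)))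
        + 4 * (Real.exp (α * F.real Uᶜ / 2) - 1) / (η * t / (4 * L)) ^ 2) := by
        refine Finset.sum_le_sum fun j _ => (measureReal_union_le _ _).trans (add_le_add ?_ ?_)
        · exact hQ.measureReal_abs_integral_gt_le hα hη (hm₁ j) hb (hb₁ j) t
        · exact hQ.measureReal_abs_integral_gt_le_of_support hα hη (hm₂ j) hL (hb₂ j) hUm.compl
            (fun y hy => Set.indicator_of_notMem hy _) ht
    _ = _ := by rw [Finset.sum_const, Finset.card_range, nsmul_eq_mul, discretizationError]

lemma abs_sum_mul_sub_le {ι : Type*} [Fintype ι] {u v r H : ι → ℝ} {L : ℝ}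
    (hL : ∀ i, |H i| ≤ L) (huv : ∀ i, |u i - v i| ≤ r i) :
    |∑ i, u i * H i - ∑ i, v i * H i| ≤ L * ∑ i, r i := by
  rw [← Finset.sum_sub_distrib, Finset.mul_sum]
  refine (Finset.abs_sum_le_sum_abs _ _).trans (Finset.sum_le_sum fun i _ => ?_)
  rw [← sub_mul, abs_mul, mul_comm]
  exact mul_le_mul (hL i) (huv i) (abs_nonneg _) ((abs_nonneg _).trans (hL i))

/-- Small ball probabilities around a finite combination of the integrands at the cell centres. -/
lemma measureReal_small_ball_ge [IsProbabilityMeasure P]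
    [IsProbabilityMeasure F] (hQ : IsSymmGammaRandomMeasure P Q α η F) (hα : 0 < α) (hη : 0 < η)
    {H : ℕ → X → ℝ} (hH : ∀ j, Measurable (H j)) {L : ℝ} (hL : 0 < L) (hHL : ∀ j z, |H j z| ≤ L)
    (n : ℕ) {ι : Type} [Fintype ι] {A : ι → Set X} (hA : ∀ i, MeasurableSet (A i))
    (hd : Pairwise fun i j => Disjoint (A i) (A j)) (z : ι → X) {b t p : ℝ} (hb : 0 < b) (ht : 0 < t)
    (hosc : ∀ i, ∀ y ∈ A i, ∀ j, |H j y - H j (z i)| ≤ b) {r v : ι → ℝ}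
    (hp : p ≤ P.real {ω | ∀ i, |Q ω (A i) - v i| ≤ r i}) :
    p - discretizationError α η b L (F.real (⋃ i, A i)ᶜ) t n ≤
      P.real {ω | ∀ j < n, |∫ᵛ y, H j y ∂•(Q ω) - ∑ i, v i * H j (z i)| ≤ 2 * t + L * ∑ i, r i} := by
  have h1 := hQ.measureReal_discretization_le hα.le hη hH hL hHL n hA hd z hb ht hosc
  have hsub : {ω | ∀ i, |Q ω (A i) - v i| ≤ r i} ⊆
      {ω | ∀ j < n, |∫ᵛ y, H j y ∂•(Q ω) - ∑ i, v i * H j (z i)| ≤ 2 * t + L * ∑ i, r i} ∪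
      {ω | ∃ j < n, 2 * t < |∫ᵛ y, H j y ∂•(Q ω) - ∑ i, Q ω (A i) * H j (z i)|} := by
    intro ω hω
    by_cases h : ∃ j < n, 2 * t < |∫ᵛ y, H j y ∂•(Q ω) - ∑ i, Q ω (A i) * H j (z i)|
    · exact Or.inr h
    · left
      push Not at h
      intro j hj
      have h2 := abs_sum_mul_sub_le (H := fun i => H j (z i)) (fun i => hHL j (z i)) hω
      calc _ = |(∫ᵛ y, H j y ∂•(Q ω) - ∑ i, Q ω (A i) * H j (z i)) +
            (∑ i, Q ω (A i) * H j (z i) - ∑ i, v i * H j (z i))| := by congr 1; ring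
        _ ≤ _ := abs_add_le _ _
        _ ≤ _ := add_le_add (h j hj) h2
  have h2 := (measureReal_mono hsub).trans (measureReal_union_le (μ := P) _ _)
  linarith

/-- With high probability the path of the integrals has a small ball probability that is not too
small. The exponent `lam` trades the probability of the exceptional set against the size of the
small ball probabilities. -/
lemma exists_typical_small_ball [IsProbabilityMeasure P] [IsProbabilityMeasure F]
    (hQ : IsSymmGammaRandomMeasure P Q α η F) (hα : 0 < α) (hη : 0 < η) {lam : ℝ} (hlam : 0 < lam) :
    ∃ c C : ℝ, 0 < c ∧ c ≤ 1 ∧ 0 < C ∧ ∀ {H : ℕ → X → ℝ} (_ : ∀ j, Measurable (H j)) {L : ℝ}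
      (_ : 0 < L) (_ : ∀ j z, |H j z| ≤ L) (n : ℕ) {ι : Type} [Fintype ι] {A : ι → Set X}
      (_ : ∀ i, MeasurableSet (A i)) (_ : Pairwise fun i j => Disjoint (A i) (A j)) (z : ι → X)
      {b t : ℝ} (_ : 0 < b) (_ : 0 < t)
      (_ : ∀ i, ∀ y ∈ A i, ∀ j, |H j y - H j (z i)| ≤ b) {r : ι → ℝ}
      (_ : ∀ i, 0 < r i ∧ r i ≤ 1 / 2) (L₀ : ℝ), ∃ G : Set Ω,
      P.real Gᶜ ≤ Real.exp (-L₀ + C * ∑ i, F.real (A i) *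
          (1 / (c * F.real (A i) * r i)) ^ lam * Real.log (1 / r i))
          + discretizationError α η b L (F.real (⋃ i, A i)ᶜ) t n ∧
      ∀ ω₀ ∈ G, Real.exp (-(C * (L₀ + ∑ i, F.real (A i) * Real.log (1 / r i))))
          - discretizationError α η b L (F.real (⋃ i, A i)ᶜ) t n ≤
        P.real {ω | ∀ j < n, |∫ᵛ y, H j y ∂•(Q ω) - ∫ᵛ y, H j y ∂•(Q ω₀)|
          ≤ 2 * (2 * t + L * ∑ i, r i)} := by
  obtain ⟨c, C₁, hc, hc1, hC₁, hcell⟩ := hQ.exists_cells_ge hα hη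
  obtain ⟨k, C₂, hk, hC₂, hlarge⟩ := hQ.exists_large_cells_le hα hη
  refine ⟨c, max (max C₁ C₂) (max (1 / lam) (C₁ / k)), hc, hc1, by positivity, ?_⟩
  set C := max (max C₁ C₂) (max (1 / lam) (C₁ / k)) with hC
  have hCC₁ : C₁ ≤ C := (le_max_left _ _).trans (le_max_left _ _)
  have hCC₂ : C₂ ≤ C := (le_max_right _ _).trans (le_max_left _ _)
  have hClam : 1 ≤ C * lam := by
    have : 1 / lam ≤ C := (le_max_left _ _).trans (le_max_right _ _)
    rwa [div_le_iff₀ hlam] at this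
  have hCk : C₁ ≤ C * k := by
    have : C₁ / k ≤ C := (le_max_right _ _).trans (le_max_right _ _)
    rwa [div_le_iff₀ hk] at this
  have hC0 : 0 < C := by positivity
  intro H hH L hL hHL n ι _ A hA hd z b t hb ht hosc r hr L₀
  set τ := F.real (⋃ i, A i)ᶜ with hτ
  -- `exp (w i)` is a small power of the inverse of the probability of hitting a prescribed value, so
  -- that `Z` has bounded exponential moments but still dominates a multiple of the total cost.
  set w : ι → ℝ := fun i => lam * Real.log (1 / (c * F.real (A i) * r i)) with hw
  set Z : Ω → ℝ := fun ω => ∑ i, if r i < |Q ω (A i)| then w i + k * |Q ω (A i)| else 0 with hZ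
  -- Cells of base mass zero almost surely receive no mass.
  set N₀ : Set Ω := ⋃ i ∈ (Finset.univ.filter fun i => F.real (A i) = 0 : Finset ι),
    {ω | r i < |Q ω (A i)|} with hN₀
  set Er : Set Ω := {ω | ∃ j < n, 2 * t < |∫ᵛ y, H j y ∂•(Q ω) - ∑ i, Q ω (A i) * H j (z i)|}
    with hEr
  have hlogr : ∀ i, 0 ≤ Real.log (1 / r i) := fun i => Real.log_nonneg (by
    rw [le_div_iff₀ (hr i).1]; linarith [(hr i).2])
  refine ⟨({ω | L₀ < Z ω} ∪ Er ∪ N₀)ᶜ, ?_, ?_⟩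
  · rw [compl_compl]
    have hZe := hlarge A r w L₀ hA hd hr
    have hEe := hQ.measureReal_discretization_le hα.le hη hH hL hHL n hA hd z hb ht hosc
    have hNe : P.real N₀ ≤ 0 := by
      refine (measureReal_biUnion_finset_le _ _).trans (Finset.sum_nonpos fun i hi => ?_)
      have hi0 : F.real (A i) = 0 := (Finset.mem_filter.1 hi).2
      have hlaw := hQ.law _ (hA i)
      have h1 := hlaw.measureReal_abs_gt_le (r := r i) (by rw [hi0]; simp) (hr i).1
      rw [hi0, mul_zero, mul_zero, zero_mul, measureReal_def,
        Measure.map_apply (hQ.measurable _ (hA i))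
          (measurableSet_lt measurable_const (by fun_prop))] at h1
      exact h1
    have hsum : C₂ * ∑ i, F.real (A i) * Real.exp (w i) * Real.log (1 / r i)
        ≤ C * ∑ i, F.real (A i) * (1 / (c * F.real (A i) * r i)) ^ lam * Real.log (1 / r i) := by
      have hle : ∀ i, F.real (A i) * Real.exp (w i) * Real.log (1 / r i)
          = F.real (A i) * (1 / (c * F.real (A i) * r i)) ^ lam * Real.log (1 / r i) := by
        intro i
        rcases (measureReal_nonneg (μ := F) (s := A i)).eq_or_lt with h0 | h0
        · rw [← h0]; simp
        · have := (hr i).1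
          rw [Real.rpow_def_of_pos (by positivity), hw]
          dsimp only
          rw [mul_comm lam]
      simp_rw [hle]
      refine mul_le_mul_of_nonneg_right hCC₂ (Finset.sum_nonneg fun i _ => ?_)
      have := hlogr i
      have := (hr i).1
      positivity
    calc _ ≤ P.real ({ω | L₀ < Z ω} ∪ Er) + P.real N₀ := measureReal_union_le _ _
      _ ≤ P.real {ω | L₀ < Z ω} + P.real Er + P.real N₀ := by
          gcongr
          exact measureReal_union_le _ _
      _ ≤ _ := by
          have := hZe.trans (Real.exp_le_exp.2 (add_le_add_right hsum (-L₀)))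
          linarith
  · intro ω₀ hω₀
    rw [Set.compl_union, Set.compl_union] at hω₀
    obtain ⟨⟨hZ₀, hE₀⟩, hN⟩ := hω₀
    have hZle : Z ω₀ ≤ L₀ := not_lt.1 hZ₀
    -- The masses below the threshold are replaced by zero, which costs nothing.
    set v : ι → ℝ := fun i => if r i < |Q ω₀ (A i)| then Q ω₀ (A i) else 0 with hv
    have hvpos : ∀ i, v i ≠ 0 → 0 < F.real (A i) := by
      intro i hi
      refine (measureReal_nonneg).lt_of_ne fun h0 => hN ?_
      refine Set.mem_biUnion (Finset.mem_coe.2 (Finset.mem_filter.2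
        ⟨Finset.mem_univ i, h0.symm⟩)) ?_
      by_contra hcon
      exact hi (if_neg hcon)
    have hcost : ∑ i, cellCost c C₁ (F.real (A i)) (r i) (v i) ≤ C * Z ω₀ := by
      rw [hZ, Finset.mul_sum]
      refine Finset.sum_le_sum fun i _ => ?_
      by_cases hi : r i < |Q ω₀ (A i)|
      · have hvi : v i = Q ω₀ (A i) := if_pos hi
        have hvi0 : v i ≠ 0 := by
          rw [hvi]
          intro h0
          rw [h0, abs_zero] at hi
          linarith [(hr i).1]
        have hF := hvpos i hvi0
        rw [if_pos hi, cellCost, if_neg hvi0, hvi, hw]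
        dsimp only
        have hl : 0 ≤ Real.log (1 / (c * F.real (A i) * r i)) := by
          have := (hr i).1
          apply Real.log_nonneg
          rw [le_div_iff₀ (by positivity), one_mul]
          have h1 : F.real (A i) ≤ 1 := measureReal_le_one
          calc c * F.real (A i) * r i ≤ 1 * 1 * 1 := by
                gcongr
                linarith [(hr i).2]
            _ = 1 := by norm_num
        nlinarith [mul_nonneg (sub_nonneg.2 hClam) hl,
          mul_nonneg (sub_nonneg.2 hCk) (abs_nonneg (Q ω₀ (A i)))]
      · have hvi : v i = 0 := if_neg hi
        rw [if_neg hi, cellCost, if_pos hvi, mul_zero]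
    have h1 := measureReal_small_ball_ge hQ hα hη hH hL hHL n hA hd z hb ht hosc
      (hcell A r v hA hd hr hvpos)
    have h2 : Real.exp (-(C * (L₀ + ∑ i, F.real (A i) * Real.log (1 / r i))))
        ≤ Real.exp (-(C₁ * ∑ i, F.real (A i) * Real.log (1 / r i)
          + ∑ i, cellCost c C₁ (F.real (A i)) (r i) (v i))) := by
      apply Real.exp_le_exp.2
      rw [neg_le_neg_iff]
      have h3 : 0 ≤ ∑ i, F.real (A i) * Real.log (1 / r i) :=
        Finset.sum_nonneg fun i _ => mul_nonneg measureReal_nonneg (hlogr i)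
      have h4 := mul_le_mul_of_nonneg_right hCC₁ h3
      have h5 := mul_le_mul_of_nonneg_left hZle hC0.le
      linarith
    refine (sub_le_sub_right h2 _).trans (h1.trans (measureReal_mono fun ω hω j hj => ?_))
    have h6 := hω j hj
    have h7 : |∫ᵛ y, H j y ∂•(Q ω₀) - ∑ i, Q ω₀ (A i) * H j (z i)| ≤ 2 * t := by
      by_contra hcon
      exact hE₀ ⟨j, hj, not_le.1 hcon⟩
    have h8 : |∑ i, Q ω₀ (A i) * H j (z i) - ∑ i, v i * H j (z i)| ≤ L * ∑ i, r i := by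
      refine abs_sum_mul_sub_le (H := fun i => H j (z i)) (fun i => hHL j (z i)) fun i => ?_
      by_cases hi : r i < |Q ω₀ (A i)|
      · have hvi : v i = Q ω₀ (A i) := if_pos hi
        rw [hvi, sub_self, abs_zero]; exact (hr i).1.le
      · have hvi : v i = 0 := if_neg hi
        rw [hvi, sub_zero]; exact not_lt.1 hi
    rw [abs_le] at *
    constructor <;> linarith [h6.1, h6.2, h7.1, h7.2, h8.1, h8.2]

end Discretization

/-! ### Kernels and cells of atoms -/

section Kernel

variable {d : ℕ}

lemma continuous_kernel (g : 𝓢(E d, ℝ)) (x : E d) :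
    Continuous fun z : Atom d => kernel g z.1 z.2.2 (x - z.2.1) := by
  unfold kernel
  have := g.continuous
  fun_prop

/-- The kernels are bounded, and Lipschitz in the atom with a constant growing linearly with the
frequency. -/
lemma exists_kernel_bounds (g : 𝓢(E d, ℝ)) : ∃ L : ℝ, 1 ≤ L ∧
    (∀ (x : E d) (z : Atom d), |kernel g z.1 z.2.2 (x - z.2.1)| ≤ L) ∧
    ∀ (x : E d) (z z' : Atom d),
      |kernel g z.1 z.2.2 (x - z.2.1) - kernel g z'.1 z'.2.2 (x - z'.2.1)|
        ≤ L * ((1 + ‖z'.1‖) * ‖z.2.1 - z'.2.1‖ + ‖z.1 - z'.1‖ + |z.2.2 - z'.2.2|) := by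
  obtain ⟨B₀, hB₀⟩ := g.decay 0 0
  obtain ⟨B₁, hB₁⟩ := g.decay 1 0
  obtain ⟨B₂, hB₂⟩ := g.decay 0 1
  have h0 : ∀ x, |g x| ≤ B₀ := fun x => by
    have := hB₀.2 x
    rwa [pow_zero, one_mul, norm_iteratedFDeriv_zero] at this
  have h1 : ∀ x, ‖x‖ * |g x| ≤ B₁ := fun x => by
    have := hB₁.2 x
    rwa [pow_one, norm_iteratedFDeriv_zero] at this
  have h2 : ∀ x y, |g x - g y| ≤ B₂ * ‖x - y‖ := fun x y => by
    have := Convex.norm_image_sub_le_of_norm_fderiv_le (𝕜 := ℝ) (f := g) (s := Set.univ) (C := B₂)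
      (x := y) (y := x)
      (fun z _ => g.differentiable.differentiableAt) (fun z _ => by
        have := hB₂.2 z
        rwa [pow_zero, one_mul, norm_iteratedFDeriv_one] at this) convex_univ trivial trivial
    exact this
  have hp0 : 0 ≤ B₀ := (abs_nonneg _).trans (h0 0)
  have hp1 : 0 ≤ B₁ := (by positivity : (0 : ℝ) ≤ ‖(0 : E d)‖ * |g 0|).trans (h1 0)
  set L := 1 + B₀ + B₁ + |B₂| with hL
  refine ⟨L, by have := abs_nonneg B₂; linarith, fun x z => ?_, fun x z z' => ?_⟩
  · unfold kernel
    rw [abs_mul]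
    calc _ ≤ B₀ * 1 := mul_le_mul (h0 _) (Real.abs_cos_le_one _) (abs_nonneg _) hp0
      _ ≤ L := by have := abs_nonneg B₂; linarith
  · unfold kernel
    set y := x - z.2.1 with hy
    set y' := x - z'.2.1 with hy'
    have hyy : y - y' = -(z.2.1 - z'.2.1) := by rw [hy, hy']; abel
    have hn : ‖y - y'‖ = ‖z.2.1 - z'.2.1‖ := by rw [hyy, norm_neg]
    have hcos : |Real.cos (inner ℝ z.1 y + z.2.2) - Real.cos (inner ℝ z'.1 y' + z'.2.2)|
        ≤ ‖z'.1‖ * ‖y - y'‖ + ‖z.1 - z'.1‖ * ‖y‖ + |z.2.2 - z'.2.2| := by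
      have := Real.lipschitzWith_cos.dist_le_mul (inner ℝ z.1 y + z.2.2) (inner ℝ z'.1 y' + z'.2.2)
      rw [Real.dist_eq, Real.dist_eq, NNReal.coe_one, one_mul] at this
      refine this.trans ?_
      have heq : inner ℝ z.1 y + z.2.2 - (inner ℝ z'.1 y' + z'.2.2)
          = inner ℝ z'.1 (y - y') + inner ℝ (z.1 - z'.1) y + (z.2.2 - z'.2.2) := by
        rw [inner_sub_right z'.1 y y', inner_sub_left z.1 z'.1 y]; ring
      rw [heq]
      refine (abs_add_le _ _).trans (add_le_add ((abs_add_le _ _).trans (add_le_add ?_ ?_)) le_rfl)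
      · exact abs_real_inner_le_norm _ _
      · exact abs_real_inner_le_norm _ _
    have hdec : g y * Real.cos (inner ℝ z.1 y + z.2.2) - g y' * Real.cos (inner ℝ z'.1 y' + z'.2.2)
        = (g y - g y') * Real.cos (inner ℝ z'.1 y' + z'.2.2) + g y * (Real.cos
          (inner ℝ z.1 y + z.2.2) - Real.cos (inner ℝ z'.1 y' + z'.2.2)) := by ring
    rw [hdec]
    refine (abs_add_le _ _).trans ?_
    rw [abs_mul, abs_mul]
    have e1 : |g y - g y'| * |Real.cos (inner ℝ z'.1 y' + z'.2.2)| ≤ |B₂| * ‖z.2.1 - z'.2.1‖ := by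
      calc _ ≤ |g y - g y'| * 1 := by gcongr; exact Real.abs_cos_le_one _
        _ ≤ B₂ * ‖y - y'‖ := by rw [mul_one]; exact h2 _ _
        _ ≤ |B₂| * ‖z.2.1 - z'.2.1‖ := by rw [hn]; gcongr; exact le_abs_self _
    have e2 : |g y| * |Real.cos (inner ℝ z.1 y + z.2.2) - Real.cos (inner ℝ z'.1 y' + z'.2.2)|
        ≤ B₀ * (‖z'.1‖ * ‖z.2.1 - z'.2.1‖) + B₁ * ‖z.1 - z'.1‖ + B₀ * |z.2.2 - z'.2.2| := by
      calc _ ≤ |g y| * (‖z'.1‖ * ‖y - y'‖ + ‖z.1 - z'.1‖ * ‖y‖ + |z.2.2 - z'.2.2|) := by gcongr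
        _ = |g y| * (‖z'.1‖ * ‖z.2.1 - z'.2.1‖) + (‖y‖ * |g y|) * ‖z.1 - z'.1‖
            + |g y| * |z.2.2 - z'.2.2| := by rw [hn]; ring
        _ ≤ _ := by
          gcongr
          · exact h0 y
          · exact h1 y
          · exact h0 y
    have n1 := norm_nonneg (z.2.1 - z'.2.1)
    have n2 := norm_nonneg (z.1 - z'.1)
    have n3 := abs_nonneg (z.2.2 - z'.2.2)
    have n4 := mul_nonneg (norm_nonneg z'.1) n1
    have n5 := abs_nonneg B₂
    rw [hL]
    nlinarith [mul_nonneg hp0 n1, mul_nonneg hp0 n2, mul_nonneg hp1 n1, mul_nonneg hp1 n3,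
      mul_nonneg hp1 n4, mul_nonneg n5 n2, mul_nonneg n5 n3, mul_nonneg n5 n4]

end Kernel

section AtomCells

variable {d : ℕ}

/-- The labels of the cells of the atom space: the integer part of the norm of the frequency and
the rounded coordinates of the atom. -/
abbrev Label (d : ℕ) : Type := ℕ × (Fin d → ℤ) × (Fin d → ℤ) × ℤ

/-- Rounding of an atom to a grid of mesh `1 / M k`, where `k` is the integer part of the norm of
the frequency. -/
def label (M : ℕ → ℕ) (z : Atom d) : Label d :=
  (⌊‖z.1‖⌋₊, fun i => ⌊(M ⌊‖z.1‖⌋₊ : ℝ) * z.1 i⌋, fun i => ⌊(M ⌊‖z.1‖⌋₊ : ℝ) * z.2.1 i⌋,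
    ⌊(M ⌊‖z.1‖⌋₊ : ℝ) * z.2.2⌋)

/-- The set of atoms charged by the base distribution. -/
def atomSupport (d : ℕ) (S : ℝ) : Set (Atom d) :=
  {z | z.2.1 ∈ cube d (2 * S) ∧ z.2.2 ∈ Set.Icc 0 (Real.pi / 2)}

/-- The atoms in the support with a given label. -/
def atomCell (S : ℝ) (M : ℕ → ℕ) (l : Label d) : Set (Atom d) :=
  {z | z ∈ atomSupport d S ∧ label M z = l}

lemma measurableSet_cube (d : ℕ) (r : ℝ) : MeasurableSet (cube d r) := by
  have : cube d r = ⋂ i, {x : E d | x i ∈ Set.Icc (-r) r} := by ext; simp [cube]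
  rw [this]
  exact MeasurableSet.iInter fun i => measurableSet_Icc.preimage (by fun_prop)

lemma measurableSet_atomSupport (d : ℕ) (S : ℝ) : MeasurableSet (atomSupport d S) :=
  ((measurableSet_cube d (2 * S)).preimage (by fun_prop : Measurable fun z : Atom d => z.2.1)).inter
    (measurableSet_Icc.preimage (by fun_prop : Measurable fun z : Atom d => z.2.2))

lemma measurable_label (M : ℕ → ℕ) : Measurable (label M : Atom d → Label d) := by
  have hk : Measurable fun z : Atom d => ⌊‖z.1‖⌋₊ :=
    Nat.measurable_floor.comp (by fun_prop : Measurable fun z : Atom d => ‖z.1‖)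
  have hM : Measurable fun z : Atom d => (M ⌊‖z.1‖⌋₊ : ℝ) :=
    (measurable_of_countable fun k : ℕ => (M k : ℝ)).comp hk
  refine hk.prodMk (Measurable.prodMk ?_ (Measurable.prodMk ?_ ?_))
  · exact measurable_pi_iff.2 fun i => Int.measurable_floor.comp
      (hM.mul (by fun_prop : Measurable fun z : Atom d => z.1 i))
  · exact measurable_pi_iff.2 fun i => Int.measurable_floor.comp
      (hM.mul (by fun_prop : Measurable fun z : Atom d => z.2.1 i))
  · exact Int.measurable_floor.comp (hM.mul (by fun_prop : Measurable fun z : Atom d => z.2.2))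

lemma measurableSet_atomCell (S : ℝ) (M : ℕ → ℕ) (l : Label d) : MeasurableSet (atomCell S M l) :=
  (measurableSet_atomSupport d S).inter (measurable_label M (measurableSet_singleton l))

lemma disjoint_atomCell (S : ℝ) (M : ℕ → ℕ) {l l' : Label d} (h : l ≠ l') :
    Disjoint (atomCell S M l) (atomCell S M l') :=
  Set.disjoint_left.2 fun _ h1 h2 => h (h1.2.symm.trans h2.2)

/-- A bound for the rounded coordinates of the atoms of level `k`. -/
def labelBound (S : ℝ) (M : ℕ → ℕ) (k : ℕ) : ℕ := M k * (k + 2 + ⌈2 * S⌉₊) + 1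

/-- A finite set containing the labels of all atoms in the support with level `k`. -/
def labelsAt (d : ℕ) (S : ℝ) (M : ℕ → ℕ) (k : ℕ) : Finset (Label d) :=
  {k} ×ˢ (Fintype.piFinset fun _ => Finset.Icc (-(labelBound S M k : ℤ)) (labelBound S M k)) ×ˢ
    (Fintype.piFinset fun _ => Finset.Icc (-(labelBound S M k : ℤ)) (labelBound S M k)) ×ˢ
    Finset.Icc (-(labelBound S M k : ℤ)) (labelBound S M k)

/-- The labels of level less than `N`. -/
def labels (d : ℕ) (S : ℝ) (M : ℕ → ℕ) (N : ℕ) : Finset (Label d) :=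
  (Finset.range N).biUnion (labelsAt d S M)

lemma card_labelsAt (d : ℕ) (S : ℝ) (M : ℕ → ℕ) (k : ℕ) :
    (labelsAt d S M k).card = (2 * labelBound S M k + 1) ^ (2 * d + 1) := by
  have h : (Finset.Icc (-(labelBound S M k : ℤ)) (labelBound S M k)).card
      = 2 * labelBound S M k + 1 := by
    rw [Int.card_Icc]; omega
  simp only [labelsAt, Finset.card_product, Finset.card_singleton, Fintype.card_piFinset, h,
    Finset.prod_const, Finset.card_univ, Fintype.card_fin]
  ring

lemma fst_eq_of_mem_labelsAt {S : ℝ} {M : ℕ → ℕ} {k : ℕ} {l : Label d}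
    (h : l ∈ labelsAt d S M k) : l.1 = k := by
  simpa using (Finset.mem_product.1 h).1

lemma sum_labels (S : ℝ) (M : ℕ → ℕ) (N : ℕ) (φ : Label d → ℝ) :
    ∑ l ∈ labels d S M N, φ l = ∑ k ∈ Finset.range N, ∑ l ∈ labelsAt d S M k, φ l := by
  refine Finset.sum_biUnion fun k _ k' _ hkk' => Finset.disjoint_left.2 fun l h1 h2 => ?_
  exact hkk' ((fst_eq_of_mem_labelsAt h1).symm.trans (fst_eq_of_mem_labelsAt h2))

lemma floor_mem_Icc_labelBound {S x : ℝ} {M : ℕ → ℕ} {k : ℕ} (hx : |x| ≤ k + 2 + ⌈2 * S⌉₊) :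
    ⌊(M k : ℝ) * x⌋ ∈ Finset.Icc (-(labelBound S M k : ℤ)) (labelBound S M k) := by
  have hM : (0 : ℝ) ≤ M k := Nat.cast_nonneg _
  have h1 : |(M k : ℝ) * x| ≤ M k * (k + 2 + ⌈2 * S⌉₊) := by
    rw [abs_mul, abs_of_nonneg hM]; gcongr
  have h2 := abs_le.1 h1
  have h3 := Int.lt_floor_add_one ((M k : ℝ) * x)
  have h4 := Int.floor_le ((M k : ℝ) * x)
  rw [Finset.mem_Icc, labelBound]
  constructor
  · have : (-((M k * (k + 2 + ⌈2 * S⌉₊) + 1 : ℕ) : ℤ) : ℝ) ≤ ⌊(M k : ℝ) * x⌋ := by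
      push_cast; linarith [h2.1]
    exact_mod_cast this
  · have : ((⌊(M k : ℝ) * x⌋ : ℤ) : ℝ) ≤ ((M k * (k + 2 + ⌈2 * S⌉₊) + 1 : ℕ) : ℤ) := by
      push_cast; linarith [h2.2]
    exact_mod_cast this

lemma abs_apply_le_norm (x : E d) (i : Fin d) : |x i| ≤ ‖x‖ := by
  simpa using PiLp.norm_apply_le x i

lemma label_mem_labels {S : ℝ} {M : ℕ → ℕ} {N : ℕ} {z : Atom d} (hz : z ∈ atomSupport d S)
    (hN : ‖z.1‖ < N) : label M z ∈ labels d S M N := by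
  have hk : ⌊‖z.1‖⌋₊ < N := (Nat.floor_lt (norm_nonneg _)).2 hN
  have hk1 : ‖z.1‖ < ⌊‖z.1‖⌋₊ + 1 := Nat.lt_floor_add_one _
  have hk0 : (0 : ℝ) ≤ ⌊‖z.1‖⌋₊ := Nat.cast_nonneg _
  have hS0 : (0 : ℝ) ≤ ⌈2 * S⌉₊ := Nat.cast_nonneg _
  refine Finset.mem_biUnion.2 ⟨_, Finset.mem_range.2 hk, ?_⟩
  refine Finset.mem_product.2 ⟨Finset.mem_singleton_self _, Finset.mem_product.2 ⟨?_,
    Finset.mem_product.2 ⟨?_, ?_⟩⟩⟩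
  · refine Fintype.mem_piFinset.2 fun i => floor_mem_Icc_labelBound ?_
    have := abs_apply_le_norm z.1 i
    linarith
  · refine Fintype.mem_piFinset.2 fun i => floor_mem_Icc_labelBound ?_
    have h1 := hz.1 i
    have h2 := Nat.le_ceil (2 * S)
    rw [abs_le]
    constructor <;> linarith [h1.1, h1.2]
  · refine floor_mem_Icc_labelBound ?_
    have h1 := hz.2
    have h2 := Real.pi_le_four
    rw [abs_le]
    constructor <;> linarith [h1.1, h1.2]

lemma abs_sub_le_of_floor_eq {m x y : ℝ} (hm : 0 < m) (h : ⌊m * x⌋ = ⌊m * y⌋) :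
    |x - y| ≤ 1 / m := by
  have := Int.abs_sub_lt_one_of_floor_eq_floor h
  rw [← mul_sub, abs_mul, abs_of_pos hm] at this
  rw [le_div_iff₀ hm, mul_comm]
  exact this.le

lemma norm_sub_le_of_coord {x y : E d} {e : ℝ} (he : 0 ≤ e) (h : ∀ i, |x i - y i| ≤ e) :
    ‖x - y‖ ≤ d * e := by
  rw [EuclideanSpace.norm_eq]
  apply Real.sqrt_le_iff.2 ⟨by positivity, ?_⟩
  calc ∑ i, ‖(x - y) i‖ ^ 2 ≤ ∑ _i : Fin d, e ^ 2 := by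
        refine Finset.sum_le_sum fun i _ => ?_
        rw [Real.norm_eq_abs]
        exact pow_le_pow_left₀ (abs_nonneg _) (h i) 2
    _ = d * e ^ 2 := by simp
    _ ≤ (d * e) ^ 2 := by
      rw [mul_pow]
      gcongr
      have : d ≤ d ^ 2 := Nat.le_self_pow two_ne_zero d
      exact_mod_cast this

/-- Oscillation of the kernels on a cell. -/
lemma kernel_sub_le_of_mem_atomCell {g : 𝓢(E d, ℝ)} {L : ℝ} (hL0 : 0 ≤ L)
    (hL : ∀ (x : E d) (z z' : Atom d),
      |kernel g z.1 z.2.2 (x - z.2.1) - kernel g z'.1 z'.2.2 (x - z'.2.1)|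
        ≤ L * ((1 + ‖z'.1‖) * ‖z.2.1 - z'.2.1‖ + ‖z.1 - z'.1‖ + |z.2.2 - z'.2.2|))
    {S : ℝ} {M : ℕ → ℕ} {l : Label d} (hM : 0 < M l.1) {z z' : Atom d} (hz : z ∈ atomCell S M l)
    (hz' : z' ∈ atomCell S M l) (x : E d) :
    |kernel g z.1 z.2.2 (x - z.2.1) - kernel g z'.1 z'.2.2 (x - z'.2.1)|
      ≤ L * ((l.1 + 4) * (d + 1)) / M l.1 := by
  have hlz := hz.2
  have hlz' := hz'.2
  have hk : ⌊‖z.1‖⌋₊ = l.1 := congrArg (fun l : Label d => l.1) hlz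
  have hk' : ⌊‖z'.1‖⌋₊ = l.1 := congrArg (fun l : Label d => l.1) hlz'
  have heq := hlz.trans hlz'.symm
  simp only [label, hk, hk', Prod.mk.injEq, true_and] at heq
  obtain ⟨h1, h2, h3⟩ := heq
  have hm : (0 : ℝ) < M l.1 := by exact_mod_cast hM
  have e1 := norm_sub_le_of_coord (x := z.1) (y := z'.1) (by positivity)
    fun i => abs_sub_le_of_floor_eq hm (congrFun h1 i)
  have e2 := norm_sub_le_of_coord (x := z.2.1) (y := z'.2.1) (by positivity)
    fun i => abs_sub_le_of_floor_eq hm (congrFun h2 i)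
  have e3 := abs_sub_le_of_floor_eq hm h3
  have e4 : ‖z'.1‖ ≤ l.1 + 1 := by
    have := (Nat.lt_floor_add_one ‖z'.1‖).le
    rwa [hk'] at this
  refine (hL x z z').trans ?_
  calc _ ≤ L * ((1 + (l.1 + 1)) * (d * (1 / M l.1)) + d * (1 / M l.1) + 1 / M l.1) := by gcongr
    _ = L * ((l.1 + 3) * d + 1) / M l.1 := by field_simp; ring
    _ ≤ _ := by
      gcongr
      have : (0 : ℝ) ≤ l.1 := Nat.cast_nonneg _
      have : (0 : ℝ) ≤ d := Nat.cast_nonneg _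
      nlinarith

end AtomCells

/-! ### Sums over cells -/

section CellSums

variable {d : ℕ}

lemma FrequencyAssumption.integrable_norm {Fξ : Measure (E d)} [IsProbabilityMeasure Fξ]
    (h : FrequencyAssumption Fξ) (hd : 0 < d) : Integrable (fun ξ => ‖ξ‖) Fξ := by
  obtain ⟨κ, b, hκ, hb, htail⟩ := h.tail
  have hd1 : (1 : ℝ) ≤ d := by exact_mod_cast hd
  refine ⟨by fun_prop, ?_⟩
  rw [hasFiniteIntegral_iff_ofReal (ae_of_all _ fun ξ => norm_nonneg ξ),
    lintegral_eq_lintegral_meas_le Fξ (ae_of_all _ fun ξ => norm_nonneg ξ) (by fun_prop)]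
  have hint : IntegrableOn (fun t : ℝ => b * (t + 1) ^ (-2 * (κ + 1))) (Set.Ioi 0) :=
    (integrableOn_add_rpow_Ioi_of_lt (by linarith) (by norm_num)).const_mul b
  refine lt_of_le_of_lt (setLIntegral_mono' measurableSet_Ioi fun t ht => ?_)
    (hint.lintegral_lt_top)
  rw [← ofReal_measureReal, add_comm t]
  exact ENNReal.ofReal_le_ofReal (htail t ht)

variable {S : ℝ} {Fξ Fμ : Measure (E d)} {Fφ : Measure ℝ}
  [IsProbabilityMeasure Fξ] [IsProbabilityMeasure Fμ] [IsProbabilityMeasure Fφ]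

lemma measure_atomSupport_compl (hFμ : LocationAssumption S Fμ) (hFφ : PhaseAssumption Fφ) :
    (Fξ.prod (Fμ.prod Fφ)) (atomSupport d S)ᶜ = 0 := by
  have h : (atomSupport d S)ᶜ ⊆ (Set.univ ×ˢ ((cube d (2 * S))ᶜ ×ˢ Set.univ)) ∪
      (Set.univ ×ˢ (Set.univ ×ˢ (Set.Icc 0 (Real.pi / 2))ᶜ)) := by
    intro z hz
    by_cases h1 : z.2.1 ∈ cube d (2 * S)
    · right
      exact ⟨trivial, trivial, fun h2 => hz ⟨h1, h2⟩⟩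
    · left
      exact ⟨trivial, h1, trivial⟩
  refine measure_mono_null h (measure_union_null ?_ ?_)
  · rw [Measure.prod_prod, Measure.prod_prod, hFμ.support]; simp
  · rw [Measure.prod_prod, Measure.prod_prod, hFφ.support]; simp

/-- The base mass outside finitely many cells can be made arbitrarily small. -/
lemma exists_measureReal_compl_atomCells_le (hFμ : LocationAssumption S Fμ)
    (hFφ : PhaseAssumption Fφ) (M : ℕ → ℕ) {τ : ℝ} (hτ : 0 < τ) :
    ∃ N₀ : ℕ, ∀ N ≥ N₀, (Fξ.prod (Fμ.prod Fφ)).real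
      (⋃ l : labels d S M N, atomCell S M (l : Label d))ᶜ ≤ τ := by
  have hanti : Antitone fun N : ℕ => {ξ : E d | (N : ℝ) ≤ ‖ξ‖} := by
    intro N N' h ξ hξ
    have h1 : (N' : ℝ) ≤ ‖ξ‖ := hξ
    have h2 : (N : ℝ) ≤ N' := by exact_mod_cast h
    exact h2.trans h1
  have hlim := tendsto_measure_iInter_atTop (μ := Fξ) (fun N : ℕ => (measurableSet_le
    (measurable_const (a := (N : ℝ))) (measurable_norm (α := E d))).nullMeasurableSet) hanti
    ⟨0, measure_ne_top _ _⟩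
  have hempty : (⋂ N : ℕ, {ξ : E d | (N : ℝ) ≤ ‖ξ‖}) = ∅ := by
    refine Set.eq_empty_of_forall_notMem fun ξ hξ => ?_
    obtain ⟨N, hN⟩ := exists_nat_gt ‖ξ‖
    exact absurd (Set.mem_iInter.1 hξ N) (not_le.2 hN)
  rw [hempty, measure_empty] at hlim
  obtain ⟨N₀, hN₀⟩ := eventually_atTop.1 (hlim.eventually (gt_mem_nhds
    (show (0 : ℝ≥0∞) < ENNReal.ofReal τ by simpa using hτ)))
  refine ⟨N₀, fun N hNN => ?_⟩
  have hN := hN₀ N hNN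
  have hsub : (⋃ l : labels d S M N, atomCell S M (l : Label d))ᶜ
      ⊆ (atomSupport d S)ᶜ ∪ ({ξ : E d | (N : ℝ) ≤ ‖ξ‖} ×ˢ Set.univ) := by
    intro z hz
    by_contra hcon
    rw [Set.mem_union, not_or, Set.notMem_compl_iff] at hcon
    have h1 : ‖z.1‖ < N := by
      by_contra h
      exact hcon.2 ⟨not_lt.1 h, trivial⟩
    exact hz (Set.mem_iUnion.2 ⟨⟨_, label_mem_labels hcon.1 h1⟩, hcon.1, rfl⟩)
  refine ENNReal.toReal_le_of_le_ofReal hτ.le ?_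
  calc _ ≤ _ := measure_mono hsub
    _ ≤ _ := measure_union_le _ _
    _ ≤ _ := by
      rw [measure_atomSupport_compl hFμ hFφ, zero_add, Measure.prod_prod, measure_univ, mul_one]
      exact hN.le

/-- The first moment of the frequency law bounds the mean level of the cells, however fine they are. -/
lemma sum_measureReal_atomCell_mul_le (hint : Integrable (fun ξ => ‖ξ‖) Fξ) (M : ℕ → ℕ) (N : ℕ) :
    ∑ l ∈ labels d S M N, (Fξ.prod (Fμ.prod Fφ)).real (atomCell S M l) * (l.1 + 1)
      ≤ 1 + ∫ ξ, ‖ξ‖ ∂Fξ := by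
  set F := Fξ.prod (Fμ.prod Fφ) with hF
  have hi : Integrable (fun z : Atom d => 1 + ‖z.1‖) F :=
    (integrable_const 1).add (hint.comp_fst _)
  have h1 : ∀ l ∈ labels d S M N, F.real (atomCell S M l) * (l.1 + 1)
      ≤ ∫ z in atomCell S M l, (1 + ‖z.1‖) ∂F := by
    intro l _
    rw [← smul_eq_mul, ← setIntegral_const]
    refine setIntegral_mono_on (integrable_const _).integrableOn hi.integrableOn
      (measurableSet_atomCell S M l) fun z hz => ?_
    have hk : ⌊‖z.1‖⌋₊ = l.1 := congrArg (fun l : Label d => l.1) hz.2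
    have := Nat.floor_le (norm_nonneg z.1)
    rw [hk] at this
    linarith
  calc _ ≤ _ := Finset.sum_le_sum h1
    _ = ∫ z in ⋃ l ∈ labels d S M N, atomCell S M l, (1 + ‖z.1‖) ∂F := by
        rw [integral_biUnion_finset _ (fun l _ => measurableSet_atomCell S M l)
          (fun l _ l' _ h => disjoint_atomCell S M h) (fun l _ => hi.integrableOn)]
    _ ≤ ∫ z, (1 + ‖z.1‖) ∂F :=
        setIntegral_le_integral hi (ae_of_all _ fun z => by positivity)
    _ = 1 + ∫ ξ, ‖ξ‖ ∂Fξ := by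
        rw [integral_add (integrable_const 1) (hint.comp_fst _)]
        congr 1
        · simp
        · rw [integral_fun_fst (fun ξ : E d => ‖ξ‖)]; simp

/-- The mesh at level `k` is `1 / (n (k + 1)) ^ K`. -/
def meshInv (n K k : ℕ) : ℕ := (n * (k + 1)) ^ K

lemma meshInv_pos {n : ℕ} (hn : 0 < n) (K k : ℕ) : 0 < meshInv n K k := by
  unfold meshInv; positivity

lemma card_labelsAt_le (d : ℕ) (S : ℝ) : ∃ A : ℕ, 0 < A ∧ ∀ n K k : ℕ, 0 < n →
    (labelsAt d S (meshInv n K) k).card ≤ A * (n * (k + 1)) ^ ((K + 1) * (2 * d + 1)) := by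
  refine ⟨(2 * ⌈2 * S⌉₊ + 7) ^ (2 * d + 1), by positivity, fun n K k hn => ?_⟩
  rw [card_labelsAt, pow_mul, ← mul_pow]
  refine Nat.pow_le_pow_left ?_ _
  unfold labelBound meshInv
  have h1 : 1 ≤ n * (k + 1) := by nlinarith
  have h2 : 1 ≤ (n * (k + 1)) ^ K := Nat.one_le_pow _ _ h1
  have h3 : k + 1 ≤ n * (k + 1) := by nlinarith
  rw [pow_succ]
  set q := (n * (k + 1)) ^ K
  set p := n * (k + 1)
  set A := ⌈2 * S⌉₊
  have h4 : k + 2 + A ≤ p * (A + 2) := by nlinarith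
  have h5 : q * (k + 2 + A) ≤ q * (p * (A + 2)) := Nat.mul_le_mul_left _ h4
  have h6 : 1 ≤ q * p := by nlinarith
  nlinarith

/-- Summability of the cell radii. -/
lemma exists_sum_labels_inv_pow_le (d : ℕ) (S : ℝ) : ∃ C : ℝ, 0 < C ∧ ∀ n K J B N : ℕ, 0 < n →
    (K + 1) * (2 * d + 1) + J + 2 ≤ B →
    ∑ l ∈ labels d S (meshInv n K) N, (((n : ℝ) * (l.1 + 1)) ^ B)⁻¹ ≤ C * ((n : ℝ) ^ J)⁻¹ := by
  obtain ⟨A, hA, hcard⟩ := card_labelsAt_le d S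
  have hsum : Summable fun k : ℕ => (((k : ℝ) + 1) ^ 2)⁻¹ := by
    have := (summable_nat_add_iff 1).2 (Real.summable_nat_pow_inv.2 (one_lt_two : 1 < 2))
    simpa using this
  have hpos : 0 < ∑' k : ℕ, (((k : ℝ) + 1) ^ 2)⁻¹ :=
    hsum.tsum_pos (fun k => by positivity) 0 (by norm_num)
  refine ⟨A * ∑' k : ℕ, (((k : ℝ) + 1) ^ 2)⁻¹, by positivity, fun n K J B N hn hB => ?_⟩
  rw [sum_labels]
  have hk : ∀ k ∈ Finset.range N, ∑ l ∈ labelsAt d S (meshInv n K) k,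
      (((n : ℝ) * (l.1 + 1)) ^ B)⁻¹ ≤ A * ((n : ℝ) ^ J)⁻¹ * (((k : ℝ) + 1) ^ 2)⁻¹ := by
    intro k _
    have hn1 : (1 : ℝ) ≤ n := by exact_mod_cast hn
    have hq : (1 : ℝ) ≤ (n : ℝ) * (k + 1) := by
      have : (0 : ℝ) ≤ k := Nat.cast_nonneg k
      nlinarith
    have h1 : ∑ l ∈ labelsAt d S (meshInv n K) k, (((n : ℝ) * (l.1 + 1)) ^ B)⁻¹
        = (labelsAt d S (meshInv n K) k).card * (((n : ℝ) * (k + 1)) ^ B)⁻¹ := by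
      rw [← nsmul_eq_mul, ← Finset.sum_const]
      exact Finset.sum_congr rfl fun l hl => by rw [fst_eq_of_mem_labelsAt hl]
    have h2 : ((labelsAt d S (meshInv n K) k).card : ℝ)
        ≤ A * ((n : ℝ) * (k + 1)) ^ ((K + 1) * (2 * d + 1)) := by
      exact_mod_cast hcard n K k hn
    rw [h1]
    calc _ ≤ A * ((n : ℝ) * (k + 1)) ^ ((K + 1) * (2 * d + 1)) * (((n : ℝ) * (k + 1)) ^ B)⁻¹ := by
          gcongr
      _ ≤ A * ((n : ℝ) * (k + 1)) ^ ((K + 1) * (2 * d + 1)) *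
          (((n : ℝ) * (k + 1)) ^ ((K + 1) * (2 * d + 1) + J + 2))⁻¹ := by
          gcongr
      _ = A * ((((n : ℝ) * (k + 1)) ^ J)⁻¹ * (((n : ℝ) * (k + 1)) ^ 2)⁻¹) := by
          rw [pow_add, pow_add]
          field_simp
      _ ≤ A * (((n : ℝ) ^ J)⁻¹ * (((k : ℝ) + 1) ^ 2)⁻¹) := by
          have hk0 : (0 : ℝ) ≤ k := Nat.cast_nonneg k
          have hn0 : (0 : ℝ) < n := by linarith
          gcongr
          · nlinarith
          · nlinarith
      _ = _ := by ring
  calc _ ≤ _ := Finset.sum_le_sum hk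
    _ = A * ((n : ℝ) ^ J)⁻¹ * ∑ k ∈ Finset.range N, (((k : ℝ) + 1) ^ 2)⁻¹ := by
        rw [Finset.mul_sum]
    _ ≤ A * ((n : ℝ) ^ J)⁻¹ * ∑' k : ℕ, (((k : ℝ) + 1) ^ 2)⁻¹ := by
        gcongr
        exact hsum.sum_le_tsum _ fun k _ => by positivity
    _ = _ := by ring

end CellSums

/-! ### Radii of the cells -/

section CellRadii

variable {d : ℕ}

lemma exp_sub_one_le_of_le_log {α ε τ τ' : ℝ} (hα : 0 < α) (hε : 0 < ε)
    (hτ : τ = 2 * Real.log (1 + ε) / α) (h : τ' ≤ τ) : Real.exp (α * τ' / 2) - 1 ≤ ε := by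
  have h1 : α * τ' / 2 ≤ Real.log (1 + ε) := by
    calc α * τ' / 2 ≤ α * τ / 2 := by gcongr
      _ = Real.log (1 + ε) := by rw [hτ]; field_simp
  have h2 := Real.exp_le_exp.2 h1
  rw [Real.exp_log (by linarith)] at h2
  linarith

/-- Discretization at a polynomially fine scale fails with a probability that is negligible
compared to `exp (-C n)` for every `C`. -/
lemma eventually_discretizationError_le {α η b L : ℝ} (hα : 0 < α) (hη : 0 < η) (hb : 0 < b)
    (hL : 0 < L) (J : ℕ) : ∀ᶠ n : ℕ in atTop, ∃ τ : ℝ, 0 < τ ∧ ∀ τ' ≤ τ,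
      discretizationError α η (b / (n : ℝ) ^ (J + 5)) L τ' (1 / (n : ℝ) ^ J) n
        ≤ Real.exp (-(n : ℝ) ^ 2) := by
  set A := 4 * Real.exp (α / 2) with hA
  set c := η / (4 * b) with hc
  have hc0 : 0 < c := by positivity
  have hA0 : 0 < A := by positivity
  obtain ⟨n₀, hn₀⟩ := exists_nat_ge ((2 + A) / c)
  filter_upwards [eventually_ge_atTop n₀, eventually_ge_atTop 1] with n hn hn1
  have hnr : (1 : ℝ) ≤ n := by exact_mod_cast hn1
  have hcn : 2 + A ≤ c * n := by
    have : (n₀ : ℝ) ≤ n := by exact_mod_cast hn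
    rw [div_le_iff₀ hc0] at hn₀
    nlinarith
  set y := η * (1 / (n : ℝ) ^ J) / (4 * L) with hy
  have hy0 : 0 < y := by positivity
  set ε := Real.exp (-(n : ℝ) ^ 2) / 2 * y ^ 2 / (4 * n) with hε
  have hε0 : 0 < ε := by positivity
  refine ⟨2 * Real.log (1 + ε) / α, ?_, fun τ' hτ' => ?_⟩
  · have := Real.log_pos (by linarith : 1 < 1 + ε)
    positivity
  have h1 := exp_sub_one_le_of_le_log hα hε0 rfl hτ'
  have h2 : (n : ℝ) * (4 * (Real.exp (α * τ' / 2) - 1) / y ^ 2) ≤ Real.exp (-(n : ℝ) ^ 2) / 2 := by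
    calc _ ≤ (n : ℝ) * (4 * ε / y ^ 2) := by gcongr
      _ = Real.exp (-(n : ℝ) ^ 2) / 2 := by rw [hε]; field_simp
  have h3 : (n : ℝ) * (2 * Real.exp (α / 2) *
      Real.exp (-(η * (1 / (n : ℝ) ^ J) / (4 * (b / (n : ℝ) ^ (J + 5))))))
      ≤ Real.exp (-(n : ℝ) ^ 2) / 2 := by
    have h4 : η * (1 / (n : ℝ) ^ J) / (4 * (b / (n : ℝ) ^ (J + 5))) = c * n * (n : ℝ) ^ 4 := by
      rw [hc, pow_add]; field_simp
    have h5 : (n : ℝ) + A + n ^ 2 ≤ c * n * (n : ℝ) ^ 4 := by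
      have e1 : (n : ℝ) ≤ (n : ℝ) ^ 4 := le_self_pow₀ hnr (by norm_num)
      have e2 : (n : ℝ) ^ 2 ≤ (n : ℝ) ^ 4 := pow_le_pow_right₀ hnr (by norm_num)
      have e3 : (1 : ℝ) ≤ (n : ℝ) ^ 4 := one_le_pow₀ hnr
      calc (n : ℝ) + A + n ^ 2 ≤ (2 + A) * (n : ℝ) ^ 4 := by nlinarith
        _ ≤ _ := by gcongr
    have h6 : (n : ℝ) * A ≤ Real.exp (n + A) := by
      rw [Real.exp_add]
      have := Real.add_one_le_exp (n : ℝ)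
      have := Real.add_one_le_exp A
      gcongr <;> linarith
    have h7 : Real.exp (-(c * n * (n : ℝ) ^ 4)) ≤ Real.exp (-(n + A)) * Real.exp (-(n : ℝ) ^ 2) := by
      rw [← Real.exp_add]
      apply Real.exp_le_exp.2
      linarith
    rw [h4]
    calc (n : ℝ) * (2 * Real.exp (α / 2) * Real.exp (-(c * n * (n : ℝ) ^ 4)))
        = (n : ℝ) * A / 2 * Real.exp (-(c * n * (n : ℝ) ^ 4)) := by rw [hA]; ring
      _ ≤ Real.exp (n + A) / 2 * (Real.exp (-(n + A)) * Real.exp (-(n : ℝ) ^ 2)) := by gcongr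
      _ = (Real.exp (n + A) * Real.exp (-(n + A))) * (Real.exp (-(n : ℝ) ^ 2) / 2) := by ring
      _ = _ := by rw [← Real.exp_add, add_neg_cancel, Real.exp_zero, one_mul]
  rw [discretizationError, mul_add]
  linarith

/-- The radius attached to a label in the discretization of the random measure. -/
def cellRadius (n B : ℕ) (l : Label d) : ℝ := (((n : ℝ) * (l.1 + 1)) ^ B)⁻¹

lemma one_le_scale {n : ℕ} (hn : 1 ≤ n) (l : Label d) : (n : ℝ) ≤ (n : ℝ) * (l.1 + 1) := by
  have : (1 : ℝ) ≤ n := by exact_mod_cast hn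
  have : (0 : ℝ) ≤ l.1 := Nat.cast_nonneg _
  nlinarith

lemma cellRadius_mem {n B : ℕ} (hn : 2 ≤ n) (hB : 1 ≤ B) (l : Label d) :
    0 < cellRadius n B l ∧ cellRadius n B l ≤ 1 / 2 := by
  have h2 : (2 : ℝ) ≤ n := by exact_mod_cast hn
  have h1 := one_le_scale (by omega : 1 ≤ n) l
  have h3 : (2 : ℝ) ≤ ((n : ℝ) * (l.1 + 1)) ^ B :=
    (h2.trans h1).trans (le_self_pow₀ (by linarith) (by omega))
  unfold cellRadius
  refine ⟨by positivity, ?_⟩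
  rw [one_div]
  exact inv_anti₀ two_pos h3

lemma log_one_div_cellRadius (n B : ℕ) (l : Label d) :
    Real.log (1 / cellRadius n B l) = B * Real.log ((n : ℝ) * (l.1 + 1)) := by
  rw [cellRadius, one_div, inv_inv, Real.log_pow]

lemma scale_rpow_le {n : ℕ} {μ : ℝ} (hμ1 : μ ≤ 1) (l : Label d) :
    ((n : ℝ) * (l.1 + 1)) ^ μ ≤ (n : ℝ) ^ μ * (l.1 + 1) := by
  rw [Real.mul_rpow (by positivity) (by positivity)]
  gcongr
  have : (1 : ℝ) ≤ (l.1 : ℝ) + 1 := by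
    have : (0 : ℝ) ≤ l.1 := Nat.cast_nonneg _
    linarith
  calc ((l.1 : ℝ) + 1) ^ μ ≤ ((l.1 : ℝ) + 1) ^ (1 : ℝ) := Real.rpow_le_rpow_of_exponent_le this hμ1
    _ = _ := Real.rpow_one _

variable {S : ℝ} {Fξ Fμ : Measure (E d)} {Fφ : Measure ℝ}
  [IsProbabilityMeasure Fξ] [IsProbabilityMeasure Fμ] [IsProbabilityMeasure Fφ]

/-- Total cost of keeping the masses of all cells below their radii: at most a small power of `n`,
because the cost of each cell is proportional to its base mass. -/
lemma sum_measureReal_mul_log_cellRadius_le (hint : Integrable (fun ξ => ‖ξ‖) Fξ) (M : ℕ → ℕ)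
    (n B N : ℕ) {μ : ℝ} (hμ : 0 < μ) (hμ1 : μ ≤ 1) :
    ∑ l ∈ labels d S M N, (Fξ.prod (Fμ.prod Fφ)).real (atomCell S M l) *
        Real.log (1 / cellRadius n B l) ≤ B / μ * (1 + ∫ ξ, ‖ξ‖ ∂Fξ) * (n : ℝ) ^ μ := by
  calc _ ≤ ∑ l ∈ labels d S M N, B / μ * (n : ℝ) ^ μ *
        ((Fξ.prod (Fμ.prod Fφ)).real (atomCell S M l) * (l.1 + 1)) := by
        refine Finset.sum_le_sum fun l _ => ?_
        rw [log_one_div_cellRadius]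
        have h1 : Real.log ((n : ℝ) * (l.1 + 1)) ≤ (n : ℝ) ^ μ * (l.1 + 1) / μ :=
          (Real.log_le_rpow_div (by positivity) hμ).trans (by gcongr; exact scale_rpow_le hμ1 l)
        calc _ ≤ (Fξ.prod (Fμ.prod Fφ)).real (atomCell S M l) *
              (B * ((n : ℝ) ^ μ * (l.1 + 1) / μ)) := by gcongr
          _ = _ := by ring
    _ ≤ B / μ * (n : ℝ) ^ μ * (1 + ∫ ξ, ‖ξ‖ ∂Fξ) := by
        rw [← Finset.mul_sum]
        gcongr
        exact sum_measureReal_atomCell_mul_le hint M N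
    _ = _ := by ring

/-- The sum that governs the exponential moment of the cost of the large cells: for an exponent that
is small with respect to `B`, it is at most a small power of `n`. -/
lemma exists_sum_rpow_cellRadius_le (hint : Integrable (fun ξ => ‖ξ‖) Fξ) {μ c : ℝ} (hμ : 0 < μ)
    (hμ1 : μ ≤ 1) (hc : 0 < c) {K B : ℕ} (hB : (K + 1) * (2 * d + 1) + 2 ≤ B) :
    ∃ C : ℝ, 0 < C ∧ ∀ n N : ℕ, 1 ≤ n →
      ∑ l ∈ labels d S (meshInv n K) N, (Fξ.prod (Fμ.prod Fφ)).real (atomCell S (meshInv n K) l) *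
        (1 / (c * (Fξ.prod (Fμ.prod Fφ)).real (atomCell S (meshInv n K) l) * cellRadius n B l))
          ^ (μ / (2 * (2 * B + 1))) * Real.log (1 / cellRadius n B l) ≤ C * (n : ℝ) ^ μ := by
  obtain ⟨C₀, hC₀, hsum⟩ := exists_sum_labels_inv_pow_le d S
  set lam := μ / (2 * (2 * B + 1)) with hlam
  have hBr : (0 : ℝ) ≤ B := Nat.cast_nonneg _
  have hlam0 : 0 < lam := by positivity
  have hlamB : lam * (2 * B + 1) = μ / 2 := by rw [hlam]; field_simp
  have hlam1 : lam ≤ 1 := by nlinarith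
  set m := ∫ ξ, ‖ξ‖ ∂Fξ with hm
  have hm0 : 0 ≤ m := integral_nonneg fun _ => norm_nonneg _
  refine ⟨(1 / c) ^ lam * (B * (2 / μ)) * ((1 + m) + C₀) + 1, by positivity, fun n N hn => ?_⟩
  set F := Fξ.prod (Fμ.prod Fφ) with hF
  have hn1 : (1 : ℝ) ≤ n := by exact_mod_cast hn
  have hterm : ∀ l ∈ labels d S (meshInv n K) N, F.real (atomCell S (meshInv n K) l) *
      (1 / (c * F.real (atomCell S (meshInv n K) l) * cellRadius n B l)) ^ lam
        * Real.log (1 / cellRadius n B l) ≤ (1 / c) ^ lam * (B * (2 / μ)) * (n : ℝ) ^ μ *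
        (F.real (atomCell S (meshInv n K) l) * (l.1 + 1) + (((n : ℝ) * (l.1 + 1)) ^ B)⁻¹) := by
    intro l _
    set a := F.real (atomCell S (meshInv n K) l) with ha
    set q := (n : ℝ) * (l.1 + 1) with hq
    have hq1 : 1 ≤ q := hn1.trans (one_le_scale hn l)
    have hq0 : 0 < q := by linarith
    have hl1 : (0 : ℝ) ≤ l.1 := Nat.cast_nonneg _
    have hlq : 0 ≤ Real.log q := Real.log_nonneg hq1
    rw [log_one_div_cellRadius, cellRadius, ← hq]
    rcases (measureReal_nonneg (μ := F) (s := atomCell S (meshInv n K) l)).eq_or_lt with h0 | h0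
    · rw [← ha] at h0
      rw [← h0]
      simp only [zero_mul, zero_add]
      positivity
    · rw [← ha] at h0
      -- Young's inequality separates the mass of the cell from a negative power of the scale.
      have hyoung : a ^ (1 - lam) * ((q ^ (B + 1))⁻¹) ^ lam ≤ a + (q ^ (B + 1))⁻¹ := by
        have := Real.geom_mean_le_arith_mean2_weighted (by linarith : 0 ≤ 1 - lam) hlam0.le
          h0.le (by positivity : 0 ≤ (q ^ (B + 1))⁻¹) (by ring)
        refine this.trans ?_
        have h1 : (1 - lam) * a ≤ 1 * a := by gcongr; linarith
        have h2 : lam * (q ^ (B + 1))⁻¹ ≤ 1 * (q ^ (B + 1))⁻¹ := by gcongr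
        linarith
      have hlog : Real.log q ≤ 2 / μ * q ^ (μ / 2) := by
        have := Real.log_le_rpow_div hq0.le (by positivity : 0 < μ / 2)
        calc _ ≤ _ := this
          _ = _ := by field_simp
      have heq : a * (1 / (c * a * (q ^ B)⁻¹)) ^ lam
          = (1 / c) ^ lam * (a ^ (1 - lam) * ((q ^ (B + 1))⁻¹) ^ lam) * q ^ (μ / 2) := by
        have e1 : 1 / (c * a * (q ^ B)⁻¹) = (1 / c) * (a⁻¹ * q ^ B) := by field_simp
        rw [e1, Real.mul_rpow (by positivity) (by positivity),
          Real.mul_rpow (by positivity) (by positivity), Real.inv_rpow h0.le,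
          Real.inv_rpow (by positivity), ← Real.rpow_natCast q (B + 1), ← Real.rpow_natCast q B,
          ← Real.rpow_mul hq0.le, ← Real.rpow_mul hq0.le, Real.rpow_sub h0, Real.rpow_one]
        have e2 : q ^ ((B : ℝ) * lam) = (q ^ (((B + 1 : ℕ) : ℝ) * lam))⁻¹ * q ^ (μ / 2) := by
          rw [← Real.rpow_neg hq0.le, ← Real.rpow_add hq0]
          congr 1
          push_cast
          linarith
        rw [e2]
        field_simp
      have hqq : q ^ (μ / 2) * q ^ (μ / 2) ≤ (n : ℝ) ^ μ * (l.1 + 1) := by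
        rw [← Real.rpow_add hq0, add_halves]
        exact scale_rpow_le hμ1 l
      have hql : (q ^ (B + 1))⁻¹ * (l.1 + 1) ≤ (q ^ B)⁻¹ := by
        rw [pow_succ, mul_inv, mul_assoc]
        refine mul_le_of_le_one_right (by positivity) ?_
        rw [inv_mul_le_one₀ hq0, hq]
        nlinarith
      rw [heq]
      calc _ ≤ (1 / c) ^ lam * (a + (q ^ (B + 1))⁻¹) * q ^ (μ / 2) *
            (B * (2 / μ * q ^ (μ / 2))) := by gcongr
        _ = (1 / c) ^ lam * (B * (2 / μ)) * (a + (q ^ (B + 1))⁻¹) * (q ^ (μ / 2) * q ^ (μ / 2)) := by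
            ring
        _ ≤ (1 / c) ^ lam * (B * (2 / μ)) * (a + (q ^ (B + 1))⁻¹) * ((n : ℝ) ^ μ * (l.1 + 1)) := by
            gcongr
        _ = (1 / c) ^ lam * (B * (2 / μ)) * (n : ℝ) ^ μ *
            (a * (l.1 + 1) + (q ^ (B + 1))⁻¹ * (l.1 + 1)) := by ring
        _ ≤ _ := by gcongr
  have h1 := sum_measureReal_atomCell_mul_le (S := S) (Fμ := Fμ) (Fφ := Fφ) hint (meshInv n K) N
  have h2 := hsum n K 0 B N hn (by omega)
  rw [pow_zero, inv_one, mul_one] at h2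
  calc _ ≤ _ := Finset.sum_le_sum hterm
    _ = (1 / c) ^ lam * (B * (2 / μ)) * (n : ℝ) ^ μ *
        (∑ l ∈ labels d S (meshInv n K) N, F.real (atomCell S (meshInv n K) l) * (l.1 + 1) +
          ∑ l ∈ labels d S (meshInv n K) N, (((n : ℝ) * (l.1 + 1)) ^ B)⁻¹) := by
        rw [← Finset.mul_sum, Finset.sum_add_distrib]
    _ ≤ (1 / c) ^ lam * (B * (2 / μ)) * (n : ℝ) ^ μ * ((1 + m) + C₀) := by gcongr
    _ ≤ _ := by
        have : 0 ≤ (n : ℝ) ^ μ := by positivity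
        nlinarith

end CellRadii

/-! ### Typical realizations of the prior -/

section TypicalPaths

variable {d : ℕ} {S : ℝ} {Fξ Fμ : Measure (E d)} {Fφ : Measure ℝ}
  [IsProbabilityMeasure Fξ] [IsProbabilityMeasure Fμ] [IsProbabilityMeasure Fφ]
  {α η : ℝ} {Ω : Type*} [MeasurableSpace Ω] {P : Measure Ω} [IsProbabilityMeasure P]
  {Q : Ω → SignedMeasure (Atom d)}

/-- A point of a cell, or an arbitrary point if the cell is empty. -/
def cellPoint (S : ℝ) (M : ℕ → ℕ) (l : Label d) : Atom d :=
  open Classical in if h : (atomCell S M l).Nonempty then h.choose else 0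

lemma cellPoint_mem {M : ℕ → ℕ} {l : Label d} (h : (atomCell S M l).Nonempty) :
    cellPoint S M l ∈ atomCell S M l := by
  rw [cellPoint, dif_pos h]; exact h.choose_spec

lemma kernel_sub_cellPoint_le {g : 𝓢(E d, ℝ)} {L : ℝ} (hL0 : 0 ≤ L)
    (hL : ∀ (x : E d) (z z' : Atom d),
      |kernel g z.1 z.2.2 (x - z.2.1) - kernel g z'.1 z'.2.2 (x - z'.2.1)|
        ≤ L * ((1 + ‖z'.1‖) * ‖z.2.1 - z'.2.1‖ + ‖z.1 - z'.1‖ + |z.2.2 - z'.2.2|))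
    {n K : ℕ} (hn : 0 < n) (hK : 1 ≤ K) {l : Label d} {z : Atom d}
    (hz : z ∈ atomCell S (meshInv n K) l) (x : E d) :
    |kernel g z.1 z.2.2 (x - z.2.1) - kernel g (cellPoint S (meshInv n K) l).1
      (cellPoint S (meshInv n K) l).2.2 (x - (cellPoint S (meshInv n K) l).2.1)|
      ≤ 4 * L * (d + 1) / (n : ℝ) ^ K := by
  refine (kernel_sub_le_of_mem_atomCell hL0 hL (meshInv_pos hn K _) hz
    (cellPoint_mem ⟨z, hz⟩) x).trans ?_
  have hn0 : (0 : ℝ) < n := by exact_mod_cast hn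
  have hl : (0 : ℝ) ≤ l.1 := Nat.cast_nonneg _
  have h1 : (meshInv n K l.1 : ℝ) = (n : ℝ) ^ K * ((l.1 : ℝ) + 1) ^ K := by
    rw [meshInv]; push_cast; rw [mul_pow]
  have h2 : (l.1 : ℝ) + 1 ≤ ((l.1 : ℝ) + 1) ^ K := le_self_pow₀ (by linarith) (by omega)
  rw [h1, div_le_div_iff₀ (by positivity) (by positivity)]
  calc L * ((l.1 + 4) * (d + 1)) * (n : ℝ) ^ K
      ≤ L * ((4 * ((l.1 : ℝ) + 1) ^ K) * (d + 1)) * (n : ℝ) ^ K := by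
        gcongr
        linarith
    _ = _ := by ring

/-- Outside an event of small probability, the prior puts sufficient mass on small neighbourhoods
of its own realizations. -/
theorem exists_typical_mixture {g : 𝓢(E d, ℝ)} (hd : 0 < d) (hα : 0 < α) (hη : 0 < η)
    (hFξ : FrequencyAssumption Fξ) (hFμ : LocationAssumption S Fμ) (hFφ : PhaseAssumption Fφ)
    (hQ : IsSymmGammaRandomMeasure P Q α η (Fξ.prod (Fμ.prod Fφ))) {μ : ℝ} (hμ : 0 < μ)
    (hμ1 : μ ≤ 1) (J : ℕ) :
    ∃ C : ℝ, 0 < C ∧ ∀ x : ℕ → E d, ∀ᶠ n : ℕ in atTop, ∀ L₀ : ℝ, 0 ≤ L₀ → ∃ G : Set Ω,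
      P.real Gᶜ ≤ Real.exp (-L₀ + C * (n : ℝ) ^ μ) + Real.exp (-(n : ℝ) ^ 2) ∧
      ∀ ω₀ ∈ G, Real.exp (-(C * (L₀ + C * (n : ℝ) ^ μ))) - Real.exp (-(n : ℝ) ^ 2) ≤
        P.real {ω | ∀ j < n, |mixture g (Q ω) (x j) - mixture g (Q ω₀) (x j)|
          ≤ C / (n : ℝ) ^ J} := by
  have hint := hFξ.integrable_norm hd
  obtain ⟨L, hL1, hLb, hLip⟩ := exists_kernel_bounds g
  have hL0 : 0 < L := by linarith
  -- The mesh exponent `K` makes the discretization error negligible, and the radius exponent `B` makes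
  -- the sum of the radii over all cells at most of the order of `n ^ (-J)`.
  set K := J + 5 with hK
  set B := (K + 1) * (2 * d + 1) + J + 2 with hB
  have hBpos : 1 ≤ B := by omega
  obtain ⟨c, C₁, hc, hc1, hC₁, htyp⟩ := exists_typical_small_ball hQ hα hη
    (lam := μ / (2 * (2 * B + 1))) (by positivity)
  obtain ⟨C₂, hC₂, hS2⟩ := exists_sum_rpow_cellRadius_le (S := S) (Fμ := Fμ) (Fφ := Fφ) hint hμ hμ1
    hc (K := K) (B := B) (by omega)
  obtain ⟨C₃, hC₃, hS3⟩ := exists_sum_labels_inv_pow_le d S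
  set C₄ := B / μ * (1 + ∫ ξ, ‖ξ‖ ∂Fξ) with hC₄
  have hm0 : 0 ≤ ∫ ξ, ‖ξ‖ ∂Fξ := integral_nonneg fun _ => norm_nonneg _
  have hC₄0 : 0 ≤ C₄ := by positivity
  refine ⟨C₁ + C₁ * C₂ + C₄ + 2 * (2 + L * C₃), by positivity, fun x => ?_⟩
  set C := C₁ + C₁ * C₂ + C₄ + 2 * (2 + L * C₃) with hC
  have hLC₃ : 0 < L * C₃ := by positivity
  have hC₁₂ : 0 < C₁ * C₂ := by positivity
  filter_upwards [eventually_discretizationError_le hα hη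
    (b := 4 * L * (d + 1)) (by positivity) hL0 J, eventually_ge_atTop 2] with n hdisc hn L₀ hL₀
  obtain ⟨τ, hτ, hdisc⟩ := hdisc
  have hn0 : (0 : ℝ) < n := by exact_mod_cast (by omega : 0 < n)
  obtain ⟨N₀, hN₀⟩ := exists_measureReal_compl_atomCells_le (Fξ := Fξ) hFμ hFφ (meshInv n K) hτ
  have herr := hdisc _ (hN₀ N₀ le_rfl)
  obtain ⟨G, hG1, hG2⟩ := htyp
    (H := fun j z => kernel g z.1 z.2.2 (x j - z.2.1))
    (fun j => (continuous_kernel g (x j)).measurable) hL0 (fun j z => hLb (x j) z) n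
    (A := fun l : labels d S (meshInv n K) N₀ => atomCell S (meshInv n K) (l : Label d))
    (fun l => measurableSet_atomCell S _ _)
    (fun l l' h => disjoint_atomCell S _ (Subtype.coe_injective.ne h))
    (fun l => cellPoint S (meshInv n K) (l : Label d))
    (b := 4 * L * (d + 1) / (n : ℝ) ^ K) (t := 1 / (n : ℝ) ^ J) (by positivity) (by positivity)
    (fun l z hz j => kernel_sub_cellPoint_le hL0.le hLip (by omega) (by omega) hz (x j))
    (r := fun l => cellRadius n B (l : Label d)) (fun l => cellRadius_mem hn hBpos _) L₀
  refine ⟨G, ?_, fun ω₀ hω₀ => ?_⟩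
  · refine hG1.trans (add_le_add (Real.exp_le_exp.2 ?_) herr)
    rw [Finset.sum_coe_sort (labels d S (meshInv n K) N₀) (fun l : Label d =>
      (Fξ.prod (Fμ.prod Fφ)).real (atomCell S (meshInv n K) l) *
        (1 / (c * (Fξ.prod (Fμ.prod Fφ)).real (atomCell S (meshInv n K) l) * cellRadius n B l))
          ^ (μ / (2 * (2 * B + 1))) * Real.log (1 / cellRadius n B l))]
    have h1 := mul_le_mul_of_nonneg_left (hS2 n N₀ (by omega)) hC₁.le
    have h2 : C₁ * (C₂ * (n : ℝ) ^ μ) ≤ C * (n : ℝ) ^ μ := by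
      rw [← mul_assoc]
      gcongr
      linarith
    linarith
  · have h1 := hG2 ω₀ hω₀
    rw [Finset.sum_coe_sort (labels d S (meshInv n K) N₀) (fun l : Label d =>
      (Fξ.prod (Fμ.prod Fφ)).real (atomCell S (meshInv n K) l) * Real.log (1 / cellRadius n B l)),
      Finset.sum_coe_sort (labels d S (meshInv n K) N₀) (fun l : Label d => cellRadius n B l)] at h1
    have h2 := sum_measureReal_mul_log_cellRadius_le (S := S) (Fμ := Fμ) (Fφ := Fφ) hint
      (meshInv n K) n B N₀ hμ hμ1
    have h3 := hS3 n K J B N₀ (by omega) le_rfl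
    refine le_trans (sub_le_sub ?_ herr) (h1.trans (measureReal_mono fun ω hω j hj => ?_))
    · apply Real.exp_le_exp.2
      rw [neg_le_neg_iff]
      have h5 : C₄ * (n : ℝ) ^ μ ≤ C * (n : ℝ) ^ μ := by
        gcongr
        linarith
      have h6 : 0 ≤ C * (n : ℝ) ^ μ := h5.trans' (by positivity)
      calc _ ≤ C₁ * (L₀ + C * (n : ℝ) ^ μ) := by
            refine mul_le_mul_of_nonneg_left ?_ hC₁.le
            linarith
        _ ≤ _ := by
            gcongr
            linarith
    · refine (hω j hj).trans ?_
      have h4 : ∑ l ∈ labels d S (meshInv n K) N₀, cellRadius n B l ≤ C₃ * ((n : ℝ) ^ J)⁻¹ := h3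
      calc _ ≤ 2 * (2 * (1 / (n : ℝ) ^ J) + L * (C₃ * ((n : ℝ) ^ J)⁻¹)) := by gcongr
        _ = 2 * (2 + L * C₃) / (n : ℝ) ^ J := by field_simp
        _ ≤ _ := by
          gcongr
          linarith

omit [IsProbabilityMeasure Fξ] in
/-- A ball of polynomially small radius around an atom carries at least polynomially small base
mass. -/
lemma exists_base_ball_ge (hFξ : FrequencyAssumption Fξ) (hFμ : LocationAssumption S Fμ)
    (hFφ : PhaseAssumption Fφ) (J m : ℕ) (hm : 1 ≤ m) : ∃ (c : ℝ) (k : ℕ), 0 < c ∧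
      ∀ n : ℕ, 2 ≤ n → ∀ z ∈ atomSupport d S, ‖z.1‖ ≤ (n : ℝ) ^ J →
        c * ((n : ℝ) ^ k)⁻¹ ≤ (Fξ.prod (Fμ.prod Fφ)).real
          ({ξ | ‖ξ - z.1‖ ≤ 1 / (n : ℝ) ^ m} ×ˢ ({μ | ‖μ - z.2.1‖ ≤ 1 / (n : ℝ) ^ m} ×ˢ
            {φ | |φ - z.2.2| ≤ 1 / (n : ℝ) ^ m})) := by
  obtain ⟨a, a', b, ha, ha', hb, h1⟩ := hFξ.small_ball
  obtain ⟨a₁, b₁, ha₁, hb₁, h2⟩ := hFμ.small_ball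
  obtain ⟨a₂, b₂, ha₂, hb₂, h3⟩ := hFφ.small_ball
  obtain ⟨k, hk⟩ := exists_nat_ge ((J + 1) * a + m * a' + m * a₁ + m * a₂)
  refine ⟨b * b₁ * b₂, k, by positivity, fun n hn z hz hzJ => ?_⟩
  have hn2 : (2 : ℝ) ≤ n := by exact_mod_cast hn
  have hn1 : (1 : ℝ) ≤ n := by linarith
  have hn0 : (0 : ℝ) < n := by linarith
  have ht : (1 / (n : ℝ) ^ m) ∈ Set.Ioo (0 : ℝ) 1 := by
    refine ⟨by positivity, ?_⟩
    rw [div_lt_one (by positivity)]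
    exact one_lt_pow₀ (by linarith) (by omega)
  have hrp : ∀ s : ℝ, (1 / (n : ℝ) ^ m) ^ s = (n : ℝ) ^ (-(m * s)) := by
    intro s
    rw [one_div, Real.inv_rpow (by positivity), ← Real.rpow_natCast, ← Real.rpow_mul hn0.le,
      Real.rpow_neg hn0.le]
  have e1 : (n : ℝ) ^ (-((J + 1) * a)) ≤ (1 + ‖z.1‖) ^ (-a) := by
    have : 1 + ‖z.1‖ ≤ (n : ℝ) ^ ((J : ℝ) + 1) := by
      rw [Real.rpow_add hn0, Real.rpow_natCast, Real.rpow_one]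
      have : (1 : ℝ) ≤ (n : ℝ) ^ J := one_le_pow₀ hn1
      nlinarith
    calc (n : ℝ) ^ (-((J + 1) * a)) = ((n : ℝ) ^ ((J : ℝ) + 1)) ^ (-a) := by
          rw [← Real.rpow_mul hn0.le]; congr 1; ring
      _ ≤ _ := Real.rpow_le_rpow_of_nonpos (by positivity) this (by linarith)
  rw [measureReal_prod_prod, measureReal_prod_prod]
  calc b * b₁ * b₂ * ((n : ℝ) ^ k)⁻¹
      ≤ b * b₁ * b₂ * (n : ℝ) ^ (-((J + 1) * a + m * a' + m * a₁ + m * a₂)) := by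
        gcongr
        rw [← Real.rpow_natCast, ← Real.rpow_neg hn0.le]
        exact Real.rpow_le_rpow_of_exponent_le hn1 (by linarith)
    _ = (b * (n : ℝ) ^ (-((J + 1) * a)) * (n : ℝ) ^ (-(m * a'))) *
        ((b₁ * (n : ℝ) ^ (-(m * a₁))) * (b₂ * (n : ℝ) ^ (-(m * a₂)))) := by
        rw [neg_add, neg_add, neg_add, Real.rpow_add hn0, Real.rpow_add hn0, Real.rpow_add hn0]
        ring
    _ ≤ _ := by
        have h1' := h1 _ ht z.1
        have h2' := h2 _ ht z.2.1 hz.1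
        have h3' := h3 _ ht z.2.2 hz.2
        rw [hrp] at h1' h2' h3'
        gcongr
        exact le_trans (by gcongr) h1'

/-- Near every atom there is a cell of polynomially large base mass. -/
lemma exists_near_cell (hFξ : FrequencyAssumption Fξ) (hFμ : LocationAssumption S Fμ)
    (hFφ : PhaseAssumption Fφ) (J K m : ℕ) (hm : 1 ≤ m) : ∃ (c : ℝ) (k : ℕ), 0 < c ∧
      ∀ n : ℕ, 2 ≤ n → ∀ z ∈ atomSupport d S, ‖z.1‖ ≤ (n : ℝ) ^ J →
        ∃ l ∈ labels d S (meshInv n K) (n ^ J + 2),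
          c * ((n : ℝ) ^ k)⁻¹ ≤ (Fξ.prod (Fμ.prod Fφ)).real (atomCell S (meshInv n K) l) ∧
          ∃ z' ∈ atomCell S (meshInv n K) l, ‖z.1 - z'.1‖ ≤ 1 / (n : ℝ) ^ m ∧
            ‖z.2.1 - z'.2.1‖ ≤ 1 / (n : ℝ) ^ m ∧ |z.2.2 - z'.2.2| ≤ 1 / (n : ℝ) ^ m := by
  obtain ⟨c, k, hc, hball⟩ := exists_base_ball_ge hFξ hFμ hFφ J m hm
  obtain ⟨A, hA, hcard⟩ := card_labelsAt_le d S
  set D := (K + 1) * (2 * d + 1) with hD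
  refine ⟨c / A, k + ((J + 2) + (J + 3) * D), by positivity, fun n hn z hz hzJ => ?_⟩
  have hn2 : (2 : ℝ) ≤ n := by exact_mod_cast hn
  have hn1 : (1 : ℝ) ≤ n := by linarith
  have hn0 : (0 : ℝ) < n := by linarith
  set F := Fξ.prod (Fμ.prod Fφ) with hF
  set U : Set (Atom d) := {ξ | ‖ξ - z.1‖ ≤ 1 / (n : ℝ) ^ m} ×ˢ
    ({μ | ‖μ - z.2.1‖ ≤ 1 / (n : ℝ) ^ m} ×ˢ {φ | |φ - z.2.2| ≤ 1 / (n : ℝ) ^ m}) with hU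
  have hUle := hball n hn z hz hzJ
  set T := labels d S (meshInv n K) (n ^ J + 2) with hT
  have hn_pow : 2 * n ^ J + 4 ≤ 2 * n ^ (J + 2) := by
    have h1 : 1 ≤ n ^ J := Nat.one_le_pow _ _ (by omega)
    have h2 : 4 ≤ n ^ 2 := by nlinarith
    rw [pow_add]
    nlinarith
  have hNle : n ^ J + 2 ≤ n ^ (J + 2) := by omega
  -- The number of cells below the relevant level is polynomial in `n`.
  have hTcard : T.card ≤ A * n ^ ((J + 2) + (J + 3) * D) := by
    calc T.card ≤ ∑ k ∈ Finset.range (n ^ J + 2), (labelsAt d S (meshInv n K) k).card :=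
          Finset.card_biUnion_le
      _ ≤ ∑ _k ∈ Finset.range (n ^ J + 2), A * (n * n ^ (J + 2)) ^ D := by
          refine Finset.sum_le_sum fun k hk => (hcard n K k (by omega)).trans ?_
          have : k + 1 ≤ n ^ (J + 2) := by
            have := Finset.mem_range.1 hk
            omega
          gcongr
      _ = (n ^ J + 2) * (A * (n * n ^ (J + 2)) ^ D) := by
          rw [Finset.sum_const, Finset.card_range, smul_eq_mul]
      _ ≤ n ^ (J + 2) * (A * (n * n ^ (J + 2)) ^ D) := by gcongr
      _ = _ := by rw [← pow_succ', ← pow_mul, pow_add]; ring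
  have hcover : U ∩ atomSupport d S ⊆ ⋃ l ∈ T, (atomCell S (meshInv n K) l ∩ U) := by
    intro z' hz'
    have h1 : ‖z'.1 - z.1‖ ≤ 1 / (n : ℝ) ^ m := hz'.1.1
    have h2 : (1 : ℝ) / (n : ℝ) ^ m ≤ 1 := by
      rw [div_le_one (by positivity)]; exact one_le_pow₀ hn1
    have h3 : ‖z'.1‖ < ((n ^ J + 2 : ℕ) : ℝ) := by
      push_cast
      have := norm_sub_norm_le z'.1 z.1
      linarith
    exact Set.mem_biUnion (label_mem_labels hz'.2 h3) ⟨⟨hz'.2, rfl⟩, hz'.1⟩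
  have hsum : F.real U ≤ ∑ l ∈ T, F.real (atomCell S (meshInv n K) l ∩ U) := by
    have h1 : F.real U ≤ F.real (U ∩ atomSupport d S) + F.real (atomSupport d S)ᶜ :=
      (measureReal_mono (fun y hy => by
        by_cases h : y ∈ atomSupport d S
        · exact Or.inl ⟨hy, h⟩
        · exact Or.inr h)).trans (measureReal_union_le _ _)
    have h2 : F.real (atomSupport d S)ᶜ = 0 := by
      rw [measureReal_def, hF, measure_atomSupport_compl hFμ hFφ]; rfl
    rw [h2, add_zero] at h1
    exact h1.trans ((measureReal_mono hcover (measure_ne_top _ _)).trans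
      (measureReal_biUnion_finset_le _ _))
  have hpos : 0 < F.real U := lt_of_lt_of_le (by positivity) hUle
  have hTne : T.Nonempty := by
    rw [Finset.nonempty_iff_ne_empty]
    intro h
    rw [h, Finset.sum_empty] at hsum
    linarith
  obtain ⟨l, hl, hle⟩ := Finset.exists_le_of_sum_le (s := T) (f := fun _ => F.real U / T.card)
    (g := fun l => F.real (atomCell S (meshInv n K) l ∩ U)) hTne (by
      rw [Finset.sum_const, nsmul_eq_mul, mul_div_cancel₀]
      · exact hsum
      · exact_mod_cast (Finset.card_pos.2 hTne).ne')
  have hTpos : (0 : ℝ) < T.card := by exact_mod_cast Finset.card_pos.2 hTne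
  have hTcard' : (T.card : ℝ) ≤ A * (n : ℝ) ^ ((J + 2) + (J + 3) * D) := by exact_mod_cast hTcard
  have hAr : (0 : ℝ) < A := by exact_mod_cast hA
  have hge : c / A * ((n : ℝ) ^ (k + ((J + 2) + (J + 3) * D)))⁻¹
      ≤ F.real (atomCell S (meshInv n K) l ∩ U) := by
    refine le_trans ?_ hle
    calc c / A * ((n : ℝ) ^ (k + ((J + 2) + (J + 3) * D)))⁻¹
        = c * ((n : ℝ) ^ k)⁻¹ / (A * (n : ℝ) ^ ((J + 2) + (J + 3) * D)) := by
          rw [pow_add]; field_simp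
      _ ≤ F.real U / T.card := by gcongr
  refine ⟨l, hl, hge.trans (measureReal_mono Set.inter_subset_left), ?_⟩
  have hne : (atomCell S (meshInv n K) l ∩ U).Nonempty := by
    rw [Set.nonempty_iff_ne_empty]
    intro h
    rw [h, measureReal_empty] at hge
    have : 0 < c / A * ((n : ℝ) ^ (k + ((J + 2) + (J + 3) * D)))⁻¹ := by positivity
    linarith
  obtain ⟨z', hz', hzU⟩ := hne
  refine ⟨z', hz', ?_, ?_, ?_⟩
  · rw [norm_sub_rev]; exact hzU.1
  · rw [norm_sub_rev]; exact hzU.2.1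
  · rw [abs_sub_comm]; exact hzU.2.2

end TypicalPaths

/-! ### Neighborhoods of finite mixtures -/

section FiniteMixtures

variable {d : ℕ} {S : ℝ} {Fξ Fμ : Measure (E d)} {Fφ : Measure ℝ}
  [IsProbabilityMeasure Fξ] [IsProbabilityMeasure Fμ] [IsProbabilityMeasure Fφ]
  {α η : ℝ} {Ω : Type*} [MeasurableSpace Ω] {P : Measure Ω} [IsProbabilityMeasure P]
  {Q : Ω → SignedMeasure (Atom d)}

lemma labels_mono (S : ℝ) (M : ℕ → ℕ) {N N' : ℕ} (h : N ≤ N') :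
    labels d S M N ⊆ labels d S M N' :=
  Finset.biUnion_subset_biUnion_of_subset_left _ (Finset.range_mono h)

lemma fst_lt_of_mem_labels {M : ℕ → ℕ} {N : ℕ} {l : Label d} (h : l ∈ labels d S M N) :
    l.1 < N := by
  obtain ⟨k, hk, hl⟩ := Finset.mem_biUnion.1 h
  rw [fst_eq_of_mem_labelsAt hl]
  exact Finset.mem_range.1 hk

/-- Prior mass of a small neighbourhood of a finite mixture with polynomially bounded
frequencies. -/
theorem exists_small_ball_mixture {g : 𝓢(E d, ℝ)} (hd : 0 < d) (hα : 0 < α) (hη : 0 < η)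
    (hFξ : FrequencyAssumption Fξ) (hFμ : LocationAssumption S Fμ) (hFφ : PhaseAssumption Fφ)
    (hQ : IsSymmGammaRandomMeasure P Q α η (Fξ.prod (Fμ.prod Fφ))) {μ : ℝ} (hμ : 0 < μ)
    (hμ1 : μ ≤ 1) (J R : ℕ) :
    ∃ C : ℝ, 0 < C ∧ ∀ x : ℕ → E d, ∀ᶠ n : ℕ in atTop, ∀ {κ : Type} [Fintype κ] (u : κ → ℝ)
      (ζ : κ → Atom d), (∀ m, ζ m ∈ atomSupport d S) → (∀ m, ‖(ζ m).1‖ ≤ (n : ℝ) ^ R) →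
      Real.exp (-(C * (Fintype.card κ * Real.log n + ∑ m, |u m| + (n : ℝ) ^ μ)))
          - Real.exp (-(n : ℝ) ^ 2) ≤
        P.real {ω | ∀ j < n, |mixture g (Q ω) (x j)
            - ∑ m, u m * kernel g (ζ m).1 (ζ m).2.2 (x j - (ζ m).2.1)|
          ≤ C * (1 + ∑ m, |u m|) / (n : ℝ) ^ J} := by
  classical
  have hint := hFξ.integrable_norm hd
  obtain ⟨L, hL1, hLb, hLip⟩ := exists_kernel_bounds g
  have hL0 : 0 < L := by linarith
  set K := J + 5 with hK
  set B := (K + 1) * (2 * d + 1) + J + 2 with hB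
  have hBpos : 1 ≤ B := by omega
  obtain ⟨c, C₁, hc, hc1, hC₁, hcells⟩ := hQ.exists_cells_ge hα hη
  obtain ⟨c', k, hc', hnear⟩ := exists_near_cell hFξ hFμ hFφ R K (J + R + 1) (by omega)
  obtain ⟨C₃, hC₃, hS3⟩ := exists_sum_labels_inv_pow_le d S
  set C₄ := B / μ * (1 + ∫ ξ, ‖ξ‖ ∂Fξ) with hC₄
  have hm0 : 0 ≤ ∫ ξ, ‖ξ‖ ∂Fξ := integral_nonneg fun _ => norm_nonneg _
  have hC₄0 : 0 ≤ C₄ := by positivity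
  set e := k + (R + 3) * B with he
  set C₅ := |Real.log (1 / (c * c'))| / Real.log 2 + e with hC₅
  have hl2 : 0 < Real.log 2 := Real.log_pos one_lt_two
  have hC₅0 : 0 ≤ C₅ := by positivity
  set Kc := 4 * L * (d + 1) + 4 * L with hKc
  refine ⟨C₁ + C₁ * C₄ + C₅ + (2 + L * C₃) + Kc, by positivity, fun x => ?_⟩
  set C := C₁ + C₁ * C₄ + C₅ + (2 + L * C₃) + Kc with hC
  have hLC₃ : 0 < L * C₃ := by positivity
  have hC₁₄ : 0 ≤ C₁ * C₄ := by positivity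
  have hKc0 : 0 < Kc := by positivity
  filter_upwards [eventually_discretizationError_le hα hη
    (b := 4 * L * (d + 1)) (by positivity) hL0 J, eventually_ge_atTop 2] with n hdisc hn
  intro κ _ u ζ hζ hζR
  obtain ⟨τ, hτ, hdisc⟩ := hdisc
  have hn2 : (2 : ℝ) ≤ n := by exact_mod_cast hn
  have hn1 : (1 : ℝ) ≤ n := by linarith
  have hn0 : (0 : ℝ) < n := by linarith
  have hlogn : Real.log 2 ≤ Real.log n := Real.log_le_log two_pos hn2
  have hlogn0 : 0 < Real.log n := by linarith
  obtain ⟨N₀, hN₀⟩ := exists_measureReal_compl_atomCells_le (Fξ := Fξ) hFμ hFφ (meshInv n K) hτ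
  set N := max N₀ (n ^ R + 2) with hN
  have herr := hdisc _ (hN₀ N (le_max_left _ _))
  set F := Fξ.prod (Fμ.prod Fφ) with hF
  set H : ℕ → Atom d → ℝ := fun j z => kernel g z.1 z.2.2 (x j - z.2.1) with hH
  have hcell := fun m => hnear n hn (ζ m) (hζ m) (hζR m)
  -- Each atom is replaced by a nearby cell of sufficient base mass; several atoms may share a cell, and
  -- `v` collects their coefficients.
  choose l hlmem hlmass z' hz'mem hz'1 hz'2 hz'3 using hcell
  set T := labels d S (meshInv n K) N with hT
  have hlT : ∀ m, l m ∈ T := fun m => labels_mono S _ (le_max_right _ _) (hlmem m)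
  set lT : κ → T := fun m => ⟨l m, hlT m⟩ with hlTdef
  set v : T → ℝ := fun i => ∑ m with lT m = i, u m with hv
  have hfib : ∀ i, v i ≠ 0 → ∃ m, lT m = i := by
    intro i hi
    obtain ⟨m, hm, -⟩ := Finset.exists_ne_zero_of_sum_ne_zero hi
    exact ⟨m, (Finset.mem_filter.1 hm).2⟩
  have hA : ∀ i : T, MeasurableSet (atomCell S (meshInv n K) (i : Label d)) :=
    fun i => measurableSet_atomCell S _ _
  have hdisj : Pairwise fun i i' : T => Disjoint (atomCell S (meshInv n K) (i : Label d))
      (atomCell S (meshInv n K) (i' : Label d)) :=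
    fun i i' h => disjoint_atomCell S _ (Subtype.coe_injective.ne h)
  have hmasspos : ∀ m, 0 < F.real (atomCell S (meshInv n K) (l m)) := fun m =>
    lt_of_lt_of_le (by positivity) (hlmass m)
  have hvpos : ∀ i, v i ≠ 0 → 0 < F.real (atomCell S (meshInv n K) (i : Label d)) := by
    intro i hi
    obtain ⟨m, rfl⟩ := hfib i hi
    exact hmasspos m
  have hp := hcells (fun i : T => atomCell S (meshInv n K) (i : Label d))
    (fun i : T => cellRadius n B (i : Label d)) v hA hdisj (fun i => cellRadius_mem hn hBpos _) hvpos
  have hball := measureReal_small_ball_ge hQ hα hη (H := H)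
    (fun j => (continuous_kernel g (x j)).measurable) hL0 (fun j z => hLb (x j) z) n
    hA hdisj (fun i => cellPoint S (meshInv n K) (i : Label d))
    (b := 4 * L * (d + 1) / (n : ℝ) ^ K) (t := 1 / (n : ℝ) ^ J) (by positivity) (by positivity)
    (fun i z hz j => kernel_sub_cellPoint_le hL0.le hLip (by omega) (by omega) hz (x j)) hp
  rw [Finset.sum_coe_sort T (fun l : Label d => cellRadius n B l),
    Finset.sum_coe_sort T (fun l : Label d => F.real (atomCell S (meshInv n K) l) *
      Real.log (1 / cellRadius n B l))] at hball
  have h2 := sum_measureReal_mul_log_cellRadius_le (S := S) (Fμ := Fμ) (Fφ := Fφ) hint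
    (meshInv n K) n B N hμ hμ1
  have h3 : ∑ l ∈ T, cellRadius n B l ≤ C₃ * ((n : ℝ) ^ J)⁻¹ := hS3 n K J B N (by omega) le_rfl
  -- The cost of a cell is charged to the atoms that it represents.
  have hcost1 : ∀ m, Real.log (1 / (c * F.real (atomCell S (meshInv n K) (l m))
      * cellRadius n B (l m))) ≤ C₅ * Real.log n := by
    intro m
    have hq : (n : ℝ) * ((l m).1 + 1) ≤ (n : ℝ) ^ (R + 3) := by
      have h1 : (l m).1 + 1 ≤ n ^ R + 2 := fst_lt_of_mem_labels (hlmem m)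
      have h2 : n ^ R + 2 ≤ n ^ (R + 2) := by
        have e1 : 1 ≤ n ^ R := Nat.one_le_pow _ _ (by omega)
        have e2 : 4 ≤ n ^ 2 := by nlinarith
        rw [pow_add]
        nlinarith
      have h3 : n * ((l m).1 + 1) ≤ n ^ (R + 3) := by
        calc _ ≤ n * n ^ (R + 2) := Nat.mul_le_mul_left _ (h1.trans h2)
          _ = _ := by rw [← pow_succ']
      exact_mod_cast h3
    have hr : (((n : ℝ) ^ (R + 3)) ^ B)⁻¹ ≤ cellRadius n B (l m) := by
      unfold cellRadius
      gcongr
    have hbase : c * c' * ((n : ℝ) ^ e)⁻¹ ≤ c * F.real (atomCell S (meshInv n K) (l m))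
        * cellRadius n B (l m) := by
      calc c * c' * ((n : ℝ) ^ e)⁻¹ = c * (c' * ((n : ℝ) ^ k)⁻¹) * (((n : ℝ) ^ (R + 3)) ^ B)⁻¹ := by
            rw [he, pow_add, ← pow_mul, mul_inv]; ring
        _ ≤ _ := by
            gcongr
            exact hlmass m
    calc _ ≤ Real.log (1 / (c * c' * ((n : ℝ) ^ e)⁻¹)) := by
          apply Real.log_le_log
          · have := (cellRadius_mem hn hBpos (l m)).1
            have := hmasspos m
            positivity
          · exact one_div_le_one_div_of_le (by positivity) hbase
      _ = Real.log (1 / (c * c')) + e * Real.log n := by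
          rw [← Real.log_pow, ← Real.log_mul (by positivity) (by positivity)]
          congr 1
          field_simp
      _ ≤ |Real.log (1 / (c * c'))| / Real.log 2 * Real.log n + e * Real.log n := by
          gcongr
          calc Real.log (1 / (c * c')) ≤ |Real.log (1 / (c * c'))| := le_abs_self _
            _ = |Real.log (1 / (c * c'))| / Real.log 2 * Real.log 2 := by field_simp
            _ ≤ _ := by gcongr
      _ = _ := by rw [hC₅]; ring
  have hcost : ∑ i : T, cellCost c C₁ (F.real (atomCell S (meshInv n K) (i : Label d)))
      (cellRadius n B (i : Label d)) (v i) ≤ Fintype.card κ * (C₅ * Real.log n)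
        + C₁ * ∑ m, |u m| := by
    calc _ ≤ ∑ i : T, ∑ m with lT m = i, (C₅ * Real.log n + C₁ * |u m|) := by
          refine Finset.sum_le_sum fun i _ => ?_
          by_cases hi : v i = 0
          · rw [cellCost, if_pos hi]
            exact Finset.sum_nonneg fun m _ => by positivity
          · rw [cellCost, if_neg hi, Finset.sum_add_distrib]
            obtain ⟨m₀, hm₀⟩ := hfib i hi
            refine add_le_add ?_ ?_
            · calc _ ≤ C₅ * Real.log n := by rw [← hm₀]; exact hcost1 m₀
                _ ≤ _ := Finset.single_le_sum (f := fun _ => C₅ * Real.log n)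
                    (fun _ _ => by positivity) (Finset.mem_filter.2 ⟨Finset.mem_univ m₀, hm₀⟩)
            · rw [← Finset.mul_sum]
              gcongr
              exact Finset.abs_sum_le_sum_abs _ _
      _ = ∑ m, (C₅ * Real.log n + C₁ * |u m|) :=
          Finset.sum_fiberwise Finset.univ lT fun m => C₅ * Real.log n + C₁ * |u m|
      _ = _ := by
          rw [Finset.sum_add_distrib, Finset.sum_const, Finset.card_univ, nsmul_eq_mul,
            Finset.mul_sum]
  have happrox : ∀ j, |∑ i : T, v i * H j (cellPoint S (meshInv n K) (i : Label d))
      - ∑ m, u m * H j (ζ m)| ≤ Kc / (n : ℝ) ^ J * ∑ m, |u m| := by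
    intro j
    have h1 : ∑ i : T, v i * H j (cellPoint S (meshInv n K) (i : Label d))
        = ∑ m, u m * H j (cellPoint S (meshInv n K) (l m)) := by
      rw [← Finset.sum_fiberwise Finset.univ lT
        fun m => u m * H j (cellPoint S (meshInv n K) (l m))]
      refine Finset.sum_congr rfl fun i _ => ?_
      rw [hv, Finset.sum_mul]
      refine Finset.sum_congr rfl fun m hm => ?_
      rw [← (Finset.mem_filter.1 hm).2]
    rw [h1, ← Finset.sum_sub_distrib, Finset.mul_sum]
    refine (Finset.abs_sum_le_sum_abs _ _).trans (Finset.sum_le_sum fun m _ => ?_)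
    rw [← mul_sub, abs_mul, mul_comm]
    refine mul_le_mul_of_nonneg_right ?_ (abs_nonneg _)
    have e1 : |H j (z' m) - H j (cellPoint S (meshInv n K) (l m))| ≤ 4 * L * (d + 1) / (n : ℝ) ^ K :=
      kernel_sub_cellPoint_le hL0.le hLip (by omega) (by omega) (hz'mem m) (x j)
    have e2 : |H j (z' m) - H j (ζ m)| ≤ 4 * L / (n : ℝ) ^ J := by
      have hs : (1 : ℝ) / (n : ℝ) ^ (J + R + 1) ≤ 1 / (n : ℝ) ^ J :=
        one_div_le_one_div_of_le (by positivity) (pow_le_pow_right₀ hn1 (by omega))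
      have hone : (1 : ℝ) ≤ (n : ℝ) ^ R := one_le_pow₀ hn1
      calc _ ≤ L * ((1 + ‖(ζ m).1‖) * ‖(z' m).2.1 - (ζ m).2.1‖ + ‖(z' m).1 - (ζ m).1‖
            + |(z' m).2.2 - (ζ m).2.2|) := hLip (x j) (z' m) (ζ m)
        _ ≤ L * ((2 * (n : ℝ) ^ R) * (1 / (n : ℝ) ^ (J + R + 1)) + 1 / (n : ℝ) ^ (J + R + 1)
            + 1 / (n : ℝ) ^ (J + R + 1)) := by
            have e3 := hz'1 m
            have e4 := hz'2 m
            have e5 := hz'3 m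
            rw [norm_sub_rev] at e3 e4
            rw [abs_sub_comm] at e5
            have e6 : 1 + ‖(ζ m).1‖ ≤ 2 * (n : ℝ) ^ R := by linarith [hζR m]
            gcongr
        _ ≤ L * (2 * (1 / (n : ℝ) ^ J) + 1 / (n : ℝ) ^ J + 1 / (n : ℝ) ^ J) := by
            have e7 : (2 * (n : ℝ) ^ R) * (1 / (n : ℝ) ^ (J + R + 1)) ≤ 2 * (1 / (n : ℝ) ^ J) := by
              rw [pow_add, pow_add, pow_one]
              calc (2 * (n : ℝ) ^ R) * (1 / ((n : ℝ) ^ J * (n : ℝ) ^ R * n))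
                  = 2 * (1 / (n : ℝ) ^ J) * (1 / n) := by field_simp
                _ ≤ 2 * (1 / (n : ℝ) ^ J) * 1 := by
                    gcongr
                    rw [div_le_one hn0]; exact hn1
                _ = _ := mul_one _
            gcongr
        _ = _ := by ring
    have e3 : 4 * L * (d + 1) / (n : ℝ) ^ K ≤ 4 * L * (d + 1) / (n : ℝ) ^ J := by
      gcongr
      omega
    calc |H j (cellPoint S (meshInv n K) (l m)) - H j (ζ m)|
        ≤ |H j (cellPoint S (meshInv n K) (l m)) - H j (z' m)| + |H j (z' m) - H j (ζ m)| :=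
          abs_sub_le _ _ _
      _ ≤ 4 * L * (d + 1) / (n : ℝ) ^ J + 4 * L / (n : ℝ) ^ J := by
          rw [abs_sub_comm]
          exact add_le_add (e1.trans e3) e2
      _ = _ := by rw [hKc]; ring
  have hu0 : 0 ≤ ∑ m, |u m| := Finset.sum_nonneg fun m _ => abs_nonneg _
  refine le_trans (sub_le_sub ?_ herr) (hball.trans (measureReal_mono fun ω hω j hj => ?_))
  · apply Real.exp_le_exp.2
    rw [neg_le_neg_iff]
    have e1 : C₁ * (C₄ * (n : ℝ) ^ μ) ≤ C * (n : ℝ) ^ μ := by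
      rw [← mul_assoc]
      gcongr
      linarith
    have e2 : C₁ * ∑ m, |u m| ≤ C * ∑ m, |u m| := by
      gcongr
      linarith
    have e3 : Fintype.card κ * (C₅ * Real.log n) ≤ C * (Fintype.card κ * Real.log n) := by
      calc _ = C₅ * (Fintype.card κ * Real.log n) := by ring
        _ ≤ _ := by
          gcongr
          linarith
    have e4 := mul_le_mul_of_nonneg_left h2 hC₁.le
    linarith
  · have e1 := hω j hj
    have e2 := happrox j
    calc |mixture g (Q ω) (x j) - ∑ m, u m * kernel g (ζ m).1 (ζ m).2.2 (x j - (ζ m).2.1)|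
        ≤ |mixture g (Q ω) (x j) - ∑ i : T, v i * H j (cellPoint S (meshInv n K) (i : Label d))|
          + |∑ i : T, v i * H j (cellPoint S (meshInv n K) (i : Label d))
            - ∑ m, u m * H j (ζ m)| := abs_sub_le _ _ _
      _ ≤ (2 * (1 / (n : ℝ) ^ J) + L * (C₃ * ((n : ℝ) ^ J)⁻¹)) + Kc / (n : ℝ) ^ J * ∑ m, |u m| := by
          refine add_le_add (e1.trans ?_) e2
          gcongr
      _ = ((2 + L * C₃) + Kc * ∑ m, |u m|) / (n : ℝ) ^ J := by field_simp
      _ ≤ _ := by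
          gcongr
          rw [mul_add, mul_one]
          gcongr
          · linarith
          · linarith

end FiniteMixtures

/-! ### Local polynomial approximation and extrapolation -/

section Extrapolation

/-- Taylor's formula in a form adapted to chains of derivatives: `φ 0, …, φ k` are successive
derivatives on `[0, T]` and the last one oscillates by at most `C`. -/
lemma exists_polynomial_near {T C : ℝ} (hT : 0 ≤ T) (k : ℕ) :
    ∀ φ : ℕ → ℝ → ℝ,
      (∀ i < k, ∀ t ∈ Set.Icc 0 T, HasDerivAt (φ i) (φ (i + 1) t) t) →
      (∀ t ∈ Set.Icc 0 T, |φ k t - φ k 0| ≤ C) →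
      ∃ p : Polynomial ℝ, p.natDegree ≤ k ∧
        ∀ t ∈ Set.Icc 0 T, |φ 0 t - p.eval t| ≤ C * T ^ k := by
  suffices H : ∀ φ : ℕ → ℝ → ℝ,
      (∀ i < k, ∀ t ∈ Set.Icc 0 T, HasDerivAt (φ i) (φ (i + 1) t) t) →
      (∀ t ∈ Set.Icc 0 T, |φ k t - φ k 0| ≤ C) →
      ∀ t ∈ Set.Icc 0 T, |φ 0 t - (∑ i ∈ Finset.range (k + 1),
        Polynomial.C (φ i 0 / (i.factorial : ℝ)) * Polynomial.X ^ i).eval t| ≤ C * T ^ k by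
    intro φ h1 h2
    refine ⟨_, ?_, H φ h1 h2⟩
    refine Polynomial.natDegree_sum_le_of_forall_le _ _ fun i hi => ?_
    refine (Polynomial.natDegree_C_mul_X_pow_le _ _).trans ?_
    have := Finset.mem_range.1 hi
    omega
  induction k with
  | zero =>
    intro φ _ h2 t ht
    simpa using h2 t ht
  | succ k ih =>
    intro φ h1 h2 t ht
    have hC : 0 ≤ C := (abs_nonneg _).trans (h2 t ht)
    have hder := ih (fun i => φ (i + 1)) (fun i hi => h1 (i + 1) (by omega)) h2
    set p : Polynomial ℝ := ∑ i ∈ Finset.range (k + 1 + 1),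
      Polynomial.C (φ i 0 / (i.factorial : ℝ)) * Polynomial.X ^ i with hp
    have hp' : Polynomial.derivative p = ∑ i ∈ Finset.range (k + 1),
        Polynomial.C (φ (i + 1) 0 / (i.factorial : ℝ)) * Polynomial.X ^ i := by
      rw [hp, Finset.sum_range_succ', Polynomial.derivative_add, Polynomial.derivative_sum]
      simp only [pow_zero, mul_one, Polynomial.derivative_C, add_zero]
      refine Finset.sum_congr rfl fun i _ => ?_
      rw [Polynomial.derivative_C_mul_X_pow, Nat.factorial_succ, Nat.add_sub_cancel]
      congr 2
      push_cast
      field_simp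
    have hp0 : p.eval 0 = φ 0 0 := by
      rw [hp, Finset.sum_range_succ']
      simp [Polynomial.eval_finsetSum]
    have hψ : ∀ s ∈ Set.Icc 0 T, HasDerivWithinAt (fun s => φ 0 s - p.eval s)
        (φ 1 s - (Polynomial.derivative p).eval s) (Set.Icc 0 T) s := fun s hs =>
      ((h1 0 (by omega) s hs).sub (p.hasDerivAt s)).hasDerivWithinAt
    have hb : ∀ s ∈ Set.Icc 0 T, ‖φ 1 s - (Polynomial.derivative p).eval s‖ ≤ C * T ^ k := by
      intro s hs
      rw [hp', Real.norm_eq_abs]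
      exact hder s hs
    have h0 : (0 : ℝ) ∈ Set.Icc 0 T := ⟨le_rfl, hT⟩
    have := (convex_Icc (0 : ℝ) T).norm_image_sub_le_of_norm_hasDerivWithin_le hψ hb h0 ht
    rw [hp0, sub_self, sub_zero, Real.norm_eq_abs, Real.norm_eq_abs, sub_zero,
      abs_of_nonneg ht.1] at this
    calc _ ≤ C * T ^ k * t := this
      _ ≤ C * T ^ k * T := by gcongr; exact ht.2
      _ = _ := by ring

/-- Extrapolation weights: a polynomial of degree less than `J` is recovered at `0` from its values
at `1, …, J`. -/
lemma exists_extrapolation_weights (J : ℕ) : ∃ c : Fin J → ℝ, ∀ p : Polynomial ℝ,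
    p.degree < J → ∑ j, c j * p.eval ((j : ℝ) + 1) = p.eval 0 := by
  refine ⟨fun j => (Lagrange.basis Finset.univ (fun i : Fin J => (i : ℝ) + 1) j).eval 0,
    fun p hp => ?_⟩
  have hinj : Set.InjOn (fun i : Fin J => (i : ℝ) + 1) (Finset.univ : Finset (Fin J)) := by
    intro a _ b _ hab
    have : (a : ℝ) = b := by simpa using hab
    exact Fin.ext (by exact_mod_cast this)
  have h := Lagrange.eq_interpolate (s := Finset.univ) hinj (f := p) (by simpa using hp)
  conv_rhs => rw [h]
  rw [Lagrange.interpolate_apply, Polynomial.eval_finsetSum]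
  refine Finset.sum_congr rfl fun j _ => ?_
  rw [Polynomial.eval_mul, Polynomial.eval_C, mul_comm]

variable {d : ℕ} {S : ℝ}

/-- The `i`-th derivative of `t ↦ F (x + t • v)`. -/
lemma hasDerivAt_iteratedFDeriv_line {F : E d → ℝ} {x v : E d} {t : ℝ} {i : ℕ}
    (hF : ContDiffAt ℝ (i + 1 : ℕ) F (x + t • v)) :
    HasDerivAt (fun t : ℝ => iteratedFDeriv ℝ i F (x + t • v) fun _ => v)
      (iteratedFDeriv ℝ (i + 1) F (x + t • v) fun _ => v) t := by
  have h1 : DifferentiableAt ℝ (iteratedFDeriv ℝ i F) (x + t • v) :=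
    hF.differentiableAt_iteratedFDeriv (by exact_mod_cast Nat.lt_succ_self i)
  have h2 : HasDerivAt (fun t : ℝ => x + t • v) v t := by
    simpa using ((hasDerivAt_id t).smul_const v).const_add x
  have h3 := h1.hasFDerivAt.comp_hasDerivAt t h2
  have h4 := ((ContinuousMultilinearMap.apply ℝ (fun _ : Fin i => E d) ℝ
    fun _ => v).hasFDerivAt).comp_hasDerivAt t h3
  rw [iteratedFDeriv_succ_apply_left]
  exact h4

/-- The `k`-th directional derivative along `v` is controlled by the partial derivatives. -/
lemma abs_iteratedFDeriv_sub_diag_le {k : ℕ} {F : E d → ℝ} {x y v : E d} {C : ℝ}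
    (h : ∀ s : Fin k → Fin d, |partialDeriv s F x - partialDeriv s F y| ≤ C) :
    |(iteratedFDeriv ℝ k F x fun _ => v) - iteratedFDeriv ℝ k F y fun _ => v|
      ≤ (d : ℝ) ^ k * C * ‖v‖ ^ k := by
  have hv : v = ∑ i, v i • EuclideanSpace.single i (1 : ℝ) := by
    ext j
    simp [Finset.sum_apply, Pi.single_apply]
  have hexp : ∀ z, (iteratedFDeriv ℝ k F z fun _ => v)
      = ∑ s : Fin k → Fin d, (∏ j, v (s j)) * partialDeriv s F z := by
    intro z
    conv_lhs => rw [hv]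
    rw [ContinuousMultilinearMap.map_sum]
    refine Finset.sum_congr rfl fun s _ => ?_
    rw [ContinuousMultilinearMap.map_smul_univ, smul_eq_mul]
    rfl
  rw [hexp, hexp, ← Finset.sum_sub_distrib]
  calc |∑ s : Fin k → Fin d, ((∏ j, v (s j)) * partialDeriv s F x
          - (∏ j, v (s j)) * partialDeriv s F y)|
      ≤ ∑ s : Fin k → Fin d, ‖v‖ ^ k * C := by
        refine (Finset.abs_sum_le_sum_abs _ _).trans (Finset.sum_le_sum fun s _ => ?_)
        rw [← mul_sub, abs_mul, Finset.abs_prod]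
        refine mul_le_mul ?_ (h s) (abs_nonneg _) (by positivity)
        calc ∏ j, |v (s j)| ≤ ∏ _j : Fin k, ‖v‖ :=
              Finset.prod_le_prod (fun _ _ => abs_nonneg _) fun j _ => abs_apply_le_norm v (s j)
          _ = _ := by simp
    _ = _ := by
        simp
        ring

lemma isOpen_openCube : IsOpen (openCube d S) := by
  have : openCube d S = ⋂ i, (fun x : E d => x i) ⁻¹' Set.Ioo (-S) S := by
    ext x; simp [openCube]
  rw [this]
  exact isOpen_iInter_of_finite fun i => isOpen_Ioo.preimage (by fun_prop)

lemma openCube_subset_cube : openCube d S ⊆ cube d S :=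
  fun _ hx i => Set.Ioo_subset_Icc_self (hx i)

lemma isClosed_cube : IsClosed (cube d S) := by
  have : cube d S = ⋂ i, (fun x : E d => x i) ⁻¹' Set.Icc (-S) S := by
    ext x; simp [cube]
  rw [this]
  exact isClosed_iInter fun i => isClosed_Icc.preimage (by fun_prop)

lemma norm_le_of_mem_cube {x : E d} (hx : x ∈ cube d S) : ‖x‖ ≤ d * |S| := by
  have := norm_sub_le_of_coord (x := x) (y := 0) (abs_nonneg S)
    (fun i => by simpa using (abs_le.2 (hx i)).trans (le_abs_self S))
  simpa using this

lemma isCompact_cube : IsCompact (cube d S) :=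
  (Metric.isCompact_of_isClosed_isBounded isClosed_cube
    ((Metric.isBounded_closedBall (x := (0 : E d)) (r := d * |S|)).subset
      fun x hx => by simpa using norm_le_of_mem_cube hx))

/-- Along segments in the open cube, a Hölder function is close to a polynomial. -/
lemma IsHolderOnCube.exists_polynomial_near {β T : ℝ} {f : E d → ℝ} (hβ : 0 < β) (hT : 0 ≤ T)
    (hf : IsHolderOnCube S β f) : ∃ C, 0 ≤ C ∧ ∀ x v : E d,
      (∀ t ∈ Set.Icc 0 T, x + t • v ∈ openCube d S) →
      ∃ p : Polynomial ℝ, p.natDegree ≤ holderOrder β ∧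
        ∀ t ∈ Set.Icc 0 T, |f (x + t • v) - p.eval t| ≤ C * ‖v‖ ^ β := by
  set k := holderOrder β with hk
  have hkβ : (k : ℝ) < β := by
    have h1 : 1 ≤ ⌈β⌉₊ := Nat.one_le_ceil_iff.2 hβ
    have h2 := Nat.ceil_lt_add_one hβ.le
    rw [hk, holderOrder, Nat.cast_sub h1]
    push_cast
    linarith
  obtain ⟨C, hC⟩ := hf.holder
  refine ⟨(d : ℝ) ^ k * (|C| * T ^ (β - k)) * T ^ k, by positivity, fun x v hxv => ?_⟩
  have hx : x ∈ openCube d S := by simpa using hxv 0 ⟨le_rfl, hT⟩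
  obtain ⟨p, hp, hp'⟩ := LocMod.exists_polynomial_near hT k
    (C := (d : ℝ) ^ k * (|C| * (T * ‖v‖) ^ (β - k)) * ‖v‖ ^ k)
    (fun i t => iteratedFDeriv ℝ i f (x + t • v) fun _ => v)
    (fun i hi t ht => hasDerivAt_iteratedFDeriv_line
      ((hf.contDiffOn.contDiffAt (isOpen_openCube.mem_nhds (hxv t ht))).of_le
        (by exact_mod_cast hi)))
    (fun t ht => by
      simp only [zero_smul, add_zero]
      refine abs_iteratedFDeriv_sub_diag_le fun s => ?_
      refine (hC s _ (hxv t ht) _ hx).trans ?_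
      rw [add_sub_cancel_left, norm_smul, Real.norm_eq_abs, abs_of_nonneg ht.1]
      have := ht.1
      have h3 : 0 ≤ β - k := by linarith
      have h4 := ht.2
      gcongr
      · exact le_abs_self C)
  refine ⟨p, hp, fun t ht => ?_⟩
  have h5 := hp' t ht
  simp only [iteratedFDeriv_zero_apply] at h5
  refine h5.trans (le_of_eq ?_)
  rcases (norm_nonneg v).eq_or_lt with h0 | h0
  · rw [← h0, mul_zero, Real.zero_rpow hβ.ne', Real.zero_rpow (by linarith : β - k ≠ 0)]
    ring
  · rw [Real.mul_rpow hT h0.le]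
    have : ‖v‖ ^ β = ‖v‖ ^ (β - k) * ‖v‖ ^ k := by
      rw [← Real.rpow_natCast, ← Real.rpow_add h0]
      ring_nf
    rw [this]
    ring

/-- Along segments in the cube, a smooth function is close to a polynomial. -/
lemma exists_polynomial_near_of_contDiffAt {T : ℝ} {h : E d → ℝ} (hT : 0 ≤ T)
    (hh : ∀ x ∈ cube d S, ∀ n : ℕ, ContDiffAt ℝ n h x) (k : ℕ) : ∃ C, 0 ≤ C ∧ ∀ x v : E d,
      (∀ t ∈ Set.Icc 0 T, x + t • v ∈ cube d S) →
      ∃ p : Polynomial ℝ, p.natDegree ≤ k ∧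
        ∀ t ∈ Set.Icc 0 T, |h (x + t • v) - p.eval t| ≤ C * ‖v‖ ^ k := by
  have hcont : ContinuousOn (iteratedFDeriv ℝ k h) (cube d S) := fun x hx =>
    ((hh x hx (k + 1)).differentiableAt_iteratedFDeriv
      (by exact_mod_cast Nat.lt_succ_self k)).continuousAt.continuousWithinAt
  obtain ⟨C, hC⟩ := isCompact_cube.exists_bound_of_continuousOn hcont
  refine ⟨2 * |C| * T ^ k, by positivity, fun x v hxv => ?_⟩
  have hb : ∀ t ∈ Set.Icc 0 T, |iteratedFDeriv ℝ k h (x + t • v) fun _ => v| ≤ |C| * ‖v‖ ^ k := by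
    intro t ht
    refine ((iteratedFDeriv ℝ k h (x + t • v)).le_opNorm _).trans ?_
    rw [Finset.prod_const, Finset.card_univ, Fintype.card_fin]
    gcongr
    exact (hC _ (hxv t ht)).trans (le_abs_self C)
  obtain ⟨p, hp, hp'⟩ := LocMod.exists_polynomial_near hT k (C := 2 * |C| * ‖v‖ ^ k)
    (fun i t => iteratedFDeriv ℝ i h (x + t • v) fun _ => v)
    (fun i hi t ht => hasDerivAt_iteratedFDeriv_line (hh _ (hxv t ht) (i + 1)))
    (fun t ht => by
      have h1 := hb t ht
      have h2 := hb 0 ⟨le_rfl, hT⟩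
      exact (abs_sub _ _).trans (by linarith))
  refine ⟨p, hp, fun t ht => ?_⟩
  have h5 := hp' t ht
  simp only [iteratedFDeriv_zero_apply] at h5
  exact h5.trans (le_of_eq (by ring))

/-- Extrapolation of the product of a Hölder function and a smooth function: its value at `x` is
recovered, up to the Hölder rate, from its values at `x + v, …, x + J v`. -/
lemma exists_extrapolation_error_le {β : ℝ} (hβ : 0 < β) {f h : E d → ℝ}
    (hf : IsHolderOnCube S β f) (hh : ∀ x ∈ cube d S, ∀ n : ℕ, ContDiffAt ℝ n h x) :
    ∃ (J : ℕ) (c : Fin J → ℝ) (C : ℝ), 0 ≤ C ∧ ∀ x v : E d, ‖v‖ ≤ 1 →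
      (∀ t ∈ Set.Icc (0 : ℝ) J, x + t • v ∈ openCube d S) →
      |f x * h x - ∑ j, c j * (f (x + ((j : ℝ) + 1) • v) * h (x + ((j : ℝ) + 1) • v))|
        ≤ C * ‖v‖ ^ β := by
  set k := holderOrder β with hk
  have hβk : β ≤ (k + 1 : ℕ) := by
    have h1 : 1 ≤ ⌈β⌉₊ := Nat.one_le_ceil_iff.2 hβ
    rw [hk, holderOrder, Nat.sub_add_cancel h1]
    exact Nat.le_ceil β
  -- `J` exceeds the degree of a product of polynomials of degrees at most `k` and `k + 1`.
  set J : ℕ := 2 * k + 2 with hJ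
  obtain ⟨c, hc⟩ := exists_extrapolation_weights J
  obtain ⟨C₁, hC₁, h1⟩ := hf.exists_polynomial_near hβ (T := J) (by positivity)
  obtain ⟨C₂, hC₂, h2⟩ := exists_polynomial_near_of_contDiffAt (T := J) (by positivity) hh (k + 1)
  obtain ⟨Mf, hMf⟩ := isCompact_cube.exists_bound_of_continuousOn hf.continuousOn
  obtain ⟨Mh, hMh⟩ := isCompact_cube.exists_bound_of_continuousOn
    (fun x hx => (hh x hx 0).continuousAt.continuousWithinAt : ContinuousOn h (cube d S))
  set C₃ : ℝ := C₁ * |Mh| + (|Mf| + C₁) * C₂ with hC₃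
  have hC₃0 : 0 ≤ C₃ := by positivity
  refine ⟨J, c, C₃ * (1 + ∑ j, |c j|), ?_, fun x v hv hxv => ?_⟩
  · have : 0 ≤ ∑ j, |c j| := Finset.sum_nonneg fun j _ => abs_nonneg (c j)
    positivity
  obtain ⟨p, hp, hp'⟩ := h1 x v hxv
  obtain ⟨q, hq, hq'⟩ := h2 x v fun t ht => openCube_subset_cube (hxv t ht)
  have hvβ1 : ‖v‖ ^ β ≤ 1 := Real.rpow_le_one (norm_nonneg _) hv hβ.le
  have hvk : ‖v‖ ^ (k + 1) ≤ ‖v‖ ^ β := by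
    rcases (norm_nonneg v).eq_or_lt with h0 | h0
    · rw [← h0, Real.zero_rpow hβ.ne', zero_pow (by omega)]
    · rw [← Real.rpow_natCast]
      exact Real.rpow_le_rpow_of_exponent_ge h0 hv hβk
  have hprod : ∀ t ∈ Set.Icc (0 : ℝ) J,
      |f (x + t • v) * h (x + t • v) - (p * q).eval t| ≤ C₃ * ‖v‖ ^ β := by
    intro t ht
    have hmem := openCube_subset_cube (hxv t ht)
    have e1 := hp' t ht
    have e2 := (hq' t ht).trans (mul_le_mul_of_nonneg_left hvk hC₂)
    have e3 : |f (x + t • v)| ≤ |Mf| := (hMf _ hmem).trans (le_abs_self _)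
    have e4 : |h (x + t • v)| ≤ |Mh| := (hMh _ hmem).trans (le_abs_self _)
    have e5 : |p.eval t| ≤ |Mf| + C₁ := by
      have e6 : |p.eval t| ≤ |f (x + t • v)| + |f (x + t • v) - p.eval t| := by
        have := abs_sub (f (x + t • v)) (f (x + t • v) - p.eval t)
        rwa [sub_sub_cancel] at this
      nlinarith
    rw [Polynomial.eval_mul]
    calc |f (x + t • v) * h (x + t • v) - p.eval t * q.eval t|
        = |(f (x + t • v) - p.eval t) * h (x + t • v)
            + p.eval t * (h (x + t • v) - q.eval t)| := by ring_nf
      _ ≤ C₁ * ‖v‖ ^ β * |Mh| + (|Mf| + C₁) * (C₂ * ‖v‖ ^ β) := by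
          refine (abs_add_le _ _).trans ?_
          rw [abs_mul, abs_mul]
          gcongr
      _ = _ := by rw [hC₃]; ring
  have hdeg : (p * q).degree < J := by
    refine Polynomial.degree_le_natDegree.trans_lt ?_
    have := (Polynomial.natDegree_mul_le (p := p) (q := q))
    exact_mod_cast (by omega : (p * q).natDegree < J)
  have e0 := hprod 0 ⟨le_rfl, by positivity⟩
  rw [zero_smul, add_zero, ← hc _ hdeg] at e0
  have e1 : |∑ j, c j * (p * q).eval ((j : ℝ) + 1)
      - ∑ j, c j * (f (x + ((j : ℝ) + 1) • v) * h (x + ((j : ℝ) + 1) • v))|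
      ≤ (∑ j, |c j|) * (C₃ * ‖v‖ ^ β) := by
    rw [← Finset.sum_sub_distrib, Finset.sum_mul]
    refine (Finset.abs_sum_le_sum_abs _ _).trans (Finset.sum_le_sum fun j _ => ?_)
    rw [← mul_sub, abs_mul, abs_sub_comm]
    gcongr
    refine hprod _ ⟨by positivity, ?_⟩
    exact_mod_cast j.2
  calc _ ≤ _ := abs_sub_le _ _ _
    _ ≤ _ := add_le_add e0 e1
    _ = _ := by ring

end Extrapolation

/-! ### Powers of the Dirichlet kernel -/

section DirichletKernel

/-- The normalized Dirichlet sum `D⁻¹ ∑_{k < D} e^{iku}`. -/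
def dirichletMean (D : ℕ) (u : ℝ) : ℂ :=
  (D : ℂ)⁻¹ * ∑ k ∈ Finset.range D, Complex.exp (Complex.I * u) ^ k

lemma norm_exp_I_mul (u : ℝ) : ‖Complex.exp (Complex.I * u)‖ = 1 := by
  rw [mul_comm, Complex.norm_exp_ofReal_mul_I]

lemma norm_dirichletMean_le_one (D : ℕ) (u : ℝ) : ‖dirichletMean D u‖ ≤ 1 := by
  rw [dirichletMean, norm_mul, norm_inv, Complex.norm_natCast]
  have h : ‖∑ k ∈ Finset.range D, Complex.exp (Complex.I * u) ^ k‖ ≤ D := by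
    refine (norm_sum_le _ _).trans ?_
    simp [norm_pow]
  rcases Nat.eq_zero_or_pos D with rfl | hD
  · simp
  · have hD' : (0 : ℝ) < D := by exact_mod_cast hD
    calc _ ≤ (D : ℝ)⁻¹ * D := by gcongr
      _ = 1 := by field_simp

/-- Away from the origin the Dirichlet sum is small, as a geometric sum. -/
lemma norm_dirichletMean_le_half {D : ℕ} {u : ℝ} (hD : 2 * Real.pi ≤ D * |u|) (hu : |u| ≤ 1) :
    ‖dirichletMean D u‖ ≤ 1 / 2 := by
  have hpi := Real.pi_gt_three
  have hDu : 0 < (D : ℝ) * |u| := by linarith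
  have hu0 : 0 < |u| := by
    by_contra h
    have : |u| = 0 := le_antisymm (not_lt.1 h) (abs_nonneg u)
    rw [this] at hDu
    simp at hDu
  have hD0 : (0 : ℝ) < D := by
    by_contra h
    nlinarith
  have h1 : 2 * |u| / Real.pi ≤ ‖Complex.exp (Complex.I * u) - 1‖ := by
    rw [Complex.norm_exp_I_mul_ofReal_sub_one, Real.norm_eq_abs, abs_mul, abs_two]
    have h2 : |u / 2| ≤ Real.pi / 2 := by
      rw [abs_div, abs_two]
      linarith
    have := Real.mul_abs_le_abs_sin h2
    rw [abs_div, abs_two] at this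
    calc 2 * |u| / Real.pi = 2 * (2 / Real.pi * (|u| / 2)) := by ring
      _ ≤ _ := by gcongr
  have h0 : 0 < 2 * |u| / Real.pi := by positivity
  have hne : Complex.exp (Complex.I * u) ≠ 1 := by
    intro h
    rw [h, sub_self, norm_zero] at h1
    linarith
  rw [dirichletMean, geom_sum_eq hne, norm_mul, norm_inv, Complex.norm_natCast, norm_div]
  have h3 : ‖Complex.exp (Complex.I * u) ^ D - 1‖ ≤ 2 := by
    refine (norm_sub_le _ _).trans ?_
    rw [norm_pow, norm_exp_I_mul]
    norm_num
  calc _ ≤ (D : ℝ)⁻¹ * (2 / (2 * |u| / Real.pi)) := by gcongr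
    _ = Real.pi / (D * |u|) := by field_simp
    _ ≤ 1 / 2 := by
      rw [div_le_iff₀ hDu]
      linarith

/-- Near the origin the Dirichlet sum is close to one. -/
lemma one_sub_le_norm_dirichletMean {D : ℕ} (hD : 0 < D) (u : ℝ) :
    1 - (D * u) ^ 2 / 2 ≤ ‖dirichletMean D u‖ := by
  have hD' : (0 : ℝ) < D := by exact_mod_cast hD
  refine le_trans ?_ (Complex.re_le_norm _)
  have h1 : (dirichletMean D u).re = (D : ℝ)⁻¹ * ∑ k ∈ Finset.range D, Real.cos (k * u) := by
    have h2 : ∀ k : ℕ, Complex.exp (Complex.I * u) ^ k = Complex.exp (((k * u : ℝ) : ℂ) * Complex.I) := by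
      intro k
      rw [← Complex.exp_nat_mul]
      congr 1
      push_cast
      ring
    rw [dirichletMean, show ((D : ℂ)⁻¹) = (((D : ℝ)⁻¹ : ℝ) : ℂ) by push_cast; rfl,
      Complex.re_ofReal_mul, Complex.re_sum]
    congr 1
    refine Finset.sum_congr rfl fun k _ => ?_
    rw [h2, Complex.exp_ofReal_mul_I_re]
  rw [h1]
  have h3 : ∑ _k ∈ Finset.range D, (1 - (D * u) ^ 2 / 2)
      ≤ ∑ k ∈ Finset.range D, Real.cos (k * u) := by
    refine Finset.sum_le_sum fun k hk => ?_
    have hk' : (k : ℝ) ≤ D := by exact_mod_cast (Finset.mem_range.1 hk).le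
    have h4 := Real.one_sub_sq_div_two_le_cos (x := k * u)
    have h5 : ((k : ℝ) * u) ^ 2 ≤ (D * u) ^ 2 := by
      rw [mul_pow, mul_pow]
      gcongr
    linarith
  rw [Finset.sum_const, Finset.card_range, nsmul_eq_mul] at h3
  calc 1 - (D * u) ^ 2 / 2 = (D : ℝ)⁻¹ * (D * (1 - (D * u) ^ 2 / 2)) := by field_simp
    _ ≤ _ := by gcongr

/-- Reversing the order of summation relates the Dirichlet sum to its conjugate, so that the square of
its modulus is a trigonometric polynomial. -/
lemma conj_dirichletMean (D : ℕ) (u : ℝ) : (starRingEnd ℂ) (dirichletMean D u)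
    = Complex.exp (-(Complex.I * u)) ^ (D - 1) * dirichletMean D u := by
  have h1 : (starRingEnd ℂ) (Complex.exp (Complex.I * u)) = Complex.exp (-(Complex.I * u)) := by
    rw [← Complex.exp_conj]
    simp
  have h2 : Complex.exp (-(Complex.I * u)) * Complex.exp (Complex.I * u) = 1 := by
    rw [← Complex.exp_add]
    simp
  rw [dirichletMean, map_mul, map_sum, map_inv₀, Complex.conj_natCast, mul_left_comm]
  congr 1
  rw [← Finset.sum_range_reflect, Finset.mul_sum]
  refine Finset.sum_congr rfl fun k hk => ?_
  have hk' := Finset.mem_range.1 hk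
  rw [map_pow, h1]
  have h3 : D - 1 = (D - 1 - k) + k := by omega
  conv_rhs => rw [h3]
  rw [pow_add, mul_assoc, ← mul_pow, h2, one_pow, mul_one]

lemma coeff_pow_nonneg {p : Polynomial ℝ} (hp : ∀ i, 0 ≤ p.coeff i) (n : ℕ) :
    ∀ i, 0 ≤ (p ^ n).coeff i := by
  induction n with
  | zero =>
    intro i
    rw [pow_zero, Polynomial.coeff_one]
    split_ifs <;> norm_num
  | succ n ih =>
    intro i
    rw [pow_succ, Polynomial.coeff_mul]
    exact Finset.sum_nonneg fun _ _ => mul_nonneg (ih _) (hp _)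

/-- The even powers of the modulus of the Dirichlet sum are convex combinations of characters. -/
lemma exists_norm_dirichletMean_pow_eq {D : ℕ} (hD : 0 < D) (r : ℕ) :
    ∃ p : Fin (2 * r * D + 1) → ℝ, (∀ m, 0 ≤ p m) ∧ ∑ m, p m = 1 ∧ ∀ u : ℝ,
      ((‖dirichletMean D u‖ ^ (2 * r) : ℝ) : ℂ)
        = ∑ m, (p m : ℂ) * Complex.exp ((((m : ℝ) - r * (D - 1 : ℕ)) * u : ℝ) * Complex.I) := by
  have hD' : (0 : ℝ) < D := by exact_mod_cast hD
  -- The Dirichlet sum is the value of `D⁻¹ q` at `e^{iu}`; the weights are the coefficients of a power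
  -- of `q`, which add up to `q(1) ^ (2 r) = D ^ (2 r)`.
  set q : Polynomial ℝ := ∑ k ∈ Finset.range D, Polynomial.X ^ k with hq
  have hq0 : ∀ i, 0 ≤ q.coeff i := by
    intro i
    rw [hq, Polynomial.finsetSum_coeff]
    refine Finset.sum_nonneg fun k _ => ?_
    rw [Polynomial.coeff_X_pow]
    split_ifs <;> norm_num
  have hdeg : (q ^ (2 * r)).natDegree < 2 * r * D + 1 := by
    have h1 : q.natDegree ≤ D := by
      refine Polynomial.natDegree_sum_le_of_forall_le _ _ fun k hk => ?_
      rw [Polynomial.natDegree_X_pow]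
      exact (Finset.mem_range.1 hk).le
    calc _ ≤ 2 * r * q.natDegree := Polynomial.natDegree_pow_le
      _ ≤ 2 * r * D := by gcongr
      _ < _ := Nat.lt_succ_self _
  refine ⟨fun m => ((D : ℝ) ^ (2 * r))⁻¹ * (q ^ (2 * r)).coeff m,
    fun m => mul_nonneg (by positivity) (coeff_pow_nonneg hq0 _ _), ?_, fun u => ?_⟩
  · rw [← Finset.mul_sum, Fin.sum_univ_eq_sum_range fun m => (q ^ (2 * r)).coeff m]
    have h := Polynomial.eval_eq_sum_range' hdeg (1 : ℝ)
    simp only [one_pow, mul_one] at h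
    rw [← h, Polynomial.eval_pow, hq, Polynomial.eval_finsetSum]
    simp only [Polynomial.eval_pow, Polynomial.eval_X, one_pow, Finset.sum_const,
      Finset.card_range, nsmul_eq_mul, mul_one]
    field_simp
  · set e : ℂ := Complex.exp (Complex.I * u) with he
    set e' : ℂ := Complex.exp (-(Complex.I * u)) with he'
    have h1 : ((‖dirichletMean D u‖ ^ (2 * r) : ℝ) : ℂ)
        = e' ^ (r * (D - 1)) * dirichletMean D u ^ (2 * r) := by
      rw [pow_mul]
      push_cast
      rw [← Complex.mul_conj', conj_dirichletMean, ← he']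
      ring
    have h2 : dirichletMean D u ^ (2 * r)
        = ((D : ℂ) ^ (2 * r))⁻¹ * Polynomial.aeval e (q ^ (2 * r)) := by
      rw [dirichletMean, mul_pow, inv_pow, map_pow, hq, map_sum]
      simp [he]
    rw [h1, h2, Polynomial.aeval_eq_sum_range' hdeg, Finset.mul_sum, Finset.mul_sum,
      ← Fin.sum_univ_eq_sum_range fun m => e' ^ (r * (D - 1)) *
        (((D : ℂ) ^ (2 * r))⁻¹ * ((q ^ (2 * r)).coeff m • e ^ m))]
    refine Finset.sum_congr rfl fun m _ => ?_
    have h3 : Complex.exp ((((m : ℝ) - r * (D - 1 : ℕ)) * u : ℝ) * Complex.I)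
        = e' ^ (r * (D - 1)) * e ^ (m : ℕ) := by
      rw [he, he', ← Complex.exp_nat_mul, ← Complex.exp_nat_mul, ← Complex.exp_add]
      congr 1
      push_cast
      ring
    rw [h3, Complex.real_smul]
    push_cast
    ring

lemma continuous_dirichletMean (D : ℕ) : Continuous (dirichletMean D) := by
  unfold dirichletMean
  fun_prop

end DirichletKernel

section ProductKernel

variable {d : ℕ}

/-- The product kernel with frequency scale `1 / l`. -/
def productKernel (D r : ℕ) (l : ℝ) (z : E d) : ℝ :=
  ∏ i, ‖dirichletMean D (z i / l)‖ ^ (2 * r)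

lemma productKernel_nonneg (D r : ℕ) (l : ℝ) (z : E d) : 0 ≤ productKernel D r l z :=
  Finset.prod_nonneg fun _ _ => by positivity

lemma continuous_productKernel (D r : ℕ) (l : ℝ) : Continuous (productKernel (d := d) D r l) := by
  unfold productKernel
  refine continuous_finsetProd _ fun i _ => ?_
  exact (((continuous_dirichletMean D).comp (by fun_prop)).norm).pow _

/-- The kernel is exponentially small in `r` where one coordinate is away from zero. -/
lemma productKernel_le_inv_four_pow {D r : ℕ} {l : ℝ} {z : E d} (i : Fin d)
    (hi : 2 * Real.pi ≤ D * |z i / l|) (hi1 : |z i / l| ≤ 1) :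
    productKernel D r l z ≤ (4 ^ r)⁻¹ := by
  rw [productKernel, ← Finset.mul_prod_erase _ _ (Finset.mem_univ i)]
  have h1 : ‖dirichletMean D (z i / l)‖ ^ (2 * r) ≤ (4 ^ r)⁻¹ := by
    calc _ ≤ (1 / 2 : ℝ) ^ (2 * r) := by
          gcongr
          exact norm_dirichletMean_le_half hi hi1
      _ = _ := by
          rw [pow_mul, ← inv_pow]
          norm_num
  have h2 : ∏ j ∈ Finset.univ.erase i, ‖dirichletMean D (z j / l)‖ ^ (2 * r) ≤ 1 :=
    Finset.prod_le_one (fun _ _ => by positivity)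
      fun j _ => pow_le_one₀ (norm_nonneg _) (norm_dirichletMean_le_one D _)
  calc _ ≤ ((4 : ℝ) ^ r)⁻¹ * 1 := by
        gcongr
    _ = _ := mul_one _

/-- The kernel is bounded below on a cube of side proportional to `1 / (D r)`. -/
lemma inv_two_pow_le_productKernel {D r : ℕ} (hD : 0 < D) (hr : 0 < r) {l : ℝ} {z : E d}
    (hz : ∀ i, |z i / l| ≤ 1 / (2 * D * r)) : (2 ^ d)⁻¹ ≤ productKernel D r l z := by
  have hD' : (0 : ℝ) < D := by exact_mod_cast hD
  have hr' : (1 : ℝ) ≤ r := by exact_mod_cast hr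
  have key : ∀ i, (1 / 2 : ℝ) ≤ ‖dirichletMean D (z i / l)‖ ^ (2 * r) := by
    intro i
    have h1 := one_sub_le_norm_dirichletMean hD (z i / l)
    have h2 : ((D : ℝ) * (z i / l)) ^ 2 ≤ (1 / (2 * r)) ^ 2 := by
      rw [← sq_abs, abs_mul, abs_of_pos hD']
      gcongr
      calc (D : ℝ) * |z i / l| ≤ D * (1 / (2 * D * r)) := by gcongr; exact hz i
        _ = _ := by field_simp
    have h3 : ((1 : ℝ) / (2 * r)) ^ 2 = 1 / (4 * r ^ 2) := by
      field_simp
      norm_num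
    have h4 : 1 / (4 * (r : ℝ) ^ 2) ≤ 1 / (4 * r) := by
      gcongr
      nlinarith
    have h4' : 1 / (4 * (r : ℝ)) ≤ 1 / 4 := by
      gcongr
      linarith
    have h5 : 1 + (-(1 / (8 * (r : ℝ)))) ≤ ‖dirichletMean D (z i / l)‖ := by
      have : 1 / (8 * (r : ℝ)) = 1 / (4 * r) / 2 := by field_simp; norm_num
      linarith
    have h8 : 1 / (8 * (r : ℝ)) ≤ 1 / 8 := by
      gcongr
      linarith
    have h6 := one_add_mul_le_pow (a := -(1 / (8 * (r : ℝ)))) (by linarith) (2 * r)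
    have h7 : (1 / 2 : ℝ) ≤ 1 + (2 * r : ℕ) * (-(1 / (8 * (r : ℝ)))) := by
      have : (1 : ℝ) + (2 * r : ℕ) * (-(1 / (8 * (r : ℝ)))) = 1 - 1 / 4 := by
        push_cast
        field_simp
        norm_num
      rw [this]
      norm_num
    exact (h7.trans h6).trans (pow_le_pow_left₀ (by linarith) h5 _)
  calc ((2 : ℝ) ^ d)⁻¹ = ∏ _i : Fin d, (1 / 2 : ℝ) := by simp
    _ ≤ _ := Finset.prod_le_prod (fun _ _ => by norm_num) fun i _ => key i

/-- The product kernel is a convex combination of cosines. -/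
lemma exists_productKernel_eq_sum_cos {D : ℕ} (hD : 0 < D) (r : ℕ) {l : ℝ} (hl : 0 < l) :
    ∃ (p : (Fin d → Fin (2 * r * D + 1)) → ℝ) (k : (Fin d → Fin (2 * r * D + 1)) → E d),
      (∀ m, 0 ≤ p m) ∧ ∑ m, p m = 1 ∧ (∀ m, ‖k m‖ ≤ d * (2 * r * D / l)) ∧
      ∀ z, productKernel D r l z = ∑ m, p m * Real.cos (inner ℝ (k m) z) := by
  obtain ⟨p, hp0, hp1, hp⟩ := exists_norm_dirichletMean_pow_eq hD r
  refine ⟨fun m => ∏ i, p (m i),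
    fun m => WithLp.toLp 2 fun i => ((m i : ℝ) - r * (D - 1 : ℕ)) / l,
    fun m => Finset.prod_nonneg fun i _ => hp0 _, ?_, fun m => ?_, fun z => ?_⟩
  · have := Finset.prod_univ_sum (fun _ : Fin d => Finset.univ) fun (_ : Fin d) m => p m
    simp only [hp1, Finset.prod_const_one, Fintype.piFinset_univ] at this
    exact this.symm
  · have := norm_sub_le_of_coord (x := WithLp.toLp 2 fun i => ((m i : ℝ) - r * (D - 1 : ℕ)) / l)
      (y := (0 : E d)) (e := 2 * r * D / l) (by positivity) (fun i => ?_)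
    · simpa using this
    · have h1 : ((m i : ℕ) : ℝ) ≤ 2 * r * D := by
        exact_mod_cast Nat.lt_succ_iff.1 (m i).2
      have h2 : (0 : ℝ) ≤ (m i : ℕ) := Nat.cast_nonneg _
      have h3 : ((D - 1 : ℕ) : ℝ) ≤ D := by exact_mod_cast Nat.sub_le D 1
      have h4 : (0 : ℝ) ≤ r * (D - 1 : ℕ) := by positivity
      have h5 : (r : ℝ) * (D - 1 : ℕ) ≤ r * D := by gcongr
      have h6 : (0 : ℝ) ≤ r * D := by positivity
      simp only [PiLp.zero_apply, sub_zero]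
      rw [abs_div, abs_of_pos hl]
      gcongr
      rw [abs_le]
      constructor <;> linarith
  · have h : ((productKernel D r l z : ℝ) : ℂ) = ∑ m : Fin d → Fin (2 * r * D + 1),
        ((∏ i, p (m i) : ℝ) : ℂ) * Complex.exp ((inner ℝ
          (WithLp.toLp 2 fun i => ((m i : ℝ) - r * (D - 1 : ℕ)) / l : E d) z : ℝ) * Complex.I) := by
      rw [productKernel, Complex.ofReal_prod]
      simp only [hp]
      rw [Finset.prod_univ_sum, Fintype.piFinset_univ]
      refine Finset.sum_congr rfl fun m _ => ?_
      rw [Finset.prod_mul_distrib, ← Complex.exp_sum, Complex.ofReal_prod]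
      congr 2
      rw [PiLp.inner_apply, Complex.ofReal_sum, Finset.sum_mul]
      refine Finset.sum_congr rfl fun i _ => ?_
      simp only [RCLike.inner_apply, conj_trivial]
      push_cast
      ring
    have h' := congrArg Complex.re h
    rw [Complex.ofReal_re, Complex.re_sum] at h'
    rw [h']
    refine Finset.sum_congr rfl fun m _ => ?_
    rw [Complex.re_ofReal_mul, Complex.exp_ofReal_mul_I_re]

end ProductKernel

/-! ### Trigonometric approximation on the cube -/

section Smoothing

variable {d : ℕ} {S : ℝ}

lemma measureReal_cube {a : ℝ} (ha : 0 ≤ a) : volume.real (cube d a) = (2 * a) ^ d := by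
  have h : cube d a = (WithLp.ofLp : E d → Fin d → ℝ) ⁻¹' Set.Icc (fun _ => -a) (fun _ => a) := by
    ext x
    simp only [cube, Set.mem_Icc, Set.mem_ofPred_eq, Set.mem_preimage, Pi.le_def]
    exact forall_and
  rw [h, measureReal_def, (PiLp.volume_preserving_ofLp (Fin d)).measure_preimage
    measurableSet_Icc.nullMeasurableSet, Real.volume_Icc_pi_toReal (fun _ => by linarith)]
  simp
  ring

lemma measure_cube_ne_top {a : ℝ} : volume (cube d a) ≠ ⊤ :=
  isCompact_cube.measure_lt_top.ne

/-- Convolving with a combination of cosines, along a contraction of the base point, gives a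
trigonometric polynomial in the base point. -/
lemma exists_integral_mul_sum_cos_eq {κ : Type*} [Fintype κ] {F : E d → ℝ} (hF : Integrable F)
    (p : κ → ℝ) (k : κ → E d) (s : ℝ) {j : ℝ} (hj : 1 ≤ j) :
    ∃ a b : κ → ℝ, (∀ m, |a m| ≤ |p m| * ∫ y, |F y|) ∧ (∀ m, |b m| ≤ |p m| * ∫ y, |F y|) ∧
      ∀ x, ∫ z, F (s • x + j • z) * ∑ m, p m * Real.cos (inner ℝ (k m) z)
        = ∑ m, (a m * Real.cos (inner ℝ ((s / j) • k m) x)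
          + b m * Real.sin (inner ℝ ((s / j) • k m) x)) := by
  have hj0 : 0 < j := by linarith
  have hjd : (j ^ d)⁻¹ ≤ 1 := inv_le_one_of_one_le₀ (one_le_pow₀ hj)
  have hjd0 : 0 ≤ (j ^ d)⁻¹ := by positivity
  have hcos : ∀ m, Integrable fun y => F y * Real.cos (inner ℝ (k m) (j⁻¹ • y)) := fun m =>
    hF.mul_bdd (c := 1) (by fun_prop) (ae_of_all _ fun y => by
      simpa using Real.abs_cos_le_one _)
  have hsin : ∀ m, Integrable fun y => F y * Real.sin (inner ℝ (k m) (j⁻¹ • y)) := fun m =>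
    hF.mul_bdd (c := 1) (by fun_prop) (ae_of_all _ fun y => by
      simpa using Real.abs_sin_le_one _)
  have hI : 0 ≤ ∫ y, |F y| := integral_nonneg fun _ => abs_nonneg _
  have hbound : ∀ (m : κ) (t : E d → ℝ), (∀ y, |t y| ≤ 1) →
      |p m * ((j ^ d)⁻¹ * ∫ y, F y * t y)| ≤ |p m| * ∫ y, |F y| := by
    intro m t ht
    rw [abs_mul, abs_mul, abs_of_nonneg hjd0]
    have h1 : |∫ y, F y * t y| ≤ ∫ y, |F y| := by
      rw [← Real.norm_eq_abs]
      refine norm_integral_le_of_norm_le hF.abs (ae_of_all _ fun y => ?_)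
      rw [Real.norm_eq_abs, abs_mul]
      exact mul_le_of_le_one_right (abs_nonneg _) (ht y)
    gcongr
    calc _ ≤ 1 * ∫ y, |F y| := by gcongr
      _ = _ := one_mul _
  refine ⟨fun m => p m * ((j ^ d)⁻¹ * ∫ y, F y * Real.cos (inner ℝ (k m) (j⁻¹ • y))),
    fun m => p m * ((j ^ d)⁻¹ * ∫ y, F y * Real.sin (inner ℝ (k m) (j⁻¹ • y))),
    fun m => hbound m _ fun y => Real.abs_cos_le_one _,
    fun m => hbound m _ fun y => Real.abs_sin_le_one _, fun x => ?_⟩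
  have h1 := Measure.integral_comp_smul (volume : Measure (E d))
    (fun w => F (s • x + w) * ∑ m, p m * Real.cos (inner ℝ (k m) (j⁻¹ • w))) j
  simp only [smul_smul, inv_mul_cancel₀ hj0.ne', one_smul] at h1
  have h2 := integral_add_left_eq_self (μ := (volume : Measure (E d)))
    (fun y => F y * ∑ m, p m * Real.cos (inner ℝ (k m) (j⁻¹ • (y - s • x)))) (s • x)
  simp only [add_sub_cancel_left] at h2
  rw [h1, h2, finrank_euclideanSpace_fin, abs_of_nonneg hjd0, smul_eq_mul]
  have h3 : ∀ y, F y * ∑ m, p m * Real.cos (inner ℝ (k m) (j⁻¹ • (y - s • x)))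
      = ∑ m, (p m * Real.cos (inner ℝ ((s / j) • k m) x)
            * (F y * Real.cos (inner ℝ (k m) (j⁻¹ • y)))
          + p m * Real.sin (inner ℝ ((s / j) • k m) x)
            * (F y * Real.sin (inner ℝ (k m) (j⁻¹ • y)))) := by
    intro y
    rw [Finset.mul_sum]
    refine Finset.sum_congr rfl fun m _ => ?_
    have h4 : inner ℝ (k m) (j⁻¹ • (y - s • x))
        = inner ℝ (k m) (j⁻¹ • y) - inner ℝ ((s / j) • k m) x := by
      rw [smul_sub, inner_sub_right, real_inner_smul_left, inner_smul_right, inner_smul_right,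
        inner_smul_right]
      ring
    rw [h4, Real.cos_sub]
    ring
  simp only [h3]
  have hi : ∀ m, Integrable fun y => p m * Real.cos (inner ℝ ((s / j) • k m) x)
            * (F y * Real.cos (inner ℝ (k m) (j⁻¹ • y)))
          + p m * Real.sin (inner ℝ ((s / j) • k m) x)
            * (F y * Real.sin (inner ℝ (k m) (j⁻¹ • y))) := fun m =>
    ((hcos m).const_mul _).add ((hsin m).const_mul _)
  rw [integral_finsetSum _ fun m _ => hi m, Finset.mul_sum]
  refine Finset.sum_congr rfl fun m _ => ?_
  rw [integral_add ((hcos m).const_mul _) ((hsin m).const_mul _), integral_const_mul,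
    integral_const_mul]
  ring

lemma productKernel_le_one (D r : ℕ) (l : ℝ) (z : E d) : productKernel D r l z ≤ 1 :=
  Finset.prod_le_one (fun _ _ => by positivity)
    fun _ _ => pow_le_one₀ (norm_nonneg _) (norm_dirichletMean_le_one D _)

/-- The product kernel `W`, renormalized to have mass one near the origin, smooths out at scale
`η`: the combination `∑ⱼ cⱼ ∫ H((1 - jη) x + j z) W(z) dz` reproduces `H(x)` whenever the weights
`cⱼ` do so locally. The contraction by `1 - jη` keeps all evaluation points in the cube. -/
lemma abs_sub_sum_integral_productKernel_le {H : E d → ℝ} {J : ℕ} {c : Fin J → ℝ} {M K η : ℝ}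
    {D r : ℕ} (hS : 0 < S) (hη : 0 < η) (hJη : J * η < 1)
    (hD : 4 * Real.pi ≤ D * η)
    (hH : ContinuousOn H (cube d S)) (hM : ∀ x ∈ cube d S, |H x| ≤ M)
    {x : E d} (hx : x ∈ openCube d S)
    (hK : ∀ v : E d, ‖v‖ ≤ 2 * d * S * η →
      (∀ t ∈ Set.Icc (0 : ℝ) J, x + t • v ∈ openCube d S) →
      |H x - ∑ j, c j * H (x + ((j : ℝ) + 1) • v)| ≤ K) :
    |(∫ z in cube d (η * S), productKernel D r (2 * S) z) * H x
      - ∑ j : Fin J, c j * ∫ z, (cube d S).indicator H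
          ((1 - ((j : ℝ) + 1) * η) • x + ((j : ℝ) + 1) • z) * productKernel D r (2 * S) z|
      ≤ K * (∫ z in cube d (η * S), productKernel D r (2 * S) z)
        + (∑ j, |c j|) * (M * (4 ^ r)⁻¹ * (4 * S) ^ d) := by
  set W := productKernel (d := d) D r (2 * S) with hW
  set F := (cube d S).indicator H with hF
  set G : Fin J → E d → ℝ := fun j z => F ((1 - ((j : ℝ) + 1) * η) • x + ((j : ℝ) + 1) • z) * W z
    with hG
  have hηS : 0 < η * S := by positivity
  have hxc := openCube_subset_cube hx
  have hM0 : 0 ≤ M := (abs_nonneg _).trans (hM x hxc)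
  have hjη : ∀ j : Fin J, ((j : ℝ) + 1) * η < 1 := fun j => by
    have : (j : ℝ) + 1 ≤ J := by exact_mod_cast j.2
    nlinarith
  have hWc : Continuous W := continuous_productKernel D r _
  have hFi : Integrable F :=
    (hH.integrableOn_compact isCompact_cube).integrable_indicator (measurableSet_cube _ _)
  have hGi : ∀ j, Integrable (G j) := fun j => by
    have h1 : Integrable fun z => F ((1 - ((j : ℝ) + 1) * η) • x + ((j : ℝ) + 1) • z) :=
      (hFi.comp_add_left ((1 - ((j : ℝ) + 1) * η) • x)).comp_smul
        (by positivity : ((j : ℝ) + 1) ≠ 0)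
    exact h1.mul_bdd (c := 1) hWc.aestronglyMeasurable (ae_of_all _ fun z => by
      rw [Real.norm_eq_abs, abs_of_nonneg (productKernel_nonneg _ _ _ _)]
      exact productKernel_le_one _ _ _ _)
  have hWi : IntegrableOn W (cube d (η * S)) :=
    hWc.continuousOn.integrableOn_compact isCompact_cube
  -- the part of the integral near the origin
  have hmain : |∫ z in cube d (η * S), (W z * H x - ∑ j, c j * G j z)|
      ≤ ∫ z in cube d (η * S), K * W z := by
    rw [← Real.norm_eq_abs]
    refine norm_integral_le_of_norm_le (hWi.const_mul K)
      ((ae_restrict_mem (measurableSet_cube _ _)).mono fun z hz => ?_)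
    set v := z - η • x with hv
    have hmem : ∀ t ∈ Set.Icc (0 : ℝ) J, x + t • v ∈ openCube d S := by
      intro t ht i
      have h1 : (x + t • v) i = (1 - t * η) * x i + t * z i := by
        simp [hv]
        ring
      have h2 : 0 < 1 - t * η := by nlinarith [ht.2]
      have h3 := hx i
      have h4 := hz i
      have ht0 := ht.1
      rw [h1]
      constructor
      · nlinarith [mul_lt_mul_of_pos_left h3.1 h2, mul_le_mul_of_nonneg_left h4.1 ht0]
      · nlinarith [mul_lt_mul_of_pos_left h3.2 h2, mul_le_mul_of_nonneg_left h4.2 ht0]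
    have hvn : ‖v‖ ≤ 2 * d * S * η := by
      have h1 := norm_le_of_mem_cube hz
      have h2 := norm_le_of_mem_cube hxc
      rw [abs_of_pos hηS] at h1
      rw [abs_of_pos hS] at h2
      calc ‖v‖ ≤ ‖z‖ + ‖η • x‖ := norm_sub_le _ _
        _ ≤ d * (η * S) + η * (d * S) := by
          rw [norm_smul, Real.norm_eq_abs, abs_of_pos hη]
          gcongr
        _ = _ := by ring
    have hGz : ∀ j, G j z = W z * H (x + ((j : ℝ) + 1) • v) := by
      intro j
      have h1 : (1 - ((j : ℝ) + 1) * η) • x + ((j : ℝ) + 1) • z = x + ((j : ℝ) + 1) • v := by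
        rw [hv]
        module
      have h2 : x + ((j : ℝ) + 1) • v ∈ cube d S :=
        openCube_subset_cube (hmem _ ⟨by positivity, by exact_mod_cast j.2⟩)
      simp only [hG]
      rw [h1, hF, Set.indicator_of_mem h2, mul_comm]
    have h1 : W z * H x - ∑ j, c j * G j z
        = W z * (H x - ∑ j, c j * H (x + ((j : ℝ) + 1) • v)) := by
      rw [mul_sub, Finset.mul_sum]
      congr 1
      refine Finset.sum_congr rfl fun j _ => ?_
      rw [hGz]
      ring
    rw [h1, Real.norm_eq_abs, abs_mul, abs_of_nonneg (productKernel_nonneg _ _ _ _), mul_comm]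
    exact mul_le_mul_of_nonneg_right (hK v hvn hmem) (productKernel_nonneg _ _ _ _)
  -- the part away from the origin, where the kernel is small
  have htail : ∀ j, |∫ z in (cube d (η * S))ᶜ, G j z| ≤ M * (4 ^ r)⁻¹ * (4 * S) ^ d := by
    intro j
    have hb : ∀ z ∈ (cube d (η * S))ᶜ, ‖G j z‖
        ≤ (cube d (2 * S)).indicator (fun _ => M * ((4 : ℝ) ^ r)⁻¹) z := by
      intro z hz
      by_cases hy : (1 - ((j : ℝ) + 1) * η) • x + ((j : ℝ) + 1) • z ∈ cube d S
      · have hz2 : z ∈ cube d (2 * S) := by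
          intro i
          have h1 := hy i
          have h2 : ((1 - ((j : ℝ) + 1) * η) • x + ((j : ℝ) + 1) • z) i
              = (1 - ((j : ℝ) + 1) * η) * x i + ((j : ℝ) + 1) * z i := by simp
          rw [h2] at h1
          have h3 := hxc i
          have h4 : 0 < 1 - ((j : ℝ) + 1) * η := by linarith [hjη j]
          have h5 : 1 - ((j : ℝ) + 1) * η ≤ 1 := by
            have : 0 ≤ ((j : ℝ) + 1) * η := by positivity
            linarith
          have h6 : (0 : ℝ) ≤ j := Nat.cast_nonneg _
          have h7 : |(1 - ((j : ℝ) + 1) * η) * x i| ≤ S := by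
            rw [abs_mul, abs_of_pos h4]
            calc _ ≤ 1 * S := by
                  gcongr
                  exact abs_le.2 h3
              _ = S := one_mul S
          have h8 : |((j : ℝ) + 1) * z i| ≤ 2 * S := by
            rw [abs_le] at h7 ⊢
            constructor <;> linarith [h1.1, h1.2, h7.1, h7.2]
          rw [abs_mul, abs_of_pos (by positivity : (0 : ℝ) < (j : ℝ) + 1)] at h8
          have h9 : |z i| ≤ 2 * S := by nlinarith [abs_nonneg (z i)]
          exact abs_le.1 h9
        have hWz : W z ≤ (4 ^ r)⁻¹ := by
          have : ∃ i, ¬ (z i ∈ Set.Icc (-(η * S)) (η * S)) := by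
            by_contra hcon
            push Not at hcon
            exact hz hcon
          obtain ⟨i, hi⟩ := this
          have hi' : η * S < |z i| := by
            rw [Set.mem_Icc, ← abs_le] at hi
            exact not_le.1 hi
          have hi2 : |z i| ≤ 2 * S := abs_le.2 (hz2 i)
          refine productKernel_le_inv_four_pow i ?_ ?_
          · rw [abs_div, abs_of_pos (by positivity : 0 < 2 * S)]
            have h1 : η / 2 ≤ |z i| / (2 * S) := by
              rw [div_le_div_iff₀ (by norm_num) (by positivity)]
              nlinarith
            calc 2 * Real.pi ≤ D * (η / 2) := by linarith
              _ ≤ _ := by gcongr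
          · rw [abs_div, abs_of_pos (by positivity : 0 < 2 * S)]
            exact div_le_one_of_le₀ hi2 (by positivity)
        rw [Set.indicator_of_mem hz2]
        simp only [hG]
        rw [hF, Set.indicator_of_mem hy, Real.norm_eq_abs, abs_mul,
          abs_of_nonneg (productKernel_nonneg _ _ _ _)]
        exact mul_le_mul (hM _ hy) hWz (productKernel_nonneg _ _ _ _) hM0
      · simp only [hG]
        rw [hF, Set.indicator_of_notMem hy, zero_mul, norm_zero]
        exact Set.indicator_nonneg (fun _ _ => by positivity) _
    have hi : Integrable ((cube d (2 * S)).indicator fun _ => M * ((4 : ℝ) ^ r)⁻¹) :=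
      (integrable_indicator_iff (measurableSet_cube _ _)).2 (integrableOn_const measure_cube_ne_top)
    calc |∫ z in (cube d (η * S))ᶜ, G j z|
        ≤ ∫ z in (cube d (η * S))ᶜ, (cube d (2 * S)).indicator (fun _ => M * ((4 : ℝ) ^ r)⁻¹) z :=
          norm_integral_le_of_norm_le hi.integrableOn
            ((ae_restrict_mem (measurableSet_cube _ _).compl).mono hb)
      _ ≤ ∫ z, (cube d (2 * S)).indicator (fun _ => M * ((4 : ℝ) ^ r)⁻¹) z :=
          setIntegral_le_integral hi (ae_of_all _ fun z =>
            Set.indicator_nonneg (fun _ _ => by positivity) _)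
      _ = _ := by
          rw [integral_indicator (measurableSet_cube _ _), setIntegral_const,
            measureReal_cube (by positivity), smul_eq_mul]
          ring
  have hsplit : (∫ z in cube d (η * S), W z) * H x - ∑ j, c j * ∫ z, G j z
      = (∫ z in cube d (η * S), (W z * H x - ∑ j, c j * G j z))
        - ∑ j, c j * ∫ z in (cube d (η * S))ᶜ, G j z := by
    have h1 : ∀ j, ∫ z, G j z = (∫ z in cube d (η * S), G j z)
        + ∫ z in (cube d (η * S))ᶜ, G j z := fun j =>
      (integral_add_compl (measurableSet_cube _ _) (hGi j)).symm
    rw [integral_sub (hWi.mul_const _) (integrable_finsetSum _ fun j _ =>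
      ((hGi j).integrableOn).const_mul (c j)), integral_mul_const,
      integral_finsetSum _ fun j _ => ((hGi j).integrableOn).const_mul (c j)]
    simp only [integral_const_mul, h1, mul_add, Finset.sum_add_distrib]
    ring
  rw [hsplit]
  refine (abs_sub _ _).trans (add_le_add (hmain.trans_eq (integral_const_mul _ _)) ?_)
  rw [Finset.sum_mul]
  refine (Finset.abs_sum_le_sum_abs _ _).trans (Finset.sum_le_sum fun j _ => ?_)
  rw [abs_mul]
  exact mul_le_mul_of_nonneg_left (htail j) (abs_nonneg _)

/-- Lower bound for the normalizing constant of the kernel, polynomial in `D r`. -/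
lemma le_integral_productKernel {η : ℝ} {D r : ℕ} (hS : 0 < S) (hη : 0 < η)
    (hD : 4 * Real.pi ≤ D * η) (hr : 0 < r) :
    (S / (D * r)) ^ d ≤ ∫ z in cube d (η * S), productKernel (d := d) D r (2 * S) z := by
  have hpi := Real.pi_gt_three
  have hDη : 0 < (D : ℝ) * η := by linarith
  have hD0 : (0 : ℝ) < D := pos_of_mul_pos_left hDη hη.le
  have hr0 : (1 : ℝ) ≤ r := by exact_mod_cast hr
  set δ := S / (D * r) with hδ
  have hδ0 : 0 < δ := by positivity
  have hsub : cube d δ ⊆ cube d (η * S) := by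
    have hle : δ ≤ η * S := by
      rw [hδ, div_le_iff₀ (by positivity)]
      have : 1 ≤ (D : ℝ) * η * r := by nlinarith
      nlinarith
    intro z hz i
    have := hz i
    exact ⟨by linarith [this.1], this.2.trans hle⟩
  have hWc := continuous_productKernel (d := d) D r (2 * S)
  calc δ ^ d = ∫ _z in cube d δ, ((2 : ℝ) ^ d)⁻¹ := by
        rw [setIntegral_const, measureReal_cube hδ0.le, smul_eq_mul, mul_pow]
        field_simp
    _ ≤ ∫ z in cube d δ, productKernel (d := d) D r (2 * S) z := by
        refine setIntegral_mono_on (integrableOn_const measure_cube_ne_top)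
          (hWc.continuousOn.integrableOn_compact isCompact_cube) (measurableSet_cube _ _)
          fun z hz => ?_
        refine inv_two_pow_le_productKernel (by exact_mod_cast hD0) hr fun i => ?_
        rw [abs_div, abs_of_pos (by positivity : 0 < 2 * S), div_le_div_iff₀ (by positivity)
          (by positivity), one_mul]
        have h1 : |z i| ≤ δ := abs_le.2 (hz i)
        calc |z i| * (2 * D * r) ≤ δ * (2 * D * r) := by gcongr
          _ = 2 * S := by
            rw [hδ]
            field_simp
    _ ≤ _ := setIntegral_mono_set (hWc.continuousOn.integrableOn_compact isCompact_cube)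
        (ae_of_all _ fun z => productKernel_nonneg _ _ _ _) (LE.le.eventuallyLE hsub)

end Smoothing

section TrigonometricApproximation

variable {d : ℕ} {S : ℝ}

/-- Bounds of continuous functions extend from the open to the closed cube. -/
lemma abs_le_on_cube (hS : 0 < S) {φ : E d → ℝ} {B : ℝ} (hφ : ContinuousOn φ (cube d S))
    (h : ∀ x ∈ openCube d S, |φ x| ≤ B) : ∀ x ∈ cube d S, |φ x| ≤ B := by
  intro x hx
  have hs : ∀ s ∈ Set.Ioo (0 : ℝ) 1, s • x ∈ openCube d S := by
    intro s hs i
    have h1 := hx i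
    simp only [PiLp.smul_apply, smul_eq_mul]
    constructor <;> nlinarith [hs.1, hs.2, h1.1, h1.2]
  have hlim : Tendsto (fun s : ℝ => s • x) (𝓝[<] 1) (𝓝[cube d S] x) := by
    refine tendsto_nhdsWithin_iff.2 ⟨?_, ?_⟩
    · have : Tendsto (fun s : ℝ => s • x) (𝓝 1) (𝓝 ((1 : ℝ) • x)) :=
        (continuous_id.smul continuous_const).tendsto _
      rw [one_smul] at this
      exact this.mono_left nhdsWithin_le_nhds
    · filter_upwards [Ioo_mem_nhdsLT (zero_lt_one' ℝ)] with s h' using openCube_subset_cube (hs s h')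
  have hcont : Tendsto (fun s : ℝ => |φ (s • x)|) (𝓝[<] 1) (𝓝 |φ x|) :=
    (hφ x hx).abs.tendsto.comp hlim
  refine le_of_tendsto hcont ?_
  filter_upwards [Ioo_mem_nhdsLT (zero_lt_one' ℝ)] with s h' using h _ (hs s h')

set_option maxHeartbeats 1000000 in
/-- Trigonometric approximation at scale `η` of the product of a Hölder function and a smooth
function on the cube, with an exponentially small price `4⁻ʳ` for using frequencies of order
`r / η` only. -/
lemma exists_trig_approx {β : ℝ} (hS : 0 < S) (hβ : 0 < β) {f h : E d → ℝ}
    (hf : IsHolderOnCube S β f) (hh : ∀ x ∈ cube d S, ∀ n : ℕ, ContDiffAt ℝ n h x) :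
    ∃ C η₀ : ℝ, 0 < C ∧ 0 < η₀ ∧ η₀ ≤ 1 ∧ ∀ (η : ℝ) (r : ℕ), 0 < η → η ≤ η₀ → 1 ≤ r →
      ∃ (κ : Type) (_ : Fintype κ) (a b : κ → ℝ) (ω : κ → E d),
        (Fintype.card κ : ℝ) ≤ C * (r / η) ^ d ∧
        ∑ m, |a m| ≤ C * (r / η) ^ d ∧ ∑ m, |b m| ≤ C * (r / η) ^ d ∧
        (∀ m, ‖ω m‖ ≤ C * (r / η)) ∧
        ∀ x ∈ cube d S, |f x * h x - ∑ m, (a m * Real.cos (inner ℝ (ω m) x)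
          + b m * Real.sin (inner ℝ (ω m) x))|
          ≤ C * (η ^ β + (r / η) ^ d * (4 ^ r)⁻¹) := by
  obtain ⟨J, c, C₁, hC₁, hext⟩ := exists_extrapolation_error_le hβ hf hh
  set H : E d → ℝ := fun x => f x * h x with hH
  have hHc : ContinuousOn H (cube d S) := hf.continuousOn.mul
    (fun x hx => (hh x hx 0).continuousAt.continuousWithinAt)
  obtain ⟨M₀, hM₀⟩ := isCompact_cube.exists_bound_of_continuousOn hHc
  set M := |M₀| with hMdef
  have hM : ∀ x ∈ cube d S, |H x| ≤ M := fun x hx => (hM₀ x hx).trans (le_abs_self _)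
  set F := (cube d S).indicator H with hF
  have hFi : Integrable F :=
    (hHc.integrableOn_compact isCompact_cube).integrable_indicator (measurableSet_cube _ _)
  set I := ∫ y, |F y| with hI
  have hI0 : 0 ≤ I := integral_nonneg fun _ => abs_nonneg _
  set A := ∑ j, |c j| with hA
  have hA0 : 0 ≤ A := Finset.sum_nonneg fun _ _ => abs_nonneg _
  set C : ℝ := 1 + J * 42 ^ d + A * I * (14 / S) ^ d + d * (14 / S) + C₁ * (2 * d * S) ^ β
    + A * (M * (4 * S) ^ d) * (14 / S) ^ d with hC
  have q1 : (0 : ℝ) ≤ J * 42 ^ d := by positivity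
  have q2 : 0 ≤ A * I * (14 / S) ^ d := by positivity
  have q3 : 0 ≤ d * (14 / S) := by positivity
  have q4 : 0 ≤ C₁ * (2 * d * S) ^ β := by positivity
  have q5 : 0 ≤ A * (M * (4 * S) ^ d) * (14 / S) ^ d := by positivity
  have hJ0 : (0 : ℝ) ≤ J := Nat.cast_nonneg J
  refine ⟨C, min (1 / (J + 1)) (1 / (2 * d * S + 1)), by linarith, by positivity,
    (min_le_left _ _).trans (div_le_one_of_le₀ (by linarith) (by positivity)),
    fun η r hη hη₀ hr => ?_⟩
  have hη1 : η ≤ 1 / (J + 1) := hη₀.trans (min_le_left _ _)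
  have hη2 : η ≤ 1 / (2 * d * S + 1) := hη₀.trans (min_le_right _ _)
  have hηle : η ≤ 1 := hη1.trans (div_le_one_of_le₀ (by linarith) (by positivity))
  rw [le_div_iff₀ (by positivity)] at hη1 hη2
  have hr1 : (1 : ℝ) ≤ r := by exact_mod_cast hr
  have hpi := Real.pi_gt_three
  -- the number of frequencies for which the kernel concentrates at scale `η`
  set D := ⌈4 * Real.pi / η⌉₊ with hDdef
  have hD4 : 4 * Real.pi ≤ D * η := by
    have := Nat.le_ceil (4 * Real.pi / η)
    rwa [div_le_iff₀ hη] at this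
  have hD14 : D * η ≤ 14 := by
    have h1 := Nat.ceil_lt_add_one (by positivity : 0 ≤ 4 * Real.pi / η)
    have h2 : (D : ℝ) * η ≤ (4 * Real.pi / η + 1) * η := by gcongr
    have h3 : (4 * Real.pi / η + 1) * η = 4 * Real.pi + η := by field_simp
    have := Real.pi_lt_d2
    linarith
  have hDη : 0 < (D : ℝ) * η := by linarith
  have hD0 : (0 : ℝ) < D := pos_of_mul_pos_left hDη hη.le
  have hD0' : 0 < D := by exact_mod_cast hD0
  have hD1 : (1 : ℝ) ≤ D := by exact_mod_cast hD0'
  have hDle : (D : ℝ) ≤ 14 / η := by rwa [le_div_iff₀ hη]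
  obtain ⟨p, k, hp0, hp1, hk, hpk⟩ :=
    exists_productKernel_eq_sum_cos (d := d) hD0' r (l := 2 * S) (by positivity)
  set N := ∫ z in cube d (η * S), productKernel (d := d) D r (2 * S) z with hN
  have hNle : (S / (D * r)) ^ d ≤ N := le_integral_productKernel hS hη hD4 hr
  have hN0 : 0 < N := lt_of_lt_of_le (by positivity) hNle
  have hNinv : N⁻¹ ≤ (14 / S) ^ d * (r / η) ^ d := by
    calc N⁻¹ ≤ ((S / (D * r)) ^ d)⁻¹ := inv_anti₀ (by positivity) hNle
      _ = ((D : ℝ) * r / S) ^ d := by rw [← inv_pow, inv_div]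
      _ ≤ (14 / η * r / S) ^ d := by gcongr
      _ = _ := by
        rw [← mul_pow]
        congr 1
        field_simp
  choose a b ha hb hab using fun j : Fin J => exists_integral_mul_sum_cos_eq hFi p k
    (1 - ((j : ℝ) + 1) * η) (j := (j : ℝ) + 1) (by
      have : (0 : ℝ) ≤ j := Nat.cast_nonneg _
      linarith)
  have hsum : ∀ t : Fin J → (Fin d → Fin (2 * r * D + 1)) → ℝ, (∀ j m, |t j m| ≤ |p m| * I) →
      ∑ q : Fin J × (Fin d → Fin (2 * r * D + 1)), |N⁻¹ * c q.1 * t q.1 q.2|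
        ≤ C * (r / η) ^ d := by
    intro t ht
    calc _ ≤ ∑ q : Fin J × (Fin d → Fin (2 * r * D + 1)), N⁻¹ * |c q.1| * (p q.2 * I) := by
          refine Finset.sum_le_sum fun q _ => ?_
          rw [abs_mul, abs_mul, abs_of_pos (inv_pos.2 hN0)]
          have := ht q.1 q.2
          rw [abs_of_nonneg (hp0 _)] at this
          gcongr
      _ = N⁻¹ * (A * I) := by
          rw [Fintype.sum_prod_type]
          simp only [← Finset.mul_sum, ← Finset.sum_mul, hp1, one_mul]
          rw [hA]
          ring
      _ ≤ ((14 / S) ^ d * (r / η) ^ d) * (A * I) := by gcongr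
      _ = (A * I * (14 / S) ^ d) * (r / η) ^ d := by ring
      _ ≤ _ := by
          gcongr
          linarith
  set T : E d → ℝ := fun x => ∑ q : Fin J × (Fin d → Fin (2 * r * D + 1)),
    (N⁻¹ * c q.1 * a q.1 q.2
        * Real.cos (inner ℝ (((1 - ((q.1 : ℝ) + 1) * η) / ((q.1 : ℝ) + 1)) • k q.2) x)
      + N⁻¹ * c q.1 * b q.1 q.2
        * Real.sin (inner ℝ (((1 - ((q.1 : ℝ) + 1) * η) / ((q.1 : ℝ) + 1)) • k q.2) x)) with hT
  have hTeq : ∀ x, T x = N⁻¹ * ∑ j : Fin J, c j * ∫ z, F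
      ((1 - ((j : ℝ) + 1) * η) • x + ((j : ℝ) + 1) • z) * productKernel D r (2 * S) z := by
    intro x
    rw [hT, Finset.mul_sum]
    simp only
    rw [Fintype.sum_prod_type]
    refine Finset.sum_congr rfl fun j _ => ?_
    simp only [hpk]
    rw [hab, Finset.mul_sum, Finset.mul_sum]
    refine Finset.sum_congr rfl fun m _ => ?_
    ring
  have hTc : Continuous T := by
    rw [hT]
    fun_prop
  have hopen : ∀ x ∈ openCube d S, |H x - T x| ≤ C * (η ^ β + (r / η) ^ d * (4 ^ r)⁻¹) := by
    intro x hx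
    have h1 := abs_sub_sum_integral_productKernel_le (c := c) (K := C₁ * (2 * d * S * η) ^ β)
      (r := r) hS hη (by nlinarith) hD4 hHc hM hx (fun v hv hmem => by
        refine (hext x v (hv.trans (by linarith)) hmem).trans ?_
        gcongr)
    have h2 : H x - T x = N⁻¹ * (N * H x - ∑ j : Fin J, c j * ∫ z, F
        ((1 - ((j : ℝ) + 1) * η) • x + ((j : ℝ) + 1) • z) * productKernel D r (2 * S) z) := by
      rw [hTeq, mul_sub]
      congr 1
      field_simp
    rw [h2, abs_mul, abs_of_pos (inv_pos.2 hN0)]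
    calc _ ≤ N⁻¹ * (C₁ * (2 * d * S * η) ^ β * N + A * (M * (4 ^ r)⁻¹ * (4 * S) ^ d)) := by
          gcongr
      _ = C₁ * (2 * d * S) ^ β * η ^ β + N⁻¹ * (A * (M * (4 ^ r)⁻¹ * (4 * S) ^ d)) := by
          rw [Real.mul_rpow (by positivity) hη.le]
          field_simp
      _ ≤ C₁ * (2 * d * S) ^ β * η ^ β
          + ((14 / S) ^ d * (r / η) ^ d) * (A * (M * (4 ^ r)⁻¹ * (4 * S) ^ d)) := by
          gcongr
      _ = C₁ * (2 * d * S) ^ β * η ^ β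
          + (A * (M * (4 * S) ^ d) * (14 / S) ^ d) * ((r / η) ^ d * (4 ^ r)⁻¹) := by ring
      _ ≤ C * η ^ β + C * ((r / η) ^ d * (4 ^ r)⁻¹) := by
          gcongr
          · linarith
          · linarith
      _ = _ := by ring
  refine ⟨Fin J × (Fin d → Fin (2 * r * D + 1)), inferInstance,
    fun q => N⁻¹ * c q.1 * a q.1 q.2, fun q => N⁻¹ * c q.1 * b q.1 q.2,
    fun q => ((1 - ((q.1 : ℝ) + 1) * η) / ((q.1 : ℝ) + 1)) • k q.2, ?_, hsum a ha, hsum b hb,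
    fun q => ?_, fun x hx => ?_⟩
  · rw [Fintype.card_prod, Fintype.card_fin, Fintype.card_fun, Fintype.card_fin, Fintype.card_fin]
    push_cast
    calc (J : ℝ) * (2 * r * D + 1) ^ d ≤ J * (42 * (r / η)) ^ d := by
          gcongr
          have h1 : (1 : ℝ) ≤ r * D := by nlinarith
          calc (2 * (r : ℝ) * D + 1) ≤ 3 * r * D := by linarith
            _ ≤ 3 * r * (14 / η) := by gcongr
            _ = _ := by ring
      _ = J * 42 ^ d * (r / η) ^ d := by rw [mul_pow]; ring
      _ ≤ _ := by
          gcongr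
          linarith
  · have hj0 : (0 : ℝ) ≤ (q.1 : ℕ) := Nat.cast_nonneg _
    have hjJ : ((q.1 : ℕ) : ℝ) + 1 ≤ J := by exact_mod_cast q.1.2
    have h1 : ‖(1 - (((q.1 : ℕ) : ℝ) + 1) * η) / (((q.1 : ℕ) : ℝ) + 1)‖ ≤ 1 := by
      have h2 : 0 ≤ 1 - (((q.1 : ℕ) : ℝ) + 1) * η := by nlinarith
      rw [Real.norm_eq_abs, abs_of_nonneg (by positivity)]
      refine div_le_one_of_le₀ ?_ (by positivity)
      have : 0 ≤ (((q.1 : ℕ) : ℝ) + 1) * η := by positivity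
      linarith
    rw [norm_smul]
    calc _ ≤ 1 * (d * (2 * r * D / (2 * S))) := by
          gcongr
          exact hk _
      _ ≤ 1 * (d * (2 * r * (14 / η) / (2 * S))) := by gcongr
      _ = d * (14 / S) * (r / η) := by field_simp
      _ ≤ _ := by
          gcongr
          linarith
  · -- the bound extends from the open to the closed cube by continuity
    exact abs_le_on_cube hS (φ := fun x => H x - T x) (hHc.sub hTc.continuousOn) hopen x hx

end TrigonometricApproximation

/-! ### Approximation by finite mixtures -/

section MixtureApproximation

variable {d : ℕ} {S : ℝ}

/-- Finitely many translates of the mother function add up to a function that is positive on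
the cube. -/
lemma exists_sum_translates_pos {g : E d → ℝ} (hg : Continuous g) (hg0 : ∀ x, 0 ≤ g x)
    (hcover : ∀ x ∈ cube d S, ∃ μ ∈ cube d (2 * S), 0 < g (x - μ)) :
    ∃ t : Finset (E d), (∀ μ ∈ t, μ ∈ cube d (2 * S)) ∧
      ∀ x ∈ cube d S, 0 < ∑ μ ∈ t, g (x - μ) := by
  obtain ⟨t, ht, htf, hcov⟩ := (isCompact_cube (d := d) (S := S)).elim_finite_subcover_image
    (b := cube d (2 * S)) (c := fun μ => {x | 0 < g (x - μ)})
    (fun μ _ => isOpen_lt continuous_const (hg.comp (continuous_id.sub continuous_const)))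
    (fun x hx => by
      obtain ⟨μ, hμ, h⟩ := hcover x hx
      exact Set.mem_iUnion₂.2 ⟨μ, hμ, h⟩)
  refine ⟨htf.toFinset, fun μ hμ => ht (htf.mem_toFinset.1 hμ), fun x hx => ?_⟩
  obtain ⟨μ, hμ, h⟩ := Set.mem_iUnion₂.1 (hcov hx)
  exact Finset.sum_pos' (fun _ _ => hg0 _) ⟨μ, htf.mem_toFinset.2 hμ, h⟩

/-- Approximation of a Hölder function by finite location-modulation mixtures: divide by a sum of
translates of the mother function, approximate the quotient by a trigonometric polynomial, and
expand each character around the location of each translate. -/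
theorem exists_mixture_approx {β : ℝ} (hS : 0 < S) (hβ : 0 < β) {g : 𝓢(E d, ℝ)}
    (hg0 : ∀ x, 0 ≤ g x) (hcover : ∀ x ∈ cube d S, ∃ μ ∈ cube d (2 * S), 0 < g (x - μ))
    {f : E d → ℝ} (hf : IsHolderOnCube S β f) :
    ∃ C η₀ : ℝ, 0 < C ∧ 0 < η₀ ∧ η₀ ≤ 1 ∧ ∀ (η : ℝ) (r : ℕ), 0 < η → η ≤ η₀ → 1 ≤ r →
      ∃ (κ : Type) (_ : Fintype κ) (u : κ → ℝ) (ζ : κ → Atom d),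
        (∀ m, ζ m ∈ atomSupport d S) ∧ (Fintype.card κ : ℝ) ≤ C * (r / η) ^ d ∧
        ∑ m, |u m| ≤ C * (r / η) ^ d ∧ (∀ m, ‖(ζ m).1‖ ≤ C * (r / η)) ∧
        ∀ x ∈ cube d S,
          |f x - ∑ m, u m * kernel g (ζ m).1 (ζ m).2.2 (x - (ζ m).2.1)|
            ≤ C * (η ^ β + (r / η) ^ d * (4 ^ r)⁻¹) := by
  obtain ⟨t, ht, hpos⟩ := exists_sum_translates_pos g.continuous hg0 hcover
  set G : E d → ℝ := fun x => ∑ μ ∈ t, g (x - μ) with hG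
  have hGs : ∀ n : ℕ, ContDiff ℝ n G := fun n =>
    ContDiff.sum fun μ _ => (g.smooth n).comp (contDiff_id.sub contDiff_const)
  obtain ⟨B, hB⟩ := (isCompact_cube (d := d) (S := S)).exists_bound_of_continuousOn
    (hGs 0).continuous.continuousOn
  obtain ⟨C, η₀, hC, hη₀, hη₁, happ⟩ := exists_trig_approx hS hβ hf
    (h := fun x => (G x)⁻¹) fun x hx n => (hGs n).contDiffAt.inv (hpos x hx).ne'
  have q1 : 0 ≤ 4 * t.card * C := by positivity
  have q2 : 0 ≤ |B| * C := by positivity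
  refine ⟨C + 4 * t.card * C + |B| * C, η₀, by linarith, hη₀, hη₁, fun η r hη hη' hr => ?_⟩
  obtain ⟨κ, _, a, b, ω, hcard, ha, hb, hω, hx⟩ := happ η r hη hη' hr
  have hr0 : (0 : ℝ) < r := by exact_mod_cast hr
  have hq : 0 < (r / η) ^ d := by positivity
  -- Coefficients of the character `a cos ⟪ω, x⟫ + b sin ⟪ω, x⟫` in terms of the cosine and the sine of
  -- `⟪ω, x - μ⟫`; the phase `π / 2` turns the cosine of the kernel into minus the sine.
  set u : (t × κ) × Bool → ℝ := fun q =>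
    if q.2 then a q.1.2 * Real.sin (inner ℝ (ω q.1.2) (q.1.1 : E d))
        - b q.1.2 * Real.cos (inner ℝ (ω q.1.2) (q.1.1 : E d))
      else a q.1.2 * Real.cos (inner ℝ (ω q.1.2) (q.1.1 : E d))
        + b q.1.2 * Real.sin (inner ℝ (ω q.1.2) (q.1.1 : E d)) with hu
  set ζ : (t × κ) × Bool → Atom d := fun q =>
    (ω q.1.2, (q.1.1 : E d), if q.2 then Real.pi / 2 else 0) with hζ
  have hpi := Real.pi_pos
  refine ⟨(t × κ) × Bool, inferInstance, u, ζ, fun q => ⟨ht _ q.1.1.2, ?_⟩, ?_, ?_, fun q => ?_,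
    fun x hxc => ?_⟩
  · simp only [hζ]
    split_ifs
    · exact ⟨by positivity, le_rfl⟩
    · exact ⟨le_rfl, by positivity⟩
  · rw [Fintype.card_prod, Fintype.card_prod, Fintype.card_bool, Fintype.card_coe]
    push_cast
    calc (t.card : ℝ) * Fintype.card κ * 2 ≤ t.card * (C * (r / η) ^ d) * 4 := by
          gcongr
          norm_num
      _ = (4 * t.card * C) * (r / η) ^ d := by ring
      _ ≤ _ := by
          gcongr
          linarith
  · have hub : ∀ q, |u q| ≤ |a q.1.2| + |b q.1.2| := by
      intro q
      have key : ∀ y z : ℝ, |y| ≤ 1 → |z| ≤ 1 →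
          |a q.1.2 * y + b q.1.2 * z| ≤ |a q.1.2| + |b q.1.2| := by
        intro y z hy hz
        refine (abs_add_le _ _).trans ?_
        rw [abs_mul, abs_mul]
        exact add_le_add (mul_le_of_le_one_right (abs_nonneg _) hy)
          (mul_le_of_le_one_right (abs_nonneg _) hz)
      simp only [hu]
      split_ifs
      · have := key _ _ (Real.abs_sin_le_one (inner ℝ (ω q.1.2) (q.1.1 : E d)))
          ((abs_neg _).trans_le (Real.abs_cos_le_one (inner ℝ (ω q.1.2) (q.1.1 : E d))))
        rwa [mul_neg, ← sub_eq_add_neg] at this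
      · exact key _ _ (Real.abs_cos_le_one _) (Real.abs_sin_le_one _)
    calc ∑ q, |u q| ≤ ∑ q : (t × κ) × Bool, (|a q.1.2| + |b q.1.2|) :=
          Finset.sum_le_sum fun q _ => hub q
      _ = 2 * t.card * (∑ m, |a m| + ∑ m, |b m|) := by
          rw [Fintype.sum_prod_type, Fintype.sum_prod_type]
          simp only [Finset.sum_const, Finset.card_univ, Fintype.card_bool, nsmul_eq_mul,
            Finset.sum_add_distrib, Fintype.card_coe, ← Finset.mul_sum]
          push_cast
          ring
      _ ≤ 2 * t.card * (C * (r / η) ^ d + C * (r / η) ^ d) := by gcongr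
      _ = (4 * t.card * C) * (r / η) ^ d := by ring
      _ ≤ _ := by
          gcongr
          linarith
  · calc ‖ω q.1.2‖ ≤ C * (r / η) := hω _
      _ ≤ _ := by
          gcongr
          linarith
  · set T := ∑ m, (a m * Real.cos (inner ℝ (ω m) x) + b m * Real.sin (inner ℝ (ω m) x)) with hT
    have hsum : ∑ q, u q * kernel g (ζ q).1 (ζ q).2.2 (x - (ζ q).2.1) = G x * T := by
      rw [Fintype.sum_prod_type, Fintype.sum_prod_type, hG]
      simp only
      rw [Finset.sum_mul, ← Finset.sum_coe_sort t fun μ => g (x - μ) * T]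
      refine Finset.sum_congr rfl fun μ _ => ?_
      rw [hT, Finset.mul_sum]
      refine Finset.sum_congr rfl fun m _ => ?_
      have h1 : inner ℝ (ω m) x = inner ℝ (ω m) (x - (μ : E d)) + inner ℝ (ω m) (μ : E d) := by
        rw [← inner_add_right, sub_add_cancel]
      rw [Fintype.sum_bool]
      simp only [hu, hζ, kernel, if_true, Bool.false_eq_true, if_false, add_zero]
      rw [Real.cos_add_pi_div_two, h1, Real.cos_add, Real.sin_add]
      ring
    rw [hsum]
    have hGx := hpos x hxc
    have h2 : f x - G x * T = G x * (f x * (G x)⁻¹ - T) := by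
      have : G x ≠ 0 := hGx.ne'
      field_simp
    rw [h2, abs_mul]
    calc _ ≤ |B| * (C * (η ^ β + (r / η) ^ d * (4 ^ r)⁻¹)) :=
          mul_le_mul ((hB x hxc).trans (le_abs_self B)) (hx x hxc) (abs_nonneg _) (abs_nonneg _)
      _ = (|B| * C) * (η ^ β + (r / η) ^ d * (4 ^ r)⁻¹) := by ring
      _ ≤ _ := by
          gcongr
          linarith

end MixtureApproximation

/-! ### The rate and the prior mass of neighborhoods of the truth -/

section Rate

variable {d : ℕ} {β : ℝ}

lemma one_le_log_natCast {n : ℕ} (hn : 3 ≤ n) : 1 ≤ Real.log n := by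
  have hn' : (3 : ℝ) ≤ n := by exact_mod_cast hn
  rw [Real.le_log_iff_exp_le (by linarith)]
  have := Real.exp_one_lt_d9
  linarith

lemma rate_eq_exp {n : ℕ} (hn : 3 ≤ n) : rate d β n = Real.exp ((-(2 * β) / (2 * β + d)
    * Real.log n + 2 * β * (2 * d + 1) / (2 * β + d) * Real.log (Real.log n)) / 2) := by
  have hL := one_le_log_natCast hn
  have hn' : (0 : ℝ) < n := by positivity
  rw [rate, Real.rpow_def_of_pos hn', Real.rpow_def_of_pos (by linarith), ← Real.exp_add,
    Real.sqrt_eq_rpow, ← Real.exp_mul]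
  congr 1
  ring

lemma rate_pos {n : ℕ} (hn : 3 ≤ n) : 0 < rate d β n := by
  rw [rate_eq_exp hn]
  positivity

/-- The identity behind the choice of the rate: at resolution `ε^{1/β}`, there are `ε^{-d/β}` cells,
and the prior pays a power of `log n` for each of them. -/
lemma inv_rate_rpow_mul_log_pow (hβ : 0 < β) {n : ℕ} (hn : 3 ≤ n) :
    ((rate d β n ^ (1 / β))⁻¹) ^ d * Real.log n ^ (2 * d + 1) = n * rate d β n ^ 2 := by
  have hL := one_le_log_natCast hn
  have hn' : (0 : ℝ) < n := by positivity
  have hd : (0 : ℝ) ≤ d := Nat.cast_nonneg d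
  have h0 : 2 * β + d ≠ 0 := by positivity
  have h1 : Real.log n ^ (2 * d + 1) = Real.exp ((2 * d + 1 : ℕ) * Real.log (Real.log n)) := by
    rw [Real.exp_nat_mul, Real.exp_log (by linarith)]
  have h2 : (n : ℝ) = Real.exp (Real.log n) := (Real.exp_log hn').symm
  rw [h1, rate_eq_exp hn]
  conv_rhs => rw [h2]
  rw [← Real.exp_mul, ← Real.exp_neg, ← Real.exp_nat_mul, ← Real.exp_nat_mul, ← Real.exp_add,
    ← Real.exp_add, Real.log_exp]
  congr 1
  push_cast
  field_simp
  ring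

/-- `n ε_n²` is at least a power of `n`, which absorbs the errors of order `n ^ μ`. -/
lemma rpow_le_mul_rate_sq (hβ : 0 < β) {n : ℕ} (hn : 3 ≤ n) :
    (n : ℝ) ^ ((d : ℝ) / (2 * β + d)) ≤ n * rate d β n ^ 2 := by
  have hL := one_le_log_natCast hn
  have hLL : 0 ≤ Real.log (Real.log n) := Real.log_nonneg hL
  have hn' : (0 : ℝ) < n := by positivity
  have hd : (0 : ℝ) ≤ d := Nat.cast_nonneg d
  have h0 : 2 * β + d ≠ 0 := by positivity
  have h2 : (n : ℝ) = Real.exp (Real.log n) := (Real.exp_log hn').symm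
  rw [rate_eq_exp hn, Real.rpow_def_of_pos hn']
  conv_rhs => rw [h2]
  rw [← Real.exp_nat_mul, ← Real.exp_add, Real.log_exp]
  apply Real.exp_le_exp.2
  have h3 : 0 ≤ 2 * β * (2 * d + 1) / (2 * β + d) * Real.log (Real.log n) := by positivity
  have h4 : Real.log n + (2 : ℕ) * ((-(2 * β) / (2 * β + d) * Real.log n
      + 2 * β * (2 * d + 1) / (2 * β + d) * Real.log (Real.log n)) / 2)
      = Real.log n * (d / (2 * β + d))
        + 2 * β * (2 * d + 1) / (2 * β + d) * Real.log (Real.log n) := by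
    push_cast
    field_simp
    ring
  rw [h4]
  linarith

lemma one_le_mul_rate_sq (hβ : 0 < β) {n : ℕ} (hn : 3 ≤ n) : 1 ≤ n * rate d β n ^ 2 := by
  have hn' : (1 : ℝ) ≤ n := by exact_mod_cast (by omega : 1 ≤ n)
  exact (Real.one_le_rpow hn' (by positivity)).trans (rpow_le_mul_rate_sq hβ hn)

lemma tendsto_rate (hβ : 0 < β) : Tendsto (rate d β) atTop (𝓝 0) := by
  have hd : (0 : ℝ) ≤ d := Nat.cast_nonneg d
  have h1 := (isLittleO_log_rpow_rpow_atTop (2 * β * (2 * d + 1) / (2 * β + d))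
    (by positivity : 0 < (2 * β) / (2 * β + d))).tendsto_div_nhds_zero.comp
      tendsto_natCast_atTop_atTop
  have h2 := h1.sqrt
  rw [Real.sqrt_zero] at h2
  refine h2.congr fun n => ?_
  simp only [Function.comp, rate]
  rw [neg_div, Real.rpow_neg (Nat.cast_nonneg n), div_eq_inv_mul]

lemma inv_natCast_le_rate (hβ : 0 < β) {n : ℕ} (hn : 3 ≤ n) (h1 : rate d β n ≤ 1) :
    (n : ℝ)⁻¹ ≤ rate d β n := by
  have h2 := one_le_mul_rate_sq (d := d) hβ hn
  have h3 := rate_pos (d := d) (β := β) hn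
  have hn' : (0 : ℝ) < n := by positivity
  rw [inv_le_iff_one_le_mul₀ hn']
  nlinarith

lemma eventually_log_le_mul_rate_sq (hd : 0 < d) (hβ : 0 < β) (C : ℝ) :
    ∀ᶠ n : ℕ in atTop, C * Real.log n ≤ n * rate d β n ^ 2 := by
  have hd' : (0 : ℝ) < d := by exact_mod_cast hd
  have h := ((isLittleO_log_rpow_atTop (by positivity : 0 < (d : ℝ) / (2 * β + d))).bound
    (by positivity : 0 < 1 / (|C| + 1)))
  filter_upwards [tendsto_natCast_atTop_atTop.eventually h, eventually_ge_atTop 3] with n hn hn3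
  have hL := one_le_log_natCast hn3
  have h1 := rpow_le_mul_rate_sq (d := d) hβ hn3
  rw [Real.norm_eq_abs, Real.norm_eq_abs, abs_of_nonneg (by linarith : 0 ≤ Real.log n),
    abs_of_nonneg (by positivity : 0 ≤ (n : ℝ) ^ ((d : ℝ) / (2 * β + d))), div_mul_eq_mul_div,
    one_mul, le_div_iff₀ (by positivity)] at hn
  calc C * Real.log n ≤ (|C| + 1) * Real.log n := by
        gcongr
        linarith [le_abs_self C]
    _ ≤ _ := by linarith

lemma exp_neg_le_mul_rpow {a b ε s m : ℝ} (hb : 0 < b) (ha : 0 < a) (hm : 0 < m)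
    (hmb : 1 / b ≤ m) (hε : m⁻¹ ≤ ε) (hs : (1 + a) * Real.log m ≤ s) :
    Real.exp (-s) ≤ b * ε ^ a := by
  have hinvexp : m⁻¹ = Real.exp (-Real.log m) := by
    rw [Real.exp_neg, Real.exp_log hm]
  have h1 : m⁻¹ ≤ b := by
    rw [one_div] at hmb
    exact inv_le_of_inv_le₀ hb hmb
  calc Real.exp (-s) ≤ Real.exp (-Real.log m) * Real.exp (-Real.log m * a) := by
        rw [← Real.exp_add]
        exact Real.exp_le_exp.2 (by linarith)
    _ = m⁻¹ * (m⁻¹) ^ a := by rw [Real.exp_mul, ← hinvexp]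
    _ ≤ b * ε ^ a := by gcongr

lemma abs_log_sub_log_le {σ₀ σ ε : ℝ} (hσ₀ : 0 < σ₀) (hσ : σ ∈ Set.Icc σ₀ (σ₀ * (1 + ε))) :
    0 < σ ∧ |Real.log σ₀ - Real.log σ| ≤ ε := by
  have hσ0 : 0 < σ := hσ₀.trans_le hσ.1
  refine ⟨hσ0, ?_⟩
  rw [abs_sub_comm, ← Real.log_div hσ0.ne' hσ₀.ne',
    abs_of_nonneg (Real.log_nonneg ((one_le_div hσ₀).2 hσ.1))]
  have h1 : σ / σ₀ ≤ 1 + ε := by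
    rw [div_le_iff₀ hσ₀, mul_comm]
    exact hσ.2
  have h2 := Real.log_le_sub_one_of_pos (div_pos hσ0 hσ₀)
  linarith

/-- An exponentially smaller error costs at most a factor `e`. -/
lemma exp_neg_sub_exp_neg_ge {A B : ℝ} (h : A + 1 ≤ B) :
    Real.exp (-(A + 1)) ≤ Real.exp (-A) - Real.exp (-B) := by
  have h1 : Real.exp (-B) ≤ Real.exp (-(A + 1)) := Real.exp_le_exp.2 (by linarith)
  have h2 : 2 * Real.exp (-(A + 1)) ≤ Real.exp (-A) := by
    have h3 : Real.exp (-A) = Real.exp (-(A + 1)) * Real.exp 1 := by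
      rw [← Real.exp_add]
      ring_nf
    have h4 := Real.add_one_le_exp (1 : ℝ)
    have h5 := Real.exp_pos (-(A + 1))
    nlinarith
  linarith

end Rate

section PriorMass

variable {d : ℕ} {S : ℝ} {Fξ Fμ : Measure (E d)} {Fφ Pσ : Measure ℝ}
  {α η : ℝ} {Ω : Type*} [MeasurableSpace Ω] {P : Measure Ω} {Q : Ω → SignedMeasure (Atom d)}
  {F : Measure (Atom d)} {g : 𝓢(E d, ℝ)}

lemma IsSymmGammaRandomMeasure.measurable_mixture (hQ : IsSymmGammaRandomMeasure P Q α η F) :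
    Measurable fun ω => mixture g (Q ω) := by
  obtain ⟨L, -, hL, -⟩ := exists_kernel_bounds g
  exact measurable_pi_iff.2 fun x =>
    hQ.measurable_integral (continuous_kernel g x).measurable (hL x)

lemma measurableSet_box (x : ℕ → E d) (v : ℕ → ℝ) (n : ℕ) (e : ℝ) :
    MeasurableSet {f : E d → ℝ | ∀ j < n, |f (x j) - v j| ≤ e} := by
  have : {f : E d → ℝ | ∀ j < n, |f (x j) - v j| ≤ e}
      = ⋂ j ∈ Finset.range n, {f : E d → ℝ | |f (x j) - v j| ≤ e} := by
    ext f
    simp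
  rw [this]
  refine Finset.measurableSet_biInter _ fun j _ => ?_
  exact measurableSet_le (((measurable_pi_apply (x j)).sub_const _).abs) measurable_const

/-- Independence of the mixture and the noise level under the prior. -/
lemma IsSymmGammaRandomMeasure.prior_real_prod [SFinite Pσ] (hQ : IsSymmGammaRandomMeasure P Q α η F)
    {A : Set (E d → ℝ)} (hA : MeasurableSet A) (B : Set ℝ) :
    (prior P g Q Pσ).real (A ×ˢ B) = P.real {ω | mixture g (Q ω) ∈ A} * Pσ.real B := by
  rw [prior, measureReal_prod_prod, map_measureReal_apply hQ.measurable_mixture hA]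
  rfl

variable [IsProbabilityMeasure Fξ] [IsProbabilityMeasure Fμ] [IsProbabilityMeasure Fφ]
  [IsProbabilityMeasure P] [SFinite Pσ]

set_option maxHeartbeats 400000 in
/-- The prior charges neighborhoods of the truth whose radius is a multiple of the rate: the truth
is close to a finite mixture with few atoms, and the random mixture is close to the latter with
sufficient probability. -/
theorem exists_prior_mass_ge (hd : 0 < d) (hS : 0 < S) (hg0 : ∀ x, 0 ≤ g x)
    (hcover : ∀ x ∈ cube d S, ∃ μ ∈ cube d (2 * S), 0 < g (x - μ)) (hα : 0 < α) (hη : 0 < η)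
    (hFξ : FrequencyAssumption Fξ) (hFμ : LocationAssumption S Fμ) (hFφ : PhaseAssumption Fφ)
    (hQ : IsSymmGammaRandomMeasure P Q α η (Fξ.prod (Fμ.prod Fφ)))
    {β : ℝ} (hβ : 0 < β) {f₀ : E d → ℝ} (hf₀ : IsHolderOnCube S β f₀)
    {σ₀ : ℝ} (hσ₀ : 0 < σ₀) (hmass : NoiseMassAt Pσ σ₀)
    {x : ℕ → E d} (hx : ∀ i, x i ∈ cube d S) :
    ∃ C K : ℝ, ∀ᶠ n in atTop, ∃ B : Set (Param d), MeasurableSet B ∧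
      Real.exp (-C * (n * rate d β n ^ 2)) ≤ (prior P g Q Pσ).real B ∧
      ∀ θ ∈ B, 0 < θ.2 ∧ |Real.log σ₀ - Real.log θ.2| ≤ rate d β n ∧
        ∀ i < n, |f₀ (x i) - θ.1 (x i)| ≤ K * rate d β n * θ.2 := by
  have hd' : (0 : ℝ) < d := by exact_mod_cast hd
  obtain ⟨Ca, η₀, hCa, hη₀, hη₁, happ⟩ := exists_mixture_approx hS hβ hg0 hcover hf₀
  set R : ℕ := ⌈1 / β⌉₊ + 2 with hR
  obtain ⟨Cb, hCb, hball⟩ := exists_small_ball_mixture hd hα hη hFξ hFμ hFφ hQ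
    (by positivity : 0 < (d : ℝ) / (2 * β + d)) (div_le_one_of_le₀ (by linarith) (by positivity)) 2 R
  obtain ⟨a, b, ha, hb, hnoise⟩ := hmass
  set K' : ℝ := Ca * (1 + 3 ^ d) + Cb * (1 + Ca * 3 ^ d) with hK'
  set Cc : ℝ := Cb * (Ca * 3 ^ d + Ca * 3 ^ d + 1) with hCc
  have hCc0 : 0 < Cc := by positivity
  have hK'0 : 0 < K' := by positivity
  refine ⟨Cc + 2, K' / σ₀, ?_⟩
  have ht := tendsto_rate (d := d) hβ
  have ht' : Tendsto (fun n => rate d β n ^ (1 / β)) atTop (𝓝 0) := by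
    have := ht.rpow_const (p := 1 / β) (Or.inr (by positivity))
    rwa [Real.zero_rpow (by positivity)] at this
  filter_upwards [hball x, eventually_ge_atTop 3, ht.eventually (gt_mem_nhds zero_lt_one),
    ht'.eventually (ge_mem_nhds hη₀), tendsto_natCast_atTop_atTop.eventually_ge_atTop (3 * Ca),
    tendsto_natCast_atTop_atTop.eventually_ge_atTop (Cc + 1),
    tendsto_natCast_atTop_atTop.eventually_ge_atTop (1 / b),
    eventually_log_le_mul_rate_sq hd hβ (1 + a)] with n hn hn3 hε1 hϱη hnCa hnCc hnb hlog
  set ε := rate d β n with hε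
  set ϱ := ε ^ (1 / β) with hϱ
  set s := n * ε ^ 2 with hs
  have hε0 : 0 < ε := rate_pos hn3
  have hϱ0 : 0 < ϱ := by positivity
  have hL1 := one_le_log_natCast hn3
  have hn1 : (1 : ℝ) ≤ n := by exact_mod_cast (by omega : 1 ≤ n)
  have hn0 : (0 : ℝ) < n := by linarith
  have hs1 : 1 ≤ s := one_le_mul_rate_sq hβ hn3
  have hsn : s ≤ n := by
    have : ε ^ 2 ≤ 1 := pow_le_one₀ hε0.le hε1.le
    nlinarith
  have hinv : (n : ℝ)⁻¹ ≤ ε := inv_natCast_le_rate hβ hn3 hε1.le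
  have hsε : s / n ^ 2 ≤ ε := by
    have : s / n ^ 2 = (n : ℝ)⁻¹ * ε * ε := by
      rw [hs]
      field_simp
    rw [this]
    have h1 : (n : ℝ)⁻¹ ≤ 1 := inv_le_one_of_one_le₀ hn1
    have h2 : (n : ℝ)⁻¹ * ε ≤ 1 := mul_le_one₀ h1 hε0.le hε1.le
    nlinarith
  -- This choice makes `4 ^ (-r)` at most `n ^ (-2)`.
  set r : ℕ := ⌈2 * Real.log n⌉₊ with hr
  have hr2 : 2 * Real.log n ≤ r := Nat.le_ceil _
  have hr3 : (r : ℝ) ≤ 3 * Real.log n := by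
    have := Nat.ceil_lt_add_one (by linarith : 0 ≤ 2 * Real.log n)
    linarith
  have hr1 : 1 ≤ r := by
    have : (1 : ℝ) ≤ r := by linarith
    exact_mod_cast this
  obtain ⟨κ, _, u, ζ, hζ, hcard, hu, hfreq, happx⟩ := happ ϱ r hϱ0 hϱη hr1
  have hXs : (ϱ⁻¹) ^ d * Real.log n ^ (2 * d + 1) = s := inv_rate_rpow_mul_log_pow hβ hn3
  have hXL : (r / ϱ) ^ d * Real.log n ≤ 3 ^ d * s := by
    calc (r / ϱ) ^ d * Real.log n ≤ (3 * Real.log n / ϱ) ^ d * Real.log n := by gcongr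
      _ = 3 ^ d * ((ϱ⁻¹) ^ d * Real.log n ^ (d + 1)) := by
          rw [div_eq_mul_inv, mul_pow, mul_pow]
          ring
      _ ≤ 3 ^ d * ((ϱ⁻¹) ^ d * Real.log n ^ (2 * d + 1)) := by
          gcongr
          omega
      _ = _ := by rw [hXs]
  have hq0 : 0 ≤ (r / ϱ) ^ d := by positivity
  have hX : (r / ϱ) ^ d ≤ 3 ^ d * s := by nlinarith
  have h4r : ((4 : ℝ) ^ r)⁻¹ ≤ ((n : ℝ) ^ 2)⁻¹ := by
    apply inv_anti₀ (by positivity)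
    calc (n : ℝ) ^ 2 = Real.exp (2 * Real.log n) := by
          rw [mul_comm, ← Real.rpow_def_of_pos hn0]
          norm_cast
      _ ≤ Real.exp r := Real.exp_le_exp.2 hr2
      _ = Real.exp 1 ^ r := by rw [← Real.exp_nat_mul, mul_one]
      _ ≤ 4 ^ r := by
          gcongr
          have := Real.exp_one_lt_d9
          linarith
  have hϱβ : ϱ ^ β = ε := by
    rw [hϱ, ← Real.rpow_mul hε0.le, one_div_mul_cancel hβ.ne', Real.rpow_one]
  have hζR : ∀ m, ‖(ζ m).1‖ ≤ (n : ℝ) ^ R := by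
    intro m
    refine (hfreq m).trans ?_
    have h1 : ϱ⁻¹ ≤ (n : ℝ) ^ ⌈1 / β⌉₊ := by
      calc ϱ⁻¹ = (ε⁻¹) ^ (1 / β) := by rw [hϱ, Real.inv_rpow hε0.le]
        _ ≤ (n : ℝ) ^ (1 / β) := by
            gcongr
            rw [inv_le_comm₀ hε0 hn0]
            exact hinv
        _ ≤ (n : ℝ) ^ ((⌈1 / β⌉₊ : ℕ) : ℝ) :=
            Real.rpow_le_rpow_of_exponent_le hn1 (Nat.le_ceil _)
        _ = _ := Real.rpow_natCast _ _
    have h2 : Real.log n ≤ n := (Real.log_le_sub_one_of_pos hn0).trans (by linarith)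
    calc Ca * (r / ϱ) = Ca * r * ϱ⁻¹ := by ring
      _ ≤ Ca * (3 * n) * (n : ℝ) ^ ⌈1 / β⌉₊ := by
          gcongr
          linarith
      _ = (3 * Ca) * n * (n : ℝ) ^ ⌈1 / β⌉₊ := by ring
      _ ≤ n * n * (n : ℝ) ^ ⌈1 / β⌉₊ := by gcongr
      _ = _ := by rw [hR]; ring
  set A : Set (E d → ℝ) := {f | ∀ i < n, |f (x i) - f₀ (x i)| ≤ K' * ε} with hA
  have hAm : MeasurableSet A := measurableSet_box x (fun i => f₀ (x i)) n (K' * ε)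
  have hPA : Real.exp (-((Cc + 1) * s)) ≤ P.real {ω | mixture g (Q ω) ∈ A} := by
    have hu' : ∑ m, |u m| ≤ Ca * (3 ^ d * s) := hu.trans (by gcongr)
    have h1 : Cb * (Fintype.card κ * Real.log n + ∑ m, |u m| + (n : ℝ) ^ ((d : ℝ) / (2 * β + d)))
        ≤ Cc * s := by
      have e1 : Fintype.card κ * Real.log n ≤ Ca * (3 ^ d * s) := by
        calc _ ≤ Ca * (r / ϱ) ^ d * Real.log n := by gcongr
          _ = Ca * ((r / ϱ) ^ d * Real.log n) := by ring
          _ ≤ _ := by gcongr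
      have e3 := rpow_le_mul_rate_sq (d := d) hβ hn3
      calc _ ≤ Cb * (Ca * (3 ^ d * s) + Ca * (3 ^ d * s) + s) := by gcongr
        _ = _ := by rw [hCc]; ring
    have h2 : Cc * s + 1 ≤ (n : ℝ) ^ 2 := by
      calc Cc * s + 1 ≤ (Cc + 1) * s := by linarith
        _ ≤ n * n := by gcongr
        _ = _ := by ring
    calc Real.exp (-((Cc + 1) * s)) ≤ Real.exp (-(Cc * s + 1)) :=
          Real.exp_le_exp.2 (by linarith)
      _ ≤ Real.exp (-(Cc * s)) - Real.exp (-(n : ℝ) ^ 2) := exp_neg_sub_exp_neg_ge h2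
      _ ≤ _ := sub_le_sub_right (Real.exp_le_exp.2 (neg_le_neg h1)) _
      _ ≤ _ := hn u ζ hζ hζR
      _ ≤ _ := by
          refine measureReal_mono fun ω hω i hi => ?_
          have e1 := hω i hi
          have e2 := happx (x i) (hx i)
          rw [abs_sub_comm] at e2
          have e3 : Cb * (1 + ∑ m, |u m|) / (n : ℝ) ^ 2 ≤ Cb * (1 + Ca * 3 ^ d) * ε := by
            calc _ ≤ Cb * (s + Ca * (3 ^ d * s)) / (n : ℝ) ^ 2 := by gcongr
              _ = Cb * (1 + Ca * 3 ^ d) * (s / n ^ 2) := by ring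
              _ ≤ _ := by gcongr
          have e4 : Ca * (ϱ ^ β + (r / ϱ) ^ d * (4 ^ r)⁻¹) ≤ Ca * (1 + 3 ^ d) * ε := by
            calc _ ≤ Ca * (ε + 3 ^ d * s * ((n : ℝ) ^ 2)⁻¹) := by
                  rw [hϱβ]
                  gcongr
              _ = Ca * (ε + 3 ^ d * (s / n ^ 2)) := by ring
              _ ≤ Ca * (ε + 3 ^ d * ε) := by gcongr
              _ = _ := by ring
          calc |mixture g (Q ω) (x i) - f₀ (x i)| ≤ _ := abs_sub_le _ _ _
            _ ≤ Cb * (1 + Ca * 3 ^ d) * ε + Ca * (1 + 3 ^ d) * ε :=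
              add_le_add (e1.trans e3) (e2.trans e4)
            _ = K' * ε := by rw [hK']; ring
  have hPσ : Real.exp (-s) ≤ Pσ.real (Set.Icc σ₀ (σ₀ * (1 + ε))) := by
    exact (exp_neg_le_mul_rpow hb ha hn0 hnb hinv (by linarith)).trans (hnoise ε ⟨hε0, hε1⟩)
  refine ⟨A ×ˢ Set.Icc σ₀ (σ₀ * (1 + ε)), hAm.prod measurableSet_Icc, ?_, ?_⟩
  · rw [hQ.prior_real_prod hAm]
    calc Real.exp (-(Cc + 2) * s) = Real.exp (-((Cc + 1) * s)) * Real.exp (-s) := by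
          rw [← Real.exp_add]
          ring_nf
      _ ≤ _ := by gcongr
  · rintro ⟨f, σ⟩ ⟨hf, hσ⟩
    simp only at hf hσ ⊢
    obtain ⟨hσ0, hlogσ⟩ := abs_log_sub_log_le hσ₀ hσ
    refine ⟨hσ0, hlogσ, fun i hi => ?_⟩
    rw [abs_sub_comm]
    calc |f (x i) - f₀ (x i)| ≤ K' * ε := hf i hi
      _ = K' / σ₀ * ε * σ₀ := by field_simp
      _ ≤ K' / σ₀ * ε * σ := by
        gcongr
        exact hσ.1

end PriorMass

/-! ### Sieves -/

section Sieve

/-- Logarithmic subdivision of an interval of noise levels. -/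
lemma exists_log_bins {lo hi ε : ℝ} (hlo : 0 < lo) (hhi : lo ≤ hi) (hε : 0 < ε) :
    ∃ (N : ℕ) (B : Fin N → Set ℝ), (∀ l, MeasurableSet (B l)) ∧
      (N : ℝ) ≤ (Real.log hi - Real.log lo) / ε + 1 ∧
      (∀ σ, lo < σ → σ ≤ hi → ∃ l, σ ∈ B l) ∧
      ∀ l, ∀ σ ∈ B l, lo < σ ∧ ∀ σ' ∈ B l, |Real.log σ - Real.log σ'| ≤ ε := by
  set q : ℝ → ℝ := fun σ => (Real.log σ - Real.log lo) / ε with hq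
  have hqm : Measurable q := (Real.measurable_log.sub_const _).div_const _
  have hq0 : ∀ σ, lo ≤ σ → 0 ≤ q σ := fun σ hσ =>
    div_nonneg (sub_nonneg.2 (Real.log_le_log hlo hσ)) hε.le
  refine ⟨⌊q hi⌋₊ + 1, fun l => Set.Ioi lo ∩ q ⁻¹' Set.Icc (l : ℝ) (l + 1), fun l =>
    measurableSet_Ioi.inter (hqm measurableSet_Icc), ?_, fun σ h1 h2 => ?_, ?_⟩
  · push_cast
    have := Nat.floor_le (hq0 hi hhi)
    linarith
  · have h3 : q σ ≤ q hi := by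
      simp only [hq]
      have := Real.log_le_log (hlo.trans h1) h2
      gcongr
    refine ⟨⟨⌊q σ⌋₊, Nat.lt_succ_of_le (Nat.floor_le_floor h3)⟩, h1, ?_⟩
    exact ⟨Nat.floor_le (hq0 σ h1.le), (Nat.lt_floor_add_one _).le⟩
  · rintro l σ ⟨hσ, h1⟩
    refine ⟨hσ, ?_⟩
    rintro σ' ⟨hσ', h2⟩
    have h3 : Real.log σ - Real.log σ' = (q σ - q σ') * ε := by
      simp only [hq]
      field_simp
      ring
    have h4 : |q σ - q σ'| ≤ 1 := by
      rw [abs_le]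
      constructor <;> linarith [h1.1, h1.2, h2.1, h2.2]
    rw [h3, abs_mul, abs_of_pos hε]
    nlinarith

/-- The noise levels outside a polynomially small and an exponentially large bound have
exponentially small prior mass. -/
lemma NoiseAssumption.exists_eventually_tails_le {Pσ : Measure ℝ} [IsProbabilityMeasure Pσ]
    (hPσ : NoiseAssumption Pσ) {s : ℕ → ℝ} (hs : ∀ᶠ n : ℕ in atTop, Real.log n ≤ s n)
    (hsn : ∀ᶠ n : ℕ in atTop, s n ≤ n) {D : ℝ} (hD : 0 ≤ D) :
    ∃ (k : ℕ) (c : ℝ), 0 < c ∧ ∀ᶠ n : ℕ in atTop,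
      Pσ.real {σ | σ ≤ ((n : ℝ) ^ k)⁻¹} ≤ Real.exp (-(D * s n)) ∧
      Pσ.real {σ | Real.exp (c * s n) < σ} ≤ Real.exp (-(D * s n)) := by
  obtain ⟨a₁, b₁, ha₁, hb₁, hup⟩ := hPσ.upper_tail
  obtain ⟨a₂, b₂, c₂, ha₂, hb₂, hc₂, hlow⟩ := hPσ.lower_tail
  set k : ℕ := ⌈2 / a₂⌉₊ with hk
  have hk2 : 2 ≤ k * a₂ := by
    have := Nat.le_ceil (2 / a₂)
    rwa [div_le_iff₀ ha₂] at this
  have hk0 : k ≠ 0 := by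
    intro h
    rw [h] at hk2
    norm_num at hk2
  have hc : 0 < (D + 1) / a₁ := by positivity
  refine ⟨k, (D + 1) / a₁, hc, ?_⟩
  have hst : Tendsto s atTop atTop := tendsto_atTop_mono' _ hs
    (Real.tendsto_log_atTop.comp tendsto_natCast_atTop_atTop)
  have h1 : Tendsto (fun n : ℕ => (n : ℝ) ^ k) atTop atTop :=
    (tendsto_pow_atTop hk0).comp tendsto_natCast_atTop_atTop
  have h2 : Tendsto (fun n : ℕ => Real.exp ((D + 1) / a₁ * s n)) atTop atTop :=
    Real.tendsto_exp_atTop.comp (hst.const_mul_atTop hc)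
  filter_upwards [h1.eventually hlow, h2.eventually hup, hs, hsn, eventually_ge_atTop 1,
    tendsto_natCast_atTop_atTop.eventually_ge_atTop b₁,
    tendsto_natCast_atTop_atTop.eventually_ge_atTop b₂,
    tendsto_natCast_atTop_atTop.eventually_ge_atTop ((D + 1) / c₂)]
    with n hl hu hsl hsn hn hnb₁ hnb₂ hnD
  have hn1 : (1 : ℝ) ≤ n := by exact_mod_cast hn
  have hn0 : (0 : ℝ) < n := by linarith
  constructor
  · rw [one_div] at hl
    refine hl.trans ?_
    have e1 : (n : ℝ) ^ (2 : ℕ) ≤ ((n : ℝ) ^ k) ^ a₂ := by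
      rw [← Real.rpow_natCast, ← Real.rpow_natCast, ← Real.rpow_mul hn0.le]
      exact Real.rpow_le_rpow_of_exponent_le hn1 (by exact_mod_cast hk2)
    rw [div_le_iff₀ hc₂] at hnD
    have e2 : b₂ ≤ Real.exp n := hnb₂.trans (by linarith [Real.add_one_le_exp (n : ℝ)])
    have e4 : n + D * s n ≤ c₂ * ((n : ℝ) ^ k) ^ a₂ := by
      calc n + D * s n ≤ n + D * n := by gcongr
        _ = n * (D + 1) := by ring
        _ ≤ n * (n * c₂) := by gcongr
        _ = c₂ * (n : ℝ) ^ (2 : ℕ) := by ring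
        _ ≤ _ := by gcongr
    calc b₂ * Real.exp (-c₂ * ((n : ℝ) ^ k) ^ a₂)
        ≤ Real.exp n * Real.exp (-c₂ * ((n : ℝ) ^ k) ^ a₂) := by gcongr
      _ = Real.exp (n - c₂ * ((n : ℝ) ^ k) ^ a₂) := by
          rw [← Real.exp_add]
          ring_nf
      _ ≤ _ := Real.exp_le_exp.2 (by linarith)
  · refine hu.trans ?_
    have e1 : b₁ ≤ Real.exp (s n) := by
      calc b₁ ≤ n := hnb₁
        _ = Real.exp (Real.log n) := (Real.exp_log hn0).symm
        _ ≤ _ := Real.exp_le_exp.2 hsl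
    calc b₁ * Real.exp ((D + 1) / a₁ * s n) ^ (-a₁)
        ≤ Real.exp (s n) * Real.exp ((D + 1) / a₁ * s n) ^ (-a₁) := by gcongr
      _ = Real.exp (-(D * s n)) := by
          rw [← Real.exp_mul, ← Real.exp_add]
          congr 1
          field_simp
          ring

variable {d : ℕ} {S : ℝ} {Fξ Fμ : Measure (E d)} {Fφ Pσ : Measure ℝ}
  {α η : ℝ} {Ω : Type*} [MeasurableSpace Ω] {P : Measure Ω} {Q : Ω → SignedMeasure (Atom d)}
  {g : 𝓢(E d, ℝ)}
  [IsProbabilityMeasure Fξ] [IsProbabilityMeasure Fμ] [IsProbabilityMeasure Fφ]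
  [IsProbabilityMeasure P] [IsProbabilityMeasure Pσ]

/-- Up to exponentially small prior mass, the path of the mixture along the design lies in one of a
controlled number of boxes of polynomially small width: each typical path has a ball of not too
small prior mass around it, so that there cannot be many disjoint such balls. -/
lemma exists_boxes_cover (hd : 0 < d) (hα : 0 < α) (hη : 0 < η)
    (hFξ : FrequencyAssumption Fξ) (hFμ : LocationAssumption S Fμ) (hFφ : PhaseAssumption Fφ)
    (hQ : IsSymmGammaRandomMeasure P Q α η (Fξ.prod (Fμ.prod Fφ)))
    {β : ℝ} (hβ : 0 < β) (x : ℕ → E d) (J : ℕ) {D : ℝ} (hD : 0 ≤ D) :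
    ∃ A C : ℝ, 0 < C ∧ 0 < A ∧ ∀ᶠ n : ℕ in atTop, ∃ (N : ℕ) (v : Fin N → ℕ → ℝ),
      (N : ℝ) ≤ Real.exp (A * (n * rate d β n ^ 2)) ∧
      P.real {ω | mixture g (Q ω) ∈ (⋃ i, {f | ∀ j < n, |f (x j) - v i j| ≤ C / (n : ℝ) ^ J})ᶜ}
        ≤ 2 * Real.exp (-(D * (n * rate d β n ^ 2))) := by
  have hd' : (0 : ℝ) < d := by exact_mod_cast hd
  obtain ⟨C, hC, htyp⟩ := exists_typical_mixture (g := g) hd hα hη hFξ hFμ hFφ hQ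
    (by positivity : 0 < (d : ℝ) / (2 * β + d)) (div_le_one_of_le₀ (by linarith) (by positivity)) J
  set A := C * (D + 2 * C) with hA
  have hA0 : 0 < A := by positivity
  refine ⟨A + 1, 2 * C, by positivity, by positivity, ?_⟩
  filter_upwards [htyp x, eventually_ge_atTop 3,
    (tendsto_rate (d := d) hβ).eventually (gt_mem_nhds zero_lt_one),
    tendsto_natCast_atTop_atTop.eventually_ge_atTop (A + 1),
    tendsto_natCast_atTop_atTop.eventually_ge_atTop D] with n hn hn3 hε1 hnA hnD
  set s := n * rate d β n ^ 2 with hs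
  have hε0 : 0 < rate d β n := rate_pos hn3
  have hs1 : 1 ≤ s := one_le_mul_rate_sq hβ hn3
  have hn1 : (1 : ℝ) ≤ n := by exact_mod_cast (by omega : 1 ≤ n)
  have hsn : s ≤ n := by
    have : rate d β n ^ 2 ≤ 1 := pow_le_one₀ hε0.le hε1.le
    nlinarith
  have hμ := rpow_le_mul_rate_sq (d := d) hβ hn3
  rw [← hs] at hμ
  obtain ⟨G, hG, hGball⟩ := hn ((D + C) * s) (by positivity)
  have hp : ∀ ω₀ ∈ G, Real.exp (-(A * s + 1)) ≤ P.real {ω | ∀ j < n,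
      |mixture g (Q ω) (x j) - mixture g (Q ω₀) (x j)| ≤ C / (n : ℝ) ^ J} := by
    intro ω₀ hω₀
    have h1 : C * ((D + C) * s + C * (n : ℝ) ^ ((d : ℝ) / (2 * β + d))) ≤ A * s := by
      calc _ ≤ C * ((D + C) * s + C * s) := by gcongr
        _ = _ := by rw [hA]; ring
    have h2 : A * s + 1 ≤ (n : ℝ) ^ 2 := by
      calc A * s + 1 ≤ (A + 1) * s := by linarith
        _ ≤ n * n := by gcongr
        _ = _ := by ring
    exact (exp_neg_sub_exp_neg_ge h2).trans
      ((sub_le_sub_right (Real.exp_le_exp.2 (neg_le_neg h1)) _).trans (hGball ω₀ hω₀))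
  obtain ⟨t, htcard, htcov⟩ := exists_cover_of_ball_mass P
    (f := fun ω j => mixture g (Q ω) (x j))
    (fun j => (measurable_pi_apply (x j)).comp hQ.measurable_mixture) n
    (Real.exp_pos _) (by positivity) hp
  refine ⟨t.card, fun i j => mixture g (Q (t.equivFin.symm i)) (x j), ?_, ?_⟩
  · refine htcard.trans ?_
    rw [one_div, ← Real.exp_neg, neg_neg]
    exact Real.exp_le_exp.2 (by linarith)
  · have hsub : {ω | mixture g (Q ω) ∈ (⋃ i, {f : E d → ℝ | ∀ j < n,
        |f (x j) - mixture g (Q (t.equivFin.symm i)) (x j)| ≤ 2 * C / (n : ℝ) ^ J})ᶜ} ⊆ Gᶜ := by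
      intro ω hω hωG
      obtain ⟨ω₀, hω₀, h⟩ := htcov ω hωG
      refine hω (Set.mem_iUnion.2 ⟨t.equivFin ⟨ω₀, hω₀⟩, fun j hj => ?_⟩)
      rw [Equiv.symm_apply_apply, mul_div_assoc]
      exact h j hj
    have h1 : -((D + C) * s) + C * (n : ℝ) ^ ((d : ℝ) / (2 * β + d)) ≤ -(D * s) := by
      have := mul_le_mul_of_nonneg_left hμ hC.le
      linarith
    have h2 : -(n : ℝ) ^ 2 ≤ -(D * s) := by
      have : D * s ≤ n * n := by gcongr
      linarith
    calc _ ≤ P.real Gᶜ := measureReal_mono hsub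
      _ ≤ _ := hG
      _ ≤ Real.exp (-(D * s)) + Real.exp (-(D * s)) :=
          add_le_add (Real.exp_le_exp.2 h1) (Real.exp_le_exp.2 h2)
      _ = _ := by ring

/-- Most of the prior mass is covered by exponentially few sets of parameters whose diameter, in
the relevant sense, is at most the rate. -/
theorem exists_sieve (hd : 0 < d) (hα : 0 < α) (hη : 0 < η)
    (hFξ : FrequencyAssumption Fξ) (hFμ : LocationAssumption S Fμ) (hFφ : PhaseAssumption Fφ)
    (hQ : IsSymmGammaRandomMeasure P Q α η (Fξ.prod (Fμ.prod Fφ))) (hPσ : NoiseAssumption Pσ)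
    {β : ℝ} (hβ : 0 < β) (x : ℕ → E d) (C : ℝ) :
    ∃ C₂ : ℝ, ∀ᶠ n in atTop, ∃ (ι : Type) (_ : Fintype ι)
      (A : ι → Set (Param d)), (∀ j, MeasurableSet (A j)) ∧
      (Fintype.card ι : ℝ) ≤ Real.exp (C₂ * (n * rate d β n ^ 2)) ∧
      (prior P g Q Pσ).real (⋃ j, A j)ᶜ ≤ Real.exp (-C * (n * rate d β n ^ 2)) ∧
      ∀ j, ∀ θ ∈ A j, ∀ θ' ∈ A j, 0 < θ.2 ∧ |Real.log θ.2 - Real.log θ'.2| ≤ rate d β n ∧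
        ∀ i < n, |θ.1 (x i) - θ'.1 (x i)| ≤ rate d β n * θ'.2 := by
  -- The two units absorb the numerical factors, since `1 ≤ n ε_n²`.
  set D := |C| + 2 with hDdef
  have hD : 0 ≤ D := by positivity
  have ht := tendsto_rate (d := d) hβ
  have hsn' : ∀ᶠ n : ℕ in atTop, n * rate d β n ^ 2 ≤ n := by
    filter_upwards [ht.eventually (gt_mem_nhds zero_lt_one), eventually_ge_atTop 3]
      with n hε1 hn3
    have : rate d β n ^ 2 ≤ 1 := pow_le_one₀ (rate_pos hn3).le hε1.le
    exact mul_le_of_le_one_right (Nat.cast_nonneg n) this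
  obtain ⟨k, c, hc, hnoise⟩ := hPσ.exists_eventually_tails_le
    (s := fun n => n * rate d β n ^ 2)
    ((eventually_log_le_mul_rate_sq hd hβ 1).mono fun n h => by rwa [one_mul] at h) hsn' hD
  obtain ⟨A, Cb, hCb, hA, hboxes⟩ := exists_boxes_cover (g := g) hd hα hη hFξ hFμ hFφ hQ hβ x
    (k + 2) hD
  refine ⟨A + 1, ?_⟩
  filter_upwards [hboxes, hnoise, hsn', eventually_ge_atTop 3,
    ht.eventually (gt_mem_nhds zero_lt_one),
    eventually_log_le_mul_rate_sq hd hβ 3,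
    tendsto_natCast_atTop_atTop.eventually_ge_atTop (2 * Cb),
    tendsto_natCast_atTop_atTop.eventually_ge_atTop (c + k + 1)]
    with n ⟨N, v, hN, hv⟩ ⟨hlow, hup⟩ hsn hn3 hε1 hlog hnCb hnc
  set ε := rate d β n with hε
  set s := n * ε ^ 2 with hs
  have hε0 : 0 < ε := rate_pos hn3
  have hs1 : 1 ≤ s := one_le_mul_rate_sq hβ hn3
  have hn1 : (1 : ℝ) ≤ n := by exact_mod_cast (by omega : 1 ≤ n)
  have hn0 : (0 : ℝ) < n := by linarith
  have hinv : (n : ℝ)⁻¹ ≤ ε := inv_natCast_le_rate hβ hn3 hε1.le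
  have hL1 := one_le_log_natCast hn3
  have hle1 : ((n : ℝ) ^ k)⁻¹ ≤ Real.exp (c * s) :=
    (inv_le_one_of_one_le₀ (one_le_pow₀ hn1)).trans (Real.one_le_exp (by positivity))
  obtain ⟨T, B, hB, hT, hBcov, hBdiam⟩ := exists_log_bins (lo := ((n : ℝ) ^ k)⁻¹)
    (hi := Real.exp (c * s)) (by positivity) hle1 hε0
  set box : Fin N → Set (E d → ℝ) := fun i =>
    {f | ∀ j < n, |f (x j) - v i j| ≤ Cb / (n : ℝ) ^ (k + 2)} with hbox
  have hboxm : ∀ i, MeasurableSet (box i) := fun i => measurableSet_box x (v i) n _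
  refine ⟨Fin N × Fin T, inferInstance, fun q => box q.1 ×ˢ B q.2,
    fun q => (hboxm _).prod (hB _), ?_, ?_, ?_⟩
  · have hTs : (T : ℝ) ≤ Real.exp s := by
      have h1 : Real.log (Real.exp (c * s)) - Real.log (((n : ℝ) ^ k)⁻¹) ≤ (c + k) * n := by
        rw [Real.log_exp, Real.log_inv, Real.log_pow]
        have h2 : Real.log n ≤ n := (Real.log_le_sub_one_of_pos hn0).trans (by linarith)
        have h3 : c * s ≤ c * n := by gcongr
        have h4 : k * Real.log n ≤ k * n := by gcongr
        linarith
      calc (T : ℝ) ≤ (c + k) * n / ε + 1 := by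
            refine hT.trans ?_
            gcongr
        _ ≤ (c + k) * n * n + 1 := by
            rw [div_eq_mul_inv]
            gcongr
            rw [inv_le_comm₀ hε0 hn0]
            exact hinv
        _ ≤ (c + k + 1) * (n * n) := by nlinarith
        _ ≤ n * (n * n) := by gcongr
        _ = Real.exp (3 * Real.log n) := by
            rw [mul_comm 3, ← Real.rpow_def_of_pos hn0]
            norm_cast
            ring
        _ ≤ _ := Real.exp_le_exp.2 hlog
    rw [Fintype.card_prod, Fintype.card_fin, Fintype.card_fin]
    push_cast
    calc (N : ℝ) * T ≤ Real.exp (A * s) * Real.exp s := by gcongr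
      _ = _ := by
        rw [← Real.exp_add]
        ring_nf
  · have hsub : (⋃ q : Fin N × Fin T, box q.1 ×ˢ B q.2)ᶜ
        ⊆ ((⋃ i, box i)ᶜ ×ˢ Set.univ ∪ Set.univ ×ˢ {σ | σ ≤ ((n : ℝ) ^ k)⁻¹})
          ∪ Set.univ ×ˢ {σ | Real.exp (c * s) < σ} := by
      rintro ⟨f, σ⟩ hθ
      by_contra hcon
      simp only [Set.mem_union, Set.mem_prod, Set.mem_univ, and_true, true_and, not_or,
        Set.mem_compl_iff, not_not, Set.mem_ofPred_eq, not_le, not_lt] at hcon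
      obtain ⟨⟨h1, h2⟩, h3⟩ := hcon
      obtain ⟨i, hi⟩ := Set.mem_iUnion.1 h1
      obtain ⟨l, hl⟩ := hBcov σ h2 h3
      exact hθ (Set.mem_iUnion.2 ⟨(i, l), hi, hl⟩)
    have hPi : IsFiniteMeasure (prior P g Q Pσ) := by
      have := Measure.isProbabilityMeasure_map (μ := P) (hQ.measurable_mixture (g := g)).aemeasurable
      unfold prior
      infer_instance
    have hU : MeasurableSet (⋃ i, box i)ᶜ := (MeasurableSet.iUnion hboxm).compl
    calc (prior P g Q Pσ).real (⋃ q : Fin N × Fin T, box q.1 ×ˢ B q.2)ᶜ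
        ≤ (prior P g Q Pσ).real ((⋃ i, box i)ᶜ ×ˢ Set.univ)
          + (prior P g Q Pσ).real (Set.univ ×ˢ {σ | σ ≤ ((n : ℝ) ^ k)⁻¹})
          + (prior P g Q Pσ).real (Set.univ ×ˢ {σ | Real.exp (c * s) < σ}) :=
          (measureReal_mono hsub (measure_ne_top _ _)).trans
            ((measureReal_union_le _ _).trans (add_le_add_left (measureReal_union_le _ _) _))
      _ ≤ 2 * Real.exp (-(D * s)) + Real.exp (-(D * s)) + Real.exp (-(D * s)) := by
          rw [hQ.prior_real_prod hU, hQ.prior_real_prod MeasurableSet.univ,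
            hQ.prior_real_prod MeasurableSet.univ]
          simp only [Set.mem_univ, Set.ofPred_true, probReal_univ, mul_one, one_mul]
          gcongr
      _ = 2 * 2 * Real.exp (-(D * s)) := by ring
      _ ≤ Real.exp 1 * Real.exp 1 * Real.exp (-(D * s)) := by
          have := Real.add_one_le_exp (1 : ℝ)
          gcongr <;> linarith
      _ = Real.exp (2 - D * s) := by
          rw [← Real.exp_add, ← Real.exp_add]
          ring_nf
      _ ≤ Real.exp (-C * s) := by
          apply Real.exp_le_exp.2
          have : C * s ≤ |C| * s := by
            gcongr
            exact le_abs_self C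
          rw [hDdef]
          linarith
  · rintro ⟨i, l⟩ ⟨f, σ⟩ ⟨hf, hσ⟩ ⟨f', σ'⟩ ⟨hf', hσ'⟩
    simp only at hf hσ hf' hσ' ⊢
    have h1 := hBdiam l σ hσ
    have h2 := hBdiam l σ' hσ'
    refine ⟨lt_of_le_of_lt (by positivity) h1.1, h1.2 σ' hσ', fun j hj => ?_⟩
    have e1 := hf j hj
    have e2 := hf' j hj
    rw [abs_sub_comm] at e2
    calc |f (x j) - f' (x j)| ≤ |f (x j) - v i j| + |v i j - f' (x j)| := abs_sub_le _ _ _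
      _ ≤ Cb / (n : ℝ) ^ (k + 2) + Cb / (n : ℝ) ^ (k + 2) := add_le_add e1 e2
      _ = (2 * Cb) * (n : ℝ)⁻¹ * ((n : ℝ)⁻¹ * ((n : ℝ) ^ k)⁻¹) := by
          rw [pow_add]
          field_simp
          ring
      _ ≤ n * (n : ℝ)⁻¹ * (ε * σ') := by
          gcongr
          exact h2.1.le
      _ = ε * σ' := by field_simp

end Sieve

end LocMod

end

/-! ### Adaptive contraction of location-modulation mixtures -/

theorem theorem4 (d : ℕ) (hd : 0 < d) (S : ℝ) (hS : 0 < S)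
    (g : 𝓢(LocMod.E d, ℝ)) (hg : LocMod.MotherAssumption g)
    (hcover : ∀ x ∈ LocMod.cube d S, ∃ μ ∈ LocMod.cube d (2 * S), 0 < g (x - μ))
    (α η : ℝ) (hα : 0 < α) (hη : 0 < η)
    (Fξ Fμ : Measure (LocMod.E d)) (Fφ : Measure ℝ)
    [IsProbabilityMeasure Fξ] [IsProbabilityMeasure Fμ] [IsProbabilityMeasure Fφ]
    (hFξ : LocMod.FrequencyAssumption Fξ) (hFμ : LocMod.LocationAssumption S Fμ)
    (hFφ : LocMod.PhaseAssumption Fφ)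
    (Pσ : Measure ℝ) [IsProbabilityMeasure Pσ] (hPσ : LocMod.NoiseAssumption Pσ)
    {Ω : Type*} [MeasurableSpace Ω] (P : Measure Ω) [IsProbabilityMeasure P]
    (Q : Ω → SignedMeasure (LocMod.Atom d))
    (hQ : LocMod.IsSymmGammaRandomMeasure P Q α η (Fξ.prod (Fμ.prod Fφ))) :
    ∀ β : ℝ, 0 < β → ∀ f₀ : LocMod.E d → ℝ, LocMod.IsHolderOnCube S β f₀ →
    ∀ σ₀ : ℝ, 0 < σ₀ → LocMod.NoiseMassAt Pσ σ₀ →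
    ∀ x : ℕ → LocMod.E d, (∀ i, x i ∈ LocMod.cube d S) →
    ∃ M : ℝ, ∀ᵐ y ∂(LocMod.dataLaw x (f₀, σ₀)),
      (∀ n, IsProbabilityMeasure (LocMod.posterior (LocMod.prior P g Q Pσ) x n y)) ∧
      Tendsto (fun n => LocMod.posterior (LocMod.prior P g Q Pσ) x n y
          {θ | M * LocMod.rate d β n < LocMod.rho x n θ (f₀, σ₀)})
        atTop (𝓝 0) := by
  intro β hβ f₀ hf₀ σ₀ hσ₀ hmass x hx
  have hmix := hQ.measurable_mixture (g := g)
  have := Measure.isProbabilityMeasure_map (μ := P) hmix.aemeasurable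
  have hprior : IsProbabilityMeasure (LocMod.prior P g Q Pσ) := by
    unfold LocMod.prior
    infer_instance
  have hpos : ∀ᵐ θ ∂(LocMod.prior P g Q Pσ), 0 < θ.2 := by
    have h : ∀ᵐ σ ∂Pσ, 0 < σ := by
      rw [ae_iff]
      simpa [Set.compl_def] using hPσ.support
    exact Measure.quasiMeasurePreserving_snd.ae h
  obtain ⟨C, K, hC⟩ := LocMod.exists_prior_mass_ge hd hS hg.nonneg hcover hα hη hFξ hFμ hFφ hQ
    hβ hf₀ hσ₀ hmass hx
  obtain ⟨M, hM⟩ := LocMod.posterior_contraction (LocMod.prior P g Q Pσ) hpos x (f₀, σ₀) hσ₀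
    (LocMod.rate d β) ((eventually_ge_atTop 3).mono fun n hn => LocMod.rate_pos hn)
    (LocMod.tendsto_rate hβ) (LocMod.eventually_log_le_mul_rate_sq hd hβ 2) hC
    fun C => LocMod.exists_sieve hd hα hη hFξ hFμ hFφ hQ hPσ hβ x C
  refine ⟨M, ?_⟩
  filter_upwards [hM, ae_all_iff.2 fun n => LocMod.ae_isProbabilityMeasure_posterior (x := x)
    (n := n) (LocMod.prior P g Q Pσ) hpos hσ₀] with y hy hy' using ⟨hy', hy⟩
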